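/- **Theorem.** Fix $0<q<1$. All Hilbert space and von Neumann algebra tensor products are denoted by $\otimes$; $\mathbb T$ carries its normalized Haar measure. *Notation.* Let $I_q=\{-q^k : k=1,2,\dots\}\cup\{q^k : k\in\mathbb Z\}$ with counting measure, and let $H=L^2(\mathbb T)\otimes L^2(I_q)$, with orthonormal basis $\zeta^m\otimes\delta_p$ ($m\in\mathbb Z$, $p\in I_q$), where $\zeta$ is the identity function of $\mathbb T$, and $\delta_x=0$ for $x\notin I_q$. On the linear span $E$ of this basis define $$\alpha_0(\zeta^m\otimes\delta_p)=\sqrt{\operatorname{sgn}(p)+p^{-2}}\;\zeta^m\otimes\delta_{qp},\qquad \gamma_0(\zeta^m\otimes\delta_p)=p^{-1}\,\zeta^{m+1}\otimes\delta_p,$$ $$e_0(\zeta^m\otimes\delta_p)=\operatorname{sgn}(p)\,\zeta^m\otimes\delta_p,\qquad u_0(\zeta^m\otimes\delta_p)=\zeta^m\otimes\delta_{-p},$$ and let $\alpha,\gamma,e,u$ be their closures. Let $M_q$ be the von Neumann algebra on $H$ generated by $\alpha,\gamma,e,u$, that is, the von Neumann algebra with commutant $\{x\in B(H) : xT\subseteq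 Tx,\ xT^*\subseteq T^*x \text{ for } T=\alpha,\gamma,e,u\}$. Put $(a;q)_n=\prod_{i=0}^{n-1}(1-q^ia)$, $(a;q)_\infty=\lim_n (a;q)_n$, $(a_1,a_2;q)_\infty=(a_1;q)_\infty(a_2;q)_\infty$, and $$\Psi(a;b;q^2,z)=\sum_{n\ge 0}\frac{(a;q^2)_n\,(bq^{2n};q^2)_\infty}{(q^2;q^2)_n}(-1)^nq^{n(n-1)}z^n .$$ Put $\chi(x)=\log_q|x|$, $\kappa(x)=\operatorname{sgn}(x)x^2$, $\nu(t)=q^{(\chi(t)-1)(\chi(t)-2)/2}$, $c_q=(\sqrt2\,q\,(q^2,-q^2;q^2)_\infty)^{-1}$, and $s(x,y)=-1$ if $x>0>y$, $s(x,y)=1$ otherwise. For $p,x,y\in I_q$ let $a_p(x,y)=0$ if $\operatorname{sgn}(xy)\ne\operatorname{sgn}(p)$, and otherwise let $a_p(x,y)$ be $$c_q\,s(x,y)(-1)^{\chi(p)}(-\operatorname{sgn}(y))^{\chi(x)}|y|\,\nu(py/x)\sqrt{\tfrac{(-\kappa(p),-\kappa(y);q^2)_\infty}{(-\kappa(x);q^2)_\infty}}\;\Psi\bigl(-q^2/\kappa(y);\,q^2\kappa(x/y);\,q^2,\,q^2\kappa(x/p)\bigr).$$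 For $r,s,m\in\mathbb Z$ and $p\in I_q$ let $F_{r,s,m,p}\in H\otimes H=L^2(\mathbb T\times I_q\times\mathbb T\times I_q)$ be the function $$F_{r,s,m,p}(\lambda,x,\mu,y)=\begin{cases}a_p(x,y)\,\lambda^{r+\chi(y/p)}\mu^{s-\chi(x/p)} & \text{if } y=\operatorname{sgn}(p)\,q^m x,\\ 0&\text{otherwise.}\end{cases}$$ *Claim.* There is a unitary $V:H\otimes H\to L^2(\mathbb T)\otimes L^2(\mathbb T)\otimes H$ with $V F_{r,s,m,p}=\zeta^r\otimes\zeta^s\otimes\zeta^m\otimes\delta_p$ for all $r,s,m\in\mathbb Z$, $p\in I_q$. The formula $$\Delta(a)=V^*(1\otimes1\otimes a)V\qquad(a\in M_q)$$ defines an injective normal unital $*$-homomorphism $\Delta:M_q\to M_q\otimes M_q$, and $\Delta$ is coassociative: the normal $*$-homomorphisms $\Delta\otimes\iota$ and $\iota\otimes\Delta$ from $M_q\otimes M_q$ to $M_q\otimes M_q\otimes M_q$ exist and $$(\Delta\otimes\iota)\Delta=(\iota\otimes\Delta)\Delta .$$ -/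

import Mathlib

open scoped TensorProduct InnerProductSpace ENNReal

noncomputable section

/-! ### Hilbert space tensor products -/

section HilbertTensor

/-- The Hilbert space tensor product: the completion of the algebraic tensor product. -/
def HTensor (H K : Type*) [NormedAddCommGroup H] [InnerProductSpace ℂ H]
    [NormedAddCommGroup K] [InnerProductSpace ℂ K] : Type _ :=
  UniformSpace.Completion (H ⊗[ℂ] K)

namespace HTensor

variable {H K L : Type*}
  [NormedAddCommGroup H] [InnerProductSpace ℂ H]
  [NormedAddCommGroup K] [InnerProductSpace ℂ K]
  [NormedAddCommGroup L] [InnerProductSpace ℂ L]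

instance : NormedAddCommGroup (HTensor H K) :=
  inferInstanceAs (NormedAddCommGroup (UniformSpace.Completion (H ⊗[ℂ] K)))

instance : InnerProductSpace ℂ (HTensor H K) :=
  inferInstanceAs (InnerProductSpace ℂ (UniformSpace.Completion (H ⊗[ℂ] K)))

instance : CompleteSpace (HTensor H K) :=
  inferInstanceAs (CompleteSpace (UniformSpace.Completion (H ⊗[ℂ] K)))

/-- The dense isometric embedding of `H ⊙ K` into `H ⊗ K`. -/
def emb : (H ⊗[ℂ] K) →ₗᵢ[ℂ] HTensor H K :=
  (UniformSpace.Completion.toComplₗᵢ :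
    (H ⊗[ℂ] K) →ₗᵢ[ℂ] UniformSpace.Completion (H ⊗[ℂ] K))

theorem denseRange_emb : DenseRange (emb (H := H) (K := K)) :=
  UniformSpace.Completion.denseRange_coe (α := H ⊗[ℂ] K)

/-- The elementary tensor `v ⊗ w`. -/
def tmul (v : H) (w : K) : HTensor H K := emb (v ⊗ₜ[ℂ] w)

/-- The bounded operator `a ⊗ b`. -/
def map (a : H →L[ℂ] H) (b : K →L[ℂ] K) : HTensor H K →L[ℂ] HTensor H K :=
  (TensorProduct.mapL a b).completion

theorem map_emb (a : H →L[ℂ] H) (b : K →L[ℂ] K) (z : H ⊗[ℂ] K) :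
    map a b (emb z) = emb (TensorProduct.mapL a b z) :=
  ContinuousLinearMap.completion_apply_coe (TensorProduct.mapL a b) z

theorem map_tmul (a : H →L[ℂ] H) (b : K →L[ℂ] K) (v : H) (w : K) :
    map a b (tmul v w) = tmul (a v) (b w) := by
  rw [tmul, map_emb, TensorProduct.mapL_tmul, tmul]

theorem inner_tmul (v v' : H) (w w' : K) :
    ⟪tmul v w, tmul v' w'⟫_ℂ = ⟪v, v'⟫_ℂ * ⟪w, w'⟫_ℂ := by
  rw [tmul, tmul, LinearIsometry.inner_map_map, TensorProduct.inner_tmul]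

/-- If `f` and `g` have dense range, so does the map `f ⊙ g` into the completed tensor product. -/
theorem denseRange_tmul {H' K' : Type*}
    [NormedAddCommGroup H'] [InnerProductSpace ℂ H']
    [NormedAddCommGroup K'] [InnerProductSpace ℂ K']
    (f : H →ₗᵢ[ℂ] H') (g : K →ₗᵢ[ℂ] K') (hf : DenseRange f) (hg : DenseRange g) :
    DenseRange ((emb.comp (TensorProduct.mapIsometry f g)).toLinearMap) := by
  have key : DenseRange (TensorProduct.mapIsometry f g) := by
    intro z
    change z ∈ closure (Set.range (TensorProduct.mapIsometry f g))
    have hcl : ((LinearMap.range (TensorProduct.mapIsometry f g).toLinearMap).topologicalClosure :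
        Set (H' ⊗[ℂ] K')) = closure (Set.range (TensorProduct.mapIsometry f g)) := rfl
    rw [← hcl, SetLike.mem_coe]
    induction z using TensorProduct.induction_on with
    | zero => exact Submodule.zero_mem _
    | add x y hx hy => exact Submodule.add_mem _ hx hy
    | tmul x y =>
      have hc : Continuous fun p : H' × K' => p.1 ⊗ₜ[ℂ] p.2 := TensorProduct.continuous_tmul
      have hd : DenseRange (Prod.map f g) := hf.prodMap hg
      have hcl' : IsClosed {p : H' × K' | p.1 ⊗ₜ[ℂ] p.2 ∈
          (LinearMap.range (TensorProduct.mapIsometry f g).toLinearMap).topologicalClosure} :=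
        (Submodule.isClosed_topologicalClosure _).preimage hc
      exact hd.induction_on (p := fun p : H' × K' => p.1 ⊗ₜ[ℂ] p.2 ∈
          (LinearMap.range (TensorProduct.mapIsometry f g).toLinearMap).topologicalClosure)
        (x, y) hcl' (fun a => Submodule.le_topologicalClosure _ ⟨a.1 ⊗ₜ a.2, by simp⟩)
  exact denseRange_emb.comp key emb.continuous

/-- The dense isometric embedding of `(H ⊙ K) ⊙ L` into `(H ⊗ K) ⊗ L`. -/
def embLeft : ((H ⊗[ℂ] K) ⊗[ℂ] L) →ₗᵢ[ℂ] HTensor (HTensor H K) L :=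
  emb.comp (TensorProduct.mapIsometry emb LinearIsometry.id)

/-- The dense isometric embedding of `H ⊙ (K ⊙ L)` into `H ⊗ (K ⊗ L)`. -/
def embRight : (H ⊗[ℂ] (K ⊗[ℂ] L)) →ₗᵢ[ℂ] HTensor H (HTensor K L) :=
  emb.comp (TensorProduct.mapIsometry LinearIsometry.id emb)

theorem denseRange_embLeft :
    DenseRange (embLeft (H := H) (K := K) (L := L)).toLinearMap := by
  exact denseRange_tmul _ _ denseRange_emb denseRange_id

theorem denseRange_embRight :
    DenseRange (embRight (H := H) (K := K) (L := L)).toLinearMap := by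
  exact denseRange_tmul _ _ denseRange_id denseRange_emb

/-- The canonical unitary `(H ⊗ K) ⊗ L ≃ H ⊗ (K ⊗ L)`. -/
def assoc : HTensor (HTensor H K) L ≃ₗᵢ[ℂ] HTensor H (HTensor K L) :=
  (TensorProduct.assoc ℂ H K L).extendOfIsometry embLeft.toLinearMap embRight.toLinearMap
    denseRange_embLeft denseRange_embRight (fun x => by
      have h1 := (embRight (H := H) (K := K) (L := L)).norm_map (TensorProduct.assoc ℂ H K L x)
      have h2 := (embLeft (H := H) (K := K) (L := L)).norm_map x
      have h3 := TensorProduct.norm_assoc x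
      exact h1.trans (h3.trans h2.symm))

theorem assoc_tmul (u : H) (v : K) (w : L) :
    assoc (tmul (tmul u v) w) = tmul u (tmul v w) := by
  have h1 : tmul (tmul u v) w = embLeft ((u ⊗ₜ[ℂ] v) ⊗ₜ[ℂ] w) := by
    simp [embLeft, tmul]
  have h2 : tmul u (tmul v w) = embRight (u ⊗ₜ[ℂ] (v ⊗ₜ[ℂ] w)) := by
    simp [embRight, tmul]
  rw [h1, h2]
  exact LinearEquiv.extendOfIsometry_eq ..

end HTensor

end HilbertTensor

/-! ### Von Neumann algebras, tensor products and normal homomorphisms -/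

section VonNeumann

namespace VonNeumannAlgebra

variable {H K H' K' : Type*}
  [NormedAddCommGroup H] [InnerProductSpace ℂ H] [CompleteSpace H]
  [NormedAddCommGroup K] [InnerProductSpace ℂ K] [CompleteSpace K]
  [NormedAddCommGroup H'] [InnerProductSpace ℂ H'] [CompleteSpace H']
  [NormedAddCommGroup K'] [InnerProductSpace ℂ K'] [CompleteSpace K']

/-- The commutant `(S ∪ S*)'` of a set of bounded operators, as a von Neumann algebra. -/
def commutantOf (S : Set (H →L[ℂ] H)) : VonNeumannAlgebra H where
  toStarSubalgebra := StarSubalgebra.centralizer ℂ S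
  centralizer_centralizer' := by
    change Set.centralizer (Set.centralizer (Set.centralizer (S ∪ star S)))
      = Set.centralizer (S ∪ star S)
    simp

/-- The von Neumann algebra generated by a set of bounded operators. -/
def generatedBy (S : Set (H →L[ℂ] H)) : VonNeumannAlgebra H :=
  commutantOf (commutantOf S : Set (H →L[ℂ] H))

theorem mem_generatedBy {S : Set (H →L[ℂ] H)} {a : H →L[ℂ] H} (ha : a ∈ S) :
    a ∈ generatedBy S := by
  have h := StarAlgebra.adjoin_le_centralizer_centralizer ℂ S
  exact h (StarAlgebra.subset_adjoin ℂ S ha)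

/-- The inclusion `x T ⊆ T x`, for a bounded operator `x` and an unbounded operator `T`. -/
def CommutesWith (x : H →L[ℂ] H) (T : H →ₗ.[ℂ] H) : Prop :=
  ∀ v : T.domain, ∃ h : x v ∈ T.domain, T ⟨x v, h⟩ = x (T v)

/-- The von Neumann algebra `N` generated by a set `S` of closed, densely defined operators:
its commutant is `{x | x T ⊆ T x and x T* ⊆ T* x for all T ∈ S}` (which is closed under adjoints
for such `S`). -/
def generatedByClosed (S : Set (H →ₗ.[ℂ] H)) : VonNeumannAlgebra H :=
  commutantOf {x | ∀ T ∈ S, CommutesWith x T ∧ CommutesWith x T.adjoint}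

/-- The von Neumann algebraic tensor product `M ⊗ N`, acting on `H ⊗ K`. -/
def tensor (M : VonNeumannAlgebra H) (N : VonNeumannAlgebra K) :
    VonNeumannAlgebra (HTensor H K) :=
  generatedBy {x | ∃ a ∈ M, ∃ b ∈ N, x = HTensor.map a b}

/-- The element `a ⊗ b` of `M ⊗ N`. -/
def tensorMk {M : VonNeumannAlgebra H} {N : VonNeumannAlgebra K}
    (a : M.toStarSubalgebra) (b : N.toStarSubalgebra) : (tensor M N).toStarSubalgebra :=
  ⟨HTensor.map a b, mem_generatedBy ⟨a, a.2, b, b.2, rfl⟩⟩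

/-- The `σ`-weakly continuous linear functionals on `M`:
`φ x = ∑ ⟪ξ n, x (η n)⟫` with `∑ ‖ξ n‖² < ∞` and `∑ ‖η n‖² < ∞`. -/
def IsNormalFunctional (M : VonNeumannAlgebra H) (φ : M.toStarSubalgebra →ₗ[ℂ] ℂ) : Prop :=
  ∃ ξ η : ℕ → H, Summable (fun n => ‖ξ n‖ ^ 2) ∧ Summable (fun n => ‖η n‖ ^ 2) ∧
    ∀ x : M.toStarSubalgebra, φ x = ∑' n, ⟪ξ n, (x : H →L[ℂ] H) (η n)⟫_ℂ

/-- A `*`-homomorphism between von Neumann algebras is normal if it is `σ`-weakly continuous. -/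
def IsNormalHom {M : VonNeumannAlgebra H} {N : VonNeumannAlgebra K}
    (π : M.toStarSubalgebra →⋆ₐ[ℂ] N.toStarSubalgebra) : Prop :=
  ∀ φ : N.toStarSubalgebra →ₗ[ℂ] ℂ, IsNormalFunctional N φ →
    IsNormalFunctional M (φ ∘ₗ π.toAlgHom.toLinearMap)

/-- `Θ` is the tensor product `π ⊗ ρ : M ⊗ N → M' ⊗ N'`, i.e. the (unique) normal
`*`-homomorphism with `Θ (a ⊗ b) = π a ⊗ ρ b`. -/
def IsTensorHom {M : VonNeumannAlgebra H} {N : VonNeumannAlgebra K}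
    {M' : VonNeumannAlgebra H'} {N' : VonNeumannAlgebra K'}
    (π : M.toStarSubalgebra →⋆ₐ[ℂ] M'.toStarSubalgebra)
    (ρ : N.toStarSubalgebra →⋆ₐ[ℂ] N'.toStarSubalgebra)
    (Θ : (tensor M N).toStarSubalgebra →⋆ₐ[ℂ] (tensor M' N').toStarSubalgebra) : Prop :=
  IsNormalHom Θ ∧ ∀ a b, Θ (tensorMk a b) = tensorMk (π a) (ρ b)

/-- Coassociativity `(Δ ⊗ ι) Δ = (ι ⊗ Δ) Δ` of a normal `*`-homomorphism `Δ : M → M ⊗ M`, where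
`(H ⊗ H) ⊗ H` and `H ⊗ (H ⊗ H)` are identified through the canonical unitary. -/
def IsCoassociative {M : VonNeumannAlgebra H}
    (Δ : M.toStarSubalgebra →⋆ₐ[ℂ] (tensor M M).toStarSubalgebra) : Prop :=
  ∃ (Δι : (tensor M M).toStarSubalgebra →⋆ₐ[ℂ] (tensor (tensor M M) M).toStarSubalgebra)
    (ιΔ : (tensor M M).toStarSubalgebra →⋆ₐ[ℂ] (tensor M (tensor M M)).toStarSubalgebra),
    IsTensorHom Δ (StarAlgHom.id ℂ M.toStarSubalgebra) Δι ∧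
    IsTensorHom (StarAlgHom.id ℂ M.toStarSubalgebra) Δ ιΔ ∧
    ∀ (x : M.toStarSubalgebra) (v : HTensor (HTensor H H) H),
      HTensor.assoc ((Δι (Δ x) : HTensor (HTensor H H) H →L[ℂ] HTensor (HTensor H H) H) v) =
        (ιΔ (Δ x) : HTensor H (HTensor H H) →L[ℂ] HTensor H (HTensor H H)) (HTensor.assoc v)

end VonNeumannAlgebra

end VonNeumann

/-! ### Special functions -/

namespace QSU11

/-- `(a; q)_n`. -/
def qPoch (q a : ℝ) (n : ℕ) : ℝ := ∏ i ∈ Finset.range n, (1 - q ^ i * a)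

/-- `(a; q)_∞`. -/
def qPochInf (q a : ℝ) : ℝ := ∏' i : ℕ, (1 - q ^ i * a)

/-- `Ψ(a; b; q, z) = ∑ (a;q)_n (b qⁿ;q)_∞ / (q;q)_n (-1)ⁿ q^{n(n-1)/2} zⁿ`. -/
def Psi (a b q z : ℝ) : ℝ :=
  ∑' n : ℕ, qPoch q a n * qPochInf q (b * q ^ n) / qPoch q q n *
    (-1) ^ n * q ^ (n * (n - 1) / 2) * z ^ n

/-- `I_q = {-q^k | k = 1, 2, …} ∪ {q^k | k ∈ ℤ}`. -/
def Iq (q : ℝ) : Set ℝ := {x | (∃ k : ℕ, 1 ≤ k ∧ x = -q ^ k) ∨ ∃ k : ℤ, x = q ^ k}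

/-- `χ(x) = log_q |x|`, which is an integer for `x ∈ -q^ℤ ∪ q^ℤ`. -/
def chi (q x : ℝ) : ℤ := ⌊Real.logb q |x|⌋

/-- `κ(x) = sgn(x) x²`. -/
def kappa (x : ℝ) : ℝ := Real.sign x * x ^ 2

/-- `ν(t) = q^{(χ(t) - 1)(χ(t) - 2) / 2}`; the division is exact. -/
def nu (q t : ℝ) : ℝ := q ^ ((chi q t - 1) * (chi q t - 2) / 2)

/-- `s(x, y) = -1` if `x > 0` and `y < 0`, and `s(x, y) = 1` otherwise. -/
def sgnPair (x y : ℝ) : ℝ := if 0 < x ∧ y < 0 then -1 else 1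

/-- `c_q = (√2 q (q², -q²; q²)_∞)⁻¹`. -/
def cq (q : ℝ) : ℝ :=
  (Real.sqrt 2 * q * (qPochInf (q ^ 2) (q ^ 2) * qPochInf (q ^ 2) (-q ^ 2)))⁻¹

/-- The function `a_p(x, y)`, for `p, x, y ∈ I_q`. -/
def aFun (q p x y : ℝ) : ℝ :=
  if Real.sign (x * y) = Real.sign p then
    cq q * sgnPair x y * (-1) ^ chi q p * (-Real.sign y) ^ chi q x * |y| * nu q (p * y / x) *
      Real.sqrt (qPochInf (q ^ 2) (-kappa p) * qPochInf (q ^ 2) (-kappa y) /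
        qPochInf (q ^ 2) (-kappa x)) *
      Psi (-q ^ 2 / kappa y) (q ^ 2 * kappa (x / y)) (q ^ 2) (q ^ 2 * kappa (x / p))
  else 0

/-! ### The Hilbert space `H = L²(𝕋) ⊗ L²(I_q)` and the von Neumann algebra `M_q` -/

/-- `L²(𝕋)` for the normalized Haar measure, with the circle `𝕋` written as `ℝ / ℤ`. -/
abbrev L2T : Type := MeasureTheory.Lp ℂ 2 (AddCircle.haarAddCircle (T := (1 : ℝ)))

/-- `ζ^m`, where `ζ` is the identity function of the circle, i.e. the character
`t ↦ e^{2 π i t}` of `ℝ / ℤ`. -/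
def zeta (m : ℤ) : L2T := fourierLp (T := (1 : ℝ)) 2 m

/-- `L²(I_q)` for the counting measure. -/
abbrev L2I (q : ℝ) : Type := lp (fun _ : Iq q => ℂ) 2

open Classical in
/-- `δ_x ∈ L²(I_q)`, with `δ_x = 0` if `x ∉ I_q`. -/
def delta (q x : ℝ) : L2I q :=
  if h : x ∈ Iq q then lp.single 2 (⟨x, h⟩ : Iq q) (1 : ℂ) else 0

/-- `H = L²(𝕋) ⊗ L²(I_q)`. -/
abbrev HSp (q : ℝ) : Type := HTensor L2T (L2I q)

/-- `ζ^m ⊗ δ_x`. -/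
def basisVec (q : ℝ) (m : ℤ) (x : ℝ) : HSp q := HTensor.tmul (zeta m) (delta q x)

theorem orthonormal_basisVec (q : ℝ) :
    Orthonormal ℂ (fun i : ℤ × Iq q => basisVec q i.1 i.2) := by
  classical
  have hz : Orthonormal ℂ zeta := orthonormal_fourier
  have hd : Orthonormal ℂ (fun x : Iq q => delta q x) := by
    rw [orthonormal_iff_ite]
    intro x y
    simp [delta, lp.inner_single_left, lp.single_apply, Pi.single_apply]
  exact (hz.tmul hd).comp_linearIsometry HTensor.emb

/-- The operator with domain `E = span {ζ^m ⊗ δ_p | m ∈ ℤ, p ∈ I_q}` that maps `ζ^m ⊗ δ_p` to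
`c m p`. -/
def opOnE (q : ℝ) (c : ℤ → ℝ → HSp q) : HSp q →ₗ.[ℂ] HSp q where
  domain := Submodule.span ℂ (Set.range fun i : ℤ × Iq q => basisVec q i.1 i.2)
  toFun := (Module.Basis.span (orthonormal_basisVec q).linearIndependent).constr ℂ
    (fun i : ℤ × Iq q => c i.1 i.2)

theorem opOnE_apply (q : ℝ) (c : ℤ → ℝ → HSp q) (m : ℤ) (p : Iq q)
    (h : basisVec q m p ∈ (opOnE q c).domain) : opOnE q c ⟨basisVec q m p, h⟩ = c m p := by
  let b := Module.Basis.span (orthonormal_basisVec q).linearIndependent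
  have hb : (⟨basisVec q m p, h⟩ : (opOnE q c).domain) = b (m, p) :=
    (Module.Basis.span_apply (orthonormal_basisVec q).linearIndependent (m, p)).symm
  rw [hb]
  exact b.constr_basis ℂ (fun i : ℤ × Iq q => c i.1 i.2) (m, p)

/-- `α₀ (ζ^m ⊗ δ_p) = √(sgn p + p⁻²) ζ^m ⊗ δ_{qp}`. -/
def alpha0 (q : ℝ) : HSp q →ₗ.[ℂ] HSp q :=
  opOnE q fun m p => ((Real.sqrt (Real.sign p + (p ^ 2)⁻¹) : ℝ) : ℂ) • basisVec q m (q * p)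

/-- `γ₀ (ζ^m ⊗ δ_p) = p⁻¹ ζ^{m+1} ⊗ δ_p`. -/
def gamma0 (q : ℝ) : HSp q →ₗ.[ℂ] HSp q :=
  opOnE q fun m p => ((p⁻¹ : ℝ) : ℂ) • basisVec q (m + 1) p

/-- `e₀ (ζ^m ⊗ δ_p) = sgn(p) ζ^m ⊗ δ_p`. -/
def e0 (q : ℝ) : HSp q →ₗ.[ℂ] HSp q :=
  opOnE q fun m p => ((Real.sign p : ℝ) : ℂ) • basisVec q m p

/-- `u₀ (ζ^m ⊗ δ_p) = ζ^m ⊗ δ_{-p}`, the restriction to `E` of the partial isometry `u` given by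
`(u f)(λ, x) = f(λ, -x)` if `-x ∈ I_q` and `(u f)(λ, x) = 0` otherwise. -/
def u0 (q : ℝ) : HSp q →ₗ.[ℂ] HSp q :=
  opOnE q fun m p => basisVec q m (-p)

/-- `M_q`, the von Neumann algebra on `H` generated by the closures `α`, `γ`, `e`, `u`. -/
def Mq (q : ℝ) : VonNeumannAlgebra (HSp q) :=
  VonNeumannAlgebra.generatedByClosed
    {(alpha0 q).closure, (gamma0 q).closure, (e0 q).closure, (u0 q).closure}

open Classical in
/-- The vector `F_{r,s,m,p} ∈ H ⊗ H`, i.e. the function on `𝕋 × I_q × 𝕋 × I_q` with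
`F_{r,s,m,p}(λ, x, μ, y) = a_p(x, y) λ^{r + χ(y/p)} μ^{s - χ(x/p)}` if `y = sgn(p) q^m x`, and
`F_{r,s,m,p}(λ, x, μ, y) = 0` otherwise, as the norm-convergent sum of its components over the
points `(x, y)`. -/
def FVec (q : ℝ) (r s m : ℤ) (p : ℝ) : HTensor (HSp q) (HSp q) :=
  ∑' z : Iq q × Iq q,
    if (z.2 : ℝ) = Real.sign p * q ^ m * z.1 then
      ((aFun q p z.1 z.2 : ℝ) : ℂ) •
        HTensor.tmul (basisVec q (r + chi q (z.2 / p)) z.1)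
          (basisVec q (s - chi q (z.1 / p)) z.2)
    else 0

end QSU11

end

/-!
# The comultiplication of the extended quantum group `SU_q(1,1)`

The points of `I_q` are written `σ q^k` with a sign `σ` and an integer exponent `k`, and
`amp q σ τ π ξ η` is `a_p(x, y)` at `x = σ q^ξ`, `y = τ q^η`, `p = σ τ q^π` (`aFun_eq_amp`). Up to
a prefactor it is a value of the series `bigR Q b z e = ∑ ∏_{i<n} (z - Q^i e) (b Q^n; Q)_∞ (-1)^n
Q^{n(n-1)/2} / (Q; Q)_n` with `Q = q²`, which is entire and symmetric in `b` and `z`. Its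
contiguous relations give first order recursions for `a_p` that express `Δ(α)` and `Δ(γ)`
(`amp_gamma`, `amp_gamma'`, `amp_alpha`, `amp_alpha'`) and a three-term recursion in `p`
(`amp_jacobi`), and its symmetry gives the symmetries of `a_p` under permutations of `p`, `x`, `y`
(`amp_swap_py`, `amp_swap_xy`).

*Unitarity.* For fixed `m` and `sgn p` the numbers `a_p(x, y)`, `y = sgn(p) q^m x`, form a matrix
indexed by `p` and `x`. The first order recursions make the inner products of its rows telescope
(`gram_eq`), and the three-term recursion does the same for its columns (`tsum_fam_sq`), once the
lengths have been computed in one explicit case. Hence the vectors `F_{r,s,m,p}` are a Hilbert basis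
of `H ⊗ H` (`fBasis`), and `V` maps it to the standard one.

*The algebra.* An operator that commutes with the generators and their adjoints acts on the
component `L²(𝕋)` only, and there as a convolution, so that `M_q` consists of all operators that
commute with the multiplication by `ζ` (`isInvariantAlgebra_Mq`). Algebras of all
translation-invariant operators are stable under tensor products (`IsInvariantAlgebra.tensor`).
As `F_{r+g,s+g',m,p}` is the image of `F_{r,s,m,p}` under multiplication by `ζ^g ⊗ ζ^{g'}`, every
operator `V* (1 ⊗ 1 ⊗ a) V` lies in `M_q ⊗ M_q`. The maps `Δ`, `Δ ⊗ ι` and `ι ⊗ Δ` are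
amplifications (`HilbertBasis.ampl`), for which normality is a rearrangement of sums.

*Coassociativity.* With `F_{r,s} : H → H ⊗ H` the isometry `ζ^m ⊗ δ_p ↦ F_{r,s,m,p}`, the operators
`(F_{r,s} ⊗ 1) F_{r',s'}` intertwine `x ∈ M_q` with `(Δ ⊗ ι) Δ x`, and `(1 ⊗ F_{r,s}) F_{r',s'}`
intertwine `x` with `(ι ⊗ Δ) Δ x`. Certain infinite linear combinations of the first, composed with
translations, agree with combinations of the second (`assoc_intertwiner`). In coordinates this is
a bilinear identity between the `a_p` (`bilinAt`),
`∑ i, c_i a_p(x q^i, z₃) a_{x q^i}(z₁, z₂) = ∑ i, c_i a_p(z₁, y q^i) a_{y q^i}(z₂, z₃)`,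
where `c_i` are the coefficients of `(-v S; Q)_∞` for `v = q |p z₂ / (z₁ z₃)|`, and
`|x y| = |p z₂|`. It is proved for one pattern of signs by a recursion that follows from the
contiguous relations, and is transported to the other patterns by analytic continuation and by the
symmetries of `a_p`. Since convolution with `(c_i)` is injective on sequences that tend to zero
(`eq_zero_of_sum_al`), the ranges of the intertwiners span a dense subspace, on which
`(Δ ⊗ ι) Δ x` and `(ι ⊗ Δ) Δ x` coincide.
-/

open Filter Topology

noncomputable section

/-! ### The entire function `R` behind the amplitudes -/

namespace QSU11

section Series

set_option linter.unusedSectionVars false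

variable {𝕜 : Type*} [NormedField 𝕜]

/-- `(Q; Q)_n`. -/
def qFac (Q : 𝕜) (n : ℕ) : 𝕜 := ∏ i ∈ Finset.range n, (1 - Q ^ (i + 1))

/-- `∏_{i < n} (z - Qⁱ e)`, a homogeneous form of `(e / z; Q)_n zⁿ`. -/
def homPoch (Q z e : 𝕜) (n : ℕ) : 𝕜 := ∏ i ∈ Finset.range n, (z - Q ^ i * e)

/-- Euler's series for `(a; Q)_∞`. -/
def eulerSeries (Q a : 𝕜) : 𝕜 :=
  ∑' n : ℕ, (-1) ^ n * Q ^ n.choose 2 * a ^ n / qFac Q n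

/-- The entire function `R(b, z, e)` with `Ψ(a; b; Q, z) = R(b, z, a z)`. It is symmetric in `b`
and `z`. -/
def bigR (Q b z e : 𝕜) : 𝕜 :=
  ∑' n : ℕ, homPoch Q z e n * eulerSeries Q (b * Q ^ n) * ((-1) ^ n * Q ^ n.choose 2 / qFac Q n)

/-- The partial theta function `∑ r^{n(n-1)/2} xⁿ`, which dominates all series below. -/
def thetaBound (r x : ℝ) : ℝ := ∑' n : ℕ, r ^ n.choose 2 * x ^ n

theorem choose_two_succ (n : ℕ) : (n + 1).choose 2 = n.choose 2 + n := by
  rw [Nat.choose_succ_succ' n 1, Nat.choose_one_right, add_comm]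

theorem summable_thetaBound {r : ℝ} (h0 : 0 ≤ r) (h1 : r < 1) (x : ℝ) :
    Summable fun n : ℕ => r ^ n.choose 2 * x ^ n := by
  refine summable_of_ratio_norm_eventually_le (r := 1 / 2) (by norm_num) ?_
  have ht : Tendsto (fun n : ℕ => r ^ n * |x|) atTop (𝓝 0) := by
    simpa using (tendsto_pow_atTop_nhds_zero_of_lt_one h0 h1).mul_const |x|
  filter_upwards [ht.eventually_le_const (show (0 : ℝ) < 1 / 2 by norm_num)] with n hn
  rw [choose_two_succ, pow_add, pow_succ]
  calc ‖r ^ n.choose 2 * r ^ n * (x ^ n * x)‖ = (r ^ n * |x|) * ‖r ^ n.choose 2 * x ^ n‖ := by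
        simp only [norm_mul, norm_pow, Real.norm_eq_abs, abs_of_nonneg h0]; ring
    _ ≤ _ := by gcongr

theorem thetaBound_nonneg {r x : ℝ} (h0 : 0 ≤ r) (hx : 0 ≤ x) : 0 ≤ thetaBound r x :=
  tsum_nonneg fun n => by positivity

theorem thetaBound_mono {r x y : ℝ} (h0 : 0 ≤ r) (h1 : r < 1) (hx : 0 ≤ x) (hxy : x ≤ y) :
    thetaBound r x ≤ thetaBound r y :=
  (summable_thetaBound h0 h1 x).tsum_le_tsum (fun n => by gcongr) (summable_thetaBound h0 h1 y)

theorem one_le_thetaBound {r x : ℝ} (h0 : 0 ≤ r) (h1 : r < 1) (hx : 0 ≤ x) :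
    1 ≤ thetaBound r x := by
  have := (summable_thetaBound h0 h1 x).le_tsum 0 (fun n _ => by positivity)
  simpa [thetaBound] using this

theorem thetaBound_eq {r : ℝ} (h0 : 0 ≤ r) (h1 : r < 1) (x : ℝ) :
    thetaBound r x = 1 + x * thetaBound r (r * x) := by
  unfold thetaBound
  rw [(summable_thetaBound h0 h1 x).tsum_eq_zero_add, ← tsum_mul_left]
  congr 1
  · simp
  · refine tsum_congr fun n => ?_
    rw [choose_two_succ]; ring

/-- Dilation of the argument costs at most a Gaussian factor. -/
theorem thetaBound_div_pow_le {r x : ℝ} (h0 : 0 < r) (h1 : r < 1) (hx : 0 ≤ x) (n : ℕ) :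
    thetaBound r (x / r ^ n) ≤ (1 + x) ^ n * (r⁻¹) ^ (n + 1).choose 2 * thetaBound r x := by
  induction n with
  | zero => simp
  | succ n ih =>
    have hT := one_le_thetaBound h0.le h1 (x := x / r ^ n) (by positivity)
    have e1 : r * (x / r ^ (n + 1)) = x / r ^ n := by field_simp; ring
    have hr : 1 ≤ (r⁻¹) ^ (n + 1) := one_le_pow₀ ((one_le_inv₀ h0).2 h1.le)
    calc thetaBound r (x / r ^ (n + 1)) = 1 + x * (r⁻¹) ^ (n + 1) * thetaBound r (x / r ^ n) := by
          rw [thetaBound_eq h0.le h1, e1, inv_pow]; ring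
      _ ≤ (r⁻¹) ^ (n + 1) * thetaBound r (x / r ^ n)
            + x * (r⁻¹) ^ (n + 1) * thetaBound r (x / r ^ n) := by
          gcongr; exact one_le_mul_of_one_le_of_one_le hr hT
      _ = (1 + x) * (r⁻¹) ^ (n + 1) * thetaBound r (x / r ^ n) := by ring
      _ ≤ (1 + x) * (r⁻¹) ^ (n + 1) *
            ((1 + x) ^ n * (r⁻¹) ^ (n + 1).choose 2 * thetaBound r x) := by gcongr
      _ = _ := by rw [choose_two_succ (n + 1)]; ring

theorem one_sub_pow_ne_zero {Q : 𝕜} (hQ : ‖Q‖ < 1) (n : ℕ) : 1 - Q ^ (n + 1) ≠ 0 := by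
  intro h
  have h1 : ‖Q ^ (n + 1)‖ < 1 := by
    rw [norm_pow]; exact pow_lt_one₀ (norm_nonneg _) hQ (by omega)
  rw [← sub_eq_zero.1 h, norm_one] at h1
  exact lt_irrefl _ h1

theorem qFac_ne_zero {Q : 𝕜} (hQ : ‖Q‖ < 1) (n : ℕ) : qFac Q n ≠ 0 :=
  Finset.prod_ne_zero_iff.2 fun i _ => one_sub_pow_ne_zero hQ i

theorem qFac_succ (Q : 𝕜) (n : ℕ) : qFac Q (n + 1) = qFac Q n * (1 - Q ^ (n + 1)) :=
  Finset.prod_range_succ _ _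

theorem norm_inv_qFac_le {Q : 𝕜} (hQ : ‖Q‖ < 1) (n : ℕ) :
    ‖(qFac Q n)⁻¹‖ ≤ ((1 - ‖Q‖)⁻¹) ^ n := by
  have h1 : 0 < 1 - ‖Q‖ := by linarith
  rw [norm_inv, inv_pow]
  refine inv_anti₀ (by positivity) ?_
  rw [qFac, norm_prod, ← Finset.card_range n, ← Finset.prod_const, Finset.card_range]
  refine Finset.prod_le_prod (fun _ _ => h1.le) fun i _ => ?_
  have h2 : ‖Q ^ (i + 1)‖ ≤ ‖Q‖ := by
    rw [norm_pow]; exact pow_le_of_le_one (norm_nonneg _) hQ.le (by omega)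
  calc 1 - ‖Q‖ ≤ ‖(1 : 𝕜)‖ - ‖Q ^ (i + 1)‖ := by rw [norm_one]; linarith
    _ ≤ _ := norm_sub_norm_le _ _

theorem homPoch_succ (Q z e : 𝕜) (n : ℕ) :
    homPoch Q z e (n + 1) = homPoch Q z e n * (z - Q ^ n * e) :=
  Finset.prod_range_succ _ _

theorem homPoch_succ' (Q z e : 𝕜) (n : ℕ) :
    homPoch Q z e (n + 1) = (z - e) * homPoch Q z (Q * e) n := by
  rw [homPoch, Finset.prod_range_succ', mul_comm]
  simp only [pow_zero, one_mul, homPoch, pow_succ, mul_assoc]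

theorem homPoch_mul (Q c z e : 𝕜) (n : ℕ) :
    homPoch Q (c * z) (c * e) n = c ^ n * homPoch Q z e n := by
  induction n with
  | zero => simp [homPoch]
  | succ n ih => rw [homPoch_succ, homPoch_succ, ih]; ring

theorem norm_homPoch_le {Q : 𝕜} (hQ : ‖Q‖ < 1) (z e : 𝕜) (n : ℕ) :
    ‖homPoch Q z e n‖ ≤ (‖z‖ + ‖e‖) ^ n := by
  rw [homPoch, norm_prod, ← Finset.card_range n, ← Finset.prod_const, Finset.card_range]
  refine Finset.prod_le_prod (fun _ _ => norm_nonneg _) fun i _ => ?_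
  refine (norm_sub_le _ _).trans ?_
  rw [norm_mul, norm_pow]
  have : ‖Q‖ ^ i ≤ 1 := pow_le_one₀ (norm_nonneg _) hQ.le
  nlinarith [norm_nonneg e]

theorem norm_eulerSeries_term_le {Q : 𝕜} (hQ : ‖Q‖ < 1) {a : 𝕜} {x : ℝ} (hx : ‖a‖ ≤ x) (n : ℕ) :
    ‖(-1) ^ n * Q ^ n.choose 2 * a ^ n / qFac Q n‖ ≤
      ‖Q‖ ^ n.choose 2 * ((1 - ‖Q‖)⁻¹ * x) ^ n := by
  have h1 : 0 < 1 - ‖Q‖ := by linarith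
  rw [div_eq_mul_inv, norm_mul, norm_mul, norm_mul, norm_pow, norm_pow, norm_pow, norm_neg,
    norm_one, one_pow, one_mul, mul_pow, mul_assoc]
  refine mul_le_mul_of_nonneg_left ?_ (by positivity)
  rw [mul_comm]
  gcongr
  exact norm_inv_qFac_le hQ n

variable [CompleteSpace 𝕜]

theorem summable_eulerSeries {Q : 𝕜} (hQ : ‖Q‖ < 1) (a : 𝕜) :
    Summable fun n : ℕ => (-1) ^ n * Q ^ n.choose 2 * a ^ n / qFac Q n :=
  .of_norm_bounded (summable_thetaBound (norm_nonneg _) hQ _)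
    (norm_eulerSeries_term_le hQ le_rfl)

theorem norm_eulerSeries_le {Q : 𝕜} (hQ : ‖Q‖ < 1) (a : 𝕜) :
    ‖eulerSeries Q a‖ ≤ thetaBound ‖Q‖ ((1 - ‖Q‖)⁻¹ * ‖a‖) :=
  tsum_of_norm_bounded (summable_thetaBound (norm_nonneg _) hQ _).hasSum
    (norm_eulerSeries_term_le hQ le_rfl)

theorem eulerSeries_zero (Q : 𝕜) : eulerSeries Q 0 = 1 := by
  rw [eulerSeries, tsum_eq_single 0]
  · simp [qFac]
  · intro n hn; simp [hn]

theorem eulerSeries_eq {Q : 𝕜} (hQ : ‖Q‖ < 1) (a : 𝕜) :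
    eulerSeries Q a = (1 - a) * eulerSeries Q (Q * a) := by
  have hs1 := summable_eulerSeries hQ a
  have hs2 := summable_eulerSeries hQ (Q * a)
  have h : eulerSeries Q a - eulerSeries Q (Q * a) = -a * eulerSeries Q (Q * a) := by
    rw [eulerSeries, eulerSeries, ← hs1.tsum_sub hs2, (hs1.sub hs2).tsum_eq_zero_add,
      ← tsum_mul_left]
    simp only [pow_zero, sub_self, zero_add]
    refine tsum_congr fun n => ?_
    have h1 := one_sub_pow_ne_zero hQ n
    have h2 := qFac_ne_zero hQ n
    rw [qFac_succ, choose_two_succ, mul_pow, mul_pow]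
    field_simp
    ring
  linear_combination h

theorem tendsto_eulerSeries {Q : 𝕜} (hQ : ‖Q‖ < 1) {ι : Type*} {l : Filter ι} {f : ι → 𝕜} {a : 𝕜}
    (hf : Tendsto f l (𝓝 a)) : Tendsto (fun i => eulerSeries Q (f i)) l (𝓝 (eulerSeries Q a)) := by
  refine tendsto_tsum_of_dominated_convergence
    (summable_thetaBound (norm_nonneg Q) hQ ((1 - ‖Q‖)⁻¹ * (‖a‖ + 1))) (fun n => ?_) ?_
  · exact ((hf.pow n).const_mul _).div_const _
  · filter_upwards [hf.norm.eventually_le_const (lt_add_one ‖a‖)] with i hi n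
    exact norm_eulerSeries_term_le hQ hi n

theorem eulerSeries_eq_zero {Q : 𝕜} (hQ : ‖Q‖ < 1) {a : 𝕜} {i : ℕ} (ha : Q ^ i * a = 1) :
    eulerSeries Q a = 0 := by
  induction i generalizing a with
  | zero => rw [eulerSeries_eq hQ]; simp at ha; simp [ha]
  | succ n ih => rw [eulerSeries_eq hQ, ih (by rw [← ha]; ring), mul_zero]

theorem norm_eulerSeries_mul_pow_le {Q : 𝕜} (hQ : ‖Q‖ < 1) (b : 𝕜) (n : ℕ) :
    ‖eulerSeries Q (b * Q ^ n)‖ ≤ thetaBound ‖Q‖ ((1 - ‖Q‖)⁻¹ * ‖b‖) := by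
  have h1 : 0 < 1 - ‖Q‖ := by linarith
  refine (norm_eulerSeries_le hQ _).trans (thetaBound_mono (norm_nonneg _) hQ (by positivity) ?_)
  gcongr
  rw [norm_mul, norm_pow]
  exact mul_le_of_le_one_right (norm_nonneg _) (pow_le_one₀ (norm_nonneg _) hQ.le)

theorem norm_bigR_term_le {Q : 𝕜} (hQ : ‖Q‖ < 1) (b : 𝕜) {z e : 𝕜} {x : ℝ} (hx : ‖z‖ + ‖e‖ ≤ x)
    (n : ℕ) :
    ‖homPoch Q z e n * eulerSeries Q (b * Q ^ n) * ((-1) ^ n * Q ^ n.choose 2 / qFac Q n)‖ ≤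
      thetaBound ‖Q‖ ((1 - ‖Q‖)⁻¹ * ‖b‖) * (‖Q‖ ^ n.choose 2 * ((1 - ‖Q‖)⁻¹ * x) ^ n) := by
  have h1 : 0 < 1 - ‖Q‖ := by linarith
  have hx0 : 0 ≤ x := le_trans (by positivity) hx
  have hT := thetaBound_nonneg (norm_nonneg Q) (x := (1 - ‖Q‖)⁻¹ * ‖b‖) (by positivity)
  rw [norm_mul, norm_mul, div_eq_mul_inv, norm_mul, norm_mul, norm_pow, norm_pow, norm_neg,
    norm_one, one_pow, one_mul, mul_pow]
  calc _ ≤ (x ^ n) * thetaBound ‖Q‖ ((1 - ‖Q‖)⁻¹ * ‖b‖) *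
        (‖Q‖ ^ n.choose 2 * ((1 - ‖Q‖)⁻¹) ^ n) := by
        gcongr
        · exact (norm_homPoch_le hQ z e n).trans (by gcongr)
        · exact norm_eulerSeries_mul_pow_le hQ b n
        · exact norm_inv_qFac_le hQ n
    _ = _ := by ring

theorem summable_norm_bigR {Q : 𝕜} (hQ : ‖Q‖ < 1) (b z e : 𝕜) :
    Summable fun n : ℕ =>
      ‖homPoch Q z e n * eulerSeries Q (b * Q ^ n) * ((-1) ^ n * Q ^ n.choose 2 / qFac Q n)‖ :=
  Summable.of_nonneg_of_le (fun _ => norm_nonneg _) (norm_bigR_term_le hQ b le_rfl)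
    ((summable_thetaBound (norm_nonneg _) hQ _).mul_left _)

theorem summable_bigR {Q : 𝕜} (hQ : ‖Q‖ < 1) (b z e : 𝕜) :
    Summable fun n : ℕ =>
      homPoch Q z e n * eulerSeries Q (b * Q ^ n) * ((-1) ^ n * Q ^ n.choose 2 / qFac Q n) :=
  (summable_norm_bigR hQ b z e).of_norm

theorem norm_bigR_le {Q : 𝕜} (hQ : ‖Q‖ < 1) (b z e : 𝕜) :
    ‖bigR Q b z e‖ ≤ thetaBound ‖Q‖ ((1 - ‖Q‖)⁻¹ * ‖b‖) *
      thetaBound ‖Q‖ ((1 - ‖Q‖)⁻¹ * (‖z‖ + ‖e‖)) :=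
  tsum_of_norm_bounded ((summable_thetaBound (norm_nonneg _) hQ _).hasSum.mul_left _)
    (norm_bigR_term_le hQ b le_rfl)

theorem tendsto_bigR {Q : 𝕜} (hQ : ‖Q‖ < 1) (b : 𝕜) {ι : Type*} {l : Filter ι} {f g : ι → 𝕜}
    {z e : 𝕜} (hf : Tendsto f l (𝓝 z)) (hg : Tendsto g l (𝓝 e)) :
    Tendsto (fun i => bigR Q b (f i) (g i)) l (𝓝 (bigR Q b z e)) := by
  refine tendsto_tsum_of_dominated_convergence
    ((summable_thetaBound (norm_nonneg Q) hQ ((1 - ‖Q‖)⁻¹ * (‖z‖ + ‖e‖ + 1))).mul_left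
      (thetaBound ‖Q‖ ((1 - ‖Q‖)⁻¹ * ‖b‖))) (fun n => ?_) ?_
  · refine Tendsto.mul_const _ (Tendsto.mul_const _ ?_)
    exact tendsto_finsetProd _ fun i _ => hf.sub (hg.const_mul _)
  · filter_upwards [(hf.norm.add hg.norm).eventually_le_const (lt_add_one (‖z‖ + ‖e‖))] with i hi n
    exact norm_bigR_term_le hQ b hi n

theorem bigR_zero_zero (Q b : 𝕜) : bigR Q b 0 0 = eulerSeries Q b := by
  rw [bigR, tsum_eq_single 0]
  · simp [qFac, homPoch]
  · intro n hn
    obtain ⟨k, rfl⟩ := Nat.exists_eq_succ_of_ne_zero hn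
    simp [homPoch_succ']

/-- For `z = e` only the first term of the series survives. -/
theorem bigR_self (Q b z : 𝕜) : bigR Q b z z = eulerSeries Q b := by
  rw [bigR, tsum_eq_single 0]
  · simp [qFac, homPoch]
  · intro n hn
    obtain ⟨k, rfl⟩ := Nat.exists_eq_succ_of_ne_zero hn
    simp [homPoch_succ']

/-- Contiguous relation in the first parameter. -/
theorem bigR_contig_fst {Q : 𝕜} (hQ : ‖Q‖ < 1) (b z e : 𝕜) :
    bigR Q b z e = bigR Q (Q * b) z e - b * bigR Q (Q * b) (Q * z) (Q * e) := by
  unfold bigR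
  rw [← tsum_mul_left, ← (summable_bigR hQ _ _ _).tsum_sub ((summable_bigR hQ _ _ _).mul_left _)]
  refine tsum_congr fun n => ?_
  rw [eulerSeries_eq hQ (b * Q ^ n), homPoch_mul, show Q * (b * Q ^ n) = Q * b * Q ^ n by ring]
  ring

/-- Contiguous relation in the last parameter. -/
theorem bigR_contig_last {Q : 𝕜} (hQ : ‖Q‖ < 1) (b z e : 𝕜) :
    bigR Q b z e = bigR Q b z (Q * e) + e * bigR Q (Q * b) (Q * z) (Q * (Q * e)) := by
  have hs1 := summable_bigR hQ b z e
  have hs2 := summable_bigR hQ b z (Q * e)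
  have h : bigR Q b z e - bigR Q b z (Q * e) = e * bigR Q (Q * b) (Q * z) (Q * (Q * e)) := by
    unfold bigR
    rw [← hs1.tsum_sub hs2, (hs1.sub hs2).tsum_eq_zero_add, ← tsum_mul_left]
    rw [show homPoch Q z e 0 = 1 by simp [homPoch], show homPoch Q z (Q * e) 0 = 1 by simp [homPoch],
      sub_self, zero_add]
    refine tsum_congr fun n => ?_
    have h1 := one_sub_pow_ne_zero hQ n
    have h2 := qFac_ne_zero hQ n
    rw [homPoch_mul, homPoch_succ', homPoch_succ, qFac_succ, choose_two_succ,
      show Q * b * Q ^ n = b * Q ^ (n + 1) by ring]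
    field_simp
    ring
  linear_combination h

/-- The generating function of `(e / z; Q)_n zⁿ / (Q; Q)_n`, as a formal power series. -/
def homPochSeries (Q z e : 𝕜) : PowerSeries 𝕜 := PowerSeries.mk fun n => homPoch Q z e n / qFac Q n

theorem homPochSeries_eq {Q : 𝕜} (hQ : ‖Q‖ < 1) (z e : 𝕜) :
    (1 - PowerSeries.C z * PowerSeries.X) * homPochSeries Q z e =
      (1 - PowerSeries.C e * PowerSeries.X) * PowerSeries.rescale Q (homPochSeries Q z e) := by
  ext n
  cases n with
  | zero => 
    simp only [homPochSeries, sub_mul, one_mul, mul_assoc, map_sub, PowerSeries.coeff_C_mul,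
      PowerSeries.coeff_zero_X_mul, PowerSeries.coeff_mk, PowerSeries.coeff_rescale]
    ring
  | succ n =>
    have h1 := one_sub_pow_ne_zero hQ n
    have h2 := qFac_ne_zero hQ n
    simp only [homPochSeries, sub_mul, one_mul, mul_assoc, map_sub, PowerSeries.coeff_C_mul,
      PowerSeries.coeff_succ_X_mul, PowerSeries.coeff_mk, PowerSeries.coeff_rescale, homPoch_succ,
      qFac_succ]
    field_simp
    ring

theorem eq_homPochSeries {Q : 𝕜} (hQ : ‖Q‖ < 1) {z e : 𝕜} {f : PowerSeries 𝕜}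
    (h0 : PowerSeries.coeff 0 f = 1)
    (hf : (1 - PowerSeries.C z * PowerSeries.X) * f =
      (1 - PowerSeries.C e * PowerSeries.X) * PowerSeries.rescale Q f) :
    f = homPochSeries Q z e := by
  ext n
  induction n with
  | zero => simp [homPochSeries, homPoch, qFac, h0]
  | succ n ih =>
    have h1 := one_sub_pow_ne_zero hQ n
    have h2 := qFac_ne_zero hQ n
    have h3 := congrArg (PowerSeries.coeff (n + 1)) hf
    simp only [sub_mul, one_mul, mul_assoc, map_sub, PowerSeries.coeff_C_mul,
      PowerSeries.coeff_succ_X_mul, PowerSeries.coeff_rescale, ih] at h3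
    simp only [homPochSeries, PowerSeries.coeff_mk] at h3 ⊢
    rw [homPoch_succ, qFac_succ, eq_div_iff (mul_ne_zero h2 h1)]
    have h4 : homPoch Q z e n / qFac Q n * qFac Q n = homPoch Q z e n := div_mul_cancel₀ _ h2
    linear_combination (qFac Q n) * h3 + (z - Q ^ n * e) * h4

/-- The `q`-binomial theorem, in the form of a factorization of formal power series. -/
theorem homPochSeries_factor {Q : 𝕜} (hQ : ‖Q‖ < 1) (z e : 𝕜) :
    homPochSeries Q z e = homPochSeries Q z 0 * homPochSeries Q 0 e := by
  refine (eq_homPochSeries hQ ?_ ?_).symm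
  · simp [homPochSeries, homPoch, qFac]
  · have h1 := homPochSeries_eq hQ z 0
    have h2 := homPochSeries_eq hQ 0 e
    simp only [map_zero, zero_mul, sub_zero, one_mul] at h1 h2
    rw [map_mul, ← mul_assoc, h1]
    nth_rewrite 1 [h2]
    ring

theorem bigR_eq_tsum_coeff {Q : 𝕜} (hQ : ‖Q‖ < 1) (b z e : 𝕜) :
    bigR Q b z e = ∑' n : ℕ, (-1) ^ n * Q ^ n.choose 2 *
      PowerSeries.coeff n (homPochSeries Q z e * homPochSeries Q b 0) := by
  have h1 : 0 < 1 - ‖Q‖ := by linarith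
  set f : ℕ × ℕ → 𝕜 := fun i => (-1) ^ (i.1 + i.2) * Q ^ (i.1 + i.2).choose 2 *
    (homPoch Q z e i.1 / qFac Q i.1 * (homPoch Q b 0 i.2 / qFac Q i.2)) with hf
  have hb : ∀ n, homPoch Q b 0 n = b ^ n := fun n => by simp [homPoch]
  have hch : ∀ m n : ℕ, (m + n).choose 2 = m.choose 2 + n.choose 2 + m * n := by
    intro m n
    induction n with
    | zero => simp
    | succ n ih => rw [← add_assoc, choose_two_succ, choose_two_succ, ih]; ring
  have hfe : ∀ n k, f (n, k) = homPoch Q z e n *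
      ((-1) ^ k * Q ^ k.choose 2 * (b * Q ^ n) ^ k / qFac Q k) *
      ((-1) ^ n * Q ^ n.choose 2 / qFac Q n) := by
    intro n k
    simp only [hf, hch, hb, pow_add, mul_pow, pow_mul]
    have h2 := qFac_ne_zero hQ n
    have h3 := qFac_ne_zero hQ k
    field_simp
  have hs : Summable f := by
    refine Summable.of_norm_bounded
      ((summable_thetaBound (norm_nonneg Q) hQ ((1 - ‖Q‖)⁻¹ * (‖z‖ + ‖e‖))).mul_of_nonneg
        (summable_thetaBound (norm_nonneg Q) hQ ((1 - ‖Q‖)⁻¹ * ‖b‖)) ?_ ?_) ?_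
    · intro n; positivity
    · intro n; positivity
    · rintro ⟨n, k⟩
      have hb' : ‖b * Q ^ n‖ ≤ ‖b‖ := by
        rw [norm_mul, norm_pow]
        exact mul_le_of_le_one_right (norm_nonneg _) (pow_le_one₀ (norm_nonneg _) hQ.le)
      have e1 := norm_eulerSeries_term_le hQ hb' k
      have e2 := norm_homPoch_le hQ z e n
      have e3 := norm_inv_qFac_le hQ n
      rw [hfe, norm_mul, norm_mul, div_eq_mul_inv _ (qFac Q n), norm_mul, norm_mul, norm_pow,
        norm_pow, norm_neg, norm_one, one_pow, one_mul]
      calc _ ≤ (‖z‖ + ‖e‖) ^ n * (‖Q‖ ^ k.choose 2 * ((1 - ‖Q‖)⁻¹ * ‖b‖) ^ k) *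
            (‖Q‖ ^ n.choose 2 * ((1 - ‖Q‖)⁻¹) ^ n) := by gcongr
        _ = _ := by rw [mul_pow _ (‖z‖ + ‖e‖)]; ring
  calc bigR Q b z e = ∑' n, ∑' k, f (n, k) := by
        unfold bigR eulerSeries
        refine tsum_congr fun n => ?_
        rw [← tsum_mul_left, ← tsum_mul_right]
        exact tsum_congr fun k => (hfe n k).symm
    _ = ∑' i, f i := (hs.tsum_prod' fun n => hs.prod_factor n).symm
    _ = ∑' i : Σ n : ℕ, Finset.HasAntidiagonal.antidiagonal n, f (Finset.HasAntidiagonal.sigmaAntidiagonalEquivProd i) :=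
        (Finset.HasAntidiagonal.sigmaAntidiagonalEquivProd.tsum_eq f).symm
    _ = ∑' n : ℕ, ∑' i : Finset.HasAntidiagonal.antidiagonal n, f (i : ℕ × ℕ) := by
        refine ((Finset.HasAntidiagonal.sigmaAntidiagonalEquivProd.summable_iff (f := f)).2 hs).tsum_sigma'
          fun n => ?_
        exact (hasSum_fintype _).summable
    _ = _ := by
        refine tsum_congr fun n => ?_
        rw [tsum_fintype, PowerSeries.coeff_mul, Finset.mul_sum, Finset.univ_eq_attach,
          Finset.sum_attach (Finset.HasAntidiagonal.antidiagonal n) f]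
        refine Finset.sum_congr rfl fun i hi => ?_
        rw [Finset.HasAntidiagonal.mem_antidiagonal] at hi
        simp only [hf, hi, homPochSeries, PowerSeries.coeff_mk]

theorem bigR_comm {Q : 𝕜} (hQ : ‖Q‖ < 1) (b z e : 𝕜) : bigR Q b z e = bigR Q z b e := by
  rw [bigR_eq_tsum_coeff hQ, bigR_eq_tsum_coeff hQ, homPochSeries_factor hQ z e,
    homPochSeries_factor hQ b e, mul_right_comm (homPochSeries Q z 0),
    mul_right_comm (homPochSeries Q b 0), mul_comm (homPochSeries Q z 0)]

/-- Contiguous relation in the second parameter. -/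
theorem bigR_contig_snd {Q : 𝕜} (hQ : ‖Q‖ < 1) (b z e : 𝕜) :
    bigR Q b z e = bigR Q b (Q * z) e - z * bigR Q (Q * b) (Q * z) (Q * e) := by
  rw [bigR_comm hQ b z, bigR_contig_fst hQ, bigR_comm hQ b, bigR_comm hQ (Q * b)]

theorem bigR_rel_gamma {Q : 𝕜} (hQ : ‖Q‖ < 1) (b z e : 𝕜) :
    z * bigR Q b z e =
      (z - e) * bigR Q (Q * b) z (Q * e) + (e - b * z) * bigR Q (Q * b) (Q * z) (Q * e) := by
  linear_combination z * bigR_contig_fst hQ b z e + z * bigR_contig_last hQ (Q * b) z e +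
    e * bigR_contig_snd hQ (Q * b) z (Q * e)

theorem bigR_rel_alpha {Q : 𝕜} (hQ : ‖Q‖ < 1) (b z e : 𝕜) :
    z * bigR Q b z e - e * bigR Q b (Q * z) (Q * e) = (z - e) * bigR Q b z (Q * e) := by
  linear_combination z * bigR_contig_last hQ b z e + e * bigR_contig_snd hQ b z (Q * e)

theorem bigR_rel_alpha' {Q : 𝕜} (hQ : ‖Q‖ < 1) (b z e : 𝕜) :
    z * (e - b) * bigR Q b (Q * z) (Q * e) + (z * b - e) * bigR Q b (Q * z) e
      + e * bigR Q b z e = 0 := by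
  linear_combination e * bigR_contig_snd hQ b z e + z * b * bigR_contig_last hQ b (Q * z) e +
    z * e * bigR_contig_fst hQ b (Q * z) (Q * e)

/-- Second order `q`-difference equation. -/
theorem bigR_jacobi {Q : 𝕜} (hQ : ‖Q‖ < 1) (b z e : 𝕜) :
    bigR Q (Q * b) z e + (b - e) * bigR Q (Q * b) (Q * (Q * z)) (Q * (Q * e)) =
      (1 + b - z) * bigR Q (Q * b) (Q * z) (Q * e) := by
  linear_combination -bigR_contig_fst hQ b z e + bigR_contig_fst hQ b (Q * z) (Q * e) +
    bigR_contig_snd hQ b z e + bigR_contig_last hQ b (Q * z) e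

theorem eulerSeries_eq_qFac {Q : 𝕜} (hQ : ‖Q‖ < 1) (n : ℕ) :
    eulerSeries Q Q = qFac Q n * eulerSeries Q (Q ^ (n + 1)) := by
  induction n with
  | zero => simp [qFac]
  | succ n ih =>
    rw [ih, eulerSeries_eq hQ (Q ^ (n + 1)), qFac_succ, ← pow_succ' Q (n + 1)]; ring

theorem homPoch_add (Q z e : 𝕜) (m n : ℕ) :
    homPoch Q z e (m + n) = homPoch Q z e m * homPoch Q z (Q ^ m * e) n := by
  rw [homPoch, Finset.prod_range_add, homPoch, homPoch]
  simp only [pow_add, mul_assoc, mul_left_comm]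

/-- If `b = Q^{1-m}`, the first `m` terms of the series vanish, and the rest is a series of the
same kind. -/
theorem bigR_shift {Q : 𝕜} (hQ : ‖Q‖ < 1) (m : ℕ) {b : 𝕜} (hb : Q ^ m * b = Q) (h0 : Q ≠ 0)
    (z e : 𝕜) :
    bigR Q b z e = (-1) ^ m * Q ^ m.choose 2 * homPoch Q z e m *
      bigR Q (Q * Q ^ m) (Q ^ m * z) (Q ^ m * (Q ^ m * e)) := by
  have hch : ∀ m n : ℕ, (m + n).choose 2 = m.choose 2 + n.choose 2 + m * n := by
    intro m n
    induction n with
    | zero => simp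
    | succ n ih => rw [← add_assoc, choose_two_succ, choose_two_succ, ih]; ring
  rw [bigR, ← (summable_bigR hQ b z e).sum_add_tsum_nat_add m, Finset.sum_eq_zero, zero_add, bigR,
    ← tsum_mul_left]
  · refine tsum_congr fun n => ?_
    have e1 : b * Q ^ (n + m) = Q ^ (n + 1) := by linear_combination Q ^ n * hb
    have e2 : eulerSeries Q (Q ^ (n + 1)) / qFac Q (n + m) =
        eulerSeries Q (Q * Q ^ m * Q ^ n) / qFac Q n := by
      rw [div_eq_div_iff (qFac_ne_zero hQ _) (qFac_ne_zero hQ _)]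
      have h1 := eulerSeries_eq_qFac hQ n
      have h2 := eulerSeries_eq_qFac hQ (n + m)
      rw [show Q ^ (n + m + 1) = Q * Q ^ m * Q ^ n by ring] at h2
      linear_combination h2 - h1
    rw [add_comm n m] at e2
    rw [e1]
    generalize Q ^ (n + 1) = y at e2 ⊢
    rw [add_comm n m, homPoch_add, homPoch_mul, hch, pow_add, pow_add, pow_add, pow_mul]
    linear_combination homPoch Q z e m * homPoch Q z (Q ^ m * e) n * (-1) ^ m * (-1) ^ n *
      (Q ^ m.choose 2 * Q ^ n.choose 2 * (Q ^ m) ^ n) * e2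
  · intro n hn
    rw [Finset.mem_range] at hn
    rw [eulerSeries_eq_zero hQ (i := m - 1 - n), mul_zero, zero_mul]
    have h1 : Q * (Q ^ (m - 1 - n) * (b * Q ^ n)) = Q * 1 := by
      obtain ⟨k, rfl⟩ : ∃ k, m = k + n + 1 := ⟨m - 1 - n, by omega⟩
      rw [show k + n + 1 - 1 - n = k by omega]
      linear_combination hb
    exact mul_left_cancel₀ h0 h1

end Series

theorem ofReal_eulerSeries (Q a : ℝ) : ((eulerSeries Q a : ℝ) : ℂ) = eulerSeries (Q : ℂ) a := by
  unfold eulerSeries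
  rw [Complex.ofReal_tsum]
  exact tsum_congr fun n => by simp [qFac]

theorem ofReal_bigR (Q b z e : ℝ) : ((bigR Q b z e : ℝ) : ℂ) = bigR (Q : ℂ) b z e := by
  unfold bigR
  rw [Complex.ofReal_tsum]
  refine tsum_congr fun n => ?_
  push_cast [ofReal_eulerSeries, homPoch, qFac]
  rfl

theorem differentiable_eulerSeries {Q : ℂ} (hQ : ‖Q‖ < 1) : Differentiable ℂ (eulerSeries Q) := by
  intro a
  refine DifferentiableOn.differentiableAt (s := Metric.ball 0 (‖a‖ + 1)) ?_
    (Metric.isOpen_ball.mem_nhds (by simp))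
  refine Complex.differentiableOn_tsum_of_summable_norm
    (summable_thetaBound (norm_nonneg Q) hQ ((1 - ‖Q‖)⁻¹ * (‖a‖ + 1))) (fun n => ?_)
    Metric.isOpen_ball fun n w hw => ?_
  · exact Differentiable.differentiableOn (by fun_prop)
  · exact norm_eulerSeries_term_le hQ ((mem_ball_zero_iff.1 hw).le) n

/-- `R` is an entire function of its three arguments. -/
theorem differentiableOn_bigR {Q : ℂ} (hQ : ‖Q‖ < 1) {U : Set ℂ} (hU : IsOpen U) {f g h : ℂ → ℂ}
    (hf : DifferentiableOn ℂ f U) (hg : DifferentiableOn ℂ g U) (hh : DifferentiableOn ℂ h U) :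
    DifferentiableOn ℂ (fun T => bigR Q (f T) (g T) (h T)) U := by
  intro T hT
  have hc : ∀ {k : ℂ → ℂ}, DifferentiableOn ℂ k U → ∀ᶠ S in 𝓝 T, ‖k S‖ ≤ ‖k T‖ + 1 := fun hk =>
    (hk.continuousOn.continuousAt (hU.mem_nhds hT)).norm.eventually_le_const (lt_add_one _)
  obtain ⟨W, hWs, hWo, hTW⟩ := mem_nhds_iff.1
    ((hU.eventually_mem hT).and ((hc hf).and ((hc hg).and (hc hh))))
  have h1 : 0 < 1 - ‖Q‖ := by linarith
  refine DifferentiableAt.differentiableWithinAt (DifferentiableOn.differentiableAt (s := W) ?_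
    (hWo.mem_nhds hTW))
  refine Complex.differentiableOn_tsum_of_summable_norm
    ((summable_thetaBound (norm_nonneg Q) hQ
      ((1 - ‖Q‖)⁻¹ * (‖g T‖ + 1 + (‖h T‖ + 1)))).mul_left
      (thetaBound ‖Q‖ ((1 - ‖Q‖)⁻¹ * (‖f T‖ + 1)))) (fun n => ?_) hWo fun n S hS => ?_
  · have hWU : W ⊆ U := fun S hS => (hWs hS).1
    have hf' := hf.mono hWU
    have hg' := hg.mono hWU
    have hh' := hh.mono hWU
    refine DifferentiableOn.mul_const (DifferentiableOn.mul ?_ ?_) _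
    · exact DifferentiableOn.fun_finsetProd fun i _ => hg'.sub (hh'.const_mul _)
    · exact (differentiable_eulerSeries hQ).comp_differentiableOn (hf'.mul_const _)
  · obtain ⟨-, h2, h3, h4⟩ := hWs hS
    refine (norm_bigR_term_le hQ (f S) (add_le_add h3 h4) n).trans ?_
    gcongr
    exact thetaBound_mono (norm_nonneg _) hQ (by positivity) (by gcongr)

theorem qPochInf_eq {Q : ℝ} (h0 : 0 ≤ Q) (h1 : Q < 1) (a : ℝ) :
    qPochInf Q a = eulerSeries Q a := by
  have hQ : ‖Q‖ < 1 := by rwa [Real.norm_of_nonneg h0]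
  have hm : Multipliable fun i : ℕ => 1 - Q ^ i * a := by
    have := Real.multipliable_one_add_of_summable (f := fun i : ℕ => -(Q ^ i * a))
      ((summable_geometric_of_lt_one h0 h1).mul_right a).neg
    simpa [sub_eq_add_neg] using this
  have h2 : ∀ n : ℕ, eulerSeries Q a =
      (∏ i ∈ Finset.range n, (1 - Q ^ i * a)) * eulerSeries Q (a * Q ^ n) := by
    intro n
    induction n with
    | zero => simp
    | succ n ih =>
      rw [ih, eulerSeries_eq hQ (a * Q ^ n), Finset.prod_range_succ,
        show Q * (a * Q ^ n) = a * Q ^ (n + 1) by ring]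
      ring
  have ht : Tendsto (fun n : ℕ => eulerSeries Q (a * Q ^ n)) atTop (𝓝 1) := by
    rw [← eulerSeries_zero Q]
    refine tendsto_eulerSeries hQ ?_
    simpa using (tendsto_pow_atTop_nhds_zero_of_norm_lt_one hQ).const_mul a
  have h3 := hm.hasProd.tendsto_prod_nat.mul ht
  simp only [← h2, mul_one] at h3
  exact (tendsto_nhds_unique tendsto_const_nhds h3).symm

theorem Psi_eq {Q : ℝ} (h0 : 0 ≤ Q) (h1 : Q < 1) (a b z : ℝ) :
    Psi a b Q z = bigR Q b z (a * z) := by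
  unfold Psi bigR
  refine tsum_congr fun n => ?_
  have e1 : qPoch Q Q n = qFac Q n := Finset.prod_congr rfl fun i _ => by ring
  have e2 : qPoch Q a n * z ^ n = homPoch Q z (a * z) n := by
    rw [qPoch, homPoch, ← Finset.card_range n, ← Finset.prod_const, Finset.card_range,
      ← Finset.prod_mul_distrib]
    exact Finset.prod_congr rfl fun i _ => by ring
  rw [qPochInf_eq h0 h1, e1, ← e2, Nat.choose_two_right]
  ring

end QSU11

/-! ### The amplitudes and their contiguous relations -/

namespace QSU11

theorem eulerSeries_pos {Q a : ℝ} (h0 : 0 ≤ Q) (h1 : Q < 1) (ha : a < 1) : 0 < eulerSeries Q a := by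
  have hQ : ‖Q‖ < 1 := by rwa [Real.norm_of_nonneg h0]
  have hlt : ∀ n : ℕ, 0 < 1 - a * Q ^ n := by
    intro n
    have h2 : Q ^ n ≤ 1 := pow_le_one₀ h0 h1.le
    have h3 : 0 ≤ Q ^ n := by positivity
    rcases le_or_gt a 0 with h | h <;> nlinarith
  have h : ∀ n : ℕ, 0 < eulerSeries Q (a * Q ^ n) → 0 < eulerSeries Q a := by
    intro n hn
    induction n with
    | zero => simpa using hn
    | succ n ih =>
      refine ih ?_
      rw [eulerSeries_eq hQ, show Q * (a * Q ^ n) = a * Q ^ (n + 1) by ring]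
      exact mul_pos (hlt n) hn
  have ht : Tendsto (fun n : ℕ => eulerSeries Q (a * Q ^ n)) atTop (𝓝 1) := by
    rw [← eulerSeries_zero Q]
    refine tendsto_eulerSeries hQ ?_
    simpa using (tendsto_pow_atTop_nhds_zero_of_norm_lt_one hQ).const_mul a
  obtain ⟨n, hn⟩ := (ht.eventually_const_lt one_pos).exists
  exact h n hn

/-- A sign, as a real number. -/
def sg (σ : ℤˣ) : ℝ := ((σ : ℤ) : ℝ)

@[simp] theorem sg_one : sg 1 = 1 := by simp [sg]
@[simp] theorem sg_neg_one : sg (-1) = -1 := by simp [sg]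
theorem sg_neg (σ : ℤˣ) : sg (-σ) = -sg σ := by simp [sg]
theorem sg_mul (σ τ : ℤˣ) : sg (σ * τ) = sg σ * sg τ := by simp [sg]
theorem sg_sq (σ : ℤˣ) : sg σ ^ 2 = 1 := by
  rcases Int.units_eq_one_or σ with rfl | rfl <;> simp
theorem sg_ne_zero (σ : ℤˣ) : sg σ ≠ 0 := by
  rcases Int.units_eq_one_or σ with rfl | rfl <;> simp

/-- The number `κ(x)` for `x = σ q^k`. -/
def kp (q : ℝ) (σ : ℤˣ) (k : ℤ) : ℝ := sg σ * (q ^ k) ^ 2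

/-- `|x|` times the coefficient of `α₀` at `x = σ q^k`. -/
def sq (q : ℝ) (σ : ℤˣ) (k : ℤ) : ℝ := Real.sqrt (1 + kp q σ k)

/-- The square root of `(-κ(x); q²)_∞` for `x = σ q^k`. It vanishes unless `x ∈ I_q`. -/
def wt (q : ℝ) (σ : ℤˣ) (k : ℤ) : ℝ := Real.sqrt (eulerSeries (q ^ 2) (-kp q σ k))

/-- The condition `σ q^k ∈ I_q`. -/
def InI (σ : ℤˣ) (k : ℤ) : Prop := σ = 1 ∨ 1 ≤ k

/-- `ν(t)` for `|t| = q^k`. -/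
def nuZ (q : ℝ) (k : ℤ) : ℝ := q ^ ((k - 1) * (k - 2) / 2)

/-- `s(x, y)` in terms of the signs of `x` and `y`. -/
def pairSign (σ τ : ℤˣ) : ℝ := if σ = 1 ∧ τ = -1 then -1 else 1

theorem pairSign_sq (σ τ : ℤˣ) : pairSign σ τ ^ 2 = 1 := by
  unfold pairSign; split_ifs <;> norm_num

/-- The factor in front of the series in `a_p(x, y)`, where `x = σ q^ξ`, `y = τ q^η` and
`p = σ τ q^π`. By the choice of `wt`, and as `1 / 0 = 0`, it vanishes unless `p, x, y ∈ I_q`. -/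
def ampPref (q : ℝ) (σ τ : ℤˣ) (π ξ η : ℤ) : ℝ :=
  cq q * pairSign σ τ * (-1) ^ π * (-sg τ) ^ ξ * q ^ η * nuZ q (π + η - ξ) *
    (wt q (σ * τ) π * wt q τ η / wt q σ ξ)

/-- The series in `a_p(x, y)`, where `x = σ q^ξ`, `y = τ q^η` and `p = σ τ q^π`. -/
def ampR (q : ℝ) (σ τ : ℤˣ) (π ξ η : ℤ) : ℝ :=
  bigR (q ^ 2) (sg σ * sg τ * (q * q ^ ξ / q ^ η) ^ 2) (sg τ * (q * q ^ ξ / q ^ π) ^ 2)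
    (-(q ^ 2 * q ^ ξ / (q ^ π * q ^ η)) ^ 2)

/-- The amplitude `a_p(x, y)`, where `x = σ q^ξ`, `y = τ q^η` and `p = σ τ q^π`, extended by `0`
to points outside `I_q`. -/
def amp (q : ℝ) (σ τ : ℤˣ) (π ξ η : ℤ) : ℝ := ampPref q σ τ π ξ η * ampR q σ τ π ξ η

section

set_option linter.unusedSectionVars false

variable {q : ℝ} (h0 : 0 < q) (h1 : q < 1)
include h0

theorem nuZ_succ (k : ℤ) : nuZ q (k + 1) * q = q ^ k * nuZ q k := by
  unfold nuZ
  rw [← zpow_add_one₀ h0.ne', ← zpow_add₀ h0.ne']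
  congr 1
  have e : (k + 1 - 1) * (k + 1 - 2) = (k - 1) * (k - 2) + (k - 1) * 2 := by ring
  rw [e, Int.add_mul_ediv_right _ _ two_ne_zero]
  ring

theorem nuZ_pred (k : ℤ) : nuZ q k * q ^ 2 = q ^ k * nuZ q (k - 1) := by
  have := nuZ_succ h0 (k - 1)
  rw [sub_add_cancel, zpow_sub_one₀ h0.ne'] at this
  field_simp at this ⊢
  exact this

theorem kp_succ (σ : ℤˣ) (k : ℤ) : kp q σ (k + 1) = q ^ 2 * kp q σ k := by
  rw [kp, kp, zpow_add_one₀ h0.ne']; ring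

include h1

theorem norm_sq_lt_one : ‖q ^ 2‖ < 1 := by
  rw [Real.norm_of_nonneg (by positivity)]; nlinarith

theorem neg_kp_lt_one {σ : ℤˣ} {k : ℤ} (h : InI σ k) : -kp q σ k < 1 := by
  rcases Int.units_eq_one_or σ with rfl | rfl
  · have : 0 < kp q 1 k := by simp only [kp, sg_one]; positivity
    linarith
  · have hk : 1 ≤ k := h.resolve_left (by decide)
    have h2 : q ^ k < 1 := zpow_lt_one₀ h0 h1 (by omega)
    have h3 : 0 < q ^ k := by positivity
    simp only [kp, sg_neg_one]; nlinarith

theorem neg_kp_eq {σ : ℤˣ} {k : ℤ} (h : ¬InI σ k) :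
    ∃ n : ℕ, (n : ℤ) = -k ∧ (q ^ 2) ^ n * -kp q σ k = 1 := by
  unfold InI at h
  push Not at h
  obtain ⟨hs, hk⟩ := h
  obtain ⟨n, hn⟩ := Int.eq_ofNat_of_zero_le (show 0 ≤ -k by omega)
  refine ⟨n, hn.symm, ?_⟩
  rw [(Int.units_eq_one_or σ).resolve_left hs, kp, show k = -(n : ℤ) by omega]
  simp only [sg_neg_one, zpow_neg, zpow_natCast]
  have := h0.ne'
  field_simp
  ring

theorem eulerSeries_kp_nonneg (σ : ℤˣ) (k : ℤ) : 0 ≤ eulerSeries (q ^ 2) (-kp q σ k) := by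
  by_cases h : InI σ k
  · exact (eulerSeries_pos (by positivity) (by nlinarith) (neg_kp_lt_one h0 h1 h)).le
  · obtain ⟨n, -, hn⟩ := neg_kp_eq h0 h1 h
    rw [eulerSeries_eq_zero (norm_sq_lt_one h0 h1) hn]

theorem wt_pos {σ : ℤˣ} {k : ℤ} (h : InI σ k) : 0 < wt q σ k :=
  Real.sqrt_pos.2 (eulerSeries_pos (by positivity) (by nlinarith) (neg_kp_lt_one h0 h1 h))

theorem wt_eq_zero {σ : ℤˣ} {k : ℤ} (h : ¬InI σ k) : wt q σ k = 0 := by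
  obtain ⟨n, -, hn⟩ := neg_kp_eq h0 h1 h
  rw [wt, eulerSeries_eq_zero (norm_sq_lt_one h0 h1) hn, Real.sqrt_zero]

theorem wt_sq (σ : ℤˣ) (k : ℤ) : wt q σ k ^ 2 = eulerSeries (q ^ 2) (-kp q σ k) :=
  Real.sq_sqrt (eulerSeries_kp_nonneg h0 h1 σ k)

theorem wt_eq (σ : ℤˣ) (k : ℤ) : wt q σ k = sq q σ k * wt q σ (k + 1) := by
  rw [wt, eulerSeries_eq (norm_sq_lt_one h0 h1), sub_neg_eq_add, mul_neg, ← kp_succ h0,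
    Real.sqrt_mul' _ (eulerSeries_kp_nonneg h0 h1 σ (k + 1))]
  rfl

theorem sq_eq_zero {σ : ℤˣ} {k : ℤ} (h : ¬InI σ k) : sq q σ k = 0 := by
  obtain ⟨n, -, hn⟩ := neg_kp_eq h0 h1 h
  refine Real.sqrt_eq_zero_of_nonpos ?_
  have h2 : (q ^ 2) ^ n ≤ 1 := pow_le_one₀ (by positivity) (by nlinarith)
  have h3 : 0 < (q ^ 2) ^ n := by positivity
  nlinarith

theorem sq_sq {σ : ℤˣ} {k : ℤ} (h : InI σ k) : sq q σ k ^ 2 = 1 + kp q σ k :=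
  Real.sq_sqrt (by linarith [neg_kp_lt_one h0 h1 h])

theorem sq_pos {σ : ℤˣ} {k : ℤ} (h : InI σ k) : 0 < sq q σ k :=
  Real.sqrt_pos.2 (by linarith [neg_kp_lt_one h0 h1 h])

theorem sq_mul_wt (σ : ℤˣ) (k : ℤ) :
    sq q σ (k - 1) * wt q σ (k - 1) = (1 + kp q σ (k - 1)) * wt q σ k := by
  have hw := wt_eq h0 h1 σ (k - 1)
  rw [sub_add_cancel] at hw
  by_cases h : InI σ (k - 1)
  · rw [hw, ← mul_assoc, ← pow_two, sq_sq h0 h1 h]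
  · rw [sq_eq_zero h0 h1 h, zero_mul]
    by_cases h' : InI σ k
    · have hk : k - 1 = 0 := by unfold InI at h h'; push Not at h; rcases h' with h' | h' <;> grind
      have hs := (Int.units_eq_one_or σ).resolve_left fun hs => h (Or.inl hs)
      rw [hk, hs]; simp [kp]
    · rw [wt_eq_zero h0 h1 h', mul_zero]

theorem sq_div_wt (σ : ℤˣ) (k : ℤ) :
    sq q σ k * (wt q σ (k + 1))⁻¹ = (1 + kp q σ k) * (wt q σ k)⁻¹ := by
  by_cases h : InI σ k
  · have h2 := sq_pos h0 h1 h
    have h3 : 0 < wt q σ (k + 1) := wt_pos h0 h1 (h.imp id fun h => by omega)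
    rw [← sq_sq h0 h1 h, wt_eq h0 h1 σ k]
    field_simp
  · rw [sq_eq_zero h0 h1 h, wt_eq_zero h0 h1 h]; simp

theorem ampPref_p (σ τ : ℤˣ) (π ξ η : ℤ) :
    sq q (σ * τ) π * ampPref q σ τ (π + 1) ξ η * q =
      -(q ^ π * q ^ η / q ^ ξ) * ampPref q σ τ π ξ η := by
  have hn := nuZ_succ h0 (π + η - ξ)
  rw [zpow_sub₀ h0.ne', zpow_add₀ h0.ne'] at hn
  unfold ampPref
  rw [wt_eq h0 h1 _ π, show π + 1 + η - ξ = π + η - ξ + 1 by ring, zpow_add_one₀ (by norm_num)]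
  linear_combination (-sq q (σ * τ) π * cq q * pairSign σ τ * (-1) ^ π * (-sg τ) ^ ξ * q ^ η *
    (wt q (σ * τ) (π + 1) * wt q τ η / wt q σ ξ)) * hn

theorem ampPref_p' (σ τ : ℤˣ) (π ξ η : ℤ) :
    sq q (σ * τ) (π - 1) * ampPref q σ τ (π - 1) ξ η * (q ^ π * q ^ η / q ^ ξ) =
      -q ^ 2 * (1 + kp q (σ * τ) (π - 1)) * ampPref q σ τ π ξ η := by
  have hn := nuZ_pred h0 (π + η - ξ)
  rw [zpow_sub₀ h0.ne', zpow_add₀ h0.ne'] at hn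
  have hw := sq_mul_wt h0 h1 (σ * τ) π
  unfold ampPref
  rw [show π - 1 + η - ξ = π + η - ξ - 1 by ring, zpow_sub_one₀ (by norm_num) π, inv_neg_one]
  linear_combination cq q * pairSign σ τ * (-1) ^ π * (-sg τ) ^ ξ * q ^ η * (wt q τ η / wt q σ ξ) *
    (sq q (σ * τ) (π - 1) * wt q (σ * τ) (π - 1) * hn - nuZ q (π + η - ξ) * q ^ 2 * hw)

theorem ampPref_y (σ τ : ℤˣ) (π ξ η : ℤ) :
    sq q τ η * ampPref q σ τ π ξ (η + 1) = (q ^ π * q ^ η / q ^ ξ) * ampPref q σ τ π ξ η := by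
  have hn := nuZ_succ h0 (π + η - ξ)
  rw [zpow_sub₀ h0.ne', zpow_add₀ h0.ne'] at hn
  unfold ampPref
  rw [wt_eq h0 h1 _ η, show π + (η + 1) - ξ = π + η - ξ + 1 by ring, zpow_add_one₀ h0.ne']
  linear_combination (sq q τ η * cq q * pairSign σ τ * (-1) ^ π * (-sg τ) ^ ξ * q ^ η *
    (wt q (σ * τ) π * wt q τ (η + 1) / wt q σ ξ)) * hn

theorem ampPref_y' (σ τ : ℤˣ) (π ξ η : ℤ) :
    sq q τ (η - 1) * ampPref q σ τ π ξ (η - 1) * (q ^ π * q ^ η / q ^ ξ) =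
      q * (1 + kp q τ (η - 1)) * ampPref q σ τ π ξ η := by
  have hn := nuZ_pred h0 (π + η - ξ)
  rw [zpow_sub₀ h0.ne', zpow_add₀ h0.ne'] at hn
  have hw := sq_mul_wt h0 h1 τ η
  have hq : q * q⁻¹ = 1 := mul_inv_cancel₀ h0.ne'
  unfold ampPref
  rw [show π + (η - 1) - ξ = π + η - ξ - 1 by ring, zpow_sub_one₀ h0.ne' η]
  linear_combination cq q * pairSign σ τ * (-1) ^ π * (-sg τ) ^ ξ * q ^ η *
    (wt q (σ * τ) π / wt q σ ξ) * (-q⁻¹ * sq q τ (η - 1) * wt q τ (η - 1) * hn +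
      nuZ q (π + η - ξ) * q * hw +
      q * nuZ q (π + η - ξ) * sq q τ (η - 1) * wt q τ (η - 1) * hq)

theorem ampPref_x (σ τ : ℤˣ) (π ξ η : ℤ) :
    sq q σ ξ * ampPref q σ τ π (ξ + 1) η * (q ^ π * q ^ η / q ^ ξ) =
      -(q ^ 2 * sg τ * (1 + kp q σ ξ) * ampPref q σ τ π ξ η) := by
  have hn := nuZ_pred h0 (π + η - ξ)
  rw [zpow_sub₀ h0.ne', zpow_add₀ h0.ne'] at hn
  have hw := sq_div_wt h0 h1 σ ξ
  unfold ampPref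
  rw [show π + η - (ξ + 1) = π + η - ξ - 1 by ring, zpow_add_one₀ (neg_ne_zero.2 (sg_ne_zero τ))]
  linear_combination cq q * pairSign σ τ * (-1) ^ π * (-sg τ) ^ ξ * sg τ * q ^ η *
    (wt q (σ * τ) π * wt q τ η) * (sq q σ ξ * (wt q σ (ξ + 1))⁻¹ * hn -
      nuZ q (π + η - ξ) * q ^ 2 * hw)

theorem ampPref_eq_zero {σ τ : ℤˣ} {π ξ η : ℤ} (h : ¬(InI (σ * τ) π ∧ InI σ ξ ∧ InI τ η)) :
    ampPref q σ τ π ξ η = 0 := by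
  unfold ampPref
  by_cases h2 : InI (σ * τ) π
  · by_cases h3 : InI σ ξ
    · rw [wt_eq_zero h0 h1 fun h4 => h ⟨h2, h3, h4⟩]; simp
    · rw [wt_eq_zero h0 h1 h3]; simp
  · rw [wt_eq_zero h0 h1 h2]; simp

theorem amp_eq_zero {σ τ : ℤˣ} {π ξ η : ℤ} (h : ¬(InI (σ * τ) π ∧ InI σ ξ ∧ InI τ η)) :
    amp q σ τ π ξ η = 0 := by
  rw [amp, ampPref_eq_zero h0 h1 h, zero_mul]

/-- If `b = Q^(1-m)`, the first `m` terms of the series vanish, and the remaining ones contain the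
factors `z - Q^i e` with `i < m`. -/
theorem bigR_eq_zero {b z e : ℝ} {m i : ℕ} (hi : i < m) (hb : (q ^ 2) ^ m * b = q ^ 2)
    (hz : z = (q ^ 2) ^ i * e) : bigR (q ^ 2) b z e = 0 := by
  rw [bigR_shift (norm_sq_lt_one h0 h1) m hb (by positivity), homPoch,
    Finset.prod_eq_zero (Finset.mem_range.2 hi) (by rw [hz, sub_self])]
  simp

/-- The series vanishes when `x` is outside `I_q` while `p` and `y` are inside. -/
theorem ampR_eq_zero {τ : ℤˣ} {π ξ η : ℤ} (hξ : ξ ≤ 0) (hp : InI (-τ) π) (hy : InI τ η) :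
    ampR q (-1) τ π ξ η = 0 := by
  have hq := h0.ne'
  unfold ampR
  rcases Int.units_eq_one_or τ with rfl | rfl
  · have hp' : 1 ≤ π := hp.resolve_left (by decide)
    obtain ⟨n, hn⟩ := Int.eq_ofNat_of_zero_le (show 0 ≤ π - 1 by omega)
    obtain ⟨k, hk⟩ := Int.eq_ofNat_of_zero_le (show 0 ≤ -ξ by omega)
    rw [bigR_comm (norm_sq_lt_one h0 h1)]
    rw [show π = n + 1 by omega, show ξ = -(k : ℤ) by omega]
    refine bigR_eq_zero h0 h1 (m := n + k + 1) (i := n) (by omega) ?_ ?_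
    · simp only [zpow_neg, zpow_natCast, zpow_add_one₀ hq, sg_one]
      field_simp
      ring
    · simp only [zpow_neg, zpow_natCast, zpow_add_one₀ hq, sg_one, sg_neg_one]
      field_simp
      ring
  · have hy' : 1 ≤ η := hy.resolve_left (by decide)
    obtain ⟨n, hn⟩ := Int.eq_ofNat_of_zero_le (show 0 ≤ η - 1 by omega)
    obtain ⟨k, hk⟩ := Int.eq_ofNat_of_zero_le (show 0 ≤ -ξ by omega)
    rw [show η = n + 1 by omega, show ξ = -(k : ℤ) by omega]
    refine bigR_eq_zero h0 h1 (m := n + k + 1) (i := n) (by omega) ?_ ?_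
    · simp only [zpow_neg, zpow_natCast, zpow_add_one₀ hq, sg_neg_one]
      field_simp
      ring
    · simp only [zpow_neg, zpow_natCast, zpow_add_one₀ hq, sg_neg_one]
      field_simp
      ring

/-- The factors of the prefactor that involve `x / q` may vanish while those of `p` and `y` do not;
the recursion holds then because the series vanishes as well (`ampR_eq_zero`). -/
theorem amp_x' (σ τ : ℤˣ) (π ξ η : ℤ) :
    sq q σ (ξ - 1) * amp q σ τ π (ξ - 1) η * q =
      -(sg τ * (q ^ π * q ^ η / q ^ ξ) * ampPref q σ τ π ξ η * ampR q σ τ π (ξ - 1) η) := by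
  by_cases hpy : InI (σ * τ) π ∧ InI τ η
  · obtain ⟨hp, hy⟩ := hpy
    by_cases hx : InI σ (ξ - 1)
    · have hn := nuZ_succ h0 (π + η - ξ)
      rw [zpow_sub₀ h0.ne', zpow_add₀ h0.ne'] at hn
      have hw := wt_eq h0 h1 σ (ξ - 1)
      rw [sub_add_cancel] at hw
      have hs := sq_pos h0 h1 hx
      have hw' : sq q σ (ξ - 1) * (wt q σ (ξ - 1))⁻¹ = (wt q σ ξ)⁻¹ := by
        rw [hw, mul_inv]; field_simp
      have ht : (-sg τ)⁻¹ = -sg τ := by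
        rcases Int.units_eq_one_or τ with rfl | rfl <;> norm_num
      unfold amp ampPref
      rw [show π + η - (ξ - 1) = π + η - ξ + 1 by ring,
        zpow_sub_one₀ (neg_ne_zero.2 (sg_ne_zero τ)), ht]
      linear_combination (-(cq q * pairSign σ τ * (-1) ^ π * (-sg τ) ^ ξ * sg τ * q ^ η *
        (wt q (σ * τ) π * wt q τ η)) * ampR q σ τ π (ξ - 1) η) *
        (nuZ q (π + η - ξ + 1) * q * hw' + (wt q σ ξ)⁻¹ * hn)
    · have hs := (Int.units_eq_one_or σ).resolve_left fun hs => hx (Or.inl hs)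
      subst hs
      have hξ : ξ - 1 ≤ 0 := by unfold InI at hx; omega
      rw [sq_eq_zero h0 h1 hx, ampR_eq_zero h0 h1 hξ (by simpa using hp) hy]
      simp
  · rw [amp_eq_zero h0 h1 (by tauto), ampPref_eq_zero h0 h1 (by tauto)]; simp

/-- The recursion between the points `(x, y)`, `(x, y / q)` and `(q x, y)` at a fixed `p`. -/
theorem amp_gamma (σ τ : ℤˣ) (π ξ η : ℤ) :
    q ^ ξ * q ^ η * amp q σ τ π ξ η = q ^ π *
      (sg τ * q * sq q τ (η - 1) * amp q σ τ π ξ (η - 1) + sq q σ ξ * amp q σ τ π (ξ + 1) η) := by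
  have hq := h0.ne'
  have e1 := ampPref_y' h0 h1 σ τ π ξ η
  have e2 := ampPref_x h0 h1 σ τ π ξ η
  set b := sg σ * sg τ * (q * q ^ ξ / q ^ η) ^ 2 with hb
  set z := sg τ * (q * q ^ ξ / q ^ π) ^ 2 with hz
  set e := -(q ^ 2 * q ^ ξ / (q ^ π * q ^ η)) ^ 2 with he
  have r0 : ampR q σ τ π ξ η = bigR (q ^ 2) b z e := rfl
  have r1 : ampR q σ τ π ξ (η - 1) = bigR (q ^ 2) (q ^ 2 * b) z (q ^ 2 * e) := by
    unfold ampR; rw [hb, hz, he, zpow_sub_one₀ hq]; congr 1 <;> field_simp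
  have r2 : ampR q σ τ π (ξ + 1) η = bigR (q ^ 2) (q ^ 2 * b) (q ^ 2 * z) (q ^ 2 * e) := by
    unfold ampR; rw [hb, hz, he, zpow_add_one₀ hq]; congr 1 <;> field_simp
  have hr := bigR_rel_gamma (norm_sq_lt_one h0 h1) b z e
  unfold amp
  rw [r0, r1, r2]
  have hkey : kp q τ (η - 1) = sg τ * (q ^ η) ^ 2 / q ^ 2 := by
    rw [kp, zpow_sub_one₀ hq]; field_simp
  rw [hkey] at e1
  rw [kp] at e2
  generalize bigR (q ^ 2) b z e = R0 at *
  generalize bigR (q ^ 2) (q ^ 2 * b) z (q ^ 2 * e) = R1 at *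
  generalize bigR (q ^ 2) (q ^ 2 * b) (q ^ 2 * z) (q ^ 2 * e) = R2 at *
  generalize ampPref q σ τ π ξ (η - 1) = g1 at *
  generalize ampPref q σ τ π (ξ + 1) η = g2 at *
  generalize ampPref q σ τ π ξ η = g at *
  have hx : 0 < q ^ ξ := by positivity
  have hy : 0 < q ^ η := by positivity
  have hp : 0 < q ^ π := by positivity
  rw [hb, hz, he] at hr
  generalize q ^ ξ = x at *
  generalize q ^ η = y at *
  generalize q ^ π = p at *
  have e1' := eq_div_of_mul_eq (by positivity) e1
  have e2' := eq_div_of_mul_eq (by positivity) e2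
  have ht := sg_ne_zero τ
  have hr' := eq_div_of_mul_eq (by positivity) ((mul_comm _ _).trans hr)
  calc x * y * (g * R0) = x * y * g * R0 := by ring
    _ = p * (sg τ * q * (sq q τ (η - 1) * g1) * R1 + (sq q σ ξ * g2) * R2) := by
      rw [e1', e2', hr']
      rcases Int.units_eq_one_or τ with rfl | rfl
      · simp only [sg_one]
        field_simp
        ring
      · simp only [sg_neg_one]
        field_simp
        ring
    _ = _ := by ring

/-- The recursion between the points `(x, y)`, `(x, q y)` and `(x / q, y)` at a fixed `p`; it is
adjoint to `amp_gamma`. -/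
theorem amp_gamma' (σ τ : ℤˣ) (π ξ η : ℤ) :
    q ^ ξ * q ^ η * amp q σ τ π ξ η = q ^ π *
      (sg τ * sq q τ η * amp q σ τ π ξ (η + 1) + q * sq q σ (ξ - 1) * amp q σ τ π (ξ - 1) η) := by
  have hq := h0.ne'
  have e1 := ampPref_y h0 h1 σ τ π ξ η
  have e2 := amp_x' h0 h1 σ τ π ξ η
  set b := sg σ * sg τ * (q ^ ξ / q ^ η) ^ 2 with hb
  set z := sg τ * (q * q ^ ξ / q ^ π) ^ 2 / q ^ 2 with hz
  set e := -(q * q ^ ξ / (q ^ π * q ^ η)) ^ 2 with he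
  have r0 : ampR q σ τ π ξ η = bigR (q ^ 2) (q ^ 2 * b) (q ^ 2 * z) (q ^ 2 * e) := by
    unfold ampR; rw [hb, hz, he]; congr 1 <;> field_simp
  have r1 : ampR q σ τ π ξ (η + 1) = bigR (q ^ 2) b (q ^ 2 * z) e := by
    unfold ampR; rw [hb, hz, he, zpow_add_one₀ hq]; congr 1 <;> field_simp
  have r2 : ampR q σ τ π (ξ - 1) η = bigR (q ^ 2) b z e := by
    unfold ampR; rw [hb, hz, he, zpow_sub_one₀ hq]; congr 1 <;> field_simp
  have hr : z * bigR (q ^ 2) (q ^ 2 * b) (q ^ 2 * z) (q ^ 2 * e) =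
      bigR (q ^ 2) b (q ^ 2 * z) e - bigR (q ^ 2) b z e := by
    linear_combination bigR_contig_snd (norm_sq_lt_one h0 h1) b z e
  rw [r2] at e2
  rw [amp, amp, r0, r1]
  generalize bigR (q ^ 2) (q ^ 2 * b) (q ^ 2 * z) (q ^ 2 * e) = R0 at *
  generalize bigR (q ^ 2) b (q ^ 2 * z) e = R1 at *
  generalize bigR (q ^ 2) b z e = R2 at *
  generalize ampPref q σ τ π ξ (η + 1) = g1 at *
  generalize amp q σ τ π (ξ - 1) η = g2 at *
  generalize ampPref q σ τ π ξ η = g at *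
  have hx : 0 < q ^ ξ := by positivity
  have hy : 0 < q ^ η := by positivity
  have hp : 0 < q ^ π := by positivity
  rw [hz] at hr
  generalize q ^ ξ = x at *
  generalize q ^ η = y at *
  generalize q ^ π = p at *
  have e1' := e1
  have e2' := eq_div_of_mul_eq h0.ne' e2
  have ht := sg_ne_zero τ
  have hr' := eq_div_of_mul_eq (by positivity) ((mul_comm _ _).trans hr)
  calc x * y * (g * R0) = x * y * g * R0 := by ring
    _ = p * (sg τ * (sq q τ η * g1) * R1 + q * (sq q σ (ξ - 1) * g2)) := by
      rw [e1', e2', hr']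
      rcases Int.units_eq_one_or τ with rfl | rfl <;>
        rcases Int.units_eq_one_or σ with rfl | rfl <;>
        simp only [sg_one, sg_neg_one] <;> field_simp <;> ring
    _ = _ := by ring

/-- The recursion that leads from `p` to `q p`. -/
theorem amp_alpha (σ τ : ℤˣ) (π ξ η : ℤ) :
    q ^ ξ * q ^ η * (sq q (σ * τ) π * amp q σ τ (π + 1) ξ η) = q ^ π *
      (q ^ 2 * sq q σ (ξ - 1) * sq q τ (η - 1) * amp q σ τ π (ξ - 1) (η - 1) +
        q * sg τ * amp q σ τ π ξ η) := by
  have hq := h0.ne'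
  have e1 := ampPref_y' h0 h1 σ τ π ξ η
  have e2 := amp_x' h0 h1 σ τ π ξ (η - 1)
  have e3 := ampPref_p h0 h1 σ τ π ξ η
  set b := sg σ * sg τ * (q * q ^ ξ / q ^ η) ^ 2 with hb
  set z := sg τ * (q ^ ξ / q ^ π) ^ 2 with hz
  set e := -(q * q ^ ξ / (q ^ π * q ^ η)) ^ 2 with he
  have r0 : ampR q σ τ π ξ η = bigR (q ^ 2) b (q ^ 2 * z) (q ^ 2 * e) := by
    unfold ampR; rw [hb, hz, he]; congr 1 <;> field_simp
  have r1 : ampR q σ τ (π + 1) ξ η = bigR (q ^ 2) b z e := by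
    unfold ampR; rw [hb, hz, he, zpow_add_one₀ hq]; congr 1 <;> field_simp
  have r2 : ampR q σ τ π (ξ - 1) (η - 1) = bigR (q ^ 2) b z (q ^ 2 * e) := by
    unfold ampR; rw [hb, hz, he, zpow_sub_one₀ hq, zpow_sub_one₀ hq]; congr 1 <;> field_simp
  have hr : z * bigR (q ^ 2) b z e = e * bigR (q ^ 2) b (q ^ 2 * z) (q ^ 2 * e) +
      (z - e) * bigR (q ^ 2) b z (q ^ 2 * e) := by
    linear_combination bigR_rel_alpha (norm_sq_lt_one h0 h1) b z e
  rw [r2] at e2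
  rw [amp, show amp q σ τ π ξ η = ampPref q σ τ π ξ η * ampR q σ τ π ξ η from rfl, r0, r1]
  have hkey : kp q τ (η - 1) = sg τ * (q ^ η) ^ 2 / q ^ 2 := by
    rw [kp, zpow_sub_one₀ hq]; field_simp
  rw [hkey] at e1
  rw [zpow_sub_one₀ hq] at e2
  generalize bigR (q ^ 2) b (q ^ 2 * z) (q ^ 2 * e) = R0 at *
  generalize bigR (q ^ 2) b z e = R1 at *
  generalize bigR (q ^ 2) b z (q ^ 2 * e) = R2 at *
  generalize ampPref q σ τ π ξ (η - 1) = g1 at *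
  generalize amp q σ τ π (ξ - 1) (η - 1) = g2 at *
  generalize ampPref q σ τ (π + 1) ξ η = g3 at *
  generalize ampPref q σ τ π ξ η = g at *
  have hx : 0 < q ^ ξ := by positivity
  have hy : 0 < q ^ η := by positivity
  have hp : 0 < q ^ π := by positivity
  rw [hz, he] at hr
  generalize q ^ ξ = x at *
  generalize q ^ η = y at *
  generalize q ^ π = p at *
  have e1' := eq_div_of_mul_eq (by positivity) e1
  have e2' := eq_div_of_mul_eq h0.ne' e2
  have e3' := eq_div_of_mul_eq h0.ne' e3
  have ht := sg_ne_zero τ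
  have hr' := eq_div_of_mul_eq (by positivity) ((mul_comm _ _).trans hr)
  calc x * y * (sq q (σ * τ) π * (g3 * R1)) = x * y * (sq q (σ * τ) π * g3) * R1 := by ring
    _ = p * (q * (-(sg τ * (p * (y * q⁻¹) / x) * (sq q τ (η - 1) * g1) * R2)) +
        q * sg τ * g * R0) := by
      rw [e1', e3', hr']
      rcases Int.units_eq_one_or τ with rfl | rfl <;>
        rcases Int.units_eq_one_or σ with rfl | rfl <;>
        simp only [sg_one, sg_neg_one] <;> field_simp <;> ring
    _ = p * (q ^ 2 * (sq q σ (ξ - 1) * g2) * sq q τ (η - 1) + q * sg τ * g * R0) := by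
      rw [e2']; field_simp
    _ = _ := by ring

/-- The recursion that leads from `p` to `p / q`; it is adjoint to `amp_alpha`. -/
theorem amp_alpha' (σ τ : ℤˣ) (π ξ η : ℤ) :
    q ^ ξ * q ^ η * (q * sq q (σ * τ) (π - 1) * amp q σ τ (π - 1) ξ η) = q ^ π *
      (sq q σ ξ * sq q τ η * amp q σ τ π (ξ + 1) (η + 1) + q * sg τ * amp q σ τ π ξ η) := by
  have hq := h0.ne'
  have e1 := ampPref_y h0 h1 σ τ π ξ η
  have e2 := ampPref_x h0 h1 σ τ π ξ (η + 1)
  have e3 := ampPref_p' h0 h1 σ τ π ξ η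
  set b := sg σ * sg τ * (q * q ^ ξ / q ^ η) ^ 2 with hb
  set z := sg τ * (q * q ^ ξ / q ^ π) ^ 2 with hz
  set e := -(q ^ 2 * q ^ ξ / (q ^ π * q ^ η)) ^ 2 with he
  have r0 : ampR q σ τ π ξ η = bigR (q ^ 2) b z e := rfl
  have r1 : ampR q σ τ (π - 1) ξ η = bigR (q ^ 2) b (q ^ 2 * z) (q ^ 2 * e) := by
    unfold ampR; rw [hb, hz, he, zpow_sub_one₀ hq]; congr 1 <;> field_simp
  have r2 : ampR q σ τ π (ξ + 1) (η + 1) = bigR (q ^ 2) b (q ^ 2 * z) e := by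
    unfold ampR; rw [hb, hz, he, zpow_add_one₀ hq, zpow_add_one₀ hq]; congr 1 <;> field_simp
  have hr : e * bigR (q ^ 2) b z e = z * (b - e) * bigR (q ^ 2) b (q ^ 2 * z) (q ^ 2 * e) +
      (e - z * b) * bigR (q ^ 2) b (q ^ 2 * z) e := by
    linear_combination bigR_rel_alpha' (norm_sq_lt_one h0 h1) b z e
  rw [amp, amp, amp, r0, r1, r2]
  have hkey : kp q (σ * τ) (π - 1) = sg σ * sg τ * (q ^ π) ^ 2 / q ^ 2 := by
    rw [kp, zpow_sub_one₀ hq, sg_mul]; field_simp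
  rw [hkey] at e3
  rw [zpow_add_one₀ hq, kp] at e2
  generalize bigR (q ^ 2) b z e = R0 at *
  generalize bigR (q ^ 2) b (q ^ 2 * z) (q ^ 2 * e) = R1 at *
  generalize bigR (q ^ 2) b (q ^ 2 * z) e = R2 at *
  generalize ampPref q σ τ π ξ (η + 1) = g1 at *
  generalize ampPref q σ τ π (ξ + 1) (η + 1) = g2 at *
  generalize ampPref q σ τ (π - 1) ξ η = g3 at *
  generalize ampPref q σ τ π ξ η = g at *
  have hx : 0 < q ^ ξ := by positivity
  have hy : 0 < q ^ η := by positivity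
  have hp : 0 < q ^ π := by positivity
  rw [hb, hz, he] at hr
  generalize q ^ ξ = x at *
  generalize q ^ η = y at *
  generalize q ^ π = p at *
  have e2' := eq_div_of_mul_eq (by positivity) e2
  have e3' := eq_div_of_mul_eq (by positivity) e3
  have ht := sg_ne_zero τ
  have hr' := eq_div_of_mul_eq (neg_ne_zero.2 (by positivity)) ((mul_comm _ _).trans hr)
  calc x * y * (q * sq q (σ * τ) (π - 1) * (g3 * R1))
      = x * y * q * (sq q (σ * τ) (π - 1) * g3) * R1 := by ring
    _ = p * (-(q ^ 2 * sg τ * (1 + sg σ * x ^ 2) * (sq q τ η * g1)) / (p * (y * q) / x) * R2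
        + q * sg τ * g * R0) := by
      rw [e1, e3', hr']
      rcases Int.units_eq_one_or τ with rfl | rfl <;>
        rcases Int.units_eq_one_or σ with rfl | rfl <;>
        simp only [sg_one, sg_neg_one] <;> field_simp <;> ring
    _ = p * ((sq q σ ξ * g2) * sq q τ η * R2 + q * sg τ * g * R0) := by
      rw [e2']; ring
    _ = _ := by ring

/-- The three-term recurrence in `p`. -/
theorem amp_jacobi (σ τ : ℤˣ) (π ξ η : ℤ) :
    kp q σ ξ * amp q σ τ π ξ η =
      kp q (σ * τ) π * (1 + sg σ * sg τ * (q ^ ξ / q ^ η) ^ 2) * amp q σ τ π ξ η +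
        sg σ * sg τ * (q ^ π * (q ^ ξ / q ^ η)) *
          (q * sq q (σ * τ) π * amp q σ τ (π + 1) ξ η +
            sq q (σ * τ) (π - 1) * amp q σ τ (π - 1) ξ η) := by
  have hq := h0.ne'
  have e1 := ampPref_p h0 h1 σ τ π ξ η
  have e3 := ampPref_p' h0 h1 σ τ π ξ η
  set b := sg σ * sg τ * (q ^ ξ / q ^ η) ^ 2 with hb
  set z := sg τ * (q ^ ξ / q ^ π) ^ 2 with hz
  set e := -(q * q ^ ξ / (q ^ π * q ^ η)) ^ 2 with he
  have r0 : ampR q σ τ π ξ η = bigR (q ^ 2) (q ^ 2 * b) (q ^ 2 * z) (q ^ 2 * e) := by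
    unfold ampR; rw [hb, hz, he]; congr 1 <;> field_simp
  have r1 : ampR q σ τ (π + 1) ξ η = bigR (q ^ 2) (q ^ 2 * b) z e := by
    unfold ampR; rw [hb, hz, he, zpow_add_one₀ hq]; congr 1 <;> field_simp
  have r2 : ampR q σ τ (π - 1) ξ η =
      bigR (q ^ 2) (q ^ 2 * b) (q ^ 2 * (q ^ 2 * z)) (q ^ 2 * (q ^ 2 * e)) := by
    unfold ampR; rw [hb, hz, he, zpow_sub_one₀ hq]; congr 1 <;> field_simp
  have hr := bigR_jacobi (norm_sq_lt_one h0 h1) b z e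
  rw [amp, amp, amp, r0, r1, r2]
  have hkey : kp q (σ * τ) (π - 1) = sg σ * sg τ * (q ^ π) ^ 2 / q ^ 2 := by
    rw [kp, zpow_sub_one₀ hq, sg_mul]; field_simp
  rw [hkey] at e3
  rw [kp, kp, sg_mul]
  generalize bigR (q ^ 2) (q ^ 2 * b) (q ^ 2 * z) (q ^ 2 * e) = R0 at *
  generalize bigR (q ^ 2) (q ^ 2 * b) z e = R1 at *
  generalize bigR (q ^ 2) (q ^ 2 * b) (q ^ 2 * (q ^ 2 * z)) (q ^ 2 * (q ^ 2 * e)) = R2 at *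
  generalize ampPref q σ τ (π + 1) ξ η = g1 at *
  generalize ampPref q σ τ (π - 1) ξ η = g3 at *
  generalize ampPref q σ τ π ξ η = g at *
  have hx : 0 < q ^ ξ := by positivity
  have hy : 0 < q ^ η := by positivity
  have hp : 0 < q ^ π := by positivity
  rw [hb, hz, he] at hr
  generalize q ^ ξ = x at *
  generalize q ^ η = y at *
  generalize q ^ π = p at *
  have e1' := eq_div_of_mul_eq h0.ne' e1
  have e3' := eq_div_of_mul_eq (by positivity) e3
  have hr' := eq_sub_of_add_eq hr
  have key : sg σ * x ^ 2 * g * R0 = sg σ * sg τ * p ^ 2 * (1 + b) * g * R0 +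
      sg σ * sg τ * (p * (x / y)) * (q * (sq q (σ * τ) π * g1) * R1 +
        (sq q (σ * τ) (π - 1) * g3) * R2) := by
    rw [e1', e3', hr', hb]
    rcases Int.units_eq_one_or τ with rfl | rfl <;>
      rcases Int.units_eq_one_or σ with rfl | rfl <;>
      simp only [sg_one, sg_neg_one] <;> field_simp <;> ring
  linear_combination key

/-- The symmetry exchanging `p` and `y`. -/
theorem amp_swap_py (σ τ : ℤˣ) (π ξ η : ℤ) :
    amp q σ τ π ξ η = (-1) ^ (π + η) * sg σ ^ ξ * (q ^ η / q ^ π) * amp q σ (σ * τ) η ξ π := by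
  have hq := h0.ne'
  have e1 : σ * (σ * τ) = τ := by rw [← mul_assoc, Int.units_mul_self, one_mul]
  have hR : ampR q σ (σ * τ) η ξ π = ampR q σ τ π ξ η := by
    unfold ampR
    rw [bigR_comm (norm_sq_lt_one h0 h1), sg_mul, ← mul_assoc, ← pow_two, sg_sq, one_mul,
      mul_comm (q ^ η)]
  have hs : pairSign σ (σ * τ) = pairSign σ τ := by
    rcases Int.units_eq_one_or σ with rfl | rfl
    · rw [one_mul]
    · simp [pairSign]
  have hm : ((-1 : ℝ) ^ η) ^ 2 = 1 := by
    rw [← zpow_natCast, ← zpow_mul, mul_comm, zpow_mul]; norm_num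
  have hσ : (sg σ ^ ξ) * (-sg (σ * τ)) ^ ξ = (-sg τ) ^ ξ := by
    rw [← mul_zpow, sg_mul]; congr 1; linear_combination -sg τ * sg_sq σ
  unfold amp ampPref
  rw [hR, hs, e1, zpow_add₀ (by norm_num), ← hσ, show η + π - ξ = π + η - ξ by ring,
    mul_comm (wt q τ η)]
  have hp : q ^ η = q ^ η / q ^ π * q ^ π := by
    have : q ^ π ≠ 0 := by positivity
    field_simp
  have hp2 : q ^ η * ((-1 : ℝ) ^ η) ^ 2 = q ^ η / q ^ π * q ^ π * ((-1 : ℝ) ^ η) ^ 2 := by rw [← hp]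
  linear_combination (-(cq q * pairSign σ τ * (-1) ^ π * (sg σ ^ ξ * (-sg (σ * τ)) ^ ξ) *
    nuZ q (π + η - ξ) * (wt q (σ * τ) π * wt q τ η / wt q σ ξ) * ampR q σ τ π ξ η)) *
    (q ^ η * hm - hp2)

theorem sg_zpow_sq (σ : ℤˣ) (k : ℤ) : (sg σ ^ k) ^ 2 = 1 := by
  rw [← zpow_natCast, ← zpow_mul, mul_comm, zpow_mul, zpow_natCast, sg_sq, one_zpow]

/-- The symmetry in `x` and `y` for equal signs, by induction on the distance of the exponents: the
exchange of `x` and `y` turns `amp_gamma` into `amp_gamma'`. -/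
theorem amp_swap_xy_aux_pos (σ : ℤˣ) (π ξ : ℤ) (m : ℕ) :
    amp q σ σ π ξ (ξ + m) = sg σ ^ ξ * sg σ ^ (ξ + m) * amp q σ σ π (ξ + m) ξ := by
  have hs := sg_ne_zero σ
  induction m generalizing ξ with
  | zero =>
    have := sg_zpow_sq h0 h1 σ ξ
    simp only [Nat.cast_zero, add_zero]
    linear_combination -(amp q σ σ π ξ ξ) * this
  | succ m ih =>
    push_cast
    have i1 := ih ξ
    have i2 := ih (ξ + 1)
    have g1 := amp_gamma h0 h1 σ σ π ξ (ξ + (m + 1))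
    have g2 := amp_gamma' h0 h1 σ σ π (ξ + (m + 1)) ξ
    rw [show ξ + ((m : ℤ) + 1) - 1 = ξ + m by ring] at g1 g2
    rw [show ξ + 1 + (m : ℤ) = ξ + (m + 1) by ring] at i2
    rw [i1, i2] at g1
    have hxy : q ^ ξ * q ^ (ξ + ((m : ℤ) + 1)) ≠ 0 := by positivity
    refine mul_left_cancel₀ hxy (g1.trans ?_)
    have e1 : sg σ ^ (ξ + ((m : ℤ) + 1)) = sg σ ^ (ξ + m) * sg σ := by
      rw [← add_assoc, zpow_add_one₀ hs]
    have e2 : sg σ ^ (ξ + 1) = sg σ ^ ξ * sg σ := zpow_add_one₀ hs _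
    rw [e1, e2]
    linear_combination (-(sg σ ^ ξ * sg σ ^ (ξ + m) * sg σ)) * g2

/-- At `p = -q` the series collapses to an infinite product. -/
theorem amp_one (σ : ℤˣ) (ξ η : ℤ) :
    amp q σ (-σ) 1 ξ η = -(cq q * pairSign σ (-σ) * sg σ ^ ξ * q ^ η * nuZ q (1 + η - ξ) *
      (wt q (-1) 1 * wt q σ ξ * wt q (-σ) η)) := by
  have hR : ampR q σ (-σ) 1 ξ η = wt q σ ξ ^ 2 := by
    rw [wt_sq h0 h1]
    unfold ampR
    have e1 : sg σ * sg (-σ) * (q * q ^ ξ / q ^ η) ^ 2 = -(q ^ 2 * q ^ ξ / (q ^ (1 : ℤ) * q ^ η)) ^ 2 := by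
      have := sg_sq σ
      rw [sg_neg, zpow_one]
      field_simp
      linear_combination -this
    have e2 : sg (-σ) * (q * q ^ ξ / q ^ (1 : ℤ)) ^ 2 = -kp q σ ξ := by
      rw [kp, sg_neg, zpow_one]; field_simp
    rw [bigR_comm (norm_sq_lt_one h0 h1), e1, bigR_self, e2]
  unfold amp ampPref
  have e3 : σ * -σ = -1 := by rw [mul_neg, Int.units_mul_self]
  rw [hR, e3, sg_neg, neg_neg, zpow_one]
  by_cases hw : wt q σ ξ = 0
  · rw [hw]; simp
  · field_simp

theorem nuZ_one_add (k : ℤ) : nuZ q (1 - k) = q ^ k * nuZ q (1 + k) := by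
  unfold nuZ
  rw [← zpow_add₀ h0.ne']
  congr 1
  have e : (1 - k - 1) * (1 - k - 2) = (1 + k - 1) * (1 + k - 2) + k * 2 := by ring
  rw [e, Int.add_mul_ediv_right _ _ two_ne_zero]
  ring

/-- The symmetry in `x` and `y` for opposite signs, by induction on `p`, from `p = -q` (`amp_one`)
by `amp_alpha`. -/
theorem amp_swap_xy_aux_neg (σ : ℤˣ) (n : ℕ) (ξ η : ℤ) :
    amp q σ (-σ) (n + 1) ξ η =
      (-1) ^ ((n : ℤ) + 1) * sg σ ^ ξ * sg (-σ) ^ η * amp q (-σ) σ (n + 1) η ξ := by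
  induction n generalizing ξ η with
  | zero =>
    have e1 := amp_one h0 h1 σ ξ η
    have e2 := amp_one h0 h1 (-σ) η ξ
    rw [neg_neg] at e2
    have hn := nuZ_one_add h0 h1 (η - ξ)
    rw [show 1 - (η - ξ) = 1 + ξ - η by ring, show 1 + (η - ξ) = 1 + η - ξ by ring,
      zpow_sub₀ h0.ne'] at hn
    have hps : pairSign (-σ) σ = -pairSign σ (-σ) := by
      rcases Int.units_eq_one_or σ with rfl | rfl <;> simp [pairSign]
    have hs := sg_zpow_sq h0 h1 (-σ) η
    have hq : q ^ ξ ≠ 0 := by positivity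
    simp only [Nat.cast_zero, zero_add, zpow_one]
    rw [e1, e2, hn, hps]
    field_simp
    linear_combination (cq q * pairSign σ (-σ) * sg σ ^ ξ * nuZ q (1 + η - ξ) *
      (wt q (-1) 1 * wt q σ ξ * wt q (-σ) η)) * hs
  | succ n ih =>
    have hs := sg_ne_zero σ
    have hs' := sg_ne_zero (-σ)
    have g1 := amp_alpha h0 h1 σ (-σ) (n + 1) ξ η
    have g2 := amp_alpha h0 h1 (-σ) σ (n + 1) η ξ
    have e3 : σ * -σ = -1 := by rw [mul_neg, Int.units_mul_self]
    rw [neg_mul, Int.units_mul_self] at g2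
    rw [e3, ih (ξ - 1) (η - 1), ih ξ η, zpow_sub_one₀ hs, zpow_sub_one₀ hs'] at g1
    have hsq : 0 < sq q (-1) ((n : ℤ) + 1) := sq_pos h0 h1 (Or.inr (by omega))
    have hne : q ^ ξ * q ^ η * sq q (-1) ((n : ℤ) + 1) ≠ 0 := by positivity
    push_cast
    refine mul_left_cancel₀ hne ?_
    have e4 : (sg σ)⁻¹ * (sg (-σ))⁻¹ = -1 := by
      rcases Int.units_eq_one_or σ with rfl | rfl <;> norm_num
    have e5 : sg (-σ) = -sg σ := sg_neg σ
    rw [zpow_add_one₀ (by norm_num) ((n : ℤ) + 1)]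
    have key : q ^ ξ * q ^ η * (sq q (-1) (↑n + 1) * amp q σ (-σ) (↑n + 1 + 1) ξ η) =
        (-1) ^ ((n : ℤ) + 1) * sg σ ^ ξ * sg (-σ) ^ η * (q ^ ((n : ℤ) + 1) *
          (-(q ^ 2 * sq q σ (ξ - 1) * sq q (-σ) (η - 1) * amp q (-σ) σ (n + 1) (η - 1) (ξ - 1)) +
            q * sg (-σ) * amp q (-σ) σ (n + 1) η ξ)) := by
      rw [g1]
      linear_combination (q ^ ((n : ℤ) + 1) * q ^ 2 * sq q σ (ξ - 1) * sq q (-σ) (η - 1) *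
        ((-1) ^ ((n : ℤ) + 1) * sg σ ^ ξ * sg (-σ) ^ η) * amp q (-σ) σ (n + 1) (η - 1) (ξ - 1)) * e4
    linear_combination key + (-1) ^ ((n : ℤ) + 1) * sg σ ^ ξ * sg (-σ) ^ η * g2 +
      (-1) ^ ((n : ℤ) + 1) * sg σ ^ ξ * sg (-σ) ^ η * q ^ ((n : ℤ) + 1) * q *
        amp q (-σ) σ (n + 1) η ξ * e5

/-- The symmetry exchanging `x` and `y`. -/
theorem amp_swap_xy (σ τ : ℤˣ) (π ξ η : ℤ) :
    amp q σ τ π ξ η = sg (σ * τ) ^ π * sg σ ^ ξ * sg τ ^ η * amp q τ σ π η ξ := by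
  by_cases hστ : τ = σ
  · subst hστ
    rw [Int.units_mul_self, sg_one, one_zpow, one_mul]
    rcases le_total ξ η with h | h
    · obtain ⟨m, hm⟩ := Int.eq_ofNat_of_zero_le (sub_nonneg.2 h)
      rw [show η = ξ + m by omega]
      exact amp_swap_xy_aux_pos h0 h1 τ π ξ m
    · obtain ⟨m, hm⟩ := Int.eq_ofNat_of_zero_le (sub_nonneg.2 h)
      have e := amp_swap_xy_aux_pos h0 h1 τ π η m
      rw [show η + (m : ℤ) = ξ by omega] at e
      rw [e]
      linear_combination (-(amp q τ τ π ξ η)) * ((sg τ ^ ξ) ^ 2 * sg_zpow_sq h0 h1 τ η +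
        sg_zpow_sq h0 h1 τ ξ)
  · have hτ : τ = -σ := by
      rcases Int.units_eq_one_or σ with rfl | rfl <;>
        rcases Int.units_eq_one_or τ with rfl | rfl <;> first | rfl | exact absurd rfl hστ
    subst hτ
    rw [mul_neg, Int.units_mul_self]
    by_cases hp : 1 ≤ π
    · obtain ⟨n, hn⟩ := Int.eq_ofNat_of_zero_le (sub_nonneg.2 hp)
      have e := amp_swap_xy_aux_neg h0 h1 σ n ξ η
      rw [show (n : ℤ) + 1 = π by omega] at e
      rw [e, sg_neg_one]
    · have hI : ¬InI (-1) π := fun h => h.elim (by decide) hp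
      rw [amp_eq_zero h0 h1 (by rw [mul_neg, Int.units_mul_self]; tauto),
        amp_eq_zero h0 h1 (by rw [neg_mul, Int.units_mul_self]; tauto), mul_zero]

end

end QSU11

/-! ### Orthogonality of the amplitudes -/

namespace QSU11

/-- A telescoping series over the integers. -/
theorem tsum_int_telescope {f U : ℤ → ℝ} {L L' : ℝ} (hs : Summable f)
    (hf : ∀ k, f k = U k - U (k - 1)) (hU : Tendsto (fun n : ℕ => U n) atTop (𝓝 L))
    (hU' : Tendsto (fun n : ℕ => U (-n)) atTop (𝓝 L')) : ∑' k, f k = L - L' := by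
  have s1 : Summable fun n : ℕ => f n := hs.comp_injective Nat.cast_injective
  have s2 : Summable fun n : ℕ => f (-((n : ℤ) + 1)) :=
    hs.comp_injective fun a b h => by simpa using h
  have p1 : ∀ n : ℕ, ∑ i ∈ Finset.range n, f i = U ((n : ℤ) - 1) - U (-1) := by
    intro n
    induction n with
    | zero => simp
    | succ n ih => rw [Finset.sum_range_succ, ih, hf]; push_cast; ring_nf
  have p2 : ∀ n : ℕ, ∑ i ∈ Finset.range n, f (-((i : ℤ) + 1)) = U (-1) - U (-(n : ℤ) - 1) := by
    intro n
    induction n with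
    | zero => simp
    | succ n ih => rw [Finset.sum_range_succ, ih, hf]; push_cast; ring_nf
  have h1 : HasSum (fun n : ℕ => f n) (L - U (-1)) := by
    have t : Tendsto (fun n : ℕ => ∑ i ∈ Finset.range (n + 1), f i) atTop (𝓝 (L - U (-1))) := by
      simp only [p1]; push_cast; simpa using hU.sub_const (U (-1))
    have := (tendsto_add_atTop_iff_nat 1).2 s1.hasSum.tendsto_sum_nat
    rw [← tendsto_nhds_unique this t]
    exact s1.hasSum
  have h2 : HasSum (fun n : ℕ => f (-((n : ℤ) + 1))) (U (-1) - L') := by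
    have t : Tendsto (fun n : ℕ => ∑ i ∈ Finset.range n, f (-((i : ℤ) + 1))) atTop
        (𝓝 (U (-1) - L')) := by
      simp only [p2]
      refine Tendsto.const_sub _ ?_
      have := (tendsto_add_atTop_iff_nat 1).2 hU'
      refine this.congr fun n => ?_
      congr 1; push_cast; ring
    rw [← tendsto_nhds_unique s2.hasSum.tendsto_sum_nat t]
    exact s2.hasSum
  rw [(HasSum.of_nat_of_neg_add_one h1 h2).tsum_eq]
  ring

theorem summable_pow_natAbs {r : ℝ} (h0 : 0 ≤ r) (h1 : r < 1) :
    Summable fun k : ℤ => r ^ k.natAbs := by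
  refine Summable.of_nat_of_neg ?_ ?_ <;>
  simpa using summable_geometric_of_lt_one h0 h1

theorem exists_bound_of_tendsto {f : ℕ → ℝ} {L : ℝ} (h : Tendsto f atTop (𝓝 L)) :
    ∃ C, ∀ n, |f n| ≤ C := by
  obtain ⟨C, hC⟩ := h.abs.bddAbove_range
  exact ⟨C, fun n => hC ⟨n, rfl⟩⟩

/-- The amplitudes `a_p(x, y)` with `p = ε q^π` on the line `y = ε q^m x`, as functions of
`x = σ q^ξ`. -/
def fam (q : ℝ) (ε : ℤˣ) (m π : ℤ) (σ : ℤˣ) (ξ : ℤ) : ℝ := amp q σ (ε * σ) π ξ (ξ + m)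

theorem mul_mul_self_unit (σ ε : ℤˣ) : σ * (ε * σ) = ε := by
  rw [mul_left_comm, Int.units_mul_self, mul_one]

section

set_option linter.unusedSectionVars false

variable {q : ℝ} (h0 : 0 < q) (h1 : q < 1)
include h0 h1

theorem fam_eq_zero {ε : ℤˣ} {m π : ℤ} {σ : ℤˣ} {ξ : ℤ}
    (h : ¬(InI ε π ∧ InI σ ξ ∧ InI (ε * σ) (ξ + m))) : fam q ε m π σ ξ = 0 :=
  amp_eq_zero h0 h1 (by rwa [mul_mul_self_unit])

theorem fam_gamma (ε : ℤˣ) (m π : ℤ) (σ : ℤˣ) (ξ : ℤ) :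
    q ^ ξ * q ^ (ξ + m + 1) * fam q ε (m + 1) π σ ξ = q ^ π *
      (sg (ε * σ) * q * sq q (ε * σ) (ξ + m) * fam q ε m π σ ξ +
        sq q σ ξ * fam q ε m π σ (ξ + 1)) := by
  have := amp_gamma h0 h1 σ (ε * σ) π ξ (ξ + m + 1)
  rw [add_sub_cancel_right] at this
  unfold fam
  rw [show ξ + (m + 1) = ξ + m + 1 by ring, show ξ + 1 + m = ξ + m + 1 by ring]
  exact this

theorem fam_gamma' (ε : ℤˣ) (m π : ℤ) (σ : ℤˣ) (ξ : ℤ) :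
    q ^ ξ * q ^ (ξ + m) * fam q ε m π σ ξ = q ^ π *
      (sg (ε * σ) * sq q (ε * σ) (ξ + m) * fam q ε (m + 1) π σ ξ +
        q * sq q σ (ξ - 1) * fam q ε (m + 1) π σ (ξ - 1)) := by
  have := amp_gamma' h0 h1 σ (ε * σ) π ξ (ξ + m)
  unfold fam
  rw [show ξ + (m + 1) = ξ + m + 1 by ring, show ξ - 1 + (m + 1) = ξ + m by ring]
  exact this

theorem fam_alpha (ε : ℤˣ) (m π : ℤ) (σ : ℤˣ) (ξ : ℤ) :
    q ^ ξ * q ^ (ξ + m) * (sq q ε π * fam q ε m (π + 1) σ ξ) = q ^ π *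
      (q ^ 2 * sq q σ (ξ - 1) * sq q (ε * σ) (ξ - 1 + m) * fam q ε m π σ (ξ - 1) +
        q * sg (ε * σ) * fam q ε m π σ ξ) := by
  have := amp_alpha h0 h1 σ (ε * σ) π ξ (ξ + m)
  rw [mul_mul_self_unit, show ξ + m - 1 = ξ - 1 + m by ring] at this
  exact this

theorem fam_alpha' (ε : ℤˣ) (m π : ℤ) (σ : ℤˣ) (ξ : ℤ) :
    q ^ ξ * q ^ (ξ + m) * (q * sq q ε π * fam q ε m π σ ξ) = q ^ (π + 1) *
      (sq q σ ξ * sq q (ε * σ) (ξ + m) * fam q ε m (π + 1) σ (ξ + 1) +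
        q * sg (ε * σ) * fam q ε m (π + 1) σ ξ) := by
  have := amp_alpha' h0 h1 σ (ε * σ) (π + 1) ξ (ξ + m)
  rw [mul_mul_self_unit, show ξ + m + 1 = ξ + 1 + m by ring, add_sub_cancel_right] at this
  exact this

theorem fam_swap (ε : ℤˣ) (m π : ℤ) (σ : ℤˣ) (ξ : ℤ) :
    fam q ε m π σ ξ = sg ε ^ π * sg σ ^ ξ * sg (ε * σ) ^ (ξ + m) *
      fam q ε (-m) π (ε * σ) (ξ + m) := by
  have := amp_swap_xy h0 h1 σ (ε * σ) π ξ (ξ + m)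
  unfold fam
  rw [this, mul_mul_self_unit, ← mul_assoc, Int.units_mul_self, one_mul, add_neg_cancel_right]

theorem abs_sg_zpow (σ : ℤˣ) (k : ℤ) : |sg σ ^ k| = 1 := by
  rw [abs_zpow]
  rcases Int.units_eq_one_or σ with rfl | rfl <;> simp

theorem tendsto_kp (σ : ℤˣ) (m : ℤ) : Tendsto (fun n : ℕ => kp q σ (n + m)) atTop (𝓝 0) := by
  have h : Tendsto (fun n : ℕ => q ^ n) atTop (𝓝 0) := tendsto_pow_atTop_nhds_zero_of_lt_one h0.le h1
  have := ((h.mul_const (q ^ m)).pow 2).const_mul (sg σ)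
  refine (this.congr fun n => ?_).trans (by simp)
  rw [kp, zpow_add₀ h0.ne', zpow_natCast]

theorem tendsto_wt (σ : ℤˣ) (m : ℤ) : Tendsto (fun n : ℕ => wt q σ (n + m)) atTop (𝓝 1) := by
  have := (tendsto_eulerSeries (norm_sq_lt_one h0 h1) (tendsto_kp h0 h1 σ m).neg).sqrt
  rw [neg_zero, eulerSeries_zero, Real.sqrt_one] at this
  exact this

theorem tendsto_sq (σ : ℤˣ) (m : ℤ) : Tendsto (fun n : ℕ => sq q σ (n + m)) atTop (𝓝 1) := by
  have := ((tendsto_kp h0 h1 σ m).const_add 1).sqrt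
  rw [add_zero, Real.sqrt_one] at this
  exact this

/-- As `x → 0`, the amplitudes have the same asymptotics on both half lines, up to sign factors. -/
theorem tendsto_fam (ε : ℤˣ) (m π : ℤ) : ∃ L, ∀ σ, Tendsto (fun n : ℕ =>
    (q ^ n)⁻¹ * (-sg (ε * σ)) ^ n * pairSign σ (ε * σ) * fam q ε m π σ n) atTop (𝓝 L) := by
  refine ⟨cq q * (-1) ^ π * q ^ m * nuZ q (π + m) * wt q ε π *
    bigR (q ^ 2) (sg ε * (q / q ^ m) ^ 2) 0 (-(q ^ 2 / (q ^ π * q ^ m)) ^ 2), fun σ => ?_⟩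
  have hw : Tendsto (fun n : ℕ => wt q (ε * σ) (n + m) / wt q σ n) atTop (𝓝 1) := by
    have h2 := tendsto_wt h0 h1 σ 0
    simp only [add_zero] at h2
    have h3 := (tendsto_wt h0 h1 (ε * σ) m).div h2 one_ne_zero
    rwa [div_one] at h3
  have hR : Tendsto (fun n : ℕ => bigR (q ^ 2) (sg ε * (q / q ^ m) ^ 2)
      (sg (ε * σ) * (q * q ^ n / q ^ π) ^ 2) (-(q ^ 2 / (q ^ π * q ^ m)) ^ 2)) atTop
      (𝓝 (bigR (q ^ 2) (sg ε * (q / q ^ m) ^ 2) 0 (-(q ^ 2 / (q ^ π * q ^ m)) ^ 2))) := by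
    refine tendsto_bigR (norm_sq_lt_one h0 h1) _ ?_ tendsto_const_nhds
    have h : Tendsto (fun n : ℕ => q ^ n) atTop (𝓝 0) :=
      tendsto_pow_atTop_nhds_zero_of_lt_one h0.le h1
    simpa using (((h.const_mul q).div_const (q ^ π)).pow 2).const_mul (sg (ε * σ))
  have := ((hw.const_mul (cq q * (-1) ^ π * q ^ m * nuZ q (π + m) * wt q ε π)).mul hR)
  rw [mul_one] at this
  refine this.congr fun n => ?_
  have hq : q ^ n ≠ 0 := by positivity
  have e1 : ((-sg (ε * σ)) ^ n) ^ 2 = 1 := by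
    rw [← pow_mul, mul_comm n, pow_mul, neg_sq, sg_sq, one_pow]
  have e2 := pairSign_sq σ (ε * σ)
  have e3 : sg σ * sg (ε * σ) = sg ε := by rw [← sg_mul, mul_mul_self_unit]
  have hR : ampR q σ (ε * σ) π n (n + m) = bigR (q ^ 2) (sg ε * (q / q ^ m) ^ 2)
      (sg (ε * σ) * (q * q ^ n / q ^ π) ^ 2) (-(q ^ 2 / (q ^ π * q ^ m)) ^ 2) := by
    have hm : q ^ m ≠ 0 := by positivity
    unfold ampR
    rw [e3, zpow_add₀ h0.ne', zpow_natCast]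
    congr 1 <;> field_simp
  unfold fam amp ampPref
  rw [hR, mul_mul_self_unit, zpow_add₀ h0.ne', zpow_natCast, zpow_natCast,
    show π + (n + m) - n = π + m by ring]
  rw [mul_div_assoc (wt q ε π)]
  have hqn : (q ^ n)⁻¹ * q ^ n = 1 := inv_mul_cancel₀ hq
  generalize bigR (q ^ 2) _ _ _ = R
  generalize wt q (ε * σ) (n + m) / wt q σ n = w at *
  linear_combination (-(cq q * (-1) ^ π * q ^ m * nuZ q (π + m) * wt q ε π * w * R)) *
    (hqn + (q ^ n)⁻¹ * q ^ n * e1 + (q ^ n)⁻¹ * q ^ n * ((-sg (ε * σ)) ^ n) ^ 2 * e2)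

/-- If `z = Q^(1-N)`, the first `N` terms of the series with `b` and `z` exchanged vanish, which leaves
a factor `Q^(N(N-1)/2)`. -/
theorem abs_bigR_le_of_terminating {b z e : ℝ} {N : ℕ} (hz : (q ^ 2) ^ N * z = q ^ 2) :
    |bigR (q ^ 2) b z e| ≤ (q ^ 2) ^ N.choose 2 * (|b| + |e|) ^ N *
      (thetaBound (q ^ 2) ((1 - q ^ 2)⁻¹) * thetaBound (q ^ 2) ((1 - q ^ 2)⁻¹ * (|b| + |e|))) := by
  have hQ := norm_sq_lt_one h0 h1
  have hQ0 : 0 ≤ q ^ 2 := by positivity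
  have hQ1 : q ^ 2 < 1 := by nlinarith
  have hc : 0 ≤ (1 - q ^ 2)⁻¹ := inv_nonneg.2 (by linarith)
  have hN : (q ^ 2) ^ N ≤ 1 := pow_le_one₀ hQ0 hQ1.le
  have hN0 : 0 ≤ (q ^ 2) ^ N := by positivity
  rw [bigR_comm hQ, bigR_shift hQ N hz (by positivity), abs_mul, abs_mul, abs_mul, abs_pow, abs_neg,
    abs_one, one_pow, one_mul, abs_of_nonneg (by positivity : 0 ≤ (q ^ 2) ^ N.choose 2)]
  have e1 : |homPoch (q ^ 2) b e N| ≤ (|b| + |e|) ^ N := norm_homPoch_le hQ b e N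
  have e2 := norm_bigR_le hQ (q ^ 2 * (q ^ 2) ^ N) ((q ^ 2) ^ N * b)
    ((q ^ 2) ^ N * ((q ^ 2) ^ N * e))
  rw [Real.norm_eq_abs, Real.norm_of_nonneg hQ0] at e2
  have t1 : thetaBound (q ^ 2) ((1 - q ^ 2)⁻¹ * ‖q ^ 2 * (q ^ 2) ^ N‖) ≤
      thetaBound (q ^ 2) ((1 - q ^ 2)⁻¹) := by
    refine thetaBound_mono hQ0 hQ1 (by positivity) ?_
    refine mul_le_of_le_one_right hc ?_
    rw [Real.norm_of_nonneg (by positivity)]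
    nlinarith
  have t2 : thetaBound (q ^ 2) ((1 - q ^ 2)⁻¹ *
      (‖(q ^ 2) ^ N * b‖ + ‖(q ^ 2) ^ N * ((q ^ 2) ^ N * e)‖)) ≤
      thetaBound (q ^ 2) ((1 - q ^ 2)⁻¹ * (|b| + |e|)) := by
    refine thetaBound_mono hQ0 hQ1 (by positivity) ?_
    refine mul_le_mul_of_nonneg_left ?_ hc
    simp only [norm_mul, Real.norm_eq_abs, abs_of_nonneg hN0]
    have := abs_nonneg b
    have := abs_nonneg e
    refine add_le_add (mul_le_of_le_one_left (abs_nonneg b) hN) ?_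
    exact (mul_le_of_le_one_left (by positivity) hN).trans (mul_le_of_le_one_left (abs_nonneg e) hN)
  refine mul_le_mul (mul_le_mul_of_nonneg_left e1 (by positivity)) (e2.trans ?_) (abs_nonneg _)
    (by positivity)
  exact mul_le_mul t1 t2 (thetaBound_nonneg hQ0 (by positivity)) (thetaBound_nonneg hQ0 hc)

theorem wt_one_antitone (k : ℤ) (n : ℕ) : wt q 1 (k + n) ≤ wt q 1 k := by
  induction n with
  | zero => simp
  | succ n ih =>
    refine le_trans ?_ ih
    rw [wt_eq h0 h1 1 (k + n), show k + ((n + 1 : ℕ) : ℤ) = k + n + 1 by push_cast; ring]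
    refine le_mul_of_one_le_left (Real.sqrt_nonneg _) (Real.one_le_sqrt.2 ?_)
    simp only [kp, sg_one]
    have : 0 ≤ (q ^ (k + n)) ^ 2 := by positivity
    linarith

theorem tendsto_fam_neg_aux (ε : ℤˣ) (m : ℕ) (π : ℤ) (σ : ℤˣ) :
    Tendsto (fun n : ℕ => (q ^ n)⁻¹ * fam q ε m π σ (-n)) atTop (𝓝 0) := by
  by_cases hc : σ = 1 ∧ ε = 1
  swap
  · have hz : ∀ᶠ n : ℕ in atTop, (0 : ℝ) = (q ^ n)⁻¹ * fam q ε m π σ (-n) := by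
      filter_upwards [eventually_ge_atTop m] with n hn
      rw [fam_eq_zero h0 h1, mul_zero]
      rintro ⟨-, h2, h3⟩
      have hs : σ = 1 := h2.resolve_right (by omega)
      subst hs
      have he : ε * 1 = 1 := h3.resolve_right (by omega)
      exact hc ⟨rfl, by simpa using he⟩
    exact tendsto_const_nhds.congr' hz
  obtain ⟨rfl, rfl⟩ := hc
  obtain ⟨d, d', hd⟩ : ∃ d d' : ℕ, (d : ℤ) + π = d' :=
    ⟨π.natAbs, (π.natAbs + π).toNat, by omega⟩
  rw [← tendsto_add_atTop_iff_nat d]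
  have hQ0 : 0 ≤ q ^ 2 := by positivity
  have hQ1 : q ^ 2 < 1 := by nlinarith
  set b : ℝ := (q / q ^ m) ^ 2 with hb
  set e : ℝ := -(q ^ 2 / (q ^ π * q ^ m)) ^ 2 with he
  set D := thetaBound (q ^ 2) ((1 - q ^ 2)⁻¹) *
    thetaBound (q ^ 2) ((1 - q ^ 2)⁻¹ * (|b| + |e|)) with hD
  set K := |cq q| * q ^ m * (q ^ π) ^ 2 * nuZ q (π + m) * wt q 1 π * D with hK
  have ht : Tendsto (fun n : ℕ => K * ((q ^ 2) ^ (n + d').choose 2 *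
      ((q ^ 2)⁻¹ * (|b| + |e|)) ^ (n + d'))) atTop (𝓝 0) := by
    have := (summable_thetaBound hQ0 hQ1 ((q ^ 2)⁻¹ * (|b| + |e|))).tendsto_atTop_zero
    simpa using ((tendsto_add_atTop_iff_nat d').2 this).const_mul K
  refine squeeze_zero_norm (fun n => ?_) ht
  have hq := h0.ne'
  have hR : |ampR q 1 1 π (-((n + d : ℕ) : ℤ)) (-((n + d : ℕ) : ℤ) + m)| ≤
      (q ^ 2) ^ (n + d').choose 2 * (|b| + |e|) ^ (n + d') * D := by
    have hx : (q ^ (n + d)) ≠ 0 := by positivity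
    have hm : q ^ m ≠ 0 := by positivity
    have hz : (q ^ 2) ^ (n + d') * (q * (q ^ (n + d))⁻¹ / q ^ π) ^ 2 = q ^ 2 := by
      have hp : q ^ (n + d') = q ^ (n + d) * q ^ π := by
        rw [← zpow_natCast, ← zpow_natCast, ← zpow_add₀ hq]
        congr 1; push_cast; omega
      have hp' : q ^ π ≠ 0 := by positivity
      rw [← pow_mul, mul_comm 2, pow_mul, hp]
      field_simp
    have := abs_bigR_le_of_terminating h0 h1 (b := b) (e := e) hz
    refine le_of_eq_of_le ?_ this
    unfold ampR
    rw [hb, he, zpow_add₀ hq, zpow_neg, zpow_natCast, zpow_natCast, sg_one]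
    congr 2 <;> field_simp
  have hw : wt q 1 (-((n + d : ℕ) : ℤ) + m) / wt q 1 (-((n + d : ℕ) : ℤ)) ≤ 1 :=
    (div_le_one (wt_pos h0 h1 (Or.inl rfl))).2 (wt_one_antitone h0 h1 _ m)
  have hw0 : 0 ≤ wt q 1 (-((n + d : ℕ) : ℤ) + m) / wt q 1 (-((n + d : ℕ) : ℤ)) :=
    div_nonneg (Real.sqrt_nonneg _) (Real.sqrt_nonneg _)
  have hwp : 0 ≤ wt q 1 π := Real.sqrt_nonneg _
  have hν : 0 < nuZ q (π + m) := zpow_pos h0 _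
  have habs : |ampPref q 1 1 π (-((n + d : ℕ) : ℤ)) (-((n + d : ℕ) : ℤ) + m)| =
      |cq q| * (q ^ m * (q ^ (n + d))⁻¹) * nuZ q (π + m) * (wt q 1 π *
        (wt q 1 (-((n + d : ℕ) : ℤ) + m) / wt q 1 (-((n + d : ℕ) : ℤ)))) := by
    unfold ampPref
    rw [zpow_add₀ hq, zpow_neg q, zpow_natCast, zpow_natCast,
      show π + (-((n + d : ℕ) : ℤ) + m) - (-((n + d : ℕ) : ℤ)) = π + m by ring, one_mul,
      mul_div_assoc]
    have hps : |pairSign 1 1| = 1 := by simp [pairSign]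
    simp only [abs_mul, abs_zpow, abs_neg, abs_one, sg_one, one_zpow, mul_one, abs_of_pos hν,
      abs_of_nonneg hwp, abs_of_nonneg hw0, hps, abs_inv, abs_pow, abs_of_pos h0]
    ring
  have hmain : ‖(q ^ (n + d))⁻¹ * fam q 1 m π 1 (-((n + d : ℕ) : ℤ))‖ =
      (q ^ (n + d))⁻¹ * (|ampPref q 1 1 π (-((n + d : ℕ) : ℤ)) (-((n + d : ℕ) : ℤ) + m)| *
        |ampR q 1 1 π (-((n + d : ℕ) : ℤ)) (-((n + d : ℕ) : ℤ) + m)|) := by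
    rw [fam, amp, one_mul, norm_mul, norm_mul, Real.norm_of_nonneg (by positivity)]
    rfl
  have hD0 : 0 ≤ (q ^ 2) ^ (n + d').choose 2 * (|b| + |e|) ^ (n + d') * D :=
    (abs_nonneg _).trans hR
  rw [hmain, habs]
  calc _ ≤ (q ^ (n + d))⁻¹ * (|cq q| * (q ^ m * (q ^ (n + d))⁻¹) * nuZ q (π + m) * (wt q 1 π * 1) *
        ((q ^ 2) ^ (n + d').choose 2 * (|b| + |e|) ^ (n + d') * D)) := by gcongr
    _ = _ := by
      have hp : q ^ (n + d') = q ^ (n + d) * q ^ π := by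
        rw [← zpow_natCast, ← zpow_natCast, ← zpow_add₀ hq]
        congr 1; push_cast; omega
      have e1 : ((q ^ 2)⁻¹) ^ (n + d') = (q ^ (n + d))⁻¹ ^ 2 * (q ^ π)⁻¹ ^ 2 := by
        rw [inv_pow, ← pow_mul, mul_comm 2, pow_mul, hp]; field_simp
      have hp' : q ^ π ≠ 0 := by positivity
      rw [mul_pow _ (|b| + |e|), e1, hK]
      field_simp

/-- The amplitudes decay as `x` tends to infinity. -/
theorem tendsto_fam_neg (ε : ℤˣ) (m π : ℤ) (σ : ℤˣ) :
    Tendsto (fun n : ℕ => (q ^ n)⁻¹ * fam q ε m π σ (-n)) atTop (𝓝 0) := by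
  rcases le_total 0 m with hm | hm
  · obtain ⟨k, rfl⟩ := Int.eq_ofNat_of_zero_le hm
    exact tendsto_fam_neg_aux h0 h1 ε k π σ
  · obtain ⟨k, hk⟩ := Int.eq_ofNat_of_zero_le (neg_nonneg.2 hm)
    have h := (tendsto_fam_neg_aux h0 h1 ε k π (ε * σ)).abs
    have h2 := ((tendsto_add_atTop_iff_nat k).2 h).const_mul (q ^ k)
    rw [abs_zero, mul_zero] at h2
    refine squeeze_zero_norm (fun n => le_of_eq ?_) h2
    rw [fam_swap h0 h1, hk, show -(n : ℤ) + m = -((n + k : ℕ) : ℤ) by push_cast; omega]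
    simp only [norm_mul, Real.norm_eq_abs, abs_mul, abs_sg_zpow h0 h1, one_mul]
    rw [← mul_assoc]
    congr 1
    rw [abs_of_pos (by positivity), abs_of_pos (by positivity), pow_add]
    field_simp

/-- The amplitudes decay geometrically at both ends of a half line. -/
theorem exists_fam_bound (ε : ℤˣ) (m π : ℤ) :
    ∃ C, 0 ≤ C ∧ ∀ σ ξ, |fam q ε m π σ ξ| ≤ C * q ^ ξ.natAbs := by
  have hσ : ∀ σ, ∃ C, ∀ ξ, |fam q ε m π σ ξ| ≤ C * q ^ ξ.natAbs := by
    intro σ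
    obtain ⟨L, hL⟩ := tendsto_fam h0 h1 ε m π
    obtain ⟨C1, hC1⟩ := exists_bound_of_tendsto (hL σ)
    obtain ⟨C2, hC2⟩ := exists_bound_of_tendsto (tendsto_fam_neg h0 h1 ε m π σ)
    have hps : |pairSign σ (ε * σ)| = 1 := by unfold pairSign; split_ifs <;> simp
    refine ⟨max C1 C2, fun ξ => ?_⟩
    obtain ⟨n, rfl | rfl⟩ := ξ.eq_nat_or_neg
    · have h := hC1 n
      have h3 := abs_sg_zpow h0 h1 (-(ε * σ)) n
      rw [sg_neg, zpow_natCast] at h3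
      rw [abs_mul, abs_mul, abs_mul, h3, hps, abs_of_pos (by positivity), mul_one, mul_one,
        inv_mul_le_iff₀ (by positivity)] at h
      rw [Int.natAbs_natCast]
      calc _ ≤ _ := h
        _ ≤ _ := by rw [mul_comm]; gcongr; exact le_max_left _ _
    · have h := hC2 n
      rw [abs_mul, abs_of_pos (by positivity), inv_mul_le_iff₀ (by positivity)] at h
      rw [Int.natAbs_neg, Int.natAbs_natCast]
      calc _ ≤ _ := h
        _ ≤ _ := by rw [mul_comm]; gcongr; exact le_max_right _ _
  obtain ⟨C1, h1'⟩ := hσ 1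
  obtain ⟨C2, h2'⟩ := hσ (-1)
  refine ⟨max 0 (max C1 C2), le_max_left _ _, fun σ ξ => ?_⟩
  rcases Int.units_eq_one_or σ with rfl | rfl
  · refine (h1' ξ).trans ?_
    gcongr
    exact (le_max_left _ _).trans (le_max_right _ _)
  · refine (h2' ξ).trans ?_
    gcongr
    exact (le_max_right _ _).trans (le_max_right _ _)

theorem summable_fam_mul (ε : ℤˣ) (m m' π π' : ℤ) (σ : ℤˣ) :
    Summable fun ξ => fam q ε m π σ ξ * fam q ε m' π' σ ξ := by
  obtain ⟨C, hC0, hC⟩ := exists_fam_bound h0 h1 ε m π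
  obtain ⟨C', hC0', hC'⟩ := exists_fam_bound h0 h1 ε m' π'
  refine Summable.of_norm_bounded
    ((summable_pow_natAbs (r := q ^ 2) (by positivity) (by nlinarith)).mul_left (C * C'))
    fun ξ => ?_
  rw [norm_mul]
  calc _ ≤ (C * q ^ ξ.natAbs) * (C' * q ^ ξ.natAbs) := by
        gcongr
        · exact hC σ ξ
        · exact hC' σ ξ
    _ = _ := by ring

/-- The Gram matrix of the families with fixed `ε` and `m`. -/
def gram (q : ℝ) (ε : ℤˣ) (m π π' : ℤ) : ℝ :=
  ∑ σ : ℤˣ, ∑' ξ : ℤ, fam q ε m π σ ξ * fam q ε m π' σ ξ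

theorem sum_units (f : ℤˣ → ℝ) : ∑ σ, f σ = f 1 + f (-1) := by
  rw [show (Finset.univ : Finset ℤˣ) = {1, -1} from rfl, Finset.sum_pair (by decide)]

theorem pow_neg_sg (τ : ℤˣ) (n : ℕ) : ((-sg τ) ^ n) ^ 2 = 1 := by
  rw [← pow_mul, mul_comm n, pow_mul, neg_sq, sg_sq, one_pow]

theorem tendsto_mul_sq_neg (σ : ℤˣ) (l : ℤ) {f : ℕ → ℝ} (hf : Tendsto f atTop (𝓝 0)) :
    Tendsto (fun n : ℕ => q ^ n * sq q σ (-n + l) * f n) atTop (𝓝 0) := by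
  have hb : ∀ n : ℕ, |q ^ n * sq q σ (-n + l)| ≤ 1 + q ^ l := by
    intro n
    have hs : 0 ≤ sq q σ (-n + l) := Real.sqrt_nonneg _
    rw [abs_of_nonneg (by positivity)]
    have h2 : sq q σ (-n + l) ≤ 1 + q ^ (-n + l) := by
      refine Real.sqrt_le_iff.2 ⟨by positivity, ?_⟩
      have hx : 0 < q ^ (-(n : ℤ) + l) := by positivity
      unfold kp
      rcases Int.units_eq_one_or σ with rfl | rfl
      · rw [sg_one]; nlinarith
      · rw [sg_neg_one]; nlinarith
    have hn : q ^ n ≤ 1 := pow_le_one₀ h0.le h1.le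
    calc q ^ n * sq q σ (-n + l) ≤ q ^ n * (1 + q ^ (-n + l)) := by gcongr
      _ = q ^ n + q ^ l := by
        rw [zpow_add₀ h0.ne', zpow_neg, zpow_natCast, mul_add, mul_one]; field_simp
      _ ≤ _ := by gcongr
  exact bdd_le_mul_tendsto_zero' _ (Eventually.of_forall hb) hf

/-- By `fam_gamma` and `fam_gamma'` the difference of the two sides is a telescoping sum on each half
line. The boundary term at infinity vanishes, and those at zero cancel between the two half lines. -/
theorem gram_step (ε : ℤˣ) (m π π' : ℤ) :
    q ^ π' * gram q ε (m + 1) π π' = q ^ π * gram q ε m π π' := by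
  have hq := h0.ne'
  obtain ⟨L, hL⟩ := tendsto_fam h0 h1 ε m π
  obtain ⟨L', hL'⟩ := tendsto_fam h0 h1 ε (m + 1) π'
  set U : ℤˣ → ℤ → ℝ := fun σ ξ => q ^ π * q ^ π' * (q ^ ξ * q ^ (ξ + m + 1))⁻¹ * sq q σ ξ *
    fam q ε m π σ (ξ + 1) * fam q ε (m + 1) π' σ ξ with hU
  have key : ∀ σ, ∑' ξ : ℤ, (q ^ π' * (fam q ε (m + 1) π σ ξ * fam q ε (m + 1) π' σ ξ) -
      q ^ π * (fam q ε m π σ ξ * fam q ε m π' σ ξ)) =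
      -(sg (ε * σ) * (q ^ π * q ^ π' * (q ^ m)⁻¹ * L * L')) - 0 := by
    intro σ
    refine tsum_int_telescope (U := U σ) (((summable_fam_mul h0 h1 _ _ _ _ _ _).mul_left _).sub
      ((summable_fam_mul h0 h1 _ _ _ _ _ _).mul_left _)) (fun ξ => ?_) ?_ ?_
    · have g1 := fam_gamma h0 h1 ε m π σ ξ
      have g2 := fam_gamma' h0 h1 ε m π' σ ξ
      simp only [hU]
      rw [sub_add_cancel, show ξ - 1 + m + 1 = ξ + m by ring]
      rw [zpow_add_one₀ hq] at g1 ⊢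
      rw [zpow_sub_one₀ hq]
      have hx : q ^ ξ ≠ 0 := by positivity
      have hy : q ^ (ξ + m) ≠ 0 := by positivity
      have g1' := eq_div_of_mul_eq (by positivity) ((mul_comm _ _).trans g1)
      have g2' := eq_div_of_mul_eq (by positivity) ((mul_comm _ _).trans g2)
      calc _ = q ^ π' * fam q ε (m + 1) π' σ ξ * fam q ε (m + 1) π σ ξ -
            q ^ π * fam q ε m π σ ξ * fam q ε m π' σ ξ := by ring
        _ = _ := by
          rw [g1', g2']
          field_simp
          ring
    · have h2 := (tendsto_sq h0 h1 σ 0).mul (((tendsto_add_atTop_iff_nat 1).2 (hL σ)).mul (hL' σ))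
      have h3 := h2.const_mul (-(sg (ε * σ) * (q ^ π * q ^ π' * (q ^ m)⁻¹)))
      refine (h3.congr fun n => ?_).trans (by
        rw [one_mul]; exact le_of_eq (congrArg _ (by ring)))
      have e1 := pow_neg_sg h0 h1 (ε * σ) n
      have e2 := pairSign_sq σ (ε * σ)
      have e3 := sg_sq (ε * σ)
      have hx : q ^ n ≠ 0 := by positivity
      have hm : q ^ m ≠ 0 := by positivity
      simp only [hU]
      rw [zpow_add_one₀ hq, zpow_add₀ hq, zpow_natCast, add_zero]
      push_cast
      generalize fam q ε m π σ (n + 1) = a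
      generalize fam q ε (m + 1) π' σ n = b
      rw [pow_succ, pow_succ]
      have : ∀ S P t : ℝ, S ^ 2 = 1 → P ^ 2 = 1 → t ^ 2 = 1 →
          -(t * (q ^ π * q ^ π' * (q ^ m)⁻¹)) * (sq q σ n * ((q ^ n * q)⁻¹ * (S * -t) * P * a *
            ((q ^ n)⁻¹ * S * P * b))) = q ^ π * q ^ π' * (q ^ n * (q ^ n * q ^ m * q))⁻¹ *
            sq q σ n * a * b := by
        intro S P t hS hP ht
        calc _ = q ^ π * q ^ π' * (q ^ n * (q ^ n * q ^ m * q))⁻¹ *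
            sq q σ n * a * b * (S ^ 2 * P ^ 2 * t ^ 2) := by field_simp
          _ = _ := by rw [hS, hP, ht]; ring
      exact this _ _ _ e1 e2 e3
    · have f1 := (tendsto_fam_neg h0 h1 ε (m + 1) π' σ)
      have f2 : Tendsto (fun n : ℕ => (q ^ n)⁻¹ * fam q ε m π σ (-n + 1)) atTop (𝓝 0) := by
        rw [← tendsto_add_atTop_iff_nat 1]
        have := (tendsto_fam_neg h0 h1 ε m π σ).const_mul q⁻¹
        rw [mul_zero] at this
        refine this.congr fun n => ?_
        rw [show -((n + 1 : ℕ) : ℤ) + 1 = -n by push_cast; ring, pow_succ, mul_inv]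
        ring
      have h4 : Tendsto (fun n : ℕ => (q ^ n) ^ 3) atTop (𝓝 0) := by
        simpa using (tendsto_pow_atTop_nhds_zero_of_lt_one h0.le h1).pow 3
      have f3 := (f1.mul f2).mul h4
      simp only [mul_zero] at f3
      have h3 := (tendsto_mul_sq_neg h0 h1 σ 0 f3).const_mul
        (q ^ π * q ^ π' * (q ^ (m + 1))⁻¹)
      simp only [mul_zero] at h3
      refine h3.congr fun n => ?_
      have hx : q ^ n ≠ 0 := by positivity
      have hm : q ^ m ≠ 0 := by positivity
      simp only [hU]
      rw [zpow_add_one₀ hq, zpow_add_one₀ hq, zpow_add₀ hq, zpow_neg, zpow_natCast, add_zero]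
      generalize fam q ε m π σ (-n + 1) = a
      generalize fam q ε (m + 1) π' σ (-n) = b
      field_simp
  have hsum : ∀ σ, q ^ π' * ∑' ξ : ℤ, fam q ε (m + 1) π σ ξ * fam q ε (m + 1) π' σ ξ -
      q ^ π * ∑' ξ : ℤ, fam q ε m π σ ξ * fam q ε m π' σ ξ =
      -(sg (ε * σ) * (q ^ π * q ^ π' * (q ^ m)⁻¹ * L * L')) := by
    intro σ
    rw [← tsum_mul_left, ← tsum_mul_left, ← Summable.tsum_sub
      ((summable_fam_mul h0 h1 _ _ _ _ _ _).mul_left _)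
      ((summable_fam_mul h0 h1 _ _ _ _ _ _).mul_left _), key, sub_zero]
  have a1 := hsum 1
  have a2 := hsum (-1)
  have hs : sg (ε * -1) = -sg (ε * 1) := by rw [mul_neg, sg_neg]
  rw [hs] at a2
  simp only [gram, sum_units h0 h1]
  linear_combination a1 + a2

/-- By the recursions in `p` the difference of the two sides telescopes on each half line, as in
`gram_step`. -/
theorem gram_succ (ε : ℤˣ) (m π : ℤ) (hp : InI ε π) :
    gram q ε m (π + 1) (π + 1) = gram q ε m π π := by
  have hq := h0.ne'
  obtain ⟨L, hL⟩ := tendsto_fam h0 h1 ε m π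
  obtain ⟨L', hL'⟩ := tendsto_fam h0 h1 ε m (π + 1)
  set U : ℤˣ → ℤ → ℝ := fun σ ξ => -(q ^ π * (q ^ ξ * q ^ (ξ + m))⁻¹ * sq q σ ξ *
    sq q (ε * σ) (ξ + m) * fam q ε m π σ ξ * fam q ε m (π + 1) σ (ξ + 1)) with hU
  have key : ∀ σ, ∑' ξ : ℤ, (sq q ε π * (fam q ε m (π + 1) σ ξ * fam q ε m (π + 1) σ ξ) -
      sq q ε π * (fam q ε m π σ ξ * fam q ε m π σ ξ)) =
      (sg (ε * σ) * (q * q ^ π * (q ^ m)⁻¹ * L * L')) - 0 := by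
    intro σ
    refine tsum_int_telescope (U := U σ) (((summable_fam_mul h0 h1 _ _ _ _ _ _).mul_left _).sub
      ((summable_fam_mul h0 h1 _ _ _ _ _ _).mul_left _)) (fun ξ => ?_) ?_ ?_
    · have g1 := fam_alpha h0 h1 ε m π σ ξ
      have g2 := fam_alpha' h0 h1 ε m π σ ξ
      simp only [hU]
      rw [sub_add_cancel]
      rw [zpow_add_one₀ hq] at g2
      have e1 : q ^ (ξ - 1 + m) = q ^ (ξ + m) / q := by
        rw [show ξ - 1 + m = ξ + m - 1 by ring, zpow_sub_one₀ hq]; rfl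
      rw [zpow_sub_one₀ hq, e1]
      have hx : q ^ ξ ≠ 0 := by positivity
      have hy : q ^ (ξ + m) ≠ 0 := by positivity
      have g1' := eq_div_of_mul_eq (by positivity) ((mul_comm _ _).trans g1)
      have g2' : sq q ε π * fam q ε m π σ ξ = q ^ π * (sq q σ ξ * sq q (ε * σ) (ξ + m) *
          fam q ε m (π + 1) σ (ξ + 1) + q * sg (ε * σ) * fam q ε m (π + 1) σ ξ) /
          (q ^ ξ * q ^ (ξ + m)) := by
        rw [eq_div_iff (by positivity)]
        refine mul_left_cancel₀ hq ?_
        linear_combination g2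
      calc _ = (sq q ε π * fam q ε m (π + 1) σ ξ) * fam q ε m (π + 1) σ ξ -
            (sq q ε π * fam q ε m π σ ξ) * fam q ε m π σ ξ := by ring
        _ = _ := by
          rw [g1', g2']
          field_simp
          ring
    · have h2 := ((tendsto_sq h0 h1 σ 0).mul (tendsto_sq h0 h1 (ε * σ) m)).mul
        ((hL σ).mul ((tendsto_add_atTop_iff_nat 1).2 (hL' σ)))
      have h3 := h2.const_mul (sg (ε * σ) * (q * q ^ π * (q ^ m)⁻¹))
      refine (h3.congr fun n => ?_).trans (by
        rw [one_mul, one_mul]; exact le_of_eq (congrArg _ (by ring)))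
      have e1 := pow_neg_sg h0 h1 (ε * σ) n
      have e2 := pairSign_sq σ (ε * σ)
      have e3 := sg_sq (ε * σ)
      have hx : q ^ n ≠ 0 := by positivity
      have hm : q ^ m ≠ 0 := by positivity
      simp only [hU]
      rw [zpow_add₀ hq, zpow_natCast, add_zero]
      push_cast
      generalize fam q ε m π σ n = a
      generalize fam q ε m (π + 1) σ (n + 1) = b
      rw [pow_succ, pow_succ]
      have : ∀ S P t : ℝ, S ^ 2 = 1 → P ^ 2 = 1 → t ^ 2 = 1 →
          (t * (q * q ^ π * (q ^ m)⁻¹)) * (sq q σ n * sq q (ε * σ) (n + m) *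
            ((q ^ n)⁻¹ * S * P * a * ((q ^ n * q)⁻¹ * (S * -t) * P * b))) =
            -(q ^ π * (q ^ n * (q ^ n * q ^ m))⁻¹ *
            sq q σ n * sq q (ε * σ) (n + m) * a * b) := by
        intro S P t hS hP ht
        calc _ = -(q ^ π * (q ^ n * (q ^ n * q ^ m))⁻¹ *
            sq q σ n * sq q (ε * σ) (n + m) * a * b * (S ^ 2 * P ^ 2 * t ^ 2)) := by field_simp
          _ = _ := by rw [hS, hP, ht]; ring
      exact this _ _ _ e1 e2 e3
    · have f1 := (tendsto_fam_neg h0 h1 ε m π σ)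
      have f2 : Tendsto (fun n : ℕ => (q ^ n)⁻¹ * fam q ε m (π + 1) σ (-n + 1)) atTop (𝓝 0) := by
        rw [← tendsto_add_atTop_iff_nat 1]
        have := (tendsto_fam_neg h0 h1 ε m (π + 1) σ).const_mul q⁻¹
        rw [mul_zero] at this
        refine this.congr fun n => ?_
        rw [show -((n + 1 : ℕ) : ℤ) + 1 = -n by push_cast; ring, pow_succ, mul_inv]
        ring
      have h4 : Tendsto (fun n : ℕ => (q ^ n) ^ 2) atTop (𝓝 0) := by
        simpa using (tendsto_pow_atTop_nhds_zero_of_lt_one h0.le h1).pow 2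
      have f3 := (f1.mul f2).mul h4
      simp only [mul_zero] at f3
      have h3 := (tendsto_mul_sq_neg h0 h1 σ 0 (tendsto_mul_sq_neg h0 h1 (ε * σ) m
        f3)).const_mul (-(q ^ π * (q ^ m)⁻¹))
      simp only [mul_zero] at h3
      refine h3.congr fun n => ?_
      have hx : q ^ n ≠ 0 := by positivity
      have hm : q ^ m ≠ 0 := by positivity
      simp only [hU]
      rw [zpow_add₀ hq, zpow_neg, zpow_natCast, add_zero]
      generalize fam q ε m π σ (-n) = a
      generalize fam q ε m (π + 1) σ (-n + 1) = b
      field_simp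
  have hsum : ∀ σ, sq q ε π * ∑' ξ : ℤ, fam q ε m (π + 1) σ ξ * fam q ε m (π + 1) σ ξ -
      sq q ε π * ∑' ξ : ℤ, fam q ε m π σ ξ * fam q ε m π σ ξ =
      (sg (ε * σ) * (q * q ^ π * (q ^ m)⁻¹ * L * L')) := by
    intro σ
    rw [← tsum_mul_left, ← tsum_mul_left, ← Summable.tsum_sub
      ((summable_fam_mul h0 h1 _ _ _ _ _ _).mul_left _)
      ((summable_fam_mul h0 h1 _ _ _ _ _ _).mul_left _), key, sub_zero]
  have a1 := hsum 1
  have a2 := hsum (-1)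
  have hs : sg (ε * -1) = -sg (ε * 1) := by rw [mul_neg, sg_neg]
  rw [hs] at a2
  refine mul_left_cancel₀ (sq_pos h0 h1 hp).ne' ?_
  simp only [gram, sum_units h0 h1]
  linear_combination a1 + a2

theorem gram_comm (ε : ℤˣ) (m π π' : ℤ) : gram q ε m π π' = gram q ε m π' π := by
  simp only [gram, mul_comm]

/-- Two applications of `gram_step`, with `p` and `p'` in either order, show that `p² - p'²`
annihilates the inner product. -/
theorem gram_eq_zero (ε : ℤˣ) (m : ℤ) {π π' : ℤ} (h : π ≠ π') : gram q ε m π π' = 0 := by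
  have e1 := gram_step h0 h1 ε m π π'
  have e2 := gram_step h0 h1 ε m π' π
  rw [gram_comm h0 h1 ε _ π', gram_comm h0 h1 ε _ π'] at e2
  have hne : (q ^ π) ^ 2 - (q ^ π') ^ 2 ≠ 0 := by
    intro h2
    have h3 : q ^ π = q ^ π' := by
      refine (pow_left_inj₀ (by positivity) (by positivity) two_ne_zero).1 (sub_eq_zero.1 h2)
    exact h (zpow_right_injective₀ h0 h1.ne h3)
  have : ((q ^ π) ^ 2 - (q ^ π') ^ 2) * gram q ε m π π' = 0 := by
    linear_combination q ^ π' * e2 - q ^ π * e1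
  exact (mul_eq_zero.1 this).resolve_left hne

theorem gram_const (ε : ℤˣ) : ∃ κ, ∀ m π, InI ε π → gram q ε m π π = κ := by
  have hm : ∀ m π, gram q ε m π π = gram q ε 0 π π := by
    intro m π
    have hs : ∀ m, gram q ε (m + 1) π π = gram q ε m π π := fun m =>
      mul_left_cancel₀ (by positivity : q ^ π ≠ 0) (gram_step h0 h1 ε m π π)
    induction m using Int.induction_on with
    | zero => rfl
    | succ k ih => rw [hs, ih]
    | pred k ih => rw [← ih, ← hs (-k - 1), sub_add_cancel]
  refine ⟨gram q ε 0 1 1, fun m π hp => ?_⟩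
  rw [hm]
  have hup : ∀ n : ℕ, ∀ k, InI ε k → gram q ε 0 (k + n) (k + n) = gram q ε 0 k k := by
    intro n k hk
    induction n with
    | zero => simp
    | succ n ih =>
      rw [← ih, ← gram_succ h0 h1 ε 0 (k + n) (hk.imp id fun h => by omega)]
      push_cast
      rw [add_assoc]
  rcases le_total 1 π with h | h
  · obtain ⟨n, hn⟩ := Int.eq_ofNat_of_zero_le (sub_nonneg.2 h)
    rw [show π = 1 + n by omega]
    exact hup n 1 (Or.inr le_rfl)
  · obtain ⟨n, hn⟩ := Int.eq_ofNat_of_zero_le (sub_nonneg.2 h)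
    have := hup n π hp
    rw [show π + (n : ℤ) = 1 by omega] at this
    exact this.symm

end

end QSU11

namespace QSU11

/-! ### Norms and orthogonality of the columns -/

section ColumnNorm

set_option linter.unusedSectionVars false

variable {ι X : Type*} [DecidableEq ι] [DecidableEq X] {v : ι → lp (fun _ : X => ℝ) 2} {κ : ℝ}

theorem orthonormal_of_gram (hκ : 0 < κ)
    (hG : ∀ i j, ⟪v i, v j⟫_ℝ = if i = j then κ else 0) :
    Orthonormal ℝ fun i => (Real.sqrt κ)⁻¹ • v i := by
  have hs : Real.sqrt κ ≠ 0 := (Real.sqrt_pos.2 hκ).ne'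
  rw [orthonormal_iff_ite]
  intro i j
  rw [real_inner_smul_left, real_inner_smul_right, hG]
  split_ifs
  · nth_rewrite 3 [← Real.sq_sqrt hκ.le]
    field_simp
  · simp

theorem inner_smul_single (i : ι) (x : X) :
    ⟪(Real.sqrt κ)⁻¹ • v i, lp.single 2 x (1 : ℝ)⟫_ℝ = (Real.sqrt κ)⁻¹ * v i x := by
  rw [real_inner_smul_left, lp.inner_single_right]
  simp

theorem summable_column (hκ : 0 < κ) (hG : ∀ i j, ⟪v i, v j⟫_ℝ = if i = j then κ else 0) (x : X) :
    Summable fun i => v i x ^ 2 := by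
  have h := (orthonormal_of_gram hκ hG).inner_products_summable (lp.single 2 x (1 : ℝ))
  have h2 := h.mul_left κ
  refine h2.congr fun i => ?_
  rw [inner_smul_single, Real.norm_eq_abs, sq_abs, mul_pow, inv_pow, Real.sq_sqrt hκ.le]
  field_simp

/-- If the rows of a matrix are orthogonal of norm `√κ` and its columns are orthogonal, then its
nonzero columns have norm `√κ` too. -/
theorem tsum_column (hκ : 0 < κ) (hG : ∀ i j, ⟪v i, v j⟫_ℝ = if i = j then κ else 0)
    (hcol : ∀ x x', x ≠ x' → ∑' i, v i x * v i x' = 0) {x : X} {j : ι} (hj : v j x ≠ 0) :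
    ∑' i, v i x ^ 2 = κ := by
  have hs : Real.sqrt κ ≠ 0 := (Real.sqrt_pos.2 hκ).ne'
  have ho := orthonormal_of_gram hκ hG
  have hsum : Summable fun i => (v i x) • ((Real.sqrt κ)⁻¹ • v i) := by
    have := (ho.orthogonalFamily).summable_iff_norm_sq_summable (fun i => v i x)
    simp only [LinearIsometry.toSpanSingleton_apply, Real.norm_eq_abs, sq_abs] at this
    exact this.2 (summable_column hκ hG x)
  set w := ∑' i, (v i x) • ((Real.sqrt κ)⁻¹ • v i) with hw
  have hwx : ∀ x', w x' = (Real.sqrt κ)⁻¹ * ∑' i, v i x * v i x' := by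
    intro x'
    have h1 : ⟪w, lp.single 2 x' (1 : ℝ)⟫_ℝ = w x' := by rw [lp.inner_single_right]; simp
    rw [← h1, real_inner_comm, hw, ← tsum_mul_left]
    have h2 := (hsum.hasSum.mapL (innerSL ℝ (lp.single 2 x' (1 : ℝ)))).tsum_eq
    simp only [innerSL_apply_apply] at h2
    rw [← h2]
    refine tsum_congr fun i => ?_
    rw [real_inner_smul_right, real_inner_comm, inner_smul_single]
    ring
  have hwe : w = ((Real.sqrt κ)⁻¹ * ∑' i, v i x ^ 2) • lp.single 2 x (1 : ℝ) := by
    ext x'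
    rw [hwx]
    by_cases h : x = x'
    · subst h
      simp [pow_two]
    · rw [hcol x x' h]
      simp [lp.single_apply, Ne.symm h]
  have h3 : ⟪w, (Real.sqrt κ)⁻¹ • v j⟫_ℝ = v j x := by
    have h2 := (hsum.hasSum.mapL (innerSL ℝ ((Real.sqrt κ)⁻¹ • v j))).tsum_eq
    simp only [innerSL_apply_apply] at h2
    rw [real_inner_comm, hw, ← h2, tsum_eq_single j]
    · rw [real_inner_smul_right, orthonormal_iff_ite.1 ho]; simp
    · intro i hi
      rw [real_inner_smul_right, orthonormal_iff_ite.1 ho, if_neg (Ne.symm hi), mul_zero]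
  rw [hwe, real_inner_smul_left, real_inner_comm, inner_smul_single] at h3
  have h4 : Real.sqrt κ ^ 2 = κ := Real.sq_sqrt hκ.le
  have h5 : (∑' i, v i x ^ 2) * v j x = Real.sqrt κ ^ 2 * v j x := by
    conv_rhs => rw [← h3]
    field_simp
  rw [← h4]
  exact mul_right_cancel₀ hj h5

end ColumnNorm

section

set_option linter.unusedSectionVars false

variable {q : ℝ} (h0 : 0 < q) (h1 : q < 1)
include h0 h1

theorem summable_fam_prod (ε : ℤˣ) (m π π' : ℤ) :
    Summable fun x : ℤˣ × ℤ => fam q ε m π x.1 x.2 * fam q ε m π' x.1 x.2 := by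
  refine Summable.of_norm ?_
  refine (summable_prod_of_nonneg fun _ => norm_nonneg _).2 ⟨fun σ => ?_, (hasSum_fintype _).summable⟩
  exact (summable_fam_mul h0 h1 ε m m π π' σ).norm

theorem tsum_fam_prod (ε : ℤˣ) (m π π' : ℤ) :
    ∑' x : ℤˣ × ℤ, fam q ε m π x.1 x.2 * fam q ε m π' x.1 x.2 = gram q ε m π π' := by
  rw [(summable_fam_prod h0 h1 ε m π π').tsum_prod, tsum_fintype]
  rfl

/-- The row `x ↦ a_p(x, ε q^m x)`, as a square summable sequence. -/
def rowVec (ε : ℤˣ) (m π : ℤ) : lp (fun _ : ℤˣ × ℤ => ℝ) 2 :=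
  ⟨fun x => fam q ε m π x.1 x.2, by
    refine memℓp_gen ?_
    refine (summable_fam_prod h0 h1 ε m π π).congr fun x => ?_
    simp [pow_two]⟩

theorem inner_rowVec (ε : ℤˣ) (m π π' : ℤ) :
    ⟪rowVec h0 h1 ε m π, rowVec h0 h1 ε m π'⟫_ℝ = gram q ε m π π' := by
  rw [lp.inner_eq_tsum, ← tsum_fam_prod h0 h1, ]
  refine tsum_congr fun x => ?_
  simp [rowVec, mul_comm]

theorem cq_pos : 0 < cq q := by
  have hQ0 : 0 ≤ q ^ 2 := by positivity
  have hQ1 : q ^ 2 < 1 := by nlinarith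
  unfold cq
  rw [qPochInf_eq hQ0 hQ1, qPochInf_eq hQ0 hQ1]
  have a1 := eulerSeries_pos hQ0 hQ1 hQ1
  have a2 := eulerSeries_pos (a := -q ^ 2) hQ0 hQ1 (by linarith)
  positivity

theorem ampPref_ne_zero {σ τ : ℤˣ} {π ξ η : ℤ} (hp : InI (σ * τ) π) (hx : InI σ ξ) (hy : InI τ η) :
    ampPref q σ τ π ξ η ≠ 0 := by
  have a1 := (cq_pos h0 h1).ne'
  have a2 := (wt_pos h0 h1 hp).ne'
  have a3 := (wt_pos h0 h1 hx).ne'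
  have a4 := (wt_pos h0 h1 hy).ne'
  have a5 : (-sg τ) ^ ξ ≠ 0 := zpow_ne_zero _ (neg_ne_zero.2 (sg_ne_zero τ))
  have a6 : pairSign σ τ ≠ 0 := by unfold pairSign; split_ifs <;> norm_num
  have a7 : nuZ q (π + η - ξ) ≠ 0 := by unfold nuZ; positivity
  have a8 : (-1 : ℝ) ^ π ≠ 0 := zpow_ne_zero _ (by norm_num)
  unfold ampPref
  positivity

/-- The limit of the series as `p` tends to infinity. -/
theorem tendsto_ampR_neg (σ τ : ℤˣ) (l ξ η : ℤ) :
    Tendsto (fun n : ℕ => ampR q σ τ (-n + l) ξ η) atTop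
      (𝓝 (eulerSeries (q ^ 2) (sg σ * sg τ * (q * q ^ ξ / q ^ η) ^ 2))) := by
  rw [← bigR_zero_zero]
  have h : Tendsto (fun n : ℕ => q ^ n) atTop (𝓝 0) := tendsto_pow_atTop_nhds_zero_of_lt_one h0.le h1
  have e1 : ∀ n : ℕ, (q ^ (-(n : ℤ) + l))⁻¹ = q ^ n * (q ^ l)⁻¹ := by
    intro n
    rw [zpow_add₀ h0.ne', zpow_neg, zpow_natCast, mul_inv, inv_inv]
  refine tendsto_bigR (norm_sq_lt_one h0 h1) _ ?_ ?_
  · have := (((h.mul_const (q ^ l)⁻¹).const_mul (q * q ^ ξ)).pow 2).const_mul (sg τ)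
    simp only [← e1] at this
    simpa [div_eq_mul_inv] using this
  · have := (((h.mul_const (q ^ l)⁻¹).const_mul (q ^ 2 * q ^ ξ * (q ^ η)⁻¹)).pow 2).neg
    simp only [← e1] at this
    refine (this.congr fun n => ?_).trans (by simp)
    rw [div_eq_mul_inv, mul_inv]
    ring

theorem wt_one_neg (n : ℕ) :
    q ^ (n * (n + 1)) * wt q 1 (-n) ^ 2 * wt q 1 (n + 1) ^ 2 = wt q 1 0 ^ 2 * wt q 1 1 ^ 2 := by
  induction n with
  | zero => simp
  | succ n ih =>
    have e1 := wt_eq h0 h1 1 (-((n + 1 : ℕ) : ℤ))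
    have e2 := wt_eq h0 h1 1 ((n : ℤ) + 1)
    have s1 := sq_sq h0 h1 (σ := 1) (k := -((n + 1 : ℕ) : ℤ)) (Or.inl rfl)
    have s2 := sq_sq h0 h1 (σ := 1) (k := (n : ℤ) + 1) (Or.inl rfl)
    rw [show -((n + 1 : ℕ) : ℤ) + 1 = -n by push_cast; ring] at e1
    rw [← ih, e1, e2, mul_pow, mul_pow, s1, s2]
    have hq := h0.ne'
    have k1 : kp q 1 (-((n + 1 : ℕ) : ℤ)) = ((q ^ (n + 1)) ^ 2)⁻¹ := by
      rw [kp, zpow_neg, zpow_natCast, sg_one, one_mul, inv_pow]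
    have k2 : kp q 1 ((n : ℤ) + 1) = (q ^ (n + 1)) ^ 2 := by
      rw [kp, sg_one, one_mul, ← zpow_natCast]; norm_cast
    rw [k1, k2]
    push_cast
    have k3 : q ^ ((n + 1) * (n + 1 + 1)) = q ^ (n * (n + 1)) * (q ^ (n + 1)) ^ 2 := by
      rw [← pow_mul, ← pow_add]; congr 1; ring
    rw [k3]
    field_simp
    ring

theorem tendsto_wt_one_neg : Tendsto (fun n : ℕ => q ^ (n * (n + 1)) * wt q 1 (-n) ^ 2) atTop
    (𝓝 (wt q 1 0 ^ 2 * wt q 1 1 ^ 2)) := by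
  have h := (((tendsto_wt h0 h1 1 1).pow 2).inv₀ (by norm_num)).const_mul
    (wt q 1 0 ^ 2 * wt q 1 1 ^ 2)
  rw [one_pow, inv_one, mul_one] at h
  refine h.congr fun n => ?_
  rw [← wt_one_neg h0 h1 n]
  have := (wt_pos h0 h1 (σ := 1) (k := (n : ℤ) + 1) (Or.inl rfl)).ne'
  field_simp

theorem kp_injective {σ σ' : ℤˣ} {ξ ξ' : ℤ} (h : kp q σ ξ = kp q σ' ξ') : σ = σ' ∧ ξ = ξ' := by
  have hx : 0 < (q ^ ξ) ^ 2 := by positivity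
  have hx' : 0 < (q ^ ξ') ^ 2 := by positivity
  unfold kp at h
  have hs : σ = σ' := by
    rcases Int.units_eq_one_or σ with rfl | rfl <;>
      rcases Int.units_eq_one_or σ' with rfl | rfl <;>
      simp only [sg_one, sg_neg_one] at h <;> first | rfl | (exfalso; nlinarith)
  subst hs
  have h2 := mul_left_cancel₀ (sg_ne_zero σ) h
  have h3 := (pow_left_inj₀ (by positivity) (by positivity) two_ne_zero).1 h2
  exact ⟨rfl, zpow_right_injective₀ h0 h1.ne h3⟩

theorem exists_fam_ne_zero_aux {m : ℤ} (hm : m ≤ 0) (σ : ℤˣ) {ξ : ℤ} (hx : InI σ ξ)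
    (hy : InI σ (ξ + m)) : ∃ π, fam q 1 m π σ ξ ≠ 0 := by
  have ht := tendsto_ampR_neg h0 h1 σ σ 0 ξ (ξ + m)
  have hne : eulerSeries (q ^ 2) (sg σ * sg σ * (q * q ^ ξ / q ^ (ξ + m)) ^ 2) ≠ 0 := by
    refine (eulerSeries_pos (by positivity) (by nlinarith) ?_).ne'
    obtain ⟨k, hk⟩ := Int.eq_ofNat_of_zero_le (neg_nonneg.2 hm)
    have hx : q ^ ξ ≠ 0 := by positivity
    have e : q * q ^ ξ / q ^ (ξ + m) = q ^ (k + 1) := by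
      rw [show m = -(k : ℤ) by omega, zpow_add₀ h0.ne', zpow_neg, zpow_natCast]
      field_simp
      ring
    rw [e, ← pow_two, sg_sq, one_mul, ← pow_mul]
    exact pow_lt_one₀ h0.le h1 (by omega)
  obtain ⟨n, hn⟩ := (ht.eventually_ne hne).exists
  refine ⟨-n + 0, ?_⟩
  unfold fam amp
  rw [one_mul]
  exact mul_ne_zero (ampPref_ne_zero h0 h1 (by rw [Int.units_mul_self]; exact Or.inl rfl) hx hy) hn

/-- No column vanishes. For positive `p` its entries are nonzero when `p` is large, which is shown
after an exchange of `x` and `y` if `m > 0`; for negative `p` the entry at `p = -q` is explicit. -/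
theorem exists_fam_ne_zero (ε : ℤˣ) (m : ℤ) (σ : ℤˣ) {ξ : ℤ} (hx : InI σ ξ)
    (hy : InI (ε * σ) (ξ + m)) : ∃ π, fam q ε m π σ ξ ≠ 0 := by
  rcases Int.units_eq_one_or ε with rfl | rfl
  · rw [one_mul] at hy
    rcases le_total m 0 with hm | hm
    · exact exists_fam_ne_zero_aux h0 h1 hm σ hx hy
    · obtain ⟨π, hπ⟩ := exists_fam_ne_zero_aux h0 h1 (neg_nonpos.2 hm) σ hy
        (by rwa [add_neg_cancel_right])
      refine ⟨π, ?_⟩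
      rw [fam_swap h0 h1, one_mul]
      have a := sg_ne_zero σ
      have b := sg_ne_zero 1
      positivity
  · rw [neg_one_mul] at hy
    refine ⟨1, ?_⟩
    unfold fam amp
    rw [neg_one_mul]
    refine mul_ne_zero (ampPref_ne_zero h0 h1 (by rw [mul_neg, Int.units_mul_self]; exact Or.inr le_rfl) hx hy) ?_
    have h := amp_one h0 h1 σ ξ (ξ + m)
    intro hR
    rw [amp, hR, mul_zero, eq_comm, neg_eq_zero] at h
    have a1 := (cq_pos h0 h1).ne'
    have a2 := (wt_pos h0 h1 (σ := -1) (k := 1) (Or.inr le_rfl)).ne'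
    have a3 := (wt_pos h0 h1 hx).ne'
    have a4 := (wt_pos h0 h1 hy).ne'
    have a5 := sg_ne_zero σ
    have a6 : pairSign σ (-σ) ≠ 0 := by unfold pairSign; split_ifs <;> norm_num
    have a7 : nuZ q (1 + (ξ + m) - ξ) ≠ 0 := by unfold nuZ; positivity
    revert h
    positivity

theorem exists_kappa (ε : ℤˣ) : ∃ κ, 0 < κ ∧ ∀ m (i j : {π : ℤ // InI ε π}),
    ⟪rowVec h0 h1 ε m i, rowVec h0 h1 ε m j⟫_ℝ = if i = j then κ else 0 := by
  obtain ⟨κ, hκ⟩ := gram_const h0 h1 ε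
  refine ⟨κ, ?_, fun m i j => ?_⟩
  · have hx : InI (ε * ε) (1 + 0) := Or.inr (by norm_num)
    obtain ⟨π, hπ⟩ := exists_fam_ne_zero h0 h1 ε 0 ε (ξ := 1) (Or.inr le_rfl) hx
    have hp : InI ε π := by
      by_contra h
      exact hπ (fam_eq_zero h0 h1 fun h' => h h'.1)
    rw [← hκ 0 π hp, ← inner_rowVec h0 h1]
    refine real_inner_self_pos.2 fun h => hπ ?_
    exact congrFun (congrArg (fun f : lp (fun _ : ℤˣ × ℤ => ℝ) 2 => (f : ℤˣ × ℤ → ℝ)) h) (ε, 1)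
  · rw [inner_rowVec]
    split_ifs with h
    · subst h; exact hκ m i i.2
    · exact gram_eq_zero h0 h1 ε m fun h' => h (Subtype.ext h')

theorem support_fam (ε : ℤˣ) (m : ℤ) (x x' : ℤˣ × ℤ) :
    Function.support (fun π => fam q ε m π x.1 x.2 * fam q ε m π x'.1 x'.2) ⊆ {π | InI ε π} := by
  intro π hπ
  by_contra h
  exact hπ (by simp only [fam_eq_zero h0 h1 (σ := x.1) fun h' => h h'.1, zero_mul])

theorem summable_fam_sq (ε : ℤˣ) (m : ℤ) (x : ℤˣ × ℤ) :
    Summable fun π => fam q ε m π x.1 x.2 ^ 2 := by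
  obtain ⟨κ, hκ0, hκ⟩ := exists_kappa h0 h1 ε
  have h : Summable fun i : {π : ℤ // InI ε π} => fam q ε m i x.1 x.2 ^ 2 :=
    summable_column hκ0 (hκ m) x
  have hs := support_fam h0 h1 ε m x x
  simp only [← pow_two] at hs
  obtain ⟨a, ha⟩ := h
  exact ⟨a, (hasSum_subtype_iff_of_support_subset (s := {π | InI ε π}) hs).1 ha⟩

theorem summable_fam_col (ε : ℤˣ) (m : ℤ) (x x' : ℤˣ × ℤ) :
    Summable fun π => fam q ε m π x.1 x.2 * fam q ε m π x'.1 x'.2 := by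
  refine Summable.of_norm_bounded (g := fun π => fam q ε m π x.1 x.2 ^ 2 + fam q ε m π x'.1 x'.2 ^ 2)
    ((summable_fam_sq h0 h1 ε m x).add (summable_fam_sq h0 h1 ε m x')) fun π => ?_
  rw [norm_mul, Real.norm_eq_abs, Real.norm_eq_abs]
  nlinarith [sq_abs (fam q ε m π x.1 x.2), sq_abs (fam q ε m π x'.1 x'.2),
    sq_nonneg (|fam q ε m π x.1 x.2| - |fam q ε m π x'.1 x'.2|),
    sq_nonneg (|fam q ε m π x.1 x.2| + |fam q ε m π x'.1 x'.2|)]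

theorem tendsto_fam_p (ε : ℤˣ) (m l : ℤ) (x : ℤˣ × ℤ) :
    Tendsto (fun n : ℕ => fam q ε m (n + l) x.1 x.2) atTop (𝓝 0) := by
  have h := ((summable_fam_sq h0 h1 ε m x).comp_injective
    (i := fun n : ℕ => (n : ℤ) + l) fun a b h => by simpa using h).tendsto_atTop_zero.sqrt
  rw [Real.sqrt_zero] at h
  refine squeeze_zero_norm (fun n => le_of_eq ?_) h
  simp only [Function.comp, Real.sqrt_sq_eq_abs, Real.norm_eq_abs]

/-- The Casorati determinant of two solutions of the recurrence in `p`. -/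
def casorati (q : ℝ) (ε : ℤˣ) (m : ℤ) (x x' : ℤˣ × ℤ) (π : ℤ) : ℝ :=
  (q ^ m)⁻¹ * q ^ (π + 1) * sq q ε π * (fam q ε m (π + 1) x.1 x.2 * fam q ε m π x'.1 x'.2 -
    fam q ε m π x.1 x.2 * fam q ε m (π + 1) x'.1 x'.2)

/-- Columns are eigenvectors, with eigenvalue `κ(x)`, of a symmetric three-term recursion in `p`, so
that the product of two of them is a difference of Casorati determinants. -/
theorem casorati_sub (ε : ℤˣ) (m : ℤ) (x x' : ℤˣ × ℤ) (π : ℤ) :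
    sg ε * (kp q x.1 x.2 - kp q x'.1 x'.2) * (fam q ε m π x.1 x.2 * fam q ε m π x'.1 x'.2) =
      casorati q ε m x x' π - casorati q ε m x x' (π - 1) := by
  have hj : ∀ x : ℤˣ × ℤ, kp q x.1 x.2 * fam q ε m π x.1 x.2 =
      kp q ε π * (1 + sg ε * ((q ^ m)⁻¹) ^ 2) * fam q ε m π x.1 x.2 +
        sg ε * (q ^ π * (q ^ m)⁻¹) * (q * sq q ε π * fam q ε m (π + 1) x.1 x.2 +
          sq q ε (π - 1) * fam q ε m (π - 1) x.1 x.2) := by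
    rintro ⟨σ, ξ⟩
    have := amp_jacobi h0 h1 σ (ε * σ) π ξ (ξ + m)
    have e : q ^ ξ / q ^ (ξ + m) = (q ^ m)⁻¹ := by
      have hx : q ^ ξ ≠ 0 := by positivity
      rw [zpow_add₀ h0.ne']; field_simp
    rwa [← sg_mul, mul_mul_self_unit, e] at this
  have e1 := hj x
  have e2 := hj x'
  have hs := sg_sq ε
  unfold casorati
  rw [sub_add_cancel, zpow_add_one₀ h0.ne']
  linear_combination (sg ε * fam q ε m π x'.1 x'.2) * e1 - (sg ε * fam q ε m π x.1 x.2) * e2 +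
    (q ^ π * (q ^ m)⁻¹ * (q * sq q ε π * (fam q ε m (π + 1) x.1 x.2 * fam q ε m π x'.1 x'.2 -
      fam q ε m π x.1 x.2 * fam q ε m (π + 1) x'.1 x'.2) +
      sq q ε (π - 1) * (fam q ε m (π - 1) x.1 x.2 * fam q ε m π x'.1 x'.2 -
        fam q ε m π x.1 x.2 * fam q ε m (π - 1) x'.1 x'.2))) * hs

theorem tendsto_casorati (ε : ℤˣ) (m : ℤ) (x x' : ℤˣ × ℤ) :
    Tendsto (fun n : ℕ => casorati q ε m x x' n) atTop (𝓝 0) := by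
  have a := fun y => tendsto_fam_p h0 h1 ε m 0 y
  have b := fun y => tendsto_fam_p h0 h1 ε m 1 y
  have s := tendsto_sq h0 h1 ε 0
  simp only [add_zero] at a s
  have hq : Tendsto (fun n : ℕ => (q ^ m)⁻¹ * q ^ ((n : ℤ) + 1)) atTop (𝓝 0) := by
    have := ((tendsto_pow_atTop_nhds_zero_of_lt_one h0.le h1).mul_const q).const_mul (q ^ m)⁻¹
    rw [zero_mul, mul_zero] at this
    exact this.congr fun n => by rw [zpow_add_one₀ h0.ne', zpow_natCast]
  have := (hq.mul s).mul (((b x).mul (a x')).sub ((a x).mul (b x')))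
  simp only [mul_zero, sub_zero] at this
  exact this

theorem exists_bound_nu_wt {m : ℤ} (hm : m ≤ 0) :
    ∃ C, ∀ n : ℕ, |(q ^ n)⁻¹ ^ 2 * nuZ q (-n + m) ^ 2 * wt q 1 (-n) ^ 2| ≤ C := by
  obtain ⟨C, hC⟩ := exists_bound_of_tendsto (tendsto_wt_one_neg h0 h1)
  obtain ⟨k, hk⟩ := Int.eq_ofNat_of_zero_le (neg_nonneg.2 hm)
  refine ⟨C, fun n => le_trans ?_ (hC n)⟩
  rw [abs_of_nonneg (by positivity), abs_of_nonneg (by positivity)]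
  gcongr
  obtain ⟨d, hd⟩ : ∃ d : ℕ, (-(n : ℤ) + m - 1) * (-n + m - 2) / 2 = (d : ℤ) ∧
      n * (n + 1) + 2 * n ≤ 2 * d := by
    refine ⟨((n + k + 1) * (n + k + 2)) / 2, ?_, ?_⟩
    · push_cast
      congr 1
      rw [show m = -(k : ℤ) by omega]
      ring
    · have h2 : 2 ∣ (n + k + 1) * (n + k + 2) := (Nat.even_mul_succ_self (n + k + 1)).two_dvd
      rw [Nat.mul_div_cancel' h2]
      nlinarith [Nat.zero_le k, Nat.zero_le (n * k)]
  unfold nuZ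
  rw [hd.1, zpow_natCast, inv_pow, inv_mul_le_iff₀ (by positivity), ← pow_mul, ← pow_mul, ← pow_add]
  exact pow_le_pow_of_le_one h0.le h1.le (by nlinarith [hd.2])

/-- As `p` tends to infinity the series in the two columns have the same limit for `m ≤ 0`, and the
leading terms of the determinant cancel. -/
theorem tendsto_casorati_neg_aux {m : ℤ} (hm : m ≤ 0) (x x' : ℤˣ × ℤ) :
    Tendsto (fun n : ℕ => casorati q 1 m x x' (-n)) atTop (𝓝 0) := by
  obtain ⟨C, hC⟩ := exists_bound_nu_wt h0 h1 hm
  set c : ℤˣ × ℤ → ℝ := fun x => cq q * pairSign x.1 x.1 * (-sg x.1) ^ x.2 * q ^ (x.2 + m) *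
    (wt q x.1 (x.2 + m) / wt q x.1 x.2) with hc
  set R : ℤˣ × ℤ → ℤ → ℝ := fun x π => ampR q x.1 x.1 π x.2 (x.2 + m) with hR
  have hpref : ∀ (x : ℤˣ × ℤ) π, ampPref q x.1 x.1 π x.2 (x.2 + m) =
      c x * (-1) ^ π * nuZ q (π + m) * wt q 1 π := by
    intro x π
    unfold ampPref
    rw [Int.units_mul_self, show π + (x.2 + m) - x.2 = π + m by ring]
    simp only [hc]
    ring
  have hlim : ∀ (x : ℤˣ × ℤ) (l : ℤ), Tendsto (fun n : ℕ => R x (-n + l)) atTop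
      (𝓝 (eulerSeries (q ^ 2) ((q / q ^ m) ^ 2))) := by
    intro x l
    refine (tendsto_ampR_neg h0 h1 x.1 x.1 l x.2 (x.2 + m)).trans (le_of_eq ?_)
    have hx : q ^ x.2 ≠ 0 := by positivity
    rw [← pow_two, sg_sq, one_mul, zpow_add₀ h0.ne']
    congr 3
    field_simp
  have hbr : Tendsto (fun n : ℕ => R x (-n + 1) * R x' (-n + 0) - R x (-n + 0) * R x' (-n + 1)) atTop
      (𝓝 0) := by
    have := ((hlim x 1).mul (hlim x' 0)).sub ((hlim x 0).mul (hlim x' 1))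
    rwa [sub_self] at this
  have := (bdd_le_mul_tendsto_zero' C (Eventually.of_forall hC) hbr).const_mul (-(c x * c x'))
  rw [mul_zero] at this
  refine this.congr fun n => ?_
  have hfam : ∀ (x : ℤˣ × ℤ) π, fam q 1 m π x.1 x.2 = c x * (-1) ^ π * nuZ q (π + m) * wt q 1 π *
      R x π := by
    intro x π
    rw [fam, one_mul, amp, hpref]
  have hfam' : ∀ (x : ℤˣ × ℤ) (π : ℤ), q * sq q 1 π * fam q 1 m (π + 1) x.1 x.2 =
      -(q ^ π * q ^ m) * (c x * (-1) ^ π * nuZ q (π + m) * wt q 1 π) * R x (π + 1) := by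
    intro x π
    have h := ampPref_p h0 h1 x.1 x.1 π x.2 (x.2 + m)
    have hx : q ^ x.2 ≠ 0 := by positivity
    rw [Int.units_mul_self, hpref, hpref, zpow_add₀ h0.ne' x.2,
      show q ^ π * (q ^ x.2 * q ^ m) / q ^ x.2 = q ^ π * q ^ m by field_simp] at h
    rw [fam, one_mul, amp, hpref]
    linear_combination (R x (π + 1)) * h
  unfold casorati
  have a1 := hfam' x (-n)
  have a2 := hfam' x' (-n)
  rw [hfam x (-n), hfam x' (-n), zpow_add_one₀ h0.ne', add_zero]
  have hqn : q ^ (-(n : ℤ)) = (q ^ n)⁻¹ := by rw [zpow_neg, zpow_natCast]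
  rw [hqn] at a1 a2 ⊢
  have hm1 : ((-1 : ℝ) ^ (-(n : ℤ))) ^ 2 = 1 := sg_neg_one ▸ sg_zpow_sq h0 h1 (-1) (-n)
  have hmm : (q ^ m)⁻¹ * q ^ m = 1 := inv_mul_cancel₀ (by positivity)
  generalize (-1 : ℝ) ^ (-(n : ℤ)) = s at *
  clear_value c R
  clear hqn hC this hbr hlim hfam hfam' hpref
  generalize (q ^ n)⁻¹ = y at *
  generalize nuZ q (-n + m) = ν at *
  generalize wt q 1 (-n) = w at *
  generalize R x (-n) = r at *
  generalize R x' (-n) = r' at *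
  generalize R x (-n + 1) = r1 at *
  generalize R x' (-n + 1) = r1' at *
  generalize sq q 1 (-n) = sn at *
  generalize fam q 1 m (-n + 1) x.1 x.2 = f1 at *
  generalize fam q 1 m (-n + 1) x'.1 x'.2 = f1' at *
  linear_combination (-(q ^ m)⁻¹ * y * c x' * s * ν * w * r') * a1 +
    ((q ^ m)⁻¹ * y * c x * s * ν * w * r) * a2 -
    (c x * c x' * (y ^ 2 * ν ^ 2 * w ^ 2) * (r1 * r' - r * r1')) * (-(q ^ m)⁻¹ * q ^ m * hm1 - hmm)

theorem fam_col_swap (m π : ℤ) (x x' : ℤˣ × ℤ) :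
    fam q 1 m π x.1 x.2 * fam q 1 m π x'.1 x'.2 =
      (sg x.1 ^ x.2 * sg x.1 ^ (x.2 + m) * (sg x'.1 ^ x'.2 * sg x'.1 ^ (x'.2 + m))) *
      (fam q 1 (-m) π x.1 (x.2 + m) * fam q 1 (-m) π x'.1 (x'.2 + m)) := by
  rw [fam_swap h0 h1 1 m π x.1, fam_swap h0 h1 1 m π x'.1]
  simp only [sg_one, one_zpow, one_mul]
  ring

theorem tsum_fam_col_aux {ε : ℤˣ} {m : ℤ} (h : m ≤ 0 ∨ ε = -1) {x x' : ℤˣ × ℤ} (hx : x ≠ x') :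
    ∑' π, fam q ε m π x.1 x.2 * fam q ε m π x'.1 x'.2 = 0 := by
  have hneg : Tendsto (fun n : ℕ => casorati q ε m x x' (-n)) atTop (𝓝 0) := by
    rcases Int.units_eq_one_or ε with rfl | rfl
    · exact tendsto_casorati_neg_aux h0 h1 (h.resolve_right (by decide)) x x'
    · refine tendsto_const_nhds.congr fun n => ?_
      have : ¬InI (-1) (-(n : ℤ)) := fun h => h.elim (by decide) fun h => by omega
      rw [casorati, sq_eq_zero h0 h1 this]
      ring
  have hne : sg ε * (kp q x.1 x.2 - kp q x'.1 x'.2) ≠ 0 := by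
    refine mul_ne_zero (sg_ne_zero ε) (sub_ne_zero.2 fun h => hx ?_)
    obtain ⟨a, b⟩ := kp_injective h0 h1 h
    exact Prod.ext a b
  have := tsum_int_telescope ((summable_fam_col h0 h1 ε m x x').mul_left
    (sg ε * (kp q x.1 x.2 - kp q x'.1 x'.2))) (casorati_sub h0 h1 ε m x x')
    (tendsto_casorati h0 h1 ε m x x') hneg
  rw [tsum_mul_left, sub_zero] at this
  exact (mul_eq_zero.1 this).resolve_left hne

/-- Distinct columns are orthogonal. The case of positive `m` and positive `p` is reduced to that of
negative `m` by the symmetry in `x` and `y`. -/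
theorem tsum_fam_col (ε : ℤˣ) (m : ℤ) {x x' : ℤˣ × ℤ} (hx : x ≠ x') :
    ∑' π, fam q ε m π x.1 x.2 * fam q ε m π x'.1 x'.2 = 0 := by
  by_cases h : m ≤ 0 ∨ ε = -1
  · exact tsum_fam_col_aux h0 h1 h hx
  · push Not at h
    obtain rfl : ε = 1 := (Int.units_eq_one_or ε).resolve_right h.2
    simp only [fam_col_swap h0 h1 m _ x x']
    rw [tsum_mul_left]
    have := tsum_fam_col_aux h0 h1 (ε := 1) (m := -m) (Or.inl (by omega)) (x := (x.1, x.2 + m))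
      (x' := (x'.1, x'.2 + m)) fun h => hx (by
        obtain ⟨a, b⟩ := Prod.mk.inj h
        exact Prod.ext a (by omega))
    rw [this, mul_zero]

/-- Rows that are orthogonal and of equal length, with orthogonal nonzero columns, force the columns
to have the same length as the rows. -/
theorem exists_kappa_col (ε : ℤˣ) : ∃ κ, 0 < κ ∧ (∀ m π, InI ε π → gram q ε m π π = κ) ∧
    ∀ m σ ξ, InI σ ξ → InI (ε * σ) (ξ + m) → ∑' π, fam q ε m π σ ξ ^ 2 = κ := by
  obtain ⟨κ, hκ0, hκ⟩ := exists_kappa h0 h1 ε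
  refine ⟨κ, hκ0, fun m π hp => ?_, fun m σ ξ hx hy => ?_⟩
  · have := hκ m ⟨π, hp⟩ ⟨π, hp⟩
    rwa [inner_rowVec, if_pos rfl] at this
  · obtain ⟨π, hπ⟩ := exists_fam_ne_zero h0 h1 ε m σ hx hy
    have hp : InI ε π := by
      by_contra h
      exact hπ (fam_eq_zero h0 h1 fun h' => h h'.1)
    have := tsum_column hκ0 (hκ m) (fun x x' hxx => ?_) (x := (σ, ξ)) (j := ⟨π, hp⟩) hπ
    · rw [← this]
      have hs := support_fam h0 h1 ε m (σ, ξ) (σ, ξ)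
      simp only [← pow_two] at hs
      exact (tsum_subtype_eq_of_support_subset hs).symm
    · rw [← tsum_fam_col h0 h1 ε m hxx]
      exact tsum_subtype_eq_of_support_subset (support_fam h0 h1 ε m x x')

end

end QSU11

namespace QSU11

/-! ### Normalization of the amplitudes -/

section

set_option linter.unusedSectionVars false

variable {q : ℝ} (h0 : 0 < q) (h1 : q < 1)
include h0 h1

/-- The column at `|x| = q` with `m = 0` is explicit, by the symmetry in `p` and `y`. -/
theorem fam_sq_one (σ : ℤˣ) (π : ℤ) : fam q (-σ) 0 π σ 1 ^ 2 =
    cq q ^ 2 * q ^ 2 * wt q (-1) 1 ^ 2 * wt q σ 1 ^ 2 * (nuZ q π ^ 2 * wt q (-σ) π ^ 2) := by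
  have e1 := amp_swap_py h0 h1 σ (-1) π 1 1
  have e2 := amp_one h0 h1 σ 1 π
  have hp : q ^ π ≠ 0 := by positivity
  rw [mul_neg_one] at e1
  unfold fam
  rw [neg_mul, Int.units_mul_self, add_zero, e1, e2, add_sub_cancel_left, zpow_one, zpow_one]
  have s1 := sg_sq σ
  have s2 := pairSign_sq σ (-σ)
  have s3 : ((-1 : ℝ) ^ (π + 1)) ^ 2 = 1 := sg_neg_one ▸ sg_zpow_sq h0 h1 (-1) (π + 1)
  calc _ = ((-1 : ℝ) ^ (π + 1)) ^ 2 * (sg σ ^ 2) ^ 2 * pairSign σ (-σ) ^ 2 * (cq q ^ 2 * q ^ 2 *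
      wt q (-1) 1 ^ 2 * wt q σ 1 ^ 2 * (nuZ q π ^ 2 * wt q (-σ) π ^ 2)) := by field_simp
    _ = _ := by rw [s1, s2, s3]; ring

theorem wt_one_zero_sq : wt q 1 0 ^ 2 = 2 * wt q 1 1 ^ 2 := by
  have hs := sq_sq h0 h1 (σ := 1) (k := 0) (Or.inl rfl)
  rw [wt_eq h0 h1 1 0, mul_pow, hs, kp]
  norm_num

theorem nuZ_natCast_sq (n : ℕ) : nuZ q ((n : ℤ) + 1) ^ 2 = (q ^ 2) ^ n.choose 2 := by
  unfold nuZ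
  rw [← pow_mul, mul_comm 2, pow_mul]
  congr 1
  rw [← zpow_natCast, Nat.choose_two_right]
  congr 1
  rcases n with _ | n
  · simp
  · push_cast
    congr 1
    ring

/-- The sum telescopes. -/
theorem tsum_nu_wt_pos : ∑' π, nuZ q π ^ 2 * wt q 1 π ^ 2 = 2 * (wt q 1 1 ^ 2) ^ 2 := by
  have hsum : Summable fun π => nuZ q π ^ 2 * wt q 1 π ^ 2 := by
    have h := summable_fam_sq h0 h1 1 0 (-1, 1)
    have hf := fam_sq_one h0 h1 (-1)
    rw [neg_neg] at hf
    simp only [hf] at h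
    have a1 := cq_pos h0 h1
    have a2 := wt_pos h0 h1 (σ := -1) (k := 1) (Or.inr le_rfl)
    exact (summable_mul_left_iff (by positivity)).1 h
  have hq := h0.ne'
  have hν : ∀ n : ℕ, nuZ q (-(n : ℤ) + 1) ^ 2 = q ^ (n * (n + 1)) := by
    intro n
    have h2 : n * (n + 1) / 2 * 2 = n * (n + 1) :=
      Nat.div_mul_cancel (Nat.even_mul_succ_self n).two_dvd
    unfold nuZ
    rw [show (-(n : ℤ) + 1 - 1) * (-n + 1 - 2) = ((n * (n + 1) : ℕ) : ℤ) by push_cast; ring,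
      show (2 : ℤ) = ((2 : ℕ) : ℤ) from rfl, ← Int.natCast_div, zpow_natCast, ← pow_mul, h2]
  have hν' := nuZ_natCast_sq h0 h1
  rw [tsum_int_telescope (U := fun k => -(nuZ q (k + 1) ^ 2 * wt q 1 k ^ 2)) (L := 0)
    (L' := -(wt q 1 0 ^ 2 * wt q 1 1 ^ 2)) hsum]
  · rw [wt_one_zero_sq h0 h1]; ring
  · intro k
    have e1 := nuZ_succ h0 k
    have e2 := wt_eq h0 h1 1 (k - 1)
    have e3 := sq_sq h0 h1 (σ := 1) (k := k - 1) (Or.inl rfl)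
    rw [sub_add_cancel] at e2
    rw [sub_add_cancel, e2, mul_pow (sq q 1 (k - 1)), e3, kp, zpow_sub_one₀ hq, sg_one]
    have e4 : nuZ q (k + 1) = q ^ k * nuZ q k * q⁻¹ := by rw [← e1]; field_simp
    rw [e4]
    ring
  · have h2 := ((summable_thetaBound (r := q ^ 2) (by positivity) (by nlinarith)
      1).tendsto_atTop_zero.mul ((tendsto_wt h0 h1 1 0).pow 2)).neg
    simp only [one_pow, mul_one, neg_zero, add_zero, ← hν'] at h2
    exact h2
  · refine (tendsto_wt_one_neg h0 h1).neg.congr fun n => ?_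
    rw [hν]

/-- The sum is an instance of Euler's identity. -/
theorem tsum_nu_wt_neg :
    ∑' π, nuZ q π ^ 2 * wt q (-1) π ^ 2 = 2 * (wt q (-1) 1 ^ 2 * wt q 1 1 ^ 2) := by
  have hQ := norm_sq_lt_one h0 h1
  have hinj : Function.Injective fun n : ℕ => (n : ℤ) + 1 := fun a b h => by simpa using h
  rw [← hinj.tsum_eq]
  · have hterm : ∀ n : ℕ, nuZ q ((n : ℤ) + 1) ^ 2 * wt q (-1) ((n : ℤ) + 1) ^ 2 =
        eulerSeries (q ^ 2) (q ^ 2) *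
          ((-1) ^ n * (q ^ 2) ^ n.choose 2 * (-1) ^ n / qFac (q ^ 2) n) := by
      intro n
      have hk : -kp q (-1) ((n : ℤ) + 1) = (q ^ 2) ^ (n + 1) := by
        rw [kp, sg_neg_one, ← pow_mul, mul_comm 2, pow_mul, ← zpow_natCast q]
        push_cast; ring
      rw [nuZ_natCast_sq h0 h1, wt_sq h0 h1, hk, eulerSeries_eq_qFac hQ n]
      have h2 := qFac_ne_zero hQ n
      have h3 : ((-1 : ℝ) ^ n) * (-1) ^ n = 1 := by rw [← mul_pow]; norm_num
      rw [mul_right_comm ((-1 : ℝ) ^ n), h3]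
      field_simp
    simp only [hterm]
    rw [tsum_mul_left]
    have h4 : ∑' n : ℕ, (-1) ^ n * (q ^ 2) ^ n.choose 2 * (-1) ^ n / qFac (q ^ 2) n =
        eulerSeries (q ^ 2) (-1) := rfl
    rw [h4, eulerSeries_eq hQ (-1), wt_sq h0 h1, wt_sq h0 h1]
    simp only [kp, sg_one, sg_neg_one, zpow_one]
    ring_nf
  · intro k hk
    have : InI (-1) k := by
      by_contra h
      exact hk (by simp only [wt_eq_zero h0 h1 h]; ring)
    obtain ⟨n, hn⟩ := Int.eq_ofNat_of_zero_le (sub_nonneg.2 (this.resolve_left (by decide)))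
    exact ⟨n, by simp only; omega⟩

theorem cq_mul : cq q ^ 2 * q ^ 2 * (2 * (wt q (-1) 1 ^ 2) ^ 2 * (wt q 1 1 ^ 2) ^ 2) = 1 := by
  have hQ0 : 0 ≤ q ^ 2 := by positivity
  have hQ1 : q ^ 2 < 1 := by nlinarith
  have a1 := eulerSeries_pos hQ0 hQ1 hQ1
  have a2 := eulerSeries_pos (a := -q ^ 2) hQ0 hQ1 (by linarith)
  unfold cq
  rw [qPochInf_eq hQ0 hQ1, qPochInf_eq hQ0 hQ1, wt_sq h0 h1, wt_sq h0 h1]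
  have e1 : -kp q (-1) 1 = q ^ 2 := by simp [kp]
  have e2 : -kp q 1 1 = -q ^ 2 := by simp [kp]
  have e3 : Real.sqrt 2 ^ 2 = 2 := Real.sq_sqrt (by norm_num)
  rw [e1, e2, inv_pow, mul_pow, mul_pow, e3]
  field_simp

theorem tsum_fam_sq_one (ε : ℤˣ) : ∑' π, fam q ε 0 π (-ε) 1 ^ 2 = 1 := by
  have hf := fam_sq_one h0 h1 (-ε)
  rw [neg_neg] at hf
  simp only [hf]
  rw [tsum_mul_left, ← cq_mul h0 h1]
  rcases Int.units_eq_one_or ε with rfl | rfl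
  · rw [tsum_nu_wt_pos h0 h1]; ring
  · rw [tsum_nu_wt_neg h0 h1, neg_neg]; ring

/-- All rows and columns have length one, since the column at `|x| = q`, `m = 0` has. -/
theorem kappa_eq_one (ε : ℤˣ) : (∀ m π, InI ε π → gram q ε m π π = 1) ∧
    ∀ m σ ξ, InI σ ξ → InI (ε * σ) (ξ + m) → ∑' π, fam q ε m π σ ξ ^ 2 = 1 := by
  obtain ⟨κ, -, hκ, hκ'⟩ := exists_kappa_col h0 h1 ε
  have h := hκ' 0 (-ε) 1 (Or.inr le_rfl) (Or.inr (by norm_num))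
  rw [tsum_fam_sq_one h0 h1] at h
  subst h
  exact ⟨hκ, hκ'⟩

/-- The rows of the matrix of amplitudes are orthonormal. -/
theorem gram_eq (ε : ℤˣ) (m π π' : ℤ) (hp : InI ε π) :
    gram q ε m π π' = if π = π' then 1 else 0 := by
  split_ifs with h
  · subst h; exact (kappa_eq_one h0 h1 ε).1 m π hp
  · exact gram_eq_zero h0 h1 ε m h

/-- The columns of the matrix of amplitudes are unit vectors. -/
theorem tsum_fam_sq (ε : ℤˣ) (m : ℤ) {σ : ℤˣ} {ξ : ℤ} (hx : InI σ ξ) (hy : InI (ε * σ) (ξ + m)) :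
    ∑' π, fam q ε m π σ ξ ^ 2 = 1 :=
  (kappa_eq_one h0 h1 ε).2 m σ ξ hx hy

end

end QSU11

/-! ### The bilinear identity behind coassociativity -/

namespace QSU11

/-- Up to the factor `(q²; q²)_∞`, the coefficient `vⁱ Q^{i(i-1)/2} / (Q; Q)_i` of `(-vS; Q)_∞`,
for `Q = q²` and `v = q^n`. It vanishes for `i < 0`. -/
def al (q : ℝ) (n i : ℤ) : ℝ := q ^ (n * i + i * (i - 1)) * wt q (-1) (i + 1) ^ 2

/-- The left-hand side of the bilinear identity, for `p = s₁ s₂ s₃ q^π`, `x = s₁ s₂ q^ξ` and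
`z_j = s_j q^{ζ_j}`. -/
def sumL (q : ℝ) (n : ℤ) (s₁ s₂ s₃ : ℤˣ) (π ξ ζ₁ ζ₂ ζ₃ : ℤ) : ℝ :=
  ∑' i : ℤ, al q n i * (amp q (s₁ * s₂) s₃ π (ξ + i) ζ₃ * amp q s₁ s₂ (ξ + i) ζ₁ ζ₂)

/-- The right-hand side of the bilinear identity, for `p = s₁ s₂ s₃ q^π`, `y = s₂ s₃ q^υ` and
`z_j = s_j q^{ζ_j}`. -/
def sumR (q : ℝ) (n : ℤ) (s₁ s₂ s₃ : ℤˣ) (π υ ζ₁ ζ₂ ζ₃ : ℤ) : ℝ :=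
  ∑' i : ℤ, al q n i * (amp q s₁ (s₂ * s₃) π ζ₁ (υ + i) * amp q s₂ s₃ (υ + i) ζ₂ ζ₃)

/-- The bilinear identity at given exponents. -/
def BilinAt (q : ℝ) (s₁ s₂ s₃ : ℤˣ) (π ξ ζ₁ ζ₂ ζ₃ : ℤ) : Prop :=
  sumL q (1 + π + ζ₂ - ζ₁ - ζ₃) s₁ s₂ s₃ π ξ ζ₁ ζ₂ ζ₃ =
    sumR q (1 + π + ζ₂ - ζ₁ - ζ₃) s₁ s₂ s₃ π (π + ζ₂ - ξ) ζ₁ ζ₂ ζ₃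

section

set_option linter.unusedSectionVars false

variable {q : ℝ} (h0 : 0 < q) (h1 : q < 1)
include h0 h1

theorem abs_amp_le_one (σ τ : ℤˣ) (π ξ η : ℤ) : |amp q σ τ π ξ η| ≤ 1 := by
  by_cases h : InI (σ * τ) π ∧ InI σ ξ ∧ InI τ η
  · have e : amp q σ τ π ξ η = fam q (σ * τ) (η - ξ) π σ ξ := by
      unfold fam
      rw [mul_comm σ τ, mul_assoc, Int.units_mul_self, mul_one, add_sub_cancel]
    have hy : InI (σ * τ * σ) (ξ + (η - ξ)) := by
      rw [mul_comm σ τ, mul_assoc, Int.units_mul_self, mul_one, add_sub_cancel]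
      exact h.2.2
    have h2 := (summable_fam_sq h0 h1 (σ * τ) (η - ξ) (σ, ξ)).le_tsum π fun _ _ => sq_nonneg _
    rw [tsum_fam_sq h0 h1 _ _ h.2.1 hy] at h2
    rw [e]
    exact (sq_le_one_iff_abs_le_one _).1 h2
  · rw [amp_eq_zero h0 h1 h, abs_zero]; exact zero_le_one

theorem al_eq_zero {i : ℤ} (hi : i < 0) (n : ℤ) : al q n i = 0 := by
  have : ¬InI (-1) (i + 1) := fun h => h.elim (by decide) fun h => by omega
  rw [al, wt_eq_zero h0 h1 this]; ring

theorem al_natCast (n : ℤ) (i : ℕ) :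
    al q n i = (q ^ 2) ^ i.choose 2 * (q ^ n) ^ i * wt q (-1) (i + 1) ^ 2 := by
  rw [al, zpow_add₀ h0.ne', zpow_mul, zpow_natCast, mul_comm (_ ^ i)]
  congr 2
  rw [← nuZ_natCast_sq h0 h1, nuZ, ← zpow_natCast, ← zpow_mul]
  congr 1
  have h2 : (2 : ℤ) ∣ ((i : ℤ) + 1 - 1) * (i + 1 - 2) := by
    rw [show ((i : ℤ) + 1 - 1) * (i + 1 - 2) = (i - 1) * (i - 1 + 1) by ring]
    exact (Int.even_mul_succ_self _).two_dvd
  push_cast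
  rw [Int.ediv_mul_cancel h2]
  ring

theorem exists_wt_bound (σ : ℤˣ) (m : ℤ) : ∃ C, 0 ≤ C ∧ ∀ n : ℕ, wt q σ (n + m) ≤ C := by
  obtain ⟨C, hC⟩ := exists_bound_of_tendsto (tendsto_wt h0 h1 σ m)
  exact ⟨C, (abs_nonneg _).trans (hC 0), fun n => (le_abs_self _).trans (hC n)⟩

theorem tsum_al (n : ℤ) (f : ℤ → ℝ) : ∑' i : ℤ, al q n i * f i = ∑' i : ℕ, al q n i * f i := by
  refine ((Nat.cast_injective (R := ℤ)).tsum_eq fun i hi => ?_).symm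
  by_contra h
  refine hi (by simp only; rw [al_eq_zero h0 h1, zero_mul]; by_contra h2; exact h ⟨i.toNat, by omega⟩)

theorem summable_al (n : ℤ) : Summable fun i => al q n i := by
  obtain ⟨C, hC0, hC⟩ := exists_wt_bound h0 h1 (-1) 1
  have hs : Summable fun i : ℕ => al q n i := by
    refine Summable.of_nonneg_of_le (fun i => by unfold al; positivity) (fun i => ?_)
      ((summable_thetaBound (r := q ^ 2) (by positivity) (by nlinarith) (q ^ n)).mul_right (C ^ 2))
    rw [al_natCast h0 h1]
    have : 0 ≤ wt q (-1) (i + 1) := Real.sqrt_nonneg _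
    gcongr
    exact hC i
  refine ((Nat.cast_injective (R := ℤ)).summable_iff fun i hi => ?_).1 hs
  exact al_eq_zero h0 h1 (by by_contra h2; exact hi ⟨i.toNat, by omega⟩) n

theorem summable_al_mul (n : ℤ) {f : ℤ → ℝ} (hf : ∀ i, |f i| ≤ 1) :
    Summable fun i => al q n i * f i := by
  refine Summable.of_norm_bounded (summable_al h0 h1 n) fun i => ?_
  have h : 0 ≤ al q n i := by unfold al; positivity
  rw [norm_mul, Real.norm_of_nonneg h]
  exact mul_le_of_le_one_right h (hf i)

theorem abs_amp_mul_amp_le (σ τ σ' τ' : ℤˣ) (π ξ η π' ξ' η' : ℤ) :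
    |amp q σ τ π ξ η * amp q σ' τ' π' ξ' η'| ≤ 1 := by
  rw [abs_mul]
  exact mul_le_one₀ (abs_amp_le_one h0 h1 ..) (abs_nonneg _) (abs_amp_le_one h0 h1 ..)

/-- Apply the recursions `amp_alpha'` and `amp_gamma'` to the two factors of each term. -/
theorem sumL_rec (n : ℤ) (s₁ s₂ s₃ : ℤˣ) (π ξ ζ₁ ζ₂ ζ₃ : ℤ) :
    q ^ ζ₁ * q ^ ζ₂ * q ^ ζ₃ * (q * sq q (s₁ * s₂ * s₃) (π - 1)) *
        sumL q n s₁ s₂ s₃ (π - 1) ξ ζ₁ ζ₂ ζ₃ =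
      q ^ π * (sq q s₁ ζ₁ * sq q s₂ ζ₂ * sq q s₃ ζ₃ *
          sumL q n s₁ s₂ s₃ π (ξ + 1) (ζ₁ + 1) (ζ₂ + 1) (ζ₃ + 1) +
        q * sg s₂ * sq q s₃ ζ₃ * sumL q n s₁ s₂ s₃ π (ξ + 1) ζ₁ ζ₂ (ζ₃ + 1) +
        q ^ 2 * (sg s₂ * sg s₃) * sq q s₂ (ζ₂ - 1) * sumL q n s₁ s₂ s₃ π ξ ζ₁ (ζ₂ - 1) ζ₃ +
        q * sg s₃ * sq q s₁ ζ₁ * sumL q n s₁ s₂ s₃ π ξ (ζ₁ + 1) ζ₂ ζ₃) := by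
  have hs : ∀ π ξ ζ₁ ζ₂ ζ₃, Summable fun i : ℤ =>
      al q n i * (amp q (s₁ * s₂) s₃ π (ξ + i) ζ₃ * amp q s₁ s₂ (ξ + i) ζ₁ ζ₂) :=
    fun π ξ ζ₁ ζ₂ ζ₃ => summable_al_mul h0 h1 n fun i => abs_amp_mul_amp_le h0 h1 ..
  unfold sumL
  simp only [← tsum_mul_left]
  rw [← ((hs _ _ _ _ _).mul_left _).tsum_add ((hs _ _ _ _ _).mul_left _),
    ← (((hs _ _ _ _ _).mul_left _).add ((hs _ _ _ _ _).mul_left _)).tsum_add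
      ((hs _ _ _ _ _).mul_left _),
    ← ((((hs _ _ _ _ _).mul_left _).add ((hs _ _ _ _ _).mul_left _)).add
      ((hs _ _ _ _ _).mul_left _)).tsum_add ((hs _ _ _ _ _).mul_left _), ← tsum_mul_left]
  refine tsum_congr fun i => ?_
  have e1 := amp_alpha' h0 h1 (s₁ * s₂) s₃ π (ξ + i) ζ₃
  have e2 := amp_alpha' h0 h1 s₁ s₂ (ξ + i + 1) ζ₁ ζ₂
  have e3 := amp_gamma h0 h1 s₁ s₂ (ξ + i) ζ₁ ζ₂
  rw [add_sub_cancel_right, zpow_add_one₀ h0.ne'] at e2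
  rw [show ξ + 1 + i = ξ + i + 1 by ring]
  have hk : q ^ (ξ + i) ≠ 0 := by positivity
  refine mul_left_cancel₀ (mul_ne_zero h0.ne' hk) ?_
  linear_combination (q * al q n i * amp q s₁ s₂ (ξ + i) ζ₁ ζ₂ * q ^ ζ₁ * q ^ ζ₂) * e1 +
    (al q n i * q ^ π * sq q s₃ ζ₃ * amp q (s₁ * s₂) s₃ π (ξ + i + 1) (ζ₃ + 1)) * e2 +
    (al q n i * q ^ π * q ^ 2 * sg s₃ * amp q (s₁ * s₂) s₃ π (ξ + i) ζ₃) * e3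

/-- The right hand side of the bilinear identity obeys the same recursion as the left hand side. -/
theorem sumR_rec (n : ℤ) (s₁ s₂ s₃ : ℤˣ) (π υ ζ₁ ζ₂ ζ₃ : ℤ) :
    q ^ ζ₁ * q ^ ζ₂ * q ^ ζ₃ * (q * sq q (s₁ * s₂ * s₃) (π - 1)) *
        sumR q n s₁ s₂ s₃ (π - 1) υ ζ₁ ζ₂ ζ₃ =
      q ^ π * (sq q s₁ ζ₁ * sq q s₂ ζ₂ * sq q s₃ ζ₃ *
          sumR q n s₁ s₂ s₃ π (υ + 1) (ζ₁ + 1) (ζ₂ + 1) (ζ₃ + 1) +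
        q * sg s₂ * sq q s₃ ζ₃ * sumR q n s₁ s₂ s₃ π υ ζ₁ ζ₂ (ζ₃ + 1) +
        q ^ 2 * (sg s₂ * sg s₃) * sq q s₂ (ζ₂ - 1) * sumR q n s₁ s₂ s₃ π υ ζ₁ (ζ₂ - 1) ζ₃ +
        q * sg s₃ * sq q s₁ ζ₁ * sumR q n s₁ s₂ s₃ π (υ + 1) (ζ₁ + 1) ζ₂ ζ₃) := by
  have hs : ∀ π υ ζ₁ ζ₂ ζ₃, Summable fun i : ℤ =>
      al q n i * (amp q s₁ (s₂ * s₃) π ζ₁ (υ + i) * amp q s₂ s₃ (υ + i) ζ₂ ζ₃) :=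
    fun π υ ζ₁ ζ₂ ζ₃ => summable_al_mul h0 h1 n fun i => abs_amp_mul_amp_le h0 h1 ..
  unfold sumR
  simp only [← tsum_mul_left]
  rw [← ((hs _ _ _ _ _).mul_left _).tsum_add ((hs _ _ _ _ _).mul_left _),
    ← (((hs _ _ _ _ _).mul_left _).add ((hs _ _ _ _ _).mul_left _)).tsum_add
      ((hs _ _ _ _ _).mul_left _),
    ← ((((hs _ _ _ _ _).mul_left _).add ((hs _ _ _ _ _).mul_left _)).add
      ((hs _ _ _ _ _).mul_left _)).tsum_add ((hs _ _ _ _ _).mul_left _), ← tsum_mul_left]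
  refine tsum_congr fun i => ?_
  have e1 := amp_alpha' h0 h1 s₁ (s₂ * s₃) π ζ₁ (υ + i)
  have e2 := amp_alpha' h0 h1 s₂ s₃ (υ + i + 1) ζ₂ ζ₃
  have e3 := amp_gamma' h0 h1 s₂ s₃ (υ + i) ζ₂ ζ₃
  rw [add_sub_cancel_right, zpow_add_one₀ h0.ne'] at e2
  rw [← mul_assoc s₁, sg_mul] at e1
  have e4 := sg_sq s₃
  rw [show υ + 1 + i = υ + i + 1 by ring]
  have hk : q ^ (υ + i) ≠ 0 := by positivity
  refine mul_left_cancel₀ (mul_ne_zero h0.ne' hk) ?_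
  linear_combination (q * al q n i * amp q s₂ s₃ (υ + i) ζ₂ ζ₃ * q ^ ζ₂ * q ^ ζ₃) * e1 +
    (al q n i * q ^ π * sq q s₁ ζ₁ * amp q s₁ (s₂ * s₃) π (ζ₁ + 1) (υ + i + 1)) * e2 +
    (al q n i * q ^ π * q ^ 2 * (sg s₂ * sg s₃) * amp q s₁ (s₂ * s₃) π ζ₁ (υ + i)) * e3 +
    (al q n i * q ^ π * q ^ 2 * sg s₂ * amp q s₁ (s₂ * s₃) π ζ₁ (υ + i) * q ^ (υ + i) *
      sq q s₃ ζ₃ * amp q s₂ s₃ (υ + i) ζ₂ (ζ₃ + 1)) * e4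

theorem sumL_eq_zero {n : ℤ} {s₁ s₂ s₃ : ℤˣ} {π ξ ζ₁ ζ₂ ζ₃ : ℤ}
    (h : ¬(InI (s₁ * s₂ * s₃) π ∧ InI s₁ ζ₁ ∧ InI s₂ ζ₂ ∧ InI s₃ ζ₃)) :
    sumL q n s₁ s₂ s₃ π ξ ζ₁ ζ₂ ζ₃ = 0 := by
  unfold sumL
  convert tsum_zero with i
  by_cases h2 : InI (s₁ * s₂ * s₃) π ∧ InI s₃ ζ₃
  · rw [amp_eq_zero h0 h1 (σ := s₁) (τ := s₂) (by tauto), mul_zero, mul_zero]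
  · rw [amp_eq_zero h0 h1 (τ := s₃) (by tauto), zero_mul, mul_zero]

theorem sumR_eq_zero {n : ℤ} {s₁ s₂ s₃ : ℤˣ} {π υ ζ₁ ζ₂ ζ₃ : ℤ}
    (h : ¬(InI (s₁ * s₂ * s₃) π ∧ InI s₁ ζ₁ ∧ InI s₂ ζ₂ ∧ InI s₃ ζ₃)) :
    sumR q n s₁ s₂ s₃ π υ ζ₁ ζ₂ ζ₃ = 0 := by
  unfold sumR
  convert tsum_zero with i
  by_cases h2 : InI (s₁ * s₂ * s₃) π ∧ InI s₁ ζ₁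
  · rw [amp_eq_zero h0 h1 (σ := s₂) (τ := s₃) (by tauto), mul_zero, mul_zero]
  · rw [amp_eq_zero h0 h1 (σ := s₁) (by rw [← mul_assoc]; tauto), zero_mul, mul_zero]

theorem bilinAt_of_not_mem {s₁ s₂ s₃ : ℤˣ} {π ξ ζ₁ ζ₂ ζ₃ : ℤ}
    (h : ¬(InI (s₁ * s₂ * s₃) π ∧ InI s₁ ζ₁ ∧ InI s₂ ζ₂ ∧ InI s₃ ζ₃)) :
    BilinAt q s₁ s₂ s₃ π ξ ζ₁ ζ₂ ζ₃ := by
  rw [BilinAt, sumL_eq_zero h0 h1 h, sumR_eq_zero h0 h1 h]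

/-- The cyclic symmetry taking `a_p(x, y)` to `a_x(y, p)`. -/
theorem amp_cycle (σ τ : ℤˣ) (π ξ η : ℤ) :
    amp q σ τ π ξ η = (-1) ^ (π + ξ) * sg σ ^ ξ * sg (σ * τ) ^ π * (q ^ ξ / q ^ π) *
      amp q τ (σ * τ) ξ η π := by
  have e1 := amp_swap_py h0 h1 σ τ π ξ η
  have e2 := amp_swap_xy h0 h1 σ (σ * τ) η ξ π
  have e3 := amp_swap_py h0 h1 (σ * τ) σ η π ξ
  have e4 := amp_swap_xy h0 h1 (σ * τ) τ ξ π η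
  have a1 : σ * (σ * τ) = τ := by rw [← mul_assoc, Int.units_mul_self, one_mul]
  have a2 : σ * τ * σ = τ := by rw [mul_comm, a1]
  have a3 : σ * τ * τ = σ := by rw [mul_assoc, Int.units_mul_self, mul_one]
  rw [a1] at e2
  rw [a2] at e3
  rw [a3] at e4
  have hη : q ^ η ≠ 0 := by positivity
  have s1 := sg_zpow_sq h0 h1 σ ξ
  have s2 := sg_zpow_sq h0 h1 (σ * τ) π
  have s3 := sg_zpow_sq h0 h1 τ η
  have s4 : ((-1 : ℝ) ^ η) ^ 2 = 1 := sg_neg_one ▸ sg_zpow_sq h0 h1 (-1) η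
  rw [e1, e2, e3, e4, zpow_add₀ (by norm_num), zpow_add₀ (by norm_num) η,
    zpow_add₀ (by norm_num) π]
  generalize amp q τ (σ * τ) ξ η π = A
  calc _ = ((-1 : ℝ) ^ η) ^ 2 * (sg σ ^ ξ) ^ 2 * (sg (σ * τ) ^ π) ^ 2 * (sg τ ^ η) ^ 2 *
      ((-1) ^ π * (-1) ^ ξ * sg σ ^ ξ * sg (σ * τ) ^ π * (q ^ ξ / q ^ π) * A) := by
        field_simp
    _ = _ := by rw [s1, s2, s3, s4]; ring

/-- The bilinear identity is symmetric under exchanging `p` with `z₂` and `z₁` with `z₃`. -/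
theorem BilinAt.swap {s₁ s₂ s₃ : ℤˣ} {π ξ ζ₁ ζ₂ ζ₃ : ℤ}
    (h : BilinAt q s₃ (s₁ * s₂ * s₃) s₁ ζ₂ ξ ζ₃ π ζ₁) : BilinAt q s₁ s₂ s₃ π ξ ζ₁ ζ₂ ζ₃ := by
  unfold BilinAt at *
  rw [show 1 + ζ₂ + π - ζ₃ - ζ₁ = 1 + π + ζ₂ - ζ₁ - ζ₃ by ring,
    show ζ₂ + π - ξ = π + ζ₂ - ξ by ring] at h
  set c : ℝ := (-1) ^ π * (-1) ^ ζ₂ * sg (s₁ * s₂ * s₃) ^ π * sg s₂ ^ ζ₂ * (q ^ ζ₂ / q ^ π) with hc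
  have a1 : s₃ * (s₁ * s₂ * s₃) = s₁ * s₂ := by
    rw [mul_left_comm, Int.units_mul_self, mul_one]
  have a2 : s₁ * s₂ * s₁ = s₂ := by rw [mul_right_comm, Int.units_mul_self, one_mul]
  have a3 : s₁ * s₂ * s₃ * s₁ = s₂ * s₃ := by
    rw [mul_comm, mul_assoc s₁, ← mul_assoc, Int.units_mul_self, one_mul]
  have a4 : s₃ * (s₂ * s₃) = s₂ := by rw [mul_left_comm, Int.units_mul_self, mul_one]
  have hq : ∀ k : ℤ, q ^ k ≠ 0 := fun k => by positivity
  have hm : ∀ k : ℤ, ((-1 : ℝ) ^ k) ^ 2 = 1 := fun k => sg_neg_one ▸ sg_zpow_sq h0 h1 (-1) k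
  have hL : ∀ n, sumL q n s₁ s₂ s₃ π ξ ζ₁ ζ₂ ζ₃ = c * sumL q n s₃ (s₁ * s₂ * s₃) s₁ ζ₂ ξ ζ₃ π ζ₁ := by
    intro n
    unfold sumL
    rw [← tsum_mul_left]
    refine tsum_congr fun i => ?_
    have e1 := amp_cycle h0 h1 (s₁ * s₂) s₃ π (ξ + i) ζ₃
    have e2 := amp_cycle h0 h1 (s₁ * s₂) s₁ ζ₂ (ξ + i) ζ₁
    rw [a2] at e2
    rw [a1, e1, e2]
    generalize amp q s₃ (s₁ * s₂ * s₃) (ξ + i) ζ₃ π = A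
    generalize amp q s₁ s₂ (ξ + i) ζ₁ ζ₂ = B
    have t1 := hm (ξ + i)
    have t2 := sg_zpow_sq h0 h1 (s₁ * s₂) (ξ + i)
    have t3 := hm ζ₂
    have t4 := sg_zpow_sq h0 h1 s₂ ζ₂
    rw [zpow_add₀ (by norm_num), zpow_add₀ (by norm_num) ζ₂, hc]
    have := hq ζ₂
    calc _ = (1 * 1) * (al q n i * (-1) ^ π * (-1) ^ (ξ + i) * sg (s₁ * s₂) ^ (ξ + i) *
          sg (s₁ * s₂ * s₃) ^ π * (q ^ (ξ + i) / q ^ π) * A * B) := by ring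
      _ = ((((-1 : ℝ) ^ ζ₂) ^ 2) * (sg s₂ ^ ζ₂) ^ 2) * (al q n i * (-1) ^ π * (-1) ^ (ξ + i) *
          sg (s₁ * s₂) ^ (ξ + i) * sg (s₁ * s₂ * s₃) ^ π * (q ^ (ξ + i) / q ^ π) * A * B) := by
          rw [t3, t4]
      _ = _ := by field_simp
  have hR : ∀ n υ, sumR q n s₁ s₂ s₃ π υ ζ₁ ζ₂ ζ₃ =
      c * sumR q n s₃ (s₁ * s₂ * s₃) s₁ ζ₂ υ ζ₃ π ζ₁ := by
    intro n υ
    unfold sumR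
    rw [← tsum_mul_left]
    refine tsum_congr fun i => ?_
    have e1 := amp_cycle h0 h1 (s₁ * s₂ * s₃) s₁ (υ + i) π ζ₁
    have e2 := amp_cycle h0 h1 s₂ s₃ (υ + i) ζ₂ ζ₃
    rw [a3] at e1 ⊢
    rw [e1, e2]
    generalize amp q s₁ (s₂ * s₃) π ζ₁ (υ + i) = A
    generalize amp q s₃ (s₂ * s₃) ζ₂ ζ₃ (υ + i) = B
    have t1 := hm π
    have t2 := sg_zpow_sq h0 h1 (s₁ * s₂ * s₃) π
    rw [zpow_add₀ (by norm_num), zpow_add₀ (by norm_num) (υ + i), hc]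
    have := hq π
    have := hq ζ₂
    have := hq (υ + i)
    calc _ = (1 * 1) * (al q n i * (-1) ^ (υ + i) * (-1) ^ ζ₂ * sg s₂ ^ ζ₂ * sg (s₂ * s₃) ^ (υ + i) *
          (q ^ ζ₂ / q ^ (υ + i)) * A * B) := by ring
      _ = ((((-1 : ℝ) ^ π) ^ 2) * (sg (s₁ * s₂ * s₃) ^ π) ^ 2) * (al q n i * (-1) ^ (υ + i) *
          (-1) ^ ζ₂ * sg s₂ ^ ζ₂ * sg (s₂ * s₃) ^ (υ + i) * (q ^ ζ₂ / q ^ (υ + i)) * A * B) := by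
          rw [t1, t2]
      _ = _ := by field_simp
  rw [hL, hR, h]

/-- The bilinear identity is symmetric under exchanging `x` with `y` and `z₁` with `z₃`. -/
theorem BilinAt.reverse {s₁ s₂ s₃ : ℤˣ} {π ξ ζ₁ ζ₂ ζ₃ : ℤ}
    (h : BilinAt q s₃ s₂ s₁ π (π + ζ₂ - ξ) ζ₃ ζ₂ ζ₁) : BilinAt q s₁ s₂ s₃ π ξ ζ₁ ζ₂ ζ₃ := by
  unfold BilinAt at *
  rw [show 1 + π + ζ₂ - ζ₃ - ζ₁ = 1 + π + ζ₂ - ζ₁ - ζ₃ by ring,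
    show π + ζ₂ - (π + ζ₂ - ξ) = ξ by ring] at h
  set c : ℝ := sg (s₁ * s₂ * s₃) ^ π * sg s₁ ^ ζ₁ * sg s₂ ^ ζ₂ * sg s₃ ^ ζ₃ with hc
  have hL : ∀ n, sumL q n s₁ s₂ s₃ π ξ ζ₁ ζ₂ ζ₃ = c * sumR q n s₃ s₂ s₁ π ξ ζ₃ ζ₂ ζ₁ := by
    intro n
    unfold sumL sumR
    rw [← tsum_mul_left]
    refine tsum_congr fun i => ?_
    rw [amp_swap_xy h0 h1 (s₁ * s₂) s₃, amp_swap_xy h0 h1 s₁ s₂, mul_comm s₂ s₁, hc]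
    linear_combination (al q n i * sg (s₁ * s₂ * s₃) ^ π * sg s₁ ^ ζ₁ * sg s₂ ^ ζ₂ * sg s₃ ^ ζ₃ *
      amp q s₃ (s₁ * s₂) π ζ₃ (ξ + i) * amp q s₂ s₁ (ξ + i) ζ₂ ζ₁) *
      sg_zpow_sq h0 h1 (s₁ * s₂) (ξ + i)
  have hR : ∀ n υ, sumR q n s₁ s₂ s₃ π υ ζ₁ ζ₂ ζ₃ = c * sumL q n s₃ s₂ s₁ π υ ζ₃ ζ₂ ζ₁ := by
    intro n υ
    unfold sumL sumR
    rw [← tsum_mul_left]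
    refine tsum_congr fun i => ?_
    rw [amp_swap_xy h0 h1 s₁ (s₂ * s₃), amp_swap_xy h0 h1 s₂ s₃, mul_comm s₃ s₂, ← mul_assoc s₁, hc]
    linear_combination (al q n i * sg (s₁ * s₂ * s₃) ^ π * sg s₁ ^ ζ₁ * sg s₂ ^ ζ₂ * sg s₃ ^ ζ₃ *
      amp q (s₂ * s₃) s₁ π (υ + i) ζ₁ * amp q s₃ s₂ (υ + i) ζ₃ ζ₂) *
      sg_zpow_sq h0 h1 (s₂ * s₃) (υ + i)
  rw [hL, hR, h]

/-- The base case: for `p = z₂ = -q` and `z₁, z₃ > 0`, all amplitudes are explicit. -/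
theorem bilinAt_base (ξ ζ₁ ζ₃ : ℤ) : BilinAt q 1 (-1) 1 1 ξ ζ₁ 1 ζ₃ := by
  unfold BilinAt sumL sumR
  have hq := h0.ne'
  set C : ℝ := cq q ^ 2 * (wt q (-1) 1 * wt q 1 ζ₁) * (wt q (-1) 1 * wt q 1 ζ₃) * q with hC
  have tL : ∀ k, amp q (1 * -1) 1 1 k ζ₃ * amp q 1 (-1) k ζ₁ 1 =
      C * (q ^ ζ₃ * nuZ q (1 + ζ₃ - k) * nuZ q (1 + k - ζ₁) * wt q (-1) k ^ 2) := by
    intro k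
    have e1 := amp_one h0 h1 (-1) k ζ₃
    have e2 := amp_swap_py h0 h1 1 (-1) k ζ₁ 1
    have e3 := amp_one h0 h1 1 ζ₁ k
    have hm : ((-1 : ℝ) ^ k) ^ 2 = 1 := sg_neg_one ▸ sg_zpow_sq h0 h1 (-1) k
    have hk : q ^ k ≠ 0 := by positivity
    rw [one_mul] at e2 ⊢
    rw [neg_neg] at e1
    rw [e1, e2, e3, hC, zpow_add_one₀ (by norm_num)]
    simp only [pairSign, sg_one, sg_neg_one, one_zpow]
    norm_num
    field_simp
    linear_combination (cq q ^ 2 * nuZ q (1 + ζ₃ - k) * wt q (-1) 1 ^ 2 * wt q (-1) k ^ 2 *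
      wt q 1 ζ₃ * nuZ q (1 + k - ζ₁) * wt q 1 ζ₁) * hm
  have tR : ∀ k, amp q 1 (-1 * 1) 1 ζ₁ k * amp q (-1) 1 k 1 ζ₃ =
      C * (q ^ k * nuZ q (1 + k - ζ₁) * nuZ q (1 + k - ζ₃) * wt q (-1) k ^ 2) := by
    intro k
    have e1 := amp_one h0 h1 1 ζ₁ k
    have e0 := amp_swap_xy h0 h1 (-1) 1 k 1 ζ₃
    have e2 := amp_swap_py h0 h1 1 (-1) k ζ₃ 1
    have e3 := amp_one h0 h1 1 ζ₃ k
    have hm : ((-1 : ℝ) ^ k) ^ 2 = 1 := sg_neg_one ▸ sg_zpow_sq h0 h1 (-1) k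
    have hk : q ^ k ≠ 0 := by positivity
    rw [one_mul] at e2
    rw [mul_one] at e0 ⊢
    rw [e0, e1, e2, e3, hC, zpow_add_one₀ (by norm_num)]
    simp only [pairSign, sg_one, sg_neg_one, one_zpow]
    norm_num
    field_simp
    linear_combination (cq q ^ 2 * nuZ q (1 + k - ζ₁) * wt q (-1) 1 ^ 2 * wt q 1 ζ₁ *
      wt q (-1) k ^ 2 * nuZ q (1 + k - ζ₃) * wt q 1 ζ₃) * hm
  simp only [tL, tR]
  rw [← (Equiv.addRight (1 - ξ)).tsum_eq]
  refine tsum_congr fun i => ?_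
  simp only [Equiv.coe_addRight, al]
  rw [show ξ + (i + (1 - ξ)) = i + 1 by ring, show i + (1 - ξ) + 1 = 1 + 1 - ξ + i by ring]
  have hexp : q ^ ((1 + 1 + 1 - ζ₁ - ζ₃) * (i + (1 - ξ)) + (i + (1 - ξ)) * (i + (1 - ξ) - 1)) *
      (q ^ ζ₃ * nuZ q (1 + ζ₃ - (i + 1)) * nuZ q (1 + (i + 1) - ζ₁)) =
      q ^ ((1 + 1 + 1 - ζ₁ - ζ₃) * i + i * (i - 1)) * (q ^ (1 + 1 - ξ + i) *
        nuZ q (1 + (1 + 1 - ξ + i) - ζ₁) * nuZ q (1 + (1 + 1 - ξ + i) - ζ₃)) := by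
    have ev : ∀ k : ℤ, (2 : ℤ) ∣ (k - 1) * (k - 2) := fun k => by
      rw [show (k - 1) * (k - 2) = (k - 2) * (k - 2 + 1) by ring]
      exact (Int.even_mul_succ_self _).two_dvd
    unfold nuZ
    obtain ⟨a, ha⟩ := ev (1 + ζ₃ - (i + 1))
    obtain ⟨b, hb⟩ := ev (1 + (i + 1) - ζ₁)
    obtain ⟨c, hc⟩ := ev (1 + (1 + 1 - ξ + i) - ζ₁)
    obtain ⟨d, hd⟩ := ev (1 + (1 + 1 - ξ + i) - ζ₃)
    rw [ha, hb, hc, hd]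
    simp only [Int.mul_ediv_cancel_left _ (two_ne_zero' ℤ), ← zpow_add₀ hq]
    congr 1
    linarith
  linear_combination (C * wt q (-1) (1 + 1 - ξ + i) ^ 2 * wt q (-1) (i + 1) ^ 2) * hexp

end

end QSU11

namespace QSU11

/-! ### Analytic continuation of the bilinear identity -/

/-- On `U`, the functions `f i` are at most of the order `X^i q^{k i(i-1)/2}`. -/
def GaussBd (q : ℝ) (k : ℤ) (U : Set ℂ) (f : ℕ → ℂ → ℂ) : Prop :=
  ∃ C X : ℝ, 0 ≤ C ∧ 0 ≤ X ∧ ∀ i, ∀ T ∈ U, ‖f i T‖ ≤ C * X ^ i * (q ^ i.choose 2) ^ k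

/-- The amplitude `a_p(x, y)` for `x = σ q^ξ`, `y = τ q^η` and `p = σ τ q^π`, without its
square roots, and with `κ(x)` and `κ(p)` both multiplied by `T`, up to the sign of the prefactor
(which is that for `T = 1`). -/
def ampCore (q : ℝ) (σ τ : ℤˣ) (π ξ η : ℤ) (T : ℂ) : ℂ :=
  ((cq q * pairSign σ τ * (-1) ^ π * (-sg τ) ^ ξ * q ^ η * nuZ q (π + η - ξ) : ℝ) : ℂ) *
    bigR ((q ^ 2 : ℝ) : ℂ) (T * ((sg σ * sg τ * (q * q ^ ξ / q ^ η) ^ 2 : ℝ) : ℂ))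
      ((sg τ * (q * q ^ ξ / q ^ π) ^ 2 : ℝ) : ℂ)
      ((-(q ^ 2 * q ^ ξ / (q ^ π * q ^ η)) ^ 2 : ℝ) : ℂ)

section

set_option linter.unusedSectionVars false

variable {q : ℝ} (h0 : 0 < q) (h1 : q < 1)
include h0 h1

theorem GaussBd.mul {k l : ℤ} {U : Set ℂ} {f g : ℕ → ℂ → ℂ} (hf : GaussBd q k U f)
    (hg : GaussBd q l U g) : GaussBd q (k + l) U fun i T => f i T * g i T := by
  obtain ⟨C, X, hC, hX, h⟩ := hf
  obtain ⟨C', X', hC', hX', h'⟩ := hg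
  refine ⟨C * C', X * X', by positivity, by positivity, fun i T hT => ?_⟩
  rw [norm_mul, zpow_add₀ (by positivity), mul_pow]
  calc _ ≤ _ := mul_le_mul (h i T hT) (h' i T hT) (norm_nonneg _) (by positivity)
    _ = _ := by ring

theorem GaussBd.mono {k l : ℤ} {U : Set ℂ} {f : ℕ → ℂ → ℂ} (hf : GaussBd q k U f) (hl : l ≤ k) :
    GaussBd q l U f := by
  obtain ⟨C, X, hC, hX, h⟩ := hf
  refine ⟨C, X, hC, hX, fun i T hT => (h i T hT).trans ?_⟩
  refine mul_le_mul_of_nonneg_left ?_ (by positivity)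
  exact zpow_le_zpow_right_of_le_one₀ (by positivity) (pow_le_one₀ h0.le h1.le) hl

theorem GaussBd.differentiableOn_tsum {U : Set ℂ} {f : ℕ → ℂ → ℂ} (hf : GaussBd q 1 U f)
    (hd : ∀ i, DifferentiableOn ℂ (f i) U) (hU : IsOpen U) :
    DifferentiableOn ℂ (fun T => ∑' i, f i T) U := by
  obtain ⟨C, X, hC, hX, h⟩ := hf
  refine Complex.differentiableOn_tsum_of_summable_norm
    ((summable_thetaBound h0.le h1 X).mul_left C) hd hU fun i T hT => (h i T hT).trans ?_
  rw [zpow_one]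
  exact le_of_eq (by ring)

theorem gaussBd_al (n : ℤ) (U : Set ℂ) : GaussBd q 2 U fun i _ => ((al q n i : ℝ) : ℂ) := by
  obtain ⟨C, hC0, hC⟩ := exists_wt_bound h0 h1 (-1) 1
  refine ⟨C ^ 2, q ^ n, by positivity, by positivity, fun i T _ => ?_⟩
  rw [Complex.norm_real, al_natCast h0 h1, Real.norm_of_nonneg (by positivity),
    show (2 : ℤ) = ((2 : ℕ) : ℤ) from rfl, zpow_natCast, ← pow_mul, ← pow_mul, mul_comm 2]
  have : 0 ≤ wt q (-1) (i + 1) := Real.sqrt_nonneg _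
  have h3 := hC i
  calc _ ≤ q ^ (i.choose 2 * 2) * (q ^ n) ^ i * C ^ 2 := by gcongr
    _ = _ := by ring

theorem gaussBd_of_bound {f : ℕ → ℝ} {C : ℝ} (hf : ∀ i, |f i| ≤ C) (U : Set ℂ) :
    GaussBd q 0 U fun i _ => ((f i : ℝ) : ℂ) :=
  ⟨C, 1, (abs_nonneg _).trans (hf 0), zero_le_one, fun i T _ => by
    rw [Complex.norm_real, one_pow, zpow_zero, mul_one, mul_one]; exact hf i⟩

theorem nuZ_add_natCast (k : ℤ) (i : ℕ) :
    nuZ q (k + i) = nuZ q k * (q ^ (k - 1)) ^ i * q ^ i.choose 2 := by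
  induction i with
  | zero => simp
  | succ i ih =>
    have := nuZ_succ h0 (k + i)
    rw [Nat.cast_succ, ← add_assoc]
    refine mul_right_cancel₀ h0.ne' ?_
    rw [this, ih, choose_two_succ, pow_succ, pow_add, zpow_add₀ h0.ne', zpow_natCast,
      zpow_sub_one₀ h0.ne']
    field_simp

theorem nuZ_sub_natCast (k : ℤ) (i : ℕ) :
    nuZ q (k - i) = nuZ q k * (q ^ (2 - k)) ^ i * q ^ i.choose 2 := by
  induction i with
  | zero => simp
  | succ i ih =>
    have := nuZ_pred h0 (k - i)
    rw [Nat.cast_succ, ← sub_sub]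
    have hk : q ^ (k - i) ≠ 0 := by positivity
    refine mul_left_cancel₀ hk ?_
    have e : q ^ (k - i) * q ^ (2 - k) * q ^ i = q ^ 2 := by
      rw [← zpow_natCast q i, ← zpow_add₀ h0.ne', ← zpow_add₀ h0.ne', ← zpow_natCast q 2]
      congr 1
      push_cast
      ring
    rw [← this, ih, choose_two_succ, pow_succ (q ^ (2 - k)), pow_add]
    linear_combination (-(nuZ q k * (q ^ (2 - k)) ^ i * q ^ i.choose 2)) * e

/-- The symmetry of the series in its first two arguments gives two bounds. Each is useful in a
different range of the exponents. -/
theorem norm_ampCore_le (σ τ : ℤˣ) (π ξ η : ℤ) {T : ℂ} {r : ℝ} (hT : ‖T‖ ≤ r) :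
    ‖ampCore q σ τ π ξ η T‖ ≤ cq q * q ^ η * nuZ q (π + η - ξ) *
      (thetaBound (q ^ 2) ((1 - q ^ 2)⁻¹ * (r * (q * q ^ ξ / q ^ η) ^ 2)) *
        thetaBound (q ^ 2) ((1 - q ^ 2)⁻¹ *
          ((q * q ^ ξ / q ^ π) ^ 2 + (q ^ 2 * q ^ ξ / (q ^ π * q ^ η)) ^ 2))) ∧
    ‖ampCore q σ τ π ξ η T‖ ≤ cq q * q ^ η * nuZ q (π + η - ξ) *
      (thetaBound (q ^ 2) ((1 - q ^ 2)⁻¹ * (q * q ^ ξ / q ^ π) ^ 2) *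
        thetaBound (q ^ 2) ((1 - q ^ 2)⁻¹ *
          (r * (q * q ^ ξ / q ^ η) ^ 2 + (q ^ 2 * q ^ ξ / (q ^ π * q ^ η)) ^ 2))) := by
  have hQ : ‖((q ^ 2 : ℝ) : ℂ)‖ < 1 := by rw [Complex.norm_real]; exact norm_sq_lt_one h0 h1
  have hQ2 : ‖((q ^ 2 : ℝ) : ℂ)‖ = q ^ 2 := by
    rw [Complex.norm_real, Real.norm_of_nonneg (by positivity)]
  have hq2 : q ^ 2 < 1 := by nlinarith
  have hinv : 0 ≤ (1 - q ^ 2)⁻¹ := inv_nonneg.2 (by linarith)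
  have hsg : ∀ s : ℤˣ, |sg s| = 1 := fun s => by simpa using abs_sg_zpow h0 h1 s 1
  have hr : 0 ≤ r := (norm_nonneg T).trans hT
  have hpre : ‖((cq q * pairSign σ τ * (-1) ^ π * (-sg τ) ^ ξ * q ^ η * nuZ q (π + η - ξ) : ℝ) : ℂ)‖
      = cq q * q ^ η * nuZ q (π + η - ξ) := by
    have hp : |pairSign σ τ| = 1 := by
      unfold pairSign
      split_ifs <;> simp
    have hn : 0 < nuZ q (π + η - ξ) := by unfold nuZ; positivity
    rw [Complex.norm_real, Real.norm_eq_abs]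
    simp only [abs_mul, hp, abs_zpow, abs_neg, abs_one, hsg, one_zpow, mul_one,
      abs_of_pos (cq_pos h0 h1), abs_of_pos hn, abs_of_pos h0]
  have hz : ‖((sg τ * (q * q ^ ξ / q ^ π) ^ 2 : ℝ) : ℂ)‖ = (q * q ^ ξ / q ^ π) ^ 2 := by
    rw [Complex.norm_real, Real.norm_eq_abs, abs_mul, hsg, one_mul, abs_of_nonneg (sq_nonneg _)]
  have he : ‖((-(q ^ 2 * q ^ ξ / (q ^ π * q ^ η)) ^ 2 : ℝ) : ℂ)‖ =
      (q ^ 2 * q ^ ξ / (q ^ π * q ^ η)) ^ 2 := by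
    rw [Complex.norm_real, Real.norm_eq_abs, abs_neg, abs_of_nonneg (sq_nonneg _)]
  have hb : ‖T * ((sg σ * sg τ * (q * q ^ ξ / q ^ η) ^ 2 : ℝ) : ℂ)‖ ≤
      r * (q * q ^ ξ / q ^ η) ^ 2 := by
    rw [norm_mul, Complex.norm_real, Real.norm_eq_abs, abs_mul, abs_mul, hsg, hsg, one_mul, one_mul,
      abs_of_nonneg (sq_nonneg _)]
    gcongr
  have hcn : 0 ≤ cq q * q ^ η * nuZ q (π + η - ξ) := hpre ▸ norm_nonneg _
  constructor
  · rw [ampCore, norm_mul, hpre]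
    refine mul_le_mul_of_nonneg_left ((norm_bigR_le hQ _ _ _).trans ?_) hcn
    rw [hQ2, hz, he]
    refine mul_le_mul_of_nonneg_right (thetaBound_mono (by positivity) hq2 (by positivity) ?_)
      (thetaBound_nonneg (by positivity) (by positivity))
    gcongr
  · rw [ampCore, norm_mul, hpre, bigR_comm hQ]
    refine mul_le_mul_of_nonneg_left ((norm_bigR_le hQ _ _ _).trans ?_) hcn
    rw [hQ2, hz, he]
    refine mul_le_mul_of_nonneg_left (thetaBound_mono (by positivity) hq2 (by positivity) ?_)
      (thetaBound_nonneg (by positivity) (by positivity))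
    gcongr

theorem gaussBd_ampCore_x (σ τ : ℤˣ) (π ξ η : ℤ) (r : ℝ) (hr : 0 ≤ r) :
    GaussBd q 1 (Metric.ball 0 r) fun i => ampCore q σ τ π (ξ + i) η := by
  have hq2 : q ^ 2 < 1 := by nlinarith
  have hinv : 0 ≤ (1 - q ^ 2)⁻¹ := inv_nonneg.2 (by linarith)
  have hcq := cq_pos h0 h1
  have hnu : ∀ k, 0 < nuZ q k := fun k => by unfold nuZ; positivity
  have ht1 := thetaBound_nonneg (r := q ^ 2) (by positivity)
    (show 0 ≤ (1 - q ^ 2)⁻¹ * (r * (q * q ^ ξ / q ^ η) ^ 2) by positivity)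
  have ht2 := thetaBound_nonneg (r := q ^ 2) (by positivity) (show 0 ≤ (1 - q ^ 2)⁻¹ *
          ((q * q ^ ξ / q ^ π) ^ 2 + (q ^ 2 * q ^ ξ / (q ^ π * q ^ η)) ^ 2) by positivity)
  refine ⟨cq q * q ^ η * nuZ q (π + η - ξ) *
      (thetaBound (q ^ 2) ((1 - q ^ 2)⁻¹ * (r * (q * q ^ ξ / q ^ η) ^ 2)) *
        thetaBound (q ^ 2) ((1 - q ^ 2)⁻¹ *
          ((q * q ^ ξ / q ^ π) ^ 2 + (q ^ 2 * q ^ ξ / (q ^ π * q ^ η)) ^ 2))),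
    q ^ (2 - (π + η - ξ)), by have := hnu (π + η - ξ); positivity, by positivity,
    fun i T hT => ?_⟩
  have hT' : ‖T‖ ≤ r := by
    have := Metric.mem_ball.1 hT
    rw [dist_zero_right] at this
    exact this.le
  refine (norm_ampCore_le h0 h1 σ τ π (ξ + i) η hT').1.trans ?_
  rw [← sub_sub (π + η) ξ, nuZ_sub_natCast h0 h1, zpow_one]
  have hi : q ^ (ξ + i) ≤ q ^ ξ := by
    rw [zpow_add₀ h0.ne', zpow_natCast]
    exact mul_le_of_le_one_right (by positivity) (pow_le_one₀ h0.le h1.le)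
  have hn := hnu (π + η - ξ)
  calc _ ≤ cq q * q ^ η * (nuZ q (π + η - ξ) * (q ^ (2 - (π + η - ξ))) ^ i * q ^ i.choose 2) *
      (thetaBound (q ^ 2) ((1 - q ^ 2)⁻¹ * (r * (q * q ^ ξ / q ^ η) ^ 2)) *
        thetaBound (q ^ 2) ((1 - q ^ 2)⁻¹ *
          ((q * q ^ ξ / q ^ π) ^ 2 + (q ^ 2 * q ^ ξ / (q ^ π * q ^ η)) ^ 2))) := by
        refine mul_le_mul_of_nonneg_left (mul_le_mul ?_ ?_ ?_ ht1) (by positivity)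
        · refine thetaBound_mono (by positivity) hq2 (by positivity) ?_
          gcongr
        · refine thetaBound_mono (by positivity) hq2 (by positivity) ?_
          gcongr
        · exact thetaBound_nonneg (by positivity) (by positivity)
    _ = _ := by ring

theorem thetaBound_dilate {x : ℝ} (hx : 0 ≤ x) (i : ℕ) :
    thetaBound (q ^ 2) (x / (q ^ i) ^ 2) * q ^ i.choose 2 ≤
      thetaBound (q ^ 2) x * ((1 + x) / q ^ 2) ^ i * (q ^ i.choose 2) ^ (-1 : ℤ) := by
  have hq2 : q ^ 2 < 1 := by nlinarith
  have h := thetaBound_div_pow_le (r := q ^ 2) (by positivity) hq2 hx i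
  rw [← pow_mul, mul_comm i, pow_mul]
  calc _ ≤ (1 + x) ^ i * ((q ^ 2)⁻¹) ^ (i + 1).choose 2 * thetaBound (q ^ 2) x * q ^ i.choose 2 := by
        gcongr
    _ = _ := by
      rw [choose_two_succ, zpow_neg_one, pow_add, div_pow, inv_pow, inv_pow, ← pow_mul q 2,
        mul_comm 2, pow_mul q]
      field_simp

theorem gaussBd_ampCore_p (σ τ : ℤˣ) (π ξ η : ℤ) (r : ℝ) (hr : 0 ≤ r) :
    GaussBd q (-1) (Metric.ball 0 r) fun i => ampCore q σ τ (π + i) ξ η := by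
  have hq2 : q ^ 2 < 1 := by nlinarith
  have hinv : 0 ≤ (1 - q ^ 2)⁻¹ := inv_nonneg.2 (by linarith)
  have hcq := cq_pos h0 h1
  have hnu : ∀ k, 0 < nuZ q k := fun k => by unfold nuZ; positivity
  set t1 := (1 - q ^ 2)⁻¹ * (r * (q * q ^ ξ / q ^ η) ^ 2)
  set t2 := (1 - q ^ 2)⁻¹ * ((q * q ^ ξ / q ^ π) ^ 2 + (q ^ 2 * q ^ ξ / (q ^ π * q ^ η)) ^ 2)
    with ht2d
  have ht1 := thetaBound_nonneg (r := q ^ 2) (by positivity) (show 0 ≤ t1 by positivity)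
  have ht2 := thetaBound_nonneg (r := q ^ 2) (by positivity) (show 0 ≤ t2 by positivity)
  have hn := hnu (π + η - ξ)
  refine ⟨cq q * q ^ η * nuZ q (π + η - ξ) * (thetaBound (q ^ 2) t1 * thetaBound (q ^ 2) t2),
    q ^ (π + η - ξ - 1) * ((1 + t2) / q ^ 2), by positivity, by positivity, fun i T hT => ?_⟩
  have hT' : ‖T‖ ≤ r := by
    have := Metric.mem_ball.1 hT
    rw [dist_zero_right] at this
    exact this.le
  refine (norm_ampCore_le h0 h1 σ τ (π + i) ξ η hT').1.trans ?_
  rw [show π + i + η - ξ = π + η - ξ + i by ring, nuZ_add_natCast h0 h1]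
  have h3 := thetaBound_dilate h0 h1 (show 0 ≤ t2 by positivity) i
  have e : (1 - q ^ 2)⁻¹ * ((q * q ^ ξ / q ^ (π + (i : ℤ))) ^ 2 +
      (q ^ 2 * q ^ ξ / (q ^ (π + (i : ℤ)) * q ^ η)) ^ 2) = t2 / (q ^ i) ^ 2 := by
    rw [ht2d, zpow_add₀ h0.ne', zpow_natCast]
    field_simp
  rw [e]
  calc _ = cq q * q ^ η * nuZ q (π + η - ξ) * (q ^ (π + η - ξ - 1)) ^ i * thetaBound (q ^ 2) t1 *
        (thetaBound (q ^ 2) (t2 / (q ^ i) ^ 2) * q ^ i.choose 2) := by ring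
    _ ≤ cq q * q ^ η * nuZ q (π + η - ξ) * (q ^ (π + η - ξ - 1)) ^ i * thetaBound (q ^ 2) t1 *
        (thetaBound (q ^ 2) t2 * ((1 + t2) / q ^ 2) ^ i * (q ^ i.choose 2) ^ (-1 : ℤ)) :=
        mul_le_mul_of_nonneg_left h3 (by positivity)
    _ = _ := by rw [mul_pow]; ring

theorem gaussBd_ampCore_y (σ τ : ℤˣ) (π ξ η : ℤ) (r : ℝ) (hr : 0 ≤ r) :
    GaussBd q (-1) (Metric.ball 0 r) fun i => ampCore q σ τ π ξ (η + i) := by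
  have hq2 : q ^ 2 < 1 := by nlinarith
  have hinv : 0 ≤ (1 - q ^ 2)⁻¹ := inv_nonneg.2 (by linarith)
  have hcq := cq_pos h0 h1
  have hnu : ∀ k, 0 < nuZ q k := fun k => by unfold nuZ; positivity
  set t1 := (1 - q ^ 2)⁻¹ * (q * q ^ ξ / q ^ π) ^ 2
  set t2 := (1 - q ^ 2)⁻¹ * (r * (q * q ^ ξ / q ^ η) ^ 2 + (q ^ 2 * q ^ ξ / (q ^ π * q ^ η)) ^ 2)
    with ht2d
  have ht1 := thetaBound_nonneg (r := q ^ 2) (by positivity) (show 0 ≤ t1 by positivity)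
  have ht2 := thetaBound_nonneg (r := q ^ 2) (by positivity) (show 0 ≤ t2 by positivity)
  have hn := hnu (π + η - ξ)
  refine ⟨cq q * q ^ η * nuZ q (π + η - ξ) * (thetaBound (q ^ 2) t1 * thetaBound (q ^ 2) t2),
    q * q ^ (π + η - ξ - 1) * ((1 + t2) / q ^ 2), by positivity, by positivity, fun i T hT => ?_⟩
  have hT' : ‖T‖ ≤ r := by
    have := Metric.mem_ball.1 hT
    rw [dist_zero_right] at this
    exact this.le
  refine (norm_ampCore_le h0 h1 σ τ π ξ (η + i) hT').2.trans ?_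
  rw [show π + (η + i) - ξ = π + η - ξ + i by ring, nuZ_add_natCast h0 h1]
  have h3 := thetaBound_dilate h0 h1 (show 0 ≤ t2 by positivity) i
  have e : (1 - q ^ 2)⁻¹ * (r * (q * q ^ ξ / q ^ (η + (i : ℤ))) ^ 2 +
      (q ^ 2 * q ^ ξ / (q ^ π * q ^ (η + (i : ℤ)))) ^ 2) = t2 / (q ^ i) ^ 2 := by
    rw [ht2d, zpow_add₀ h0.ne', zpow_natCast]
    field_simp
  rw [e, zpow_add₀ h0.ne', zpow_natCast]
  calc _ = cq q * q ^ η * nuZ q (π + η - ξ) * q ^ i * (q ^ (π + η - ξ - 1)) ^ i *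
        thetaBound (q ^ 2) t1 * (thetaBound (q ^ 2) (t2 / (q ^ i) ^ 2) * q ^ i.choose 2) := by ring
    _ ≤ cq q * q ^ η * nuZ q (π + η - ξ) * q ^ i * (q ^ (π + η - ξ - 1)) ^ i *
        thetaBound (q ^ 2) t1 *
        (thetaBound (q ^ 2) t2 * ((1 + t2) / q ^ 2) ^ i * (q ^ i.choose 2) ^ (-1 : ℤ)) :=
        mul_le_mul_of_nonneg_left h3 (by positivity)
    _ = _ := by rw [mul_pow, mul_pow]; ring

theorem differentiableOn_ampCore (σ τ : ℤˣ) (π ξ η : ℤ) {U : Set ℂ} (hU : IsOpen U) :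
    DifferentiableOn ℂ (ampCore q σ τ π ξ η) U := by
  have hQ : ‖((q ^ 2 : ℝ) : ℂ)‖ < 1 := by rw [Complex.norm_real]; exact norm_sq_lt_one h0 h1
  unfold ampCore
  refine (differentiableOn_const _).mul (differentiableOn_bigR hQ hU ?_ (differentiableOn_const _)
    (differentiableOn_const _))
  exact differentiableOn_id.mul_const _

theorem amp_eq_ampCore (σ τ : ℤˣ) (π ξ η : ℤ) : ((amp q σ τ π ξ η : ℝ) : ℂ) =
    ((wt q (σ * τ) π * wt q τ η / wt q σ ξ : ℝ) : ℂ) * ampCore q σ τ π ξ η 1 := by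
  rw [ampCore, one_mul, ← ofReal_bigR, ← Complex.ofReal_mul, ← Complex.ofReal_mul, amp, ampPref,
    ampR]
  congr 1
  ring

theorem amp_neg_eq_ampCore (σ τ : ℤˣ) (π ξ η : ℤ) (n : ℕ) :
    ((amp q (-σ) τ (π + n) (ξ + n) η : ℝ) : ℂ) =
      ((sg τ ^ (n + 1) * (wt q (-(σ * τ)) (π + n) * wt q τ η / wt q (-σ) (ξ + n)) : ℝ) : ℂ) *
        ampCore q σ τ π ξ η ((-(q ^ 2) ^ n : ℝ) : ℂ) := by
  rw [ampCore, ← Complex.ofReal_mul, ← ofReal_bigR, ← Complex.ofReal_mul, ← Complex.ofReal_mul, amp,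
    ampPref, ampR, neg_mul]
  have hps : pairSign (-σ) τ = sg τ * pairSign σ τ := by
    rcases Int.units_eq_one_or σ with rfl | rfl <;> rcases Int.units_eq_one_or τ with rfl | rfl <;>
      simp [pairSign]
  have hq := h0.ne'
  have hsg := sg_ne_zero τ
  have hR : bigR (q ^ 2) (sg (-σ) * sg τ * (q * q ^ (ξ + (n : ℤ)) / q ^ η) ^ 2)
      (sg τ * (q * q ^ (ξ + (n : ℤ)) / q ^ (π + (n : ℤ))) ^ 2)
      (-(q ^ 2 * q ^ (ξ + (n : ℤ)) / (q ^ (π + (n : ℤ)) * q ^ η)) ^ 2) =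
    bigR (q ^ 2) (-(q ^ 2) ^ n * (sg σ * sg τ * (q * q ^ ξ / q ^ η) ^ 2))
      (sg τ * (q * q ^ ξ / q ^ π) ^ 2) (-(q ^ 2 * q ^ ξ / (q ^ π * q ^ η)) ^ 2) := by
    simp only [zpow_add₀ hq, zpow_natCast, sg_neg]
    congr 1
    · ring
    · field_simp
    · field_simp
  rw [hR, hps, show π + n + η - (ξ + n) = π + η - ξ by ring, zpow_add₀ (by norm_num),
    zpow_add₀ (neg_ne_zero.2 hsg), zpow_natCast, zpow_natCast]
  have hs : (-1 : ℝ) ^ n * (-sg τ) ^ n = sg τ ^ n := by rw [← mul_pow]; simp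
  rw [pow_succ (sg τ), ← hs]
  congr 1
  ring

/-- The series on the left of the bilinear identity as an entire function of the scale of `p`, `x`
and `z₁`. -/
def entireL (q : ℝ) (n : ℤ) (s₁ s₂ s₃ : ℤˣ) (π ξ ζ₁ ζ₂ ζ₃ : ℤ) (T : ℂ) : ℂ :=
  ∑' i : ℕ, ((al q n i : ℝ) : ℂ) * (ampCore q (s₁ * s₂) s₃ π (ξ + i) ζ₃ T *
    ampCore q s₁ s₂ (ξ + i) ζ₁ ζ₂ T)

/-- The series on the right of the bilinear identity as an entire function of the scale of `p`,
`x` and `z₁`. -/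
def entireR (q : ℝ) (n : ℤ) (s₁ s₂ s₃ : ℤˣ) (π υ ζ₁ ζ₂ ζ₃ : ℤ) (T : ℂ) : ℂ :=
  ∑' i : ℕ, ((al q n i : ℝ) : ℂ) * (((wt q (s₂ * s₃) (υ + i) * amp q s₂ s₃ (υ + i) ζ₂ ζ₃ : ℝ) : ℂ) *
    ampCore q s₁ (s₂ * s₃) π ζ₁ (υ + i) T)

theorem differentiable_of_ball {f : ℂ → ℂ}
    (h : ∀ r : ℝ, 0 ≤ r → DifferentiableOn ℂ f (Metric.ball 0 r)) : Differentiable ℂ f :=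
  fun z => (h (‖z‖ + 1) (by positivity)).differentiableAt
    (Metric.isOpen_ball.mem_nhds (by simp))

theorem differentiable_entireL (n : ℤ) (s₁ s₂ s₃ : ℤˣ) (π ξ ζ₁ ζ₂ ζ₃ : ℤ) :
    Differentiable ℂ (entireL q n s₁ s₂ s₃ π ξ ζ₁ ζ₂ ζ₃) := by
  refine differentiable_of_ball h0 h1 fun r hr => ?_
  have hb := (gaussBd_al h0 h1 n (Metric.ball 0 r)).mul h0 h1
    ((gaussBd_ampCore_x h0 h1 (s₁ * s₂) s₃ π ξ ζ₃ r hr).mul h0 h1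
      (gaussBd_ampCore_p h0 h1 s₁ s₂ ξ ζ₁ ζ₂ r hr))
  refine (hb.mono h0 h1 (l := 1) (by norm_num)).differentiableOn_tsum h0 h1 (fun i => ?_)
    Metric.isOpen_ball
  exact (differentiableOn_const _).mul ((differentiableOn_ampCore h0 h1 _ _ _ _ _
    Metric.isOpen_ball).mul (differentiableOn_ampCore h0 h1 _ _ _ _ _ Metric.isOpen_ball))

theorem differentiable_entireR (n : ℤ) (s₁ s₂ s₃ : ℤˣ) (π υ ζ₁ ζ₂ ζ₃ : ℤ) :
    Differentiable ℂ (entireR q n s₁ s₂ s₃ π υ ζ₁ ζ₂ ζ₃) := by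
  refine differentiable_of_ball h0 h1 fun r hr => ?_
  obtain ⟨C, hC0, hC⟩ := exists_wt_bound h0 h1 (s₂ * s₃) υ
  have hf : ∀ i : ℕ, |wt q (s₂ * s₃) (υ + i) * amp q s₂ s₃ (υ + i) ζ₂ ζ₃| ≤ C := fun i => by
    have hw : 0 ≤ wt q (s₂ * s₃) (υ + i) := Real.sqrt_nonneg _
    rw [abs_mul, abs_of_nonneg hw, add_comm υ]
    exact (mul_le_of_le_one_right (Real.sqrt_nonneg _) (abs_amp_le_one h0 h1 ..)).trans (hC i)
  have hb := (gaussBd_al h0 h1 n (Metric.ball 0 r)).mul h0 h1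
    ((gaussBd_of_bound h0 h1 hf _).mul h0 h1 (gaussBd_ampCore_y h0 h1 s₁ (s₂ * s₃) π ζ₁ υ r hr))
  refine (hb.mono h0 h1 (l := 1) (by norm_num)).differentiableOn_tsum h0 h1 (fun i => ?_)
    Metric.isOpen_ball
  exact (differentiableOn_const _).mul ((differentiableOn_const _).mul
    (differentiableOn_ampCore h0 h1 _ _ _ _ _ Metric.isOpen_ball))

theorem sumL_eq_entireL (n : ℤ) {s₁ s₂ s₃ : ℤˣ} {π ξ ζ₁ ζ₂ ζ₃ : ℤ}
    (h : InI (s₁ * s₂ * s₃) π ∧ InI s₁ ζ₁ ∧ InI s₂ ζ₂ ∧ InI s₃ ζ₃) :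
    ((sumL q n s₁ s₂ s₃ π ξ ζ₁ ζ₂ ζ₃ : ℝ) : ℂ) =
      ((wt q (s₁ * s₂ * s₃) π / wt q s₁ ζ₁ : ℝ) : ℂ) *
        (((wt q s₂ ζ₂ * wt q s₃ ζ₃ : ℝ) : ℂ) * entireL q n s₁ s₂ s₃ π ξ ζ₁ ζ₂ ζ₃ 1) := by
  rw [sumL, tsum_al h0 h1, Complex.ofReal_tsum, entireL, ← tsum_mul_left, ← tsum_mul_left]
  refine tsum_congr fun i => ?_
  rw [Complex.ofReal_mul, Complex.ofReal_mul]
  by_cases hx : InI (s₁ * s₂) (ξ + i)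
  · have hw := wt_pos h0 h1 hx
    rw [amp_eq_ampCore h0 h1, amp_eq_ampCore h0 h1]
    have e : (((wt q (s₁ * s₂ * s₃) π * wt q s₃ ζ₃ / wt q (s₁ * s₂) (ξ + i) : ℝ) : ℂ) *
        ((wt q (s₁ * s₂) (ξ + i) * wt q s₂ ζ₂ / wt q s₁ ζ₁ : ℝ) : ℂ)) =
        ((wt q (s₁ * s₂ * s₃) π / wt q s₁ ζ₁ : ℝ) : ℂ) * ((wt q s₂ ζ₂ * wt q s₃ ζ₃ : ℝ) : ℂ) := by
      rw [← Complex.ofReal_mul, ← Complex.ofReal_mul]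
      congr 1
      field_simp
    linear_combination (((al q n i : ℝ) : ℂ) * ampCore q (s₁ * s₂) s₃ π (ξ + i) ζ₃ 1 *
      ampCore q s₁ s₂ (ξ + i) ζ₁ ζ₂ 1) * e
  · -- The factor `a_p(x, z₃)` vanishes by its definition, and its series vanishes as well.
    have hx1 : s₁ * s₂ = -1 := by
      rcases Int.units_eq_one_or (s₁ * s₂) with h2 | h2
      · exact absurd (Or.inl h2) hx
      · exact h2
    have hx2 : ξ + i ≤ 0 := by
      by_contra h2
      exact hx (Or.inr (by omega))
    have hR := ampR_eq_zero h0 h1 (τ := s₃) (π := π) (η := ζ₃) hx2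
      (by have := h.1; rwa [hx1, neg_one_mul] at this) h.2.2.2
    have hc : ampCore q (s₁ * s₂) s₃ π (ξ + i) ζ₃ 1 = 0 := by
      rw [ampR] at hR
      rw [ampCore, one_mul, ← ofReal_bigR, hx1, hR, Complex.ofReal_zero, mul_zero]
    rw [amp_eq_zero h0 h1 (σ := s₁ * s₂) (by tauto), hc]
    simp

theorem sumR_eq_entireR (n : ℤ) (s₁ s₂ s₃ : ℤˣ) (π υ ζ₁ ζ₂ ζ₃ : ℤ) :
    ((sumR q n s₁ s₂ s₃ π υ ζ₁ ζ₂ ζ₃ : ℝ) : ℂ) =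
      ((wt q (s₁ * s₂ * s₃) π / wt q s₁ ζ₁ : ℝ) : ℂ) * entireR q n s₁ s₂ s₃ π υ ζ₁ ζ₂ ζ₃ 1 := by
  rw [sumR, tsum_al h0 h1, Complex.ofReal_tsum, entireR, ← tsum_mul_left]
  refine tsum_congr fun i => ?_
  rw [Complex.ofReal_mul, Complex.ofReal_mul, amp_eq_ampCore h0 h1 s₁ (s₂ * s₃), ← mul_assoc s₁]
  push_cast
  ring

theorem sumL_neg_eq_entireL (n : ℤ) {s₁ s₂ s₃ : ℤˣ} {π ξ ζ₁ ζ₂ ζ₃ : ℤ} {k : ℕ} (hk : 1 ≤ ξ + k) :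
    ((sumL q n (-s₁) s₂ s₃ (π + k) (ξ + k) (ζ₁ + k) ζ₂ ζ₃ : ℝ) : ℂ) =
      ((sg (s₂ * s₃) ^ (k + 1) * (wt q (-(s₁ * s₂ * s₃)) (π + k) / wt q (-s₁) (ζ₁ + k)) : ℝ) : ℂ) *
        (((wt q s₂ ζ₂ * wt q s₃ ζ₃ : ℝ) : ℂ) *
          entireL q n s₁ s₂ s₃ π ξ ζ₁ ζ₂ ζ₃ ((-(q ^ 2) ^ k : ℝ) : ℂ)) := by
  rw [sumL, tsum_al h0 h1, Complex.ofReal_tsum, entireL, ← tsum_mul_left, ← tsum_mul_left]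
  refine tsum_congr fun i => ?_
  have hw := wt_pos h0 h1 (show InI (-(s₁ * s₂)) (ξ + i + k) from Or.inr (by omega))
  rw [Complex.ofReal_mul, Complex.ofReal_mul, neg_mul, show ξ + k + i = ξ + i + (k : ℤ) by ring,
    amp_neg_eq_ampCore h0 h1, amp_neg_eq_ampCore h0 h1]
  generalize ampCore q (s₁ * s₂) s₃ π (ξ + i) ζ₃ _ = A
  generalize ampCore q s₁ s₂ (ξ + i) ζ₁ ζ₂ _ = B
  have e : (((sg s₃ ^ (k + 1) * (wt q (-(s₁ * s₂ * s₃)) (π + k) * wt q s₃ ζ₃ /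
        wt q (-(s₁ * s₂)) (ξ + i + k)) : ℝ) : ℂ) *
      ((sg s₂ ^ (k + 1) * (wt q (-(s₁ * s₂)) (ξ + i + k) * wt q s₂ ζ₂ / wt q (-s₁) (ζ₁ + k)) : ℝ) :
        ℂ)) =
      ((sg (s₂ * s₃) ^ (k + 1) * (wt q (-(s₁ * s₂ * s₃)) (π + k) / wt q (-s₁) (ζ₁ + k)) : ℝ) : ℂ) *
        ((wt q s₂ ζ₂ * wt q s₃ ζ₃ : ℝ) : ℂ) := by
    rw [← Complex.ofReal_mul, ← Complex.ofReal_mul, sg_mul, mul_pow]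
    congr 1
    field_simp
  linear_combination (((al q n i : ℝ) : ℂ) * A * B) * e

theorem sumR_neg_eq_entireR (n : ℤ) (s₁ s₂ s₃ : ℤˣ) (π υ ζ₁ ζ₂ ζ₃ : ℤ) (k : ℕ) :
    ((sumR q n (-s₁) s₂ s₃ (π + k) υ (ζ₁ + k) ζ₂ ζ₃ : ℝ) : ℂ) =
      ((sg (s₂ * s₃) ^ (k + 1) * (wt q (-(s₁ * s₂ * s₃)) (π + k) / wt q (-s₁) (ζ₁ + k)) : ℝ) : ℂ) *
        entireR q n s₁ s₂ s₃ π υ ζ₁ ζ₂ ζ₃ ((-(q ^ 2) ^ k : ℝ) : ℂ) := by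
  rw [sumR, tsum_al h0 h1, Complex.ofReal_tsum, entireR, ← tsum_mul_left]
  refine tsum_congr fun i => ?_
  rw [Complex.ofReal_mul, Complex.ofReal_mul, amp_neg_eq_ampCore h0 h1, ← mul_assoc s₁]
  push_cast
  ring

/-- The sign of `p`, `x` and `z₁` can be flipped simultaneously: both sides of the identity extend
to entire functions of the common scale `T` of `κ(p)`, `κ(x)`, `κ(z₁)`, and the identity for the
flipped signs says that these functions agree at `T = -q^{2k}` for all large `k`. -/
theorem BilinAt.flip {s₁ s₂ s₃ : ℤˣ}
    (H : ∀ π ξ ζ₁ ζ₂ ζ₃, BilinAt q (-s₁) s₂ s₃ π ξ ζ₁ ζ₂ ζ₃) (π ξ ζ₁ ζ₂ ζ₃ : ℤ) :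
    BilinAt q s₁ s₂ s₃ π ξ ζ₁ ζ₂ ζ₃ := by
  by_cases h : InI (s₁ * s₂ * s₃) π ∧ InI s₁ ζ₁ ∧ InI s₂ ζ₂ ∧ InI s₃ ζ₃
  swap
  · exact bilinAt_of_not_mem h0 h1 h
  set n := 1 + π + ζ₂ - ζ₁ - ζ₃ with hn
  have hfun : (fun T => ((wt q s₂ ζ₂ * wt q s₃ ζ₃ : ℝ) : ℂ) * entireL q n s₁ s₂ s₃ π ξ ζ₁ ζ₂ ζ₃ T) =
      entireR q n s₁ s₂ s₃ π (π + ζ₂ - ξ) ζ₁ ζ₂ ζ₃ := by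
    refine AnalyticOnNhd.eq_of_frequently_eq (𝕜 := ℂ) (z₀ := 0)
      (Complex.analyticOnNhd_univ_iff_differentiable.2
        ((differentiable_entireL h0 h1 _ _ _ _ _ _ _ _ _).const_mul _))
      (Complex.analyticOnNhd_univ_iff_differentiable.2 (differentiable_entireR h0 h1 _ _ _ _ _ _ _ _ _)) ?_
    have ht : Tendsto (fun k : ℕ => ((-(q ^ 2) ^ k : ℝ) : ℂ)) atTop (𝓝[≠] 0) := by
      refine tendsto_nhdsWithin_iff.2 ⟨?_, Eventually.of_forall fun k => ?_⟩
      · rw [← Complex.ofReal_zero]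
        refine (Complex.continuous_ofReal.tendsto _).comp ?_
        simpa using (tendsto_pow_atTop_nhds_zero_of_norm_lt_one (norm_sq_lt_one h0 h1)).neg
      · rw [Set.mem_compl_singleton_iff, Complex.ofReal_ne_zero]
        have : 0 < (q ^ 2) ^ k := by positivity
        linarith
    refine ht.frequently (Eventually.frequently ?_)
    filter_upwards [eventually_ge_atTop (1 - ξ).toNat, eventually_ge_atTop (1 - π).toNat,
      eventually_ge_atTop (1 - ζ₁).toNat] with k hk1 hk2 hk3
    have hb := H (π + k) (ξ + k) (ζ₁ + k) ζ₂ ζ₃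
    rw [BilinAt, show 1 + (π + k) + ζ₂ - (ζ₁ + k) - ζ₃ = n by rw [hn]; ring,
      show π + k + ζ₂ - (ξ + k) = π + ζ₂ - ξ by ring] at hb
    have hb2 := congrArg (fun t : ℝ => (t : ℂ)) hb
    beta_reduce at hb2
    rw [sumL_neg_eq_entireL h0 h1 n (by omega), sumR_neg_eq_entireR h0 h1] at hb2
    refine mul_left_cancel₀ (Complex.ofReal_ne_zero.2 ?_) hb2
    have w1 := wt_pos h0 h1 (show InI (-(s₁ * s₂ * s₃)) (π + k) from Or.inr (by omega))
    have w2 := wt_pos h0 h1 (show InI (-s₁) (ζ₁ + k) from Or.inr (by omega))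
    have := sg_ne_zero (s₂ * s₃)
    positivity
  rw [BilinAt]
  apply Complex.ofReal_injective
  rw [← hn, sumL_eq_entireL h0 h1 n h, sumR_eq_entireR h0 h1, ← hfun]

/-- The recursion, solved for the term with `q z₂` in place of `z₂`. -/
theorem bilinAt_step {π ζ₂ : ℤ} (hζ : 1 ≤ ζ₂)
    (H1 : ∀ ξ ζ₁ ζ₃, BilinAt q 1 (-1) 1 (π - 1) ξ ζ₁ ζ₂ ζ₃)
    (H2 : ∀ ξ ζ₁ ζ₃, BilinAt q 1 (-1) 1 π ξ ζ₁ ζ₂ ζ₃)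
    (H3 : ∀ ξ ζ₁ ζ₃, BilinAt q 1 (-1) 1 π ξ ζ₁ (ζ₂ - 1) ζ₃) (ξ ζ₁ ζ₃ : ℤ) :
    BilinAt q 1 (-1) 1 π ξ ζ₁ (ζ₂ + 1) ζ₃ := by
  obtain ⟨ξ, rfl⟩ : ∃ k, ξ = k + 1 := ⟨ξ - 1, by ring⟩
  obtain ⟨ζ₁, rfl⟩ : ∃ k, ζ₁ = k + 1 := ⟨ζ₁ - 1, by ring⟩
  obtain ⟨ζ₃, rfl⟩ : ∃ k, ζ₃ = k + 1 := ⟨ζ₃ - 1, by ring⟩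
  have b1 := H1 ξ ζ₁ ζ₃
  have b2 := H2 (ξ + 1) ζ₁ (ζ₃ + 1)
  have b3 := H3 ξ ζ₁ ζ₃
  have b4 := H2 ξ (ζ₁ + 1) ζ₃
  unfold BilinAt at *
  rw [show 1 + (π - 1) + ζ₂ - ζ₁ - ζ₃ = π + ζ₂ - ζ₁ - ζ₃ by ring,
    show π - 1 + ζ₂ - ξ = π + ζ₂ - ξ - 1 by ring] at b1
  rw [show 1 + π + ζ₂ - ζ₁ - (ζ₃ + 1) = π + ζ₂ - ζ₁ - ζ₃ by ring,
    show π + ζ₂ - (ξ + 1) = π + ζ₂ - ξ - 1 by ring] at b2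
  rw [show 1 + π + (ζ₂ - 1) - ζ₁ - ζ₃ = π + ζ₂ - ζ₁ - ζ₃ by ring,
    show π + (ζ₂ - 1) - ξ = π + ζ₂ - ξ - 1 by ring] at b3
  rw [show 1 + π + ζ₂ - (ζ₁ + 1) - ζ₃ = π + ζ₂ - ζ₁ - ζ₃ by ring] at b4
  rw [show 1 + π + (ζ₂ + 1) - (ζ₁ + 1) - (ζ₃ + 1) = π + ζ₂ - ζ₁ - ζ₃ by ring,
    show π + (ζ₂ + 1) - (ξ + 1) = π + ζ₂ - ξ by ring]
  have rL := sumL_rec h0 h1 (π + ζ₂ - ζ₁ - ζ₃) 1 (-1) 1 π ξ ζ₁ ζ₂ ζ₃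
  have rR := sumR_rec h0 h1 (π + ζ₂ - ζ₁ - ζ₃) 1 (-1) 1 π (π + ζ₂ - ξ - 1) ζ₁ ζ₂ ζ₃
  rw [sub_add_cancel] at rR
  rw [b1, b2, b3, b4, rR] at rL
  have hπ : q ^ π ≠ 0 := by positivity
  have h2 := mul_left_cancel₀ hπ rL
  have hc : sq q 1 ζ₁ * sq q (-1) ζ₂ * sq q 1 ζ₃ ≠ 0 :=
    (mul_pos (mul_pos (sq_pos h0 h1 (Or.inl rfl)) (sq_pos h0 h1 (Or.inr hζ)))
      (sq_pos h0 h1 (Or.inl rfl))).ne'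
  refine mul_left_cancel₀ hc ?_
  linarith

/-- Induction on the exponent of `z₂`, at a fixed `p`. -/
theorem bilinAt_column {π : ℤ} (H1 : ∀ ξ ζ₁ ζ₂ ζ₃, BilinAt q 1 (-1) 1 (π - 1) ξ ζ₁ ζ₂ ζ₃)
    (H2 : ∀ ξ ζ₁ ζ₃, BilinAt q 1 (-1) 1 π ξ ζ₁ 1 ζ₃) (ξ ζ₁ ζ₂ ζ₃ : ℤ) :
    BilinAt q 1 (-1) 1 π ξ ζ₁ ζ₂ ζ₃ := by
  have hneg : ∀ ζ₂ ≤ 0, ∀ ξ ζ₁ ζ₃, BilinAt q 1 (-1) 1 π ξ ζ₁ ζ₂ ζ₃ := fun ζ₂ h ξ ζ₁ ζ₃ =>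
    bilinAt_of_not_mem h0 h1 fun h2 => by
      have := h2.2.2.1.resolve_left (by decide)
      omega
  have key : ∀ k : ℕ, (∀ ξ ζ₁ ζ₃, BilinAt q 1 (-1) 1 π ξ ζ₁ k ζ₃) ∧
      ∀ ξ ζ₁ ζ₃, BilinAt q 1 (-1) 1 π ξ ζ₁ (k + 1 : ℤ) ζ₃ := by
    intro k
    induction k with
    | zero => exact ⟨fun ξ ζ₁ ζ₃ => hneg _ (by simp) .., by simpa using H2⟩
    | succ k ih =>
      refine ⟨by simpa using ih.2, ?_⟩
      refine bilinAt_step h0 h1 (by omega) (fun ξ ζ₁ ζ₃ => H1 ..) ?_ ?_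
      · simpa using ih.2
      · simpa using ih.1
  rcases le_or_gt ζ₂ 0 with h | h
  · exact hneg _ h ..
  · obtain ⟨k, rfl⟩ := Int.eq_ofNat_of_zero_le h.le
    exact (key k).1 ..

/-- Induction on the exponent of `p`. The start `z₂ = -q` of each column is the case `p = -q`, since
the identity is symmetric in `p` and `z₂`. -/
theorem bilinAt_pos_neg_pos (π ξ ζ₁ ζ₂ ζ₃ : ℤ) : BilinAt q 1 (-1) 1 π ξ ζ₁ ζ₂ ζ₃ := by
  have hneg : ∀ π ≤ 0, ∀ ξ ζ₁ ζ₂ ζ₃, BilinAt q 1 (-1) 1 π ξ ζ₁ ζ₂ ζ₃ := fun π h ξ ζ₁ ζ₂ ζ₃ =>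
    bilinAt_of_not_mem h0 h1 fun h2 => by
      have := h2.1.resolve_left (by decide)
      omega
  have hone : ∀ ξ ζ₁ ζ₂ ζ₃, BilinAt q 1 (-1) 1 1 ξ ζ₁ ζ₂ ζ₃ :=
    bilinAt_column h0 h1 (hneg _ (by norm_num)) fun ξ ζ₁ ζ₃ => bilinAt_base h0 h1 ξ ζ₁ ζ₃
  have key : ∀ k : ℕ, ∀ ξ ζ₁ ζ₂ ζ₃, BilinAt q 1 (-1) 1 k ξ ζ₁ ζ₂ ζ₃ := by
    intro k
    induction k with
    | zero => exact hneg _ (by simp)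
    | succ k ih =>
      refine bilinAt_column h0 h1 (by simpa using ih) fun ξ ζ₁ ζ₃ => BilinAt.swap h0 h1 ?_
      exact hone ..
  rcases le_or_gt π 0 with h | h
  · exact hneg _ h ..
  · obtain ⟨k, rfl⟩ := Int.eq_ofNat_of_zero_le h.le
    exact key k ..

/-- The bilinear identity. It is spread from the signs `(+, -, +)` of `(z₁, z₂, z₃)` to all signs
by flips and by the symmetries that permute the roles of the points. -/
theorem bilinAt (s₁ s₂ s₃ : ℤˣ) (π ξ ζ₁ ζ₂ ζ₃ : ℤ) : BilinAt q s₁ s₂ s₃ π ξ ζ₁ ζ₂ ζ₃ := by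
  have pnp := bilinAt_pos_neg_pos h0 h1
  have nnp : ∀ π ξ ζ₁ ζ₂ ζ₃, BilinAt q (-1) (-1) 1 π ξ ζ₁ ζ₂ ζ₃ := BilinAt.flip h0 h1 (by simpa using pnp)
  have pnn : ∀ π ξ ζ₁ ζ₂ ζ₃, BilinAt q 1 (-1) (-1) π ξ ζ₁ ζ₂ ζ₃ :=
    fun π ξ ζ₁ ζ₂ ζ₃ => BilinAt.reverse h0 h1 (nnp ..)
  have nnn : ∀ π ξ ζ₁ ζ₂ ζ₃, BilinAt q (-1) (-1) (-1) π ξ ζ₁ ζ₂ ζ₃ := BilinAt.flip h0 h1 (by simpa using pnn)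
  have ppn : ∀ π ξ ζ₁ ζ₂ ζ₃, BilinAt q 1 1 (-1) π ξ ζ₁ ζ₂ ζ₃ :=
    fun π ξ ζ₁ ζ₂ ζ₃ => BilinAt.swap h0 h1 (nnp ..)
  have npn : ∀ π ξ ζ₁ ζ₂ ζ₃, BilinAt q (-1) 1 (-1) π ξ ζ₁ ζ₂ ζ₃ := BilinAt.flip h0 h1 (by simpa using ppn)
  have npp : ∀ π ξ ζ₁ ζ₂ ζ₃, BilinAt q (-1) 1 1 π ξ ζ₁ ζ₂ ζ₃ :=
    fun π ξ ζ₁ ζ₂ ζ₃ => BilinAt.reverse h0 h1 (ppn ..)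
  have ppp : ∀ π ξ ζ₁ ζ₂ ζ₃, BilinAt q 1 1 1 π ξ ζ₁ ζ₂ ζ₃ := BilinAt.flip h0 h1 npp
  rcases Int.units_eq_one_or s₁ with rfl | rfl <;> rcases Int.units_eq_one_or s₂ with rfl | rfl <;>
    rcases Int.units_eq_one_or s₃ with rfl | rfl
  exacts [ppp .., ppn .., pnp .., pnn .., npp .., npn .., nnp .., nnn ..]

end

end QSU11

/-! ### Hilbert bases and tensor products -/

section HilbertBases

set_option linter.unusedSectionVars false

variable {ι ι' κ : Type*} {H K L E : Type*}
  [NormedAddCommGroup H] [InnerProductSpace ℂ H] [CompleteSpace H]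
  [NormedAddCommGroup K] [InnerProductSpace ℂ K] [CompleteSpace K]
  [NormedAddCommGroup L] [InnerProductSpace ℂ L] [CompleteSpace L]
  [NormedAddCommGroup E] [InnerProductSpace ℂ E] [CompleteSpace E]

namespace HilbertBasis

theorem clm_ext (b : HilbertBasis ι ℂ H) {F : Type*} [NormedAddCommGroup F] [NormedSpace ℂ F]
    {f g : H →L[ℂ] F} (h : ∀ i, f (b i) = g (b i)) : f = g := by
  refine ContinuousLinearMap.ext_on (s := Set.range b) ?_ (by rintro _ ⟨i, rfl⟩; exact h i)
  intro v
  have := b.dense_span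
  rw [← Submodule.topologicalClosure_coe, this]
  trivial

theorem ext_inner (b : HilbertBasis ι ℂ H) {x y : H} (h : ∀ i, ⟪b i, x⟫_ℂ = ⟪b i, y⟫_ℂ) : x = y :=
  b.repr.injective (by ext i; rw [b.repr_apply_apply, b.repr_apply_apply, h i])

theorem map_mem_of_isClosed (b : HilbertBasis ι ℂ H) {F : Type*} [NormedAddCommGroup F]
    [NormedSpace ℂ F] (f : H →L[ℂ] F) {S : Submodule ℂ F} (hS : IsClosed (S : Set F))
    (h : ∀ i, f (b i) ∈ S) (v : H) : f v ∈ S := by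
  have h1 : (Submodule.span ℂ (Set.range b)).topologicalClosure ≤ S.comap (f : H →ₗ[ℂ] F) := by
    refine Submodule.topologicalClosure_minimal _ (Submodule.span_le.2 ?_) (hS.preimage f.continuous)
    rintro _ ⟨i, rfl⟩
    exact h i
  rw [b.dense_span] at h1
  exact h1 (Submodule.mem_top (x := v))

/-- A Hilbert basis with its index set replaced by an equivalent one. -/
def reindex (b : HilbertBasis ι ℂ H) (e : ι' ≃ ι) : HilbertBasis ι' ℂ H :=
  HilbertBasis.mk (v := fun i => b (e i)) (b.orthonormal.comp e e.injective) (by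
    rw [show (Set.range fun i => b (e i)) = Set.range b from e.surjective.range_comp b,
      b.dense_span])

@[simp] theorem reindex_apply (b : HilbertBasis ι ℂ H) (e : ι' ≃ ι) (i : ι') :
    b.reindex e i = b (e i) := by
  simp [reindex]

/-- The unitary that maps one Hilbert basis to another one. -/
def equiv (b : HilbertBasis ι ℂ H) (c : HilbertBasis ι ℂ K) : H ≃ₗᵢ[ℂ] K :=
  b.repr.trans c.repr.symm

@[simp] theorem equiv_apply (b : HilbertBasis ι ℂ H) (c : HilbertBasis ι ℂ K) (i : ι) :
    b.equiv c (b i) = c i := by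
  classical
  simp [equiv, HilbertBasis.repr_self, HilbertBasis.repr_symm_single]

theorem inner_eq_ite [DecidableEq ι] (b : HilbertBasis ι ℂ H) (i j : ι) :
    ⟪b i, b j⟫_ℂ = if i = j then 1 else 0 :=
  orthonormal_iff_ite.1 b.orthonormal i j

/-- The standard basis of `ℓ²`. -/
def std (ι : Type*) : HilbertBasis ι ℂ (lp (fun _ : ι => ℂ) 2) :=
  .ofRepr (.refl ℂ _)

end HilbertBasis

namespace HTensor

theorem norm_tmul (v : H) (w : K) : ‖tmul v w‖ = ‖v‖ * ‖w‖ := by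
  rw [tmul, LinearIsometry.norm_map, TensorProduct.norm_tmul]

/-- The bounded bilinear map `(v, w) ↦ v ⊗ w`. -/
def tmulL (v : H) : K →L[ℂ] HTensor H K :=
  emb.toContinuousLinearMap ∘L TensorProduct.mkL ℂ H K v

@[simp] theorem tmulL_apply (v : H) (w : K) : tmulL v w = tmul v w := rfl

/-- The bounded map `v ↦ v ⊗ w`. -/
def tmulR (w : K) : H →L[ℂ] HTensor H K :=
  emb.toContinuousLinearMap ∘L (TensorProduct.mkL ℂ H K).flip w

@[simp] theorem tmulR_apply (v : H) (w : K) : tmulR w v = tmul v w := rfl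

theorem tmul_smul (c : ℂ) (v : H) (w : K) : tmul v (c • w) = c • tmul v w :=
  (tmulL v).map_smul c w

theorem smul_tmul (c : ℂ) (v : H) (w : K) : tmul (c • v) w = c • tmul v w :=
  (tmulR w).map_smul c v

@[simp] theorem tmul_zero (v : H) : tmul v (0 : K) = 0 := (tmulL v).map_zero

@[simp] theorem zero_tmul (w : K) : tmul (0 : H) w = 0 := (tmulR w).map_zero

/-- A closed subspace containing all elementary tensors is everything. -/
theorem mem_of_isClosed {S : Submodule ℂ (HTensor H K)} (hS : IsClosed (S : Set (HTensor H K)))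
    (h : ∀ v w, tmul v w ∈ S) (x : HTensor H K) : x ∈ S := by
  refine denseRange_emb.induction_on (p := fun x => x ∈ S) x hS fun z => ?_
  induction z using TensorProduct.induction_on with
  | zero => rw [map_zero]; exact S.zero_mem
  | add x y hx hy => rw [map_add]; exact S.add_mem hx hy
  | tmul v w => exact h v w

theorem clm_ext {F : Type*} [NormedAddCommGroup F] [NormedSpace ℂ F] {f g : HTensor H K →L[ℂ] F}
    (h : ∀ v w, f (tmul v w) = g (tmul v w)) : f = g := by
  ext x
  refine mem_of_isClosed (S := LinearMap.eqLocus (f : HTensor H K →ₗ[ℂ] F) g)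
    (isClosed_eq f.continuous g.continuous) h x

theorem ext_inner {x y : HTensor H K} (h : ∀ v w, ⟪tmul v w, x⟫_ℂ = ⟪tmul v w, y⟫_ℂ) : x = y := by
  have e : innerSL ℂ x = innerSL ℂ y := clm_ext fun v w => by
    have := congrArg (starRingEnd ℂ) (h v w)
    simpa using this
  refine ext_inner_right ℂ fun z => ?_
  exact congrArg (fun f : HTensor H K →L[ℂ] ℂ => f z) e

theorem map_mul (a a' : H →L[ℂ] H) (b b' : K →L[ℂ] K) :
    map (a * a') (b * b') = map a b * map a' b' :=
  clm_ext fun v w => by simp [map_tmul]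

theorem map_one : map (1 : H →L[ℂ] H) (1 : K →L[ℂ] K) = 1 :=
  clm_ext fun v w => by simp [map_tmul]

theorem star_map (a : H →L[ℂ] H) (b : K →L[ℂ] K) : star (map a b) = map (star a) (star b) :=
  clm_ext fun v w => ext_inner fun v' w' => by
    rw [ContinuousLinearMap.star_eq_adjoint, ContinuousLinearMap.adjoint_inner_right, map_tmul,
      map_tmul, inner_tmul, inner_tmul, ContinuousLinearMap.star_eq_adjoint,
      ContinuousLinearMap.star_eq_adjoint, ContinuousLinearMap.adjoint_inner_right,
      ContinuousLinearMap.adjoint_inner_right]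

/-- The amplification `b ↦ 1 ⊗ b`. -/
def amplify (H K : Type*) [NormedAddCommGroup H] [InnerProductSpace ℂ H] [CompleteSpace H]
    [NormedAddCommGroup K] [InnerProductSpace ℂ K] [CompleteSpace K] :
    (K →L[ℂ] K) →⋆ₐ[ℂ] (HTensor H K →L[ℂ] HTensor H K) where
  toFun b := map 1 b
  map_one' := map_one
  map_mul' b b' := by rw [← map_mul, one_mul]
  map_zero' := clm_ext fun v w => by simp [map_tmul]
  map_add' b b' := clm_ext fun v w => by
    simp only [map_tmul, add_apply]
    exact (tmulL _).map_add _ _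
  commutes' c := clm_ext fun v w => by
    simp [map_tmul, Algebra.algebraMap_eq_smul_one, tmul_smul]
  map_star' b := by rw [star_map, star_one]

@[simp] theorem amplify_tmul (b : K →L[ℂ] K) (v : H) (w : K) :
    amplify H K b (tmul v w) = tmul v (b w) := map_tmul 1 b v w

end HTensor

theorem HTensor.orthonormal_tmul {v : ι → H} {w : κ → K} (hv : Orthonormal ℂ v)
    (hw : Orthonormal ℂ w) : Orthonormal ℂ fun i : ι × κ => HTensor.tmul (v i.1) (w i.2) :=
  (hv.tmul hw).comp_linearIsometry HTensor.emb

/-- The elementary tensors of two Hilbert bases form a Hilbert basis of the tensor product. -/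
def HilbertBasis.tensor (b : HilbertBasis ι ℂ H) (c : HilbertBasis κ ℂ K) :
    HilbertBasis (ι × κ) ℂ (HTensor H K) :=
  HilbertBasis.mk (HTensor.orthonormal_tmul b.orthonormal c.orthonormal) (by
      intro x _
      refine HTensor.mem_of_isClosed (Submodule.isClosed_topologicalClosure _) (fun v w => ?_) x
      refine b.map_mem_of_isClosed (HTensor.tmulR w) (Submodule.isClosed_topologicalClosure _)
        (fun i => ?_) v
      refine c.map_mem_of_isClosed (HTensor.tmulL (b i)) (Submodule.isClosed_topologicalClosure _)
        (fun k => ?_) w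
      exact Submodule.le_topologicalClosure _ (Submodule.subset_span ⟨(i, k), rfl⟩))

@[simp] theorem HilbertBasis.tensor_apply (b : HilbertBasis ι ℂ H) (c : HilbertBasis κ ℂ K)
    (i : ι × κ) : b.tensor c i = HTensor.tmul (b i.1) (c i.2) := by
  rw [HilbertBasis.tensor, HilbertBasis.coe_mk]

end HilbertBases

/-! ### Amplifications -/

section Amplification

set_option linter.unusedSectionVars false

variable {I Λ : Type*} {K L : Type*}
  [NormedAddCommGroup K] [InnerProductSpace ℂ K] [CompleteSpace K]
  [NormedAddCommGroup L] [InnerProductSpace ℂ L] [CompleteSpace L]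

namespace HilbertBasis

variable (c : HilbertBasis (I × Λ) ℂ K) (b : HilbertBasis Λ ℂ L)

/-- The unitary `K ≃ ℓ²(I) ⊗ L` that identifies a Hilbert basis `c` of `K`, indexed by `I × Λ`,
with the tensor product of the standard basis of `ℓ²(I)` and a basis `b` of `L`. -/
def splitEquiv : K ≃ₗᵢ[ℂ] HTensor (lp (fun _ : I => ℂ) 2) L := c.equiv ((std I).tensor b)

/-- The isometry `L → K` that maps `b l` to `c (i, l)`. -/
def slice (i : I) : L →L[ℂ] K :=
  (c.splitEquiv b).symm.toContinuousLinearEquiv.toContinuousLinearMap ∘L HTensor.tmulL (std I i)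

theorem slice_eq (i : I) (v : L) :
    c.slice b i v = (c.splitEquiv b).symm (HTensor.tmul (std I i) v) := rfl

@[simp] theorem slice_apply (i : I) (l : Λ) : c.slice b i (b l) = c (i, l) := by
  rw [slice_eq, LinearIsometryEquiv.symm_apply_eq, splitEquiv, equiv_apply, tensor_apply]

theorem slice_unique {i : I} {f : L →L[ℂ] K} (h : ∀ l, f (b l) = c (i, l)) : f = c.slice b i :=
  b.clm_ext fun l => by rw [h, slice_apply]

theorem norm_slice_apply (i : I) (v : L) : ‖c.slice b i v‖ = ‖v‖ := by
  rw [slice_eq, LinearIsometryEquiv.norm_map, HTensor.norm_tmul, (std I).orthonormal.1 i, one_mul]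

theorem ext_slice {F : Type*} [NormedAddCommGroup F] [NormedSpace ℂ F] {f g : K →L[ℂ] F}
    (h : ∀ i v, f (c.slice b i v) = g (c.slice b i v)) : f = g :=
  c.clm_ext fun i => by
    have := h i.1 (b i.2)
    rwa [slice_apply] at this

/-- The amplification `B(L) → B(K)` that acts on each slice of `K` as on `L`. -/
def ampl : (L →L[ℂ] L) →⋆ₐ[ℂ] (K →L[ℂ] K) :=
  (StarAlgHomClass.toStarAlgHom (c.splitEquiv b).symm.conjStarAlgEquiv).comp (HTensor.amplify _ _)

theorem ampl_slice (x : L →L[ℂ] L) (i : I) (v : L) :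
    c.ampl b x (c.slice b i v) = c.slice b i (x v) := by
  change (c.splitEquiv b).symm (HTensor.amplify _ _ x ((c.splitEquiv b).symm.symm _)) = _
  rw [slice_eq, LinearIsometryEquiv.symm_symm, LinearIsometryEquiv.apply_symm_apply,
    HTensor.amplify_tmul, slice_eq]

theorem ampl_apply (x : L →L[ℂ] L) (i : I) (l : Λ) :
    c.ampl b x (c (i, l)) = c.slice b i (x (b l)) := by
  rw [← slice_apply c b, ampl_slice]

theorem ampl_injective [Nonempty I] : Function.Injective (c.ampl b) := by
  intro x y h
  obtain ⟨i⟩ := ‹Nonempty I›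
  ext v
  have h1 := c.ampl_slice b x i v
  rw [h, ampl_slice] at h1
  have h2 := c.norm_slice_apply b i (x v - y v)
  rw [map_sub, ← h1, sub_self, norm_zero] at h2
  exact sub_eq_zero.1 (norm_eq_zero.1 h2.symm)

theorem adjoint_slice_ampl (x : L →L[ℂ] L) (i : I) (η : K) :
    (c.slice b i).adjoint (c.ampl b x η) = x ((c.slice b i).adjoint η) := by
  refine ext_inner_left ℂ fun v => ?_
  rw [ContinuousLinearMap.adjoint_inner_right, ← ContinuousLinearMap.adjoint_inner_left (c.ampl b x),
    ← ContinuousLinearMap.star_eq_adjoint, ← map_star, ampl_slice,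
    ← ContinuousLinearMap.adjoint_inner_right, ContinuousLinearMap.star_eq_adjoint,
    ContinuousLinearMap.adjoint_inner_left]

/-- Parseval's identity for the decomposition of `K` into slices. -/
theorem hasSum_inner_slice (ξ η : K) :
    HasSum (fun i => ⟪(c.slice b i).adjoint ξ, (c.slice b i).adjoint η⟫_ℂ) ⟪ξ, η⟫_ℂ := by
  refine (c.hasSum_inner_mul_inner ξ η).prod_fiberwise fun i => ?_
  have := b.hasSum_inner_mul_inner ((c.slice b i).adjoint ξ) ((c.slice b i).adjoint η)
  simpa only [ContinuousLinearMap.adjoint_inner_right, ContinuousLinearMap.adjoint_inner_left,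
    slice_apply] using this

theorem hasSum_norm_sq_slice (ξ : K) :
    HasSum (fun i => ‖(c.slice b i).adjoint ξ‖ ^ 2) (‖ξ‖ ^ 2) := by
  have := c.hasSum_inner_slice b ξ ξ
  simp only [inner_self_eq_norm_sq_to_K] at this
  exact_mod_cast this

theorem summable_norm_sq_slice {ξ : ℕ → K} (h : Summable fun n => ‖ξ n‖ ^ 2) :
    Summable fun z : ℕ × I => ‖(c.slice b z.2).adjoint (ξ z.1)‖ ^ 2 := by
  refine (summable_prod_of_nonneg fun z => sq_nonneg _).2 ⟨fun n =>
    (c.hasSum_norm_sq_slice b (ξ n)).summable, ?_⟩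
  simpa only [(c.hasSum_norm_sq_slice b _).tsum_eq] using h

theorem tsum_inner_ampl {ξ η : ℕ → K} (hξ : Summable fun n => ‖ξ n‖ ^ 2)
    (hη : Summable fun n => ‖η n‖ ^ 2) (x : L →L[ℂ] L) :
    ∑' n, ⟪ξ n, c.ampl b x (η n)⟫_ℂ = ∑' z : ℕ × I, ⟪(c.slice b z.2).adjoint (ξ z.1),
      x ((c.slice b z.2).adjoint (η z.1))⟫_ℂ := by
  have hs : Summable fun z : ℕ × I => ⟪(c.slice b z.2).adjoint (ξ z.1),
      x ((c.slice b z.2).adjoint (η z.1))⟫_ℂ := by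
    refine Summable.of_norm_bounded ((((c.summable_norm_sq_slice b hξ).add
      (c.summable_norm_sq_slice b hη)).mul_left ‖x‖)) fun z => ?_
    refine (norm_inner_le_norm _ _).trans ((mul_le_mul_of_nonneg_left
      (x.le_opNorm _) (norm_nonneg _)).trans ?_)
    have h1 := norm_nonneg x
    generalize ‖(c.slice b z.2).adjoint (ξ z.1)‖ = s
    generalize ‖(c.slice b z.2).adjoint (η z.1)‖ = t
    nlinarith [mul_nonneg h1 (sq_nonneg (s - t)), mul_nonneg h1 (sq_nonneg (s + t))]
  rw [hs.tsum_prod]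
  refine tsum_congr fun n => ?_
  rw [← (c.hasSum_inner_slice b _ _).tsum_eq]
  simp only [adjoint_slice_ampl]

/-- A `*`-homomorphism that is the restriction of an amplification is normal. -/
theorem isNormalHom_of_ampl [Denumerable I] {M : VonNeumannAlgebra L} {N : VonNeumannAlgebra K}
    (π : M.toStarSubalgebra →⋆ₐ[ℂ] N.toStarSubalgebra)
    (h : ∀ x, (π x : K →L[ℂ] K) = c.ampl b x) : VonNeumannAlgebra.IsNormalHom π := by
  rintro φ ⟨ξ, η, hξ, hη, hφ⟩
  obtain ⟨e⟩ : Nonempty (ℕ ≃ ℕ × I) := ⟨(Denumerable.eqv (ℕ × I)).symm⟩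
  refine ⟨fun n => (c.slice b (e n).2).adjoint (ξ (e n).1),
    fun n => (c.slice b (e n).2).adjoint (η (e n).1),
    e.summable_iff.2 (c.summable_norm_sq_slice b hξ),
    e.summable_iff.2 (c.summable_norm_sq_slice b hη), fun x => ?_⟩
  have h1 : φ (π x) = ∑' n, ⟪ξ n, c.ampl b x (η n)⟫_ℂ := by
    rw [hφ (π x)]
    simp only [h]
  exact h1.trans ((c.tsum_inner_ampl b hξ hη x).trans (e.tsum_eq _).symm)

end HilbertBasis

end Amplification

/-! ### Translation-invariant operators -/

section Translation

set_option linter.unusedSectionVars false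

namespace HilbertBasis

variable {G G' I I' : Type*} {H H' : Type*} [AddCommGroup G] [AddCommGroup G']
  [NormedAddCommGroup H] [InnerProductSpace ℂ H] [CompleteSpace H]
  [NormedAddCommGroup H'] [InnerProductSpace ℂ H'] [CompleteSpace H']

/-- The unitary that maps the basis vector `b (h, i)` to `b (g + h, i)`. -/
def shift (b : HilbertBasis (G × I) ℂ H) (g : G) : H →L[ℂ] H :=
  (b.equiv (b.reindex ((Equiv.addLeft g).prodCongr (Equiv.refl I)))
    ).toContinuousLinearEquiv.toContinuousLinearMap

@[simp] theorem shift_apply (b : HilbertBasis (G × I) ℂ H) (g h : G) (i : I) :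
    b.shift g (b (h, i)) = b (g + h, i) := by
  change b.equiv _ (b (h, i)) = _
  simp

theorem norm_shift_apply (b : HilbertBasis (G × I) ℂ H) (g : G) (v : H) : ‖b.shift g v‖ = ‖v‖ :=
  LinearIsometryEquiv.norm_map _ v

theorem shift_add (b : HilbertBasis (G × I) ℂ H) (g h : G) :
    b.shift (g + h) = b.shift g * b.shift h :=
  b.clm_ext fun i => by
    obtain ⟨k, i⟩ := i
    simp [add_assoc]

theorem shift_zero (b : HilbertBasis (G × I) ℂ H) : b.shift 0 = 1 :=
  b.clm_ext fun i => by
    obtain ⟨k, i⟩ := i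
    simp

theorem shift_comm (b : HilbertBasis (G × I) ℂ H) (g h : G) :
    b.shift g * b.shift h = b.shift h * b.shift g := by
  rw [← shift_add, ← shift_add, add_comm]

theorem inner_shift (b : HilbertBasis (G × I) ℂ H) (g : G) (v w : H) :
    ⟪b.shift g v, b.shift g w⟫_ℂ = ⟪v, w⟫_ℂ :=
  LinearIsometryEquiv.inner_map_map _ v w

theorem inner_shift_left (b : HilbertBasis (G × I) ℂ H) (g : G) (v w : H) :
    ⟪b.shift g v, w⟫_ℂ = ⟪v, b.shift (-g) w⟫_ℂ := by
  rw [← b.inner_shift (-g), ← mul_apply_eq_comp, ← shift_add, neg_add_cancel,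
    shift_zero, one_apply_eq_self]

theorem star_shift (b : HilbertBasis (G × I) ℂ H) (g : G) : star (b.shift g) = b.shift (-g) := by
  ext v
  refine ext_inner_left ℂ fun w => ?_
  rw [ContinuousLinearMap.star_eq_adjoint, ContinuousLinearMap.adjoint_inner_right,
    inner_shift_left]

/-- The von Neumann algebra `N` consists of the operators that commute with the translations of
the basis `b`. -/
def IsInvariantAlgebra (b : HilbertBasis (G × I) ℂ H) (N : VonNeumannAlgebra H) : Prop :=
  ∀ x, x ∈ N ↔ ∀ g, x * b.shift g = b.shift g * x

/-- A convolution operator: it only acts on the group component of the basis `b`, and there by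
a kernel `c (g - h)`. -/
def IsConvolution (b : HilbertBasis (G × I) ℂ H) (y : H →L[ℂ] H) : Prop :=
  (∀ g h i j, i ≠ j → ⟪b (g, i), y (b (h, j))⟫_ℂ = 0) ∧
  ∃ c : G → ℂ, ∀ g h i, ⟪b (g, i), y (b (h, i))⟫_ℂ = c (g - h)

theorem IsConvolution.mul_comm {b : HilbertBasis (G × I) ℂ H} {y : H →L[ℂ] H}
    (hy : b.IsConvolution y) {x : H →L[ℂ] H} (hx : ∀ g, x * b.shift g = b.shift g * x) :
    x * y = y * x := by
  obtain ⟨h0, c, hc⟩ := hy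
  have hx' : ∀ g h k i j, ⟪b (g + k, i), x (b (h + k, j))⟫_ℂ = ⟪b (g, i), x (b (h, j))⟫_ℂ := by
    intro g h k i j
    have e := congrArg (fun z : H →L[ℂ] H => z (b (h, j))) (hx k)
    simp only [mul_apply_eq_comp, shift_apply] at e
    rw [add_comm g, add_comm h, e, ← shift_apply, inner_shift]
  refine b.clm_ext fun ⟨h, j⟩ => b.ext_inner fun ⟨g, i⟩ => ?_
  have e1 : ⟪b (g, i), (x * y) (b (h, j))⟫_ℂ =
      ∑' k, ⟪b (g, i), x (b (k, j))⟫_ℂ * ⟪b (k, j), y (b (h, j))⟫_ℂ := by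
    rw [mul_apply_eq_comp, ← ContinuousLinearMap.adjoint_inner_left,
      ← b.tsum_inner_mul_inner]
    simp only [ContinuousLinearMap.adjoint_inner_left]
    refine ((Prod.mk_left_injective j).tsum_eq fun z hz => ?_).symm
    by_contra h2
    refine hz ?_
    have : z.2 ≠ j := fun h3 => h2 ⟨z.1, by rw [← h3]⟩
    simp only
    rw [h0 z.1 h z.2 j this, mul_zero]
  have e2 : ⟪b (g, i), (y * x) (b (h, j))⟫_ℂ =
      ∑' k, ⟪b (g, i), y (b (k, i))⟫_ℂ * ⟪b (k, i), x (b (h, j))⟫_ℂ := by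
    rw [mul_apply_eq_comp, ← ContinuousLinearMap.adjoint_inner_left,
      ← b.tsum_inner_mul_inner]
    simp only [ContinuousLinearMap.adjoint_inner_left]
    refine ((Prod.mk_left_injective i).tsum_eq fun z hz => ?_).symm
    by_contra h2
    refine hz ?_
    have : z.2 ≠ i := fun h3 => h2 ⟨z.1, by rw [← h3]⟩
    simp only
    rw [h0 g z.1 i z.2 this.symm, zero_mul]
  rw [e1, e2, ← (Equiv.subLeft (g + h)).tsum_eq]
  refine tsum_congr fun k => ?_
  rw [Equiv.subLeft_apply, hc, hc, _root_.mul_comm, show g + h - k - h = g - k by abel]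
  congr 1
  rw [← hx' g (g + h - k) (k - g), add_sub_cancel, show g + h - k + (k - g) = h by abel]

/-- An operator that commutes with translations and with a system of matrix units on the second
component of the basis is a convolution operator. -/
theorem isConvolution_of_commute (b : HilbertBasis (G × I) ℂ H) {y : H →L[ℂ] H}
    (h1 : ∀ g, y * b.shift g = b.shift g * y) {u : I → I → H →L[ℂ] H}
    (hu : ∀ i j g, u i j (b (g, j)) = b (g, i)) (hu0 : ∀ i j k g, k ≠ j → u i j (b (g, k)) = 0)
    (hs : ∀ i j, star (u i j) = u j i) (h2 : ∀ i j, y * u i j = u i j * y) : b.IsConvolution y := by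
  have key : ∀ g h i j k, ⟪b (g, i), y (b (h, j))⟫_ℂ = ⟪u k j (b (g, i)), y (b (h, k))⟫_ℂ := by
    intro g h i j k
    have e := congrArg (fun z : H →L[ℂ] H => z (b (h, k))) (h2 j k)
    simp only [mul_apply_eq_comp, hu] at e
    rw [e, ← ContinuousLinearMap.adjoint_inner_left, ← ContinuousLinearMap.star_eq_adjoint, hs]
  have h3 : ∀ g h k i, ⟪b (g + k, i), y (b (h + k, i))⟫_ℂ = ⟪b (g, i), y (b (h, i))⟫_ℂ := by
    intro g h k i
    have e := congrArg (fun z : H →L[ℂ] H => z (b (h, i))) (h1 k)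
    simp only [mul_apply_eq_comp, shift_apply] at e
    rw [add_comm g, add_comm h, e, ← shift_apply, inner_shift]
  refine ⟨fun g h i j hij => ?_, ?_⟩
  · rw [key g h i j j, hu0 _ _ _ _ hij, inner_zero_left]
  · rcases isEmpty_or_nonempty I with hI | ⟨⟨i₀⟩⟩
    · exact ⟨0, fun g h i => (hI.false i).elim⟩
    · refine ⟨fun g => ⟪b (g, i₀), y (b (0, i₀))⟫_ℂ, fun g h i => ?_⟩
      have := h3 (g - h) 0 h i₀
      rw [sub_add_cancel, zero_add] at this
      rw [key g h i i i₀, hu, this]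

theorem mem_commutantOf {S : Set (H →L[ℂ] H)} {x : H →L[ℂ] H} :
    x ∈ VonNeumannAlgebra.commutantOf S ↔ ∀ s ∈ S, s * x = x * s ∧ star s * x = x * star s := by
  change x ∈ StarSubalgebra.centralizer ℂ S ↔ _
  rw [StarSubalgebra.mem_centralizer_iff]

/-- The matrix unit that maps `b (g, j)` to `b (g, i)`. -/
def unit (b : HilbertBasis (G × I) ℂ H) (i j : I) : H →L[ℂ] H :=
  b.ampl (std I) (InnerProductSpace.rankOne ℂ (std I i) (std I j))

theorem unit_apply (b : HilbertBasis (G × I) ℂ H) [DecidableEq I] (i j k : I) (g : G) :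
    b.unit i j (b (g, k)) = if k = j then b (g, i) else 0 := by
  rw [unit, ampl_apply, InnerProductSpace.rankOne_apply, inner_eq_ite, ite_smul, one_smul,
    zero_smul]
  simp only [eq_comm (a := k)]
  split_ifs
  · rw [slice_apply]
  · rw [map_zero]

theorem star_unit (b : HilbertBasis (G × I) ℂ H) (i j : I) : star (b.unit i j) = b.unit j i := by
  rw [unit, ← map_star, ContinuousLinearMap.star_eq_adjoint, InnerProductSpace.adjoint_rankOne,
    unit]

theorem shift_slice {L : Type*} [NormedAddCommGroup L] [InnerProductSpace ℂ L] [CompleteSpace L]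
    (b : HilbertBasis (G × I) ℂ H) (c : HilbertBasis I ℂ L) (g h : G) (v : L) :
    b.shift g (b.slice c h v) = b.slice c (g + h) v := by
  have : b.shift g ∘L b.slice c h = b.slice c (g + h) := slice_unique _ _ fun l => by simp
  exact congrArg (fun f : L →L[ℂ] H => f v) this

theorem ampl_mul_shift {L : Type*} [NormedAddCommGroup L] [InnerProductSpace ℂ L] [CompleteSpace L]
    (b : HilbertBasis (G × I) ℂ H) (c : HilbertBasis I ℂ L) (x : L →L[ℂ] L) (g : G) :
    b.ampl c x * b.shift g = b.shift g * b.ampl c x :=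
  b.ext_slice c fun h v => by
    simp only [mul_apply_eq_comp]
    rw [shift_slice, ampl_slice, ampl_slice, shift_slice]

/-- The tensor product of two bases indexed by `G × I` and `G' × I'`, indexed by
`(G × G') × (I × I')`. -/
def prodTensor (b : HilbertBasis (G × I) ℂ H) (b' : HilbertBasis (G' × I') ℂ H') :
    HilbertBasis ((G × G') × (I × I')) ℂ (HTensor H H') :=
  (b.tensor b').reindex (Equiv.prodProdProdComm G G' I I')

@[simp] theorem prodTensor_apply (b : HilbertBasis (G × I) ℂ H) (b' : HilbertBasis (G' × I') ℂ H')
    (g : G) (g' : G') (i : I) (i' : I') :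
    b.prodTensor b' ((g, g'), (i, i')) = HTensor.tmul (b (g, i)) (b' (g', i')) := by
  simp [prodTensor]

theorem shift_prodTensor (b : HilbertBasis (G × I) ℂ H) (b' : HilbertBasis (G' × I') ℂ H')
    (g : G) (g' : G') : (b.prodTensor b').shift (g, g') = HTensor.map (b.shift g) (b'.shift g') :=
  (b.prodTensor b').clm_ext fun ⟨⟨h, h'⟩, ⟨i, i'⟩⟩ => by
    rw [shift_apply, Prod.mk_add_mk, prodTensor_apply, prodTensor_apply, HTensor.map_tmul,
      shift_apply, shift_apply]

/-- The tensor product of two algebras of translation-invariant operators is the algebra of all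
operators that are invariant under the product of the two groups. -/
theorem IsInvariantAlgebra.tensor {b : HilbertBasis (G × I) ℂ H} {b' : HilbertBasis (G' × I') ℂ H'}
    {M : VonNeumannAlgebra H} {N : VonNeumannAlgebra H'} (hM : b.IsInvariantAlgebra M)
    (hN : b'.IsInvariantAlgebra N) :
    (b.prodTensor b').IsInvariantAlgebra (VonNeumannAlgebra.tensor M N) := by
  classical
  intro x
  constructor
  · rintro hx ⟨g, g'⟩
    have hx2 := (mem_commutantOf.1 hx) ((b.prodTensor b').shift (g, g')) ?_
    · exact hx2.1.symm
    rw [SetLike.mem_coe, mem_commutantOf]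
    have hc : ∀ a ∈ M, ∀ a' ∈ N, HTensor.map a a' * (b.prodTensor b').shift (g, g') =
        (b.prodTensor b').shift (g, g') * HTensor.map a a' := fun a ha a' ha' => by
      rw [shift_prodTensor, ← HTensor.map_mul, ← HTensor.map_mul, (hM a).1 ha, (hN a').1 ha']
    rintro _ ⟨a, ha, a', ha', rfl⟩
    refine ⟨hc a ha a' ha', ?_⟩
    rw [HTensor.star_map]
    exact hc _ (star_mem ha) _ (star_mem ha')
  · intro hx
    refine mem_commutantOf.2 fun y hy => ?_
    have key : ∀ y ∈ VonNeumannAlgebra.commutantOf {x | ∃ a ∈ M, ∃ b ∈ N, x = HTensor.map a b},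
        y * x = x * y := by
      intro y hy
      have hy' := mem_commutantOf.1 hy
      refine (IsConvolution.mul_comm (isConvolution_of_commute (b.prodTensor b') (y := y)
        (u := fun i j => HTensor.map (b.unit i.1 j.1) (b'.unit i.2 j.2)) ?_ ?_ ?_ ?_ ?_) hx).symm
      · rintro ⟨g, g'⟩
        rw [shift_prodTensor]
        exact (hy' _ ⟨_, (hM _).2 fun h => shift_comm .., _, (hN _).2 fun h => shift_comm .., rfl⟩
          ).1.symm
      · rintro ⟨i, i'⟩ ⟨j, j'⟩ ⟨g, g'⟩
        simp [HTensor.map_tmul, unit_apply]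
      · rintro ⟨i, i'⟩ ⟨j, j'⟩ ⟨k, k'⟩ ⟨g, g'⟩ h
        simp only [prodTensor_apply, HTensor.map_tmul, unit_apply]
        by_cases h1 : k = j
        · rw [if_neg (show k' ≠ j' from fun h2 => h (by rw [h1, h2])), HTensor.tmul_zero]
        · rw [if_neg h1, HTensor.zero_tmul]
      · rintro ⟨i, i'⟩ ⟨j, j'⟩
        rw [HTensor.star_map, star_unit, star_unit]
      · rintro ⟨i, i'⟩ ⟨j, j'⟩
        exact (hy' _ ⟨_, (hM _).2 fun h => ampl_mul_shift .., _, (hN _).2 fun h => ampl_mul_shift ..,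
          rfl⟩).1.symm
    exact ⟨key y hy, key _ (star_mem (SetLike.mem_coe.1 hy))⟩

end HilbertBasis

end Translation

/-! ### Coordinates on `I_q` -/

namespace QSU11

section

set_option linter.unusedSectionVars false

variable {q : ℝ} (h0 : 0 < q) (h1 : q < 1)
include h0

theorem sign_pt (σ : ℤˣ) (k : ℤ) : Real.sign (sg σ * q ^ k) = sg σ := by
  have : 0 < q ^ k := by positivity
  rcases Int.units_eq_one_or σ with rfl | rfl
  · rw [sg_one, one_mul, Real.sign_of_pos this]
  · rw [sg_neg_one, Real.sign_of_neg (by linarith)]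

theorem pt_ne_zero (σ : ℤˣ) (k : ℤ) : sg σ * q ^ k ≠ 0 :=
  mul_ne_zero (sg_ne_zero σ) (by positivity)

theorem abs_pt (σ : ℤˣ) (k : ℤ) : |sg σ * q ^ k| = q ^ k := by
  have : 0 < q ^ k := by positivity
  rcases Int.units_eq_one_or σ with rfl | rfl <;> simp [abs_of_pos h0]

theorem sg_injective {σ τ : ℤˣ} (h : sg σ = sg τ) : σ = τ := by
  rcases Int.units_eq_one_or σ with rfl | rfl <;> rcases Int.units_eq_one_or τ with rfl | rfl <;>
    first | rfl | (norm_num at h)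

include h1

theorem chi_pt (σ : ℤˣ) (k : ℤ) : chi q (sg σ * q ^ k) = k := by
  rw [chi, abs_pt h0, ← Real.rpow_intCast, Real.logb_rpow h0 h1.ne, Int.floor_intCast]

theorem pt_injective {σ τ : ℤˣ} {k l : ℤ} (h : sg σ * q ^ k = sg τ * q ^ l) : σ = τ ∧ k = l := by
  constructor
  · have := congrArg Real.sign h
    rw [sign_pt h0, sign_pt h0] at this
    exact sg_injective h0 this
  · rw [← chi_pt h0 h1 σ k, h, chi_pt h0 h1]

theorem pt_mem_Iq {σ : ℤˣ} {k : ℤ} : sg σ * q ^ k ∈ Iq q ↔ InI σ k := by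
  constructor
  · rintro (⟨l, hl, h⟩ | ⟨l, h⟩)
    · rw [← zpow_natCast, ← neg_one_mul, ← sg_neg_one] at h
      obtain ⟨-, rfl⟩ := pt_injective h0 h1 h
      exact Or.inr (by exact_mod_cast hl)
    · rw [← one_mul (q ^ l), ← sg_one] at h
      exact Or.inl (pt_injective h0 h1 h).1
  · intro h
    rcases Int.units_eq_one_or σ with rfl | rfl
    · exact Or.inr ⟨k, by simp⟩
    · have hk : 1 ≤ k := h.resolve_left (by decide)
      obtain ⟨n, rfl⟩ := Int.eq_ofNat_of_zero_le (by omega : 0 ≤ k)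
      exact Or.inl ⟨n, by omega, by simp⟩

theorem exists_pt {x : ℝ} (hx : x ∈ Iq q) : ∃ z : ℤˣ × ℤ, InI z.1 z.2 ∧ x = sg z.1 * q ^ z.2 := by
  obtain ⟨z, hz⟩ : ∃ z : ℤˣ × ℤ, x = sg z.1 * q ^ z.2 := by
    rcases hx with ⟨k, hk, rfl⟩ | ⟨k, rfl⟩
    · exact ⟨(-1, k), by simp⟩
    · exact ⟨(1, k), by simp⟩
  exact ⟨z, (pt_mem_Iq h0 h1).1 (hz ▸ hx), hz⟩

theorem nu_pt (σ : ℤˣ) (k : ℤ) : nu q (sg σ * q ^ k) = nuZ q k := by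
  rw [nu, chi_pt h0 h1, nuZ]

theorem kappa_pt (σ : ℤˣ) (k : ℤ) : kappa (sg σ * q ^ k) = kp q σ k := by
  rw [kappa, sign_pt h0, kp, mul_pow, sg_sq, one_mul]

theorem sgnPair_pt (σ τ : ℤˣ) (k l : ℤ) : sgnPair (sg σ * q ^ k) (sg τ * q ^ l) = pairSign σ τ := by
  have hk : 0 < q ^ k := by positivity
  have hl : 0 < q ^ l := by positivity
  rcases Int.units_eq_one_or σ with rfl | rfl <;> rcases Int.units_eq_one_or τ with rfl | rfl <;>
    simp [sgnPair, pairSign, hk, hl, hk.le, hl.le, not_lt.2]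

theorem pt_div (σ τ : ℤˣ) (k l : ℤ) :
    sg σ * q ^ k / (sg τ * q ^ l) = sg (σ * τ) * q ^ (k - l) := by
  have e : (sg τ)⁻¹ = sg τ := by rcases Int.units_eq_one_or τ with rfl | rfl <;> norm_num
  rw [zpow_sub₀ h0.ne', sg_mul, mul_div_mul_comm, div_eq_mul_inv (sg σ), e]

theorem pt_mul (σ τ : ℤˣ) (k l : ℤ) :
    sg σ * q ^ k * (sg τ * q ^ l) = sg (σ * τ) * q ^ (k + l) := by
  rw [zpow_add₀ h0.ne', sg_mul]; ring

/-- The amplitude `amp` agrees with `a_p(x, y)` on `I_q`. -/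
theorem aFun_eq_amp (σ τ : ℤˣ) (π ξ η : ℤ) :
    aFun q (sg (σ * τ) * q ^ π) (sg σ * q ^ ξ) (sg τ * q ^ η) = amp q σ τ π ξ η := by
  have hq2 : q ^ 2 < 1 := by nlinarith
  have e1 : σ * (σ * τ) = τ := by rw [← mul_assoc, Int.units_mul_self, one_mul]
  rw [aFun, if_pos (by rw [pt_mul h0 h1, sign_pt h0, sign_pt h0])]
  simp only [pt_div h0 h1, pt_mul h0 h1, e1, nu_pt h0 h1, kappa_pt h0 h1, sgnPair_pt h0 h1,
    chi_pt h0 h1, sign_pt h0, abs_pt h0, Psi_eq (sq_nonneg q) hq2,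
    qPochInf_eq (sq_nonneg q) hq2]
  rw [amp, ampPref, ampR, Real.sqrt_div
    (mul_nonneg (eulerSeries_kp_nonneg h0 h1 _ _) (eulerSeries_kp_nonneg h0 h1 _ _)),
    Real.sqrt_mul (eulerSeries_kp_nonneg h0 h1 _ _)]
  have hq := h0.ne'
  have hτ := sg_ne_zero τ
  unfold wt
  congr 2
  · rw [kp, zpow_sub₀ hq, sg_mul]
    field_simp
  · rw [kp, zpow_sub₀ hq]
    field_simp
  · rw [kp, kp, zpow_sub₀ hq]
    field_simp

end

/-! ### The algebra `M_q` as the algebra of invariant operators -/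

theorem mem_graph_closure {E F : Type*} [NormedAddCommGroup E] [NormedSpace ℂ E]
    [NormedAddCommGroup F] [NormedSpace ℂ F] (T : E →ₗ.[ℂ] F) {S : Submodule ℂ (E × F)}
    (hS : IsClosed (S : Set (E × F))) (h : T.graph ≤ S) : T.closure.graph ≤ S := by
  by_cases hT : T.IsClosable
  · rw [← hT.graph_closure_eq_closure_graph]
    exact Submodule.topologicalClosure_minimal _ h hS
  · rwa [LinearPMap.closure_def' hT]

theorem commutesWith_iff {H : Type*} [NormedAddCommGroup H] [InnerProductSpace ℂ H]
    [CompleteSpace H] {x : H →L[ℂ] H} {T : H →ₗ.[ℂ] H} :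
    VonNeumannAlgebra.CommutesWith x T ↔ ∀ z ∈ T.graph, (x z.1, x z.2) ∈ T.graph := by
  constructor
  · rintro h ⟨_, _⟩ hz
    obtain ⟨v, rfl, rfl⟩ := T.mem_graph_iff.1 hz
    obtain ⟨h1, h2⟩ := h v
    exact T.mem_graph_iff.2 ⟨⟨x v, h1⟩, rfl, h2⟩
  · intro h v
    obtain ⟨w, h1, h2⟩ := T.mem_graph_iff.1 (h _ (T.mem_graph v))
    simp only at h1 h2
    refine ⟨h1 ▸ w.2, ?_⟩
    rw [← h2]
    congr 1
    exact Subtype.ext h1.symm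

theorem CommutesWith.closure {H : Type*} [NormedAddCommGroup H] [InnerProductSpace ℂ H]
    [CompleteSpace H] {x : H →L[ℂ] H} {T : H →ₗ.[ℂ] H} (h : VonNeumannAlgebra.CommutesWith x T) :
    VonNeumannAlgebra.CommutesWith x T.closure := by
  rw [commutesWith_iff] at h ⊢
  by_cases hT : T.IsClosable
  · rw [← hT.graph_closure_eq_closure_graph]
    have hc : Continuous fun z : H × H => (x z.1, x z.2) := by fun_prop
    intro z hz
    exact map_mem_closure (f := fun z : H × H => (x z.1, x z.2)) hc hz h
  · rwa [LinearPMap.closure_def' hT]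

/-- If `y` commutes with a densely defined operator, then `y*` commutes with its adjoint. -/
theorem CommutesWith.adjoint {H : Type*} [NormedAddCommGroup H] [InnerProductSpace ℂ H]
    [CompleteSpace H] {x y : H →L[ℂ] H} (hxy : ∀ v w, ⟪x v, w⟫_ℂ = ⟪v, y w⟫_ℂ) {T : H →ₗ.[ℂ] H}
    (hT : Dense (T.domain : Set H)) (h : VonNeumannAlgebra.CommutesWith y T) :
    VonNeumannAlgebra.CommutesWith x T.adjoint := by
  intro v
  have key : ∀ w : T.domain, ⟪x (T.adjoint v), (w : H)⟫_ℂ = ⟪x (v : H), T w⟫_ℂ := by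
    intro w
    obtain ⟨h1, h2⟩ := h w
    rw [hxy, hxy, ← h2]
    exact LinearPMap.adjoint_isFormalAdjoint hT v ⟨y w, h1⟩
  have hd := T.mem_adjoint_domain_of_exists (x (v : H)) ⟨_, key⟩
  exact ⟨hd, LinearPMap.adjoint_apply_eq hT ⟨_, hd⟩ key⟩

theorem delta_of_mem {q x : ℝ} (h : x ∈ Iq q) : delta q x = HilbertBasis.std (Iq q) ⟨x, h⟩ := by
  classical
  rw [delta, dif_pos h]
  have := (HilbertBasis.std (Iq q)).repr_symm_single ⟨x, h⟩
  rw [← this]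
  change _ = lp.single 2 _ _
  congr

theorem basisVec_of_not_mem {q : ℝ} (m : ℤ) {x : ℝ} (h : x ∉ Iq q) : basisVec q m x = 0 := by
  rw [basisVec, delta, dif_neg h, HTensor.tmul_zero]

/-- The basis `ζ^m ⊗ δ_p` of `H`. -/
def hBasis (q : ℝ) : HilbertBasis (ℤ × Iq q) ℂ (HSp q) :=
  fourierBasis.tensor (HilbertBasis.std (Iq q))

@[simp] theorem hBasis_apply (q : ℝ) (m : ℤ) (p : Iq q) : hBasis q (m, p) = basisVec q m p := by
  rw [hBasis, HilbertBasis.tensor_apply, basisVec, delta_of_mem p.2, coe_fourierBasis]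
  rfl

theorem inner_basisVec {q : ℝ} (n m : ℤ) (x y : ℝ) [Decidable (n = m ∧ x = y ∧ y ∈ Iq q)] :
    ⟪basisVec q n x, basisVec q m y⟫_ℂ = if n = m ∧ x = y ∧ y ∈ Iq q then 1 else 0 := by
  classical
  by_cases hx : x ∈ Iq q
  · by_cases hy : y ∈ Iq q
    · rw [← hBasis_apply q n ⟨x, hx⟩, ← hBasis_apply q m ⟨y, hy⟩, HilbertBasis.inner_eq_ite]
      simp [hy]
    · rw [basisVec_of_not_mem m hy, inner_zero_right, if_neg (by tauto)]
  · rw [basisVec_of_not_mem n hx, inner_zero_left, if_neg]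
    rintro ⟨-, rfl, h⟩
    exact hx h

@[simp] theorem shift_basisVec (q : ℝ) (k m : ℤ) (x : ℝ) :
    (hBasis q).shift k (basisVec q m x) = basisVec q (k + m) x := by
  by_cases hx : x ∈ Iq q
  · rw [← hBasis_apply q m ⟨x, hx⟩, HilbertBasis.shift_apply, hBasis_apply]
  · rw [basisVec_of_not_mem m hx, basisVec_of_not_mem _ hx, map_zero]

theorem basisVec_mem_domain (q : ℝ) (c : ℤ → ℝ → HSp q) (m : ℤ) (p : Iq q) :
    basisVec q m p ∈ (opOnE q c).domain :=
  Submodule.subset_span ⟨(m, p), rfl⟩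

theorem mem_graph_opOnE (q : ℝ) (c : ℤ → ℝ → HSp q) (m : ℤ) (p : Iq q) :
    (basisVec q m p, c m p) ∈ (opOnE q c).graph :=
  LinearPMap.mem_graph_iff _ |>.2 ⟨⟨_, basisVec_mem_domain q c m p⟩, rfl, opOnE_apply q c m p _⟩

theorem dense_domain_opOnE (q : ℝ) (c : ℤ → ℝ → HSp q) :
    Dense ((opOnE q c).domain : Set (HSp q)) := by
  have h := (hBasis q).dense_span
  have e : Set.range (hBasis q) = Set.range fun i : ℤ × Iq q => basisVec q i.1 i.2 := by
    congr 1
    ext1 i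
    exact hBasis_apply q i.1 i.2
  rw [e] at h
  exact Submodule.dense_iff_topologicalClosure_eq_top.2 h

/-- The graph of an operator on `E` is spanned by the pairs given by the basis vectors. -/
theorem graph_opOnE_le (q : ℝ) (c : ℤ → ℝ → HSp q) {S : Submodule ℂ (HSp q × HSp q)}
    (h : ∀ m (p : Iq q), (basisVec q m p, c m p) ∈ S) : (opOnE q c).graph ≤ S := by
  rintro ⟨_, _⟩ hz
  obtain ⟨⟨v, hv⟩, rfl, rfl⟩ := (LinearPMap.mem_graph_iff _).1 hz
  change (v, opOnE q c ⟨v, hv⟩) ∈ S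
  induction hv using Submodule.span_induction with
  | mem x hx =>
    obtain ⟨⟨m, p⟩, rfl⟩ := hx
    change ((basisVec q m p : HSp q), opOnE q c ⟨basisVec q m p, basisVec_mem_domain q c m p⟩) ∈ S
    rw [opOnE_apply]
    exact h m p
  | zero =>
    have : opOnE q c ⟨0, (opOnE q c).domain.zero_mem⟩ = 0 := (opOnE q c).map_zero
    rw [this]
    exact S.zero_mem
  | add x y hx hy ihx ihy =>
    have := S.add_mem (ihx ((opOnE q c).mem_graph _)) (ihy ((opOnE q c).mem_graph _))
    rwa [Prod.mk_add_mk, ← (opOnE q c).map_add] at this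
  | smul a x hx ih =>
    have := S.smul_mem a (ih ((opOnE q c).mem_graph _))
    rwa [Prod.smul_mk, ← (opOnE q c).map_smul] at this

/-- The translations commute with every operator on `E` whose values are translation covariant. -/
theorem shift_commutesWith (q : ℝ) {c : ℤ → ℝ → HSp q}
    (hc : ∀ k m p, (hBasis q).shift k (c m p) = c (k + m) p) (k : ℤ) :
    VonNeumannAlgebra.CommutesWith ((hBasis q).shift k) (opOnE q c).closure ∧
      VonNeumannAlgebra.CommutesWith ((hBasis q).shift k) (opOnE q c).closure.adjoint := by
  have h : ∀ k, VonNeumannAlgebra.CommutesWith ((hBasis q).shift k) (opOnE q c).closure := by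
    refine fun k => CommutesWith.closure (commutesWith_iff.2 ?_)
    have := graph_opOnE_le q c (S := (opOnE q c).graph.comap
      (((hBasis q).shift k : HSp q →ₗ[ℂ] HSp q).prodMap ((hBasis q).shift k : HSp q →ₗ[ℂ] HSp q)))
      fun m p => by
        have := mem_graph_opOnE q c (k + m) p
        rw [← hc, ← shift_basisVec] at this
        exact this
    exact fun z hz => this hz
  refine ⟨h k, CommutesWith.adjoint (y := (hBasis q).shift (-k))
    (fun v w => HilbertBasis.inner_shift_left ..) ?_ (h _)⟩
  exact (dense_domain_opOnE q c).mono (LinearPMap.le_closure _).1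

/-- The matrix form of the commutation of `y` with the closure of an operator on `E`; `d` plays
the role of the adjoint of the operator at the basis vector `ζ^n ⊗ δ_r`. -/
theorem inner_of_commutesWith {q : ℝ} {c : ℤ → ℝ → HSp q} {y : HSp q →L[ℂ] HSp q}
    (hy : VonNeumannAlgebra.CommutesWith y (opOnE q c).closure) {f d : HSp q}
    (hd : ∀ m (p : Iq q), ⟪f, c m p⟫_ℂ = ⟪d, basisVec q m p⟫_ℂ) (m : ℤ) (p : Iq q) :
    ⟪d, y (basisVec q m p)⟫_ℂ = ⟪f, y (c m p)⟫_ℂ := by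
  let φ : HSp q × HSp q →L[ℂ] ℂ :=
    innerSL ℂ f ∘L ContinuousLinearMap.snd ℂ _ _ - innerSL ℂ d ∘L ContinuousLinearMap.fst ℂ _ _
  have h1 : (opOnE q c).closure.graph ≤ LinearMap.ker (φ : HSp q × HSp q →ₗ[ℂ] ℂ) := by
    refine mem_graph_closure _ φ.isClosed_ker (graph_opOnE_le q c fun m p => ?_)
    change ⟪f, c m p⟫_ℂ - ⟪d, basisVec q m p⟫_ℂ = 0
    rw [hd, sub_self]
  have h2 : (basisVec q m p, c m p) ∈ (opOnE q c).closure.graph :=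
    LinearPMap.le_graph_of_le (LinearPMap.le_closure _) (mem_graph_opOnE q c m p)
  have h3 := h1 (commutesWith_iff.1 hy _ h2)
  exact (sub_eq_zero.1 h3).symm

section

set_option linter.unusedSectionVars false

variable {q : ℝ} (h0 : 0 < q) (h1 : q < 1)
include h0 h1

theorem isConvolution_of_commutesWith {y : HSp q →L[ℂ] HSp q}
    (hα : VonNeumannAlgebra.CommutesWith y (alpha0 q).closure)
    (hγ : VonNeumannAlgebra.CommutesWith y (gamma0 q).closure)
    (he : VonNeumannAlgebra.CommutesWith y (e0 q).closure)
    (hu : VonNeumannAlgebra.CommutesWith y (u0 q).closure) : (hBasis q).IsConvolution y := by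
  classical
  have pne : ∀ p : Iq q, (p : ℝ) ≠ 0 := fun p => by
    obtain ⟨z, -, hz⟩ := exists_pt h0 h1 p.2
    rw [hz]; exact pt_ne_zero h0 _ _
  -- the four relations between the matrix entries of `y`
  have rγ : ∀ n m (r p : Iq q), ((r : ℝ) : ℂ)⁻¹ * ⟪basisVec q (n - 1) r, y (basisVec q m p)⟫_ℂ =
      ((p : ℝ) : ℂ)⁻¹ * ⟪basisVec q n r, y (basisVec q (m + 1) p)⟫_ℂ := by
    intro n m r p
    have := inner_of_commutesWith hγ (f := basisVec q n r)
      (d := (((r : ℝ)⁻¹ : ℝ) : ℂ) • basisVec q (n - 1) r) (fun m p => ?_) m p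
    · rw [inner_smul_left, map_smul, inner_smul_right, Complex.conj_ofReal] at this
      simpa using this
    · rw [inner_smul_left, inner_smul_right, inner_basisVec, inner_basisVec, Complex.conj_ofReal]
      by_cases h : n - 1 = m ∧ (r : ℝ) = p
      · rw [if_pos ⟨by omega, h.2, p.2⟩, if_pos ⟨h.1, h.2, p.2⟩, h.2]
      · rw [if_neg (fun h2 => h ⟨by omega, h2.2.1⟩), if_neg (fun h2 => h ⟨h2.1, h2.2.1⟩), mul_zero,
          mul_zero]
  have re : ∀ n m (r p : Iq q), ((Real.sign r : ℝ) : ℂ) * ⟪basisVec q n r, y (basisVec q m p)⟫_ℂ =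
      ((Real.sign p : ℝ) : ℂ) * ⟪basisVec q n r, y (basisVec q m p)⟫_ℂ := by
    intro n m r p
    have := inner_of_commutesWith he (f := basisVec q n r)
      (d := ((Real.sign r : ℝ) : ℂ) • basisVec q n r) (fun m p => ?_) m p
    · rwa [inner_smul_left, map_smul, inner_smul_right, Complex.conj_ofReal] at this
    · rw [inner_smul_left, inner_smul_right, inner_basisVec, Complex.conj_ofReal]
      by_cases h : n = m ∧ (r : ℝ) = p
      · rw [h.2]
      · rw [if_neg (fun h2 => h ⟨h2.1, h2.2.1⟩), mul_zero, mul_zero]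
  have rα : ∀ n m (p p' : Iq q), (p' : ℝ) = q * p → 0 < Real.sign p + ((p : ℝ) ^ 2)⁻¹ →
      ⟪basisVec q n p, y (basisVec q m p)⟫_ℂ = ⟪basisVec q n p', y (basisVec q m p')⟫_ℂ := by
    intro n m p p' hp hpos
    have := inner_of_commutesWith hα (f := basisVec q n p')
      (d := ((Real.sqrt (Real.sign p + ((p : ℝ) ^ 2)⁻¹) : ℝ) : ℂ) • basisVec q n p)
      (fun m r => ?_) m p
    · rw [inner_smul_left, map_smul, inner_smul_right, Complex.conj_ofReal, ← hp] at this
      exact mul_left_cancel₀ (Complex.ofReal_ne_zero.2 (Real.sqrt_pos.2 hpos).ne') this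
    · rw [inner_smul_left, inner_smul_right, inner_basisVec, inner_basisVec, Complex.conj_ofReal]
      by_cases h : n = m ∧ (p : ℝ) = r
      · rw [if_pos ⟨h.1, by rw [hp, h.2], by rw [← h.2, ← hp]; exact p'.2⟩, if_pos ⟨h.1, h.2, r.2⟩,
          h.2]
      · rw [if_neg (fun h2 => h ⟨h2.1, mul_left_cancel₀ h0.ne' (hp ▸ h2.2.1)⟩),
          if_neg (fun h2 => h ⟨h2.1, h2.2.1⟩), mul_zero, mul_zero]
  have ru : ∀ n m (p p' : Iq q), (p' : ℝ) = -p →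
      ⟪basisVec q n p, y (basisVec q m p)⟫_ℂ = ⟪basisVec q n p', y (basisVec q m p')⟫_ℂ := by
    intro n m p p' hp
    have := inner_of_commutesWith hu (f := basisVec q n p') (d := basisVec q n p)
      (fun m r => ?_) m p
    · rwa [← hp] at this
    · rw [inner_basisVec, inner_basisVec]
      by_cases h : n = m ∧ (p : ℝ) = r
      · rw [if_pos ⟨h.1, by rw [hp, h.2], by rw [← h.2, ← hp]; exact p'.2⟩, if_pos ⟨h.1, h.2, r.2⟩]
      · rw [if_neg (fun h2 => h ⟨h2.1, neg_injective (hp ▸ h2.2.1)⟩),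
          if_neg (fun h2 => h ⟨h2.1, h2.2.1⟩)]
  have bound : ∀ n m (r p : Iq q), ‖⟪basisVec q n r, y (basisVec q m p)⟫_ℂ‖ ≤ ‖y‖ := by
    intro n m r p
    refine (norm_inner_le_norm _ _).trans ?_
    have hn : ∀ n (r : Iq q), ‖basisVec q n r‖ = 1 := fun n r => (orthonormal_basisVec q).1 (n, r)
    rw [hn, one_mul]
    simpa [hn] using y.le_opNorm (basisVec q m p)
  have iter : ∀ n m (r p : Iq q) (k : ℕ), ⟪basisVec q (n + k) r, y (basisVec q (m + k) p)⟫_ℂ =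
      (((p / r : ℝ) : ℂ)) ^ k * ⟪basisVec q n r, y (basisVec q m p)⟫_ℂ := by
    intro n m r p k
    induction k with
    | zero => simp
    | succ k ih =>
      have := rγ (n + k + 1) (m + k) r p
      rw [add_sub_cancel_right, ih] at this
      have hr := Complex.ofReal_ne_zero.2 (pne r)
      have hp := Complex.ofReal_ne_zero.2 (pne p)
      rw [Nat.cast_succ, ← add_assoc, ← add_assoc, pow_succ, Complex.ofReal_div]
      rw [Complex.ofReal_div] at this
      field_simp at this ⊢
      rw [← this]
  -- entries with `|r| ≠ |p|` grow geometrically in one direction, so they vanish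
  have vanish : ∀ n m (r p : Iq q), |(r : ℝ)| < |(p : ℝ)| →
      ⟪basisVec q n r, y (basisVec q m p)⟫_ℂ = 0 := by
    intro n m r p h
    by_contra hne
    have hgt : 1 < ‖((p / r : ℝ) : ℂ)‖ := by
      rw [Complex.norm_real, norm_div, Real.norm_eq_abs, Real.norm_eq_abs]
      exact (one_lt_div (abs_pos.2 (pne r))).2 h
    have ht := (tendsto_pow_atTop_atTop_of_one_lt hgt).atTop_mul_const (norm_pos_iff.2 hne)
    obtain ⟨k, hk⟩ := (ht.eventually_gt_atTop ‖y‖).exists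
    have := bound (n + k) (m + k) r p
    rw [iter, norm_mul, norm_pow] at this
    exact absurd hk (not_lt.2 this)
  have vanish' : ∀ n m (r p : Iq q), |(p : ℝ)| < |(r : ℝ)| →
      ⟪basisVec q n r, y (basisVec q m p)⟫_ℂ = 0 := by
    intro n m r p h
    by_contra hne
    have hlt : ‖((p / r : ℝ) : ℂ)‖ < 1 := by
      rw [Complex.norm_real, norm_div, Real.norm_eq_abs, Real.norm_eq_abs]
      exact (div_lt_one (abs_pos.2 (pne r))).2 h
    have ht := (tendsto_pow_atTop_nhds_zero_of_lt_one (norm_nonneg _) hlt).mul_const ‖y‖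
    rw [zero_mul] at ht
    obtain ⟨k, hk⟩ := (ht.eventually_lt_const (norm_pos_iff.2 hne)).exists
    have := iter (n - k) (m - k) r p k
    rw [sub_add_cancel, sub_add_cancel] at this
    have h2 := congrArg norm this
    rw [norm_mul, norm_pow] at h2
    refine absurd hk (not_lt.2 (h2.le.trans ?_))
    gcongr
    exact bound ..
  have diag : ∀ n m (p : Iq q), ⟪basisVec q n p, y (basisVec q m p)⟫_ℂ =
      ⟪basisVec q (n - m) p, y (basisVec q 0 p)⟫_ℂ := by
    intro n m p
    have hp := Complex.ofReal_ne_zero.2 (pne p)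
    rcases le_total 0 m with h | h
    · obtain ⟨k, rfl⟩ := Int.eq_ofNat_of_zero_le h
      have := iter (n - k) 0 p p k
      rwa [sub_add_cancel, zero_add, div_self (pne p), Complex.ofReal_one, one_pow, one_mul] at this
    · obtain ⟨k, hk⟩ := Int.eq_ofNat_of_zero_le (show 0 ≤ -m by omega)
      have := iter n m p p k
      rw [← hk, add_neg_cancel, ← sub_eq_add_neg, div_self (pne p), Complex.ofReal_one, one_pow,
        one_mul] at this
      exact this.symm
  have one_mem : (1 : ℝ) ∈ Iq q := Or.inr ⟨0, by simp⟩
  have pos_mem : ∀ k : ℤ, q ^ k ∈ Iq q := fun k => Or.inr ⟨k, rfl⟩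
  have pos : ∀ n (k : ℤ), ⟪basisVec q n (q ^ k), y (basisVec q 0 (q ^ k))⟫_ℂ =
      ⟪basisVec q n 1, y (basisVec q 0 1)⟫_ℂ := by
    intro n k
    have step : ∀ k : ℤ, ⟪basisVec q n (q ^ k), y (basisVec q 0 (q ^ k))⟫_ℂ =
        ⟪basisVec q n (q ^ (k + 1)), y (basisVec q 0 (q ^ (k + 1)))⟫_ℂ := fun k =>
      rα n 0 ⟨_, pos_mem k⟩ ⟨_, pos_mem (k + 1)⟩ (by simp [zpow_add_one₀ h0.ne', mul_comm]) (by
        have : 0 < q ^ k := by positivity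
        simp only [Real.sign_of_pos this]
        positivity)
    induction k with
    | zero => simp
    | succ k ih => rw [← step, ih]
    | pred k ih => rw [step, sub_add_cancel, ih]
  refine ⟨fun n m r p hne => ?_, fun g => ⟪basisVec q g 1, y (basisVec q 0 1)⟫_ℂ, fun n m p => ?_⟩
  · rw [hBasis_apply, hBasis_apply]
    rcases lt_trichotomy |(r : ℝ)| |(p : ℝ)| with h | h | h
    · exact vanish n m r p h
    · by_contra h2
      have := Complex.ofReal_injective (mul_right_cancel₀ h2 (re n m r p))
      rcases abs_eq_abs.1 h with h3 | h3
      · exact hne (Subtype.ext h3)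
      · rw [h3, Real.sign_neg] at this
        exact pne p (Real.sign_eq_zero_iff.1 (by linarith))
    · exact vanish' n m r p h
  · rw [hBasis_apply, hBasis_apply, diag]
    rcases p.2 with ⟨k, hk, h⟩ | ⟨k, h⟩
    · rw [ru _ _ p ⟨_, pos_mem k⟩ (by simp [h])]
      exact pos _ _
    · rw [h, pos]

theorem isInvariantAlgebra_Mq : (hBasis q).IsInvariantAlgebra (Mq q) := by
  have hstar : ∀ x : HSp q →L[ℂ] HSp q, (∀ g, x * (hBasis q).shift g = (hBasis q).shift g * x) →
      ∀ g, star x * (hBasis q).shift g = (hBasis q).shift g * star x := by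
    intro x hx g
    have := congrArg star (hx (-g))
    rw [star_mul, star_mul, HilbertBasis.star_shift, neg_neg] at this
    exact this.symm
  intro x
  constructor
  · intro hx g
    refine ((HilbertBasis.mem_commutantOf.1 hx) ((hBasis q).shift g) ?_).1.symm
    rintro T (rfl | rfl | rfl | rfl)
    · exact shift_commutesWith q (fun k m p => by rw [map_smul, shift_basisVec]) g
    · exact shift_commutesWith q (fun k m p => by rw [map_smul, shift_basisVec, add_assoc]) g
    · exact shift_commutesWith q (fun k m p => by rw [map_smul, shift_basisVec]) g
    · exact shift_commutesWith q (fun k m p => by rw [shift_basisVec]) g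
  · intro hx
    refine HilbertBasis.mem_commutantOf.2 fun y hy => ?_
    have hc : (hBasis q).IsConvolution y := isConvolution_of_commutesWith h0 h1
      (hy _ (by simp)).1 (hy _ (by simp)).1 (hy _ (by simp)).1 (hy _ (by simp)).1
    refine ⟨(hc.mul_comm hx).symm, ?_⟩
    have := congrArg star (hc.mul_comm (hstar x hx))
    rw [star_mul, star_mul, star_star] at this
    exact this

end

end QSU11

/-! ### The Hilbert basis of the vectors `F` -/

theorem Orthonormal.mem_closure_span {ι E : Type*} [NormedAddCommGroup E] [InnerProductSpace ℂ E]
    {v : ι → E} (hv : Orthonormal ℂ v) {x : E}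
    (h : HasSum (fun j => ‖⟪v j, x⟫_ℂ‖ ^ 2) (‖x‖ ^ 2)) :
    x ∈ (Submodule.span ℂ (Set.range v)).topologicalClosure := by
  have key : ∀ s : Finset ι, ‖x - ∑ j ∈ s, ⟪v j, x⟫_ℂ • v j‖ ^ 2 =
      ‖x‖ ^ 2 - ∑ j ∈ s, ‖⟪v j, x⟫_ℂ‖ ^ 2 := by
    intro s
    have e1 : ⟪∑ j ∈ s, ⟪v j, x⟫_ℂ • v j, x⟫_ℂ = ((∑ j ∈ s, ‖⟪v j, x⟫_ℂ‖ ^ 2 : ℝ) : ℂ) := by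
      rw [sum_inner, Complex.ofReal_sum]
      refine Finset.sum_congr rfl fun j _ => ?_
      rw [inner_smul_left, Complex.conj_mul', Complex.ofReal_pow]
    have e2 : ⟪∑ j ∈ s, ⟪v j, x⟫_ℂ • v j, ∑ j ∈ s, ⟪v j, x⟫_ℂ • v j⟫_ℂ =
        ((∑ j ∈ s, ‖⟪v j, x⟫_ℂ‖ ^ 2 : ℝ) : ℂ) := by
      rw [hv.inner_sum, Complex.ofReal_sum]
      refine Finset.sum_congr rfl fun j _ => ?_
      rw [Complex.conj_mul', Complex.ofReal_pow]
    rw [norm_sub_sq (𝕜 := ℂ), ← inner_conj_symm, e1, Complex.conj_ofReal, ← inner_self_eq_norm_sq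
      (𝕜 := ℂ) (∑ j ∈ s, _), e2]
    simp only [RCLike.re_to_complex, Complex.ofReal_re]
    ring
  have ht : Tendsto (fun s : Finset ι => ∑ j ∈ s, ⟪v j, x⟫_ℂ • v j) atTop (𝓝 x) := by
    rw [tendsto_iff_norm_sub_tendsto_zero]
    have h2 : Tendsto (fun s : Finset ι => ‖x - ∑ j ∈ s, ⟪v j, x⟫_ℂ • v j‖ ^ 2) atTop (𝓝 0) := by
      simp only [key]
      have := h.const_sub (‖x‖ ^ 2)
      rwa [sub_self] at this
    have h3 := h2.sqrt
    simp only [Real.sqrt_sq (norm_nonneg _), Real.sqrt_zero] at h3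
    simpa only [norm_sub_rev] using h3
  refine mem_closure_of_tendsto ht (Eventually.of_forall fun s => ?_)
  exact Submodule.sum_mem _ fun j _ => Submodule.smul_mem _ _ (Submodule.subset_span ⟨j, rfl⟩)

namespace QSU11

/-- The vector `ζ^n ⊗ δ_x` for `x = σ q^k`; it vanishes unless `x ∈ I_q`. -/
def ptVec (q : ℝ) (n : ℤ) (σ : ℤˣ) (k : ℤ) : HSp q := basisVec q n (sg σ * q ^ k)

/-- The coordinates of a nonzero real number, with `x = σ q^k` for `x ∈ I_q`. -/
def coord (q x : ℝ) : ℤˣ × ℤ := (if 0 < x then 1 else -1, chi q x)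

open Classical in
/-- The coefficient of `F_{r,s,m,p}`, with `p = ε q^π`, at a pair of points. -/
def fcoef (q : ℝ) (ε : ℤˣ) (m π : ℤ) (z : Iq q × Iq q) : ℂ :=
  if (z.2 : ℝ) = sg ε * q ^ m * z.1 then
    ((fam q ε m π (coord q z.1).1 (coord q z.1).2 : ℝ) : ℂ) else 0

/-- The unit vector that goes with the coefficient `fcoef` in `F_{r,s,m,p}`. -/
def fvec (q : ℝ) (r s π : ℤ) (z : Iq q × Iq q) : HTensor (HSp q) (HSp q) :=
  HTensor.tmul (basisVec q (r + chi q z.2 - π) z.1) (basisVec q (s - chi q z.1 + π) z.2)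

theorem orthonormal_fvec {q : ℝ} (r s π : ℤ) : Orthonormal ℂ (fvec q r s π) :=
  (HTensor.orthonormal_tmul (orthonormal_basisVec q) (orthonormal_basisVec q)).comp
    (fun z : Iq q × Iq q => ((r + chi q z.2 - π, z.1), (s - chi q z.1 + π, z.2)))
    fun z w h => by
      simp only [Prod.mk.injEq] at h
      exact Prod.ext h.1.2 h.2.2

section

set_option linter.unusedSectionVars false

variable {q : ℝ} (h0 : 0 < q) (h1 : q < 1)
include h0 h1

theorem coord_pt (σ : ℤˣ) (k : ℤ) : coord q (sg σ * q ^ k) = (σ, k) := by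
  have hk : 0 < q ^ k := by positivity
  rw [coord, chi_pt h0 h1]
  rcases Int.units_eq_one_or σ with rfl | rfl <;> simp [hk, hk.le, not_lt.2]

theorem inner_ptVec (n m : ℤ) (σ τ : ℤˣ) (k l : ℤ)
    [Decidable (n = m ∧ σ = τ ∧ k = l ∧ InI τ l)] : ⟪ptVec q n σ k, ptVec q m τ l⟫_ℂ =
      if n = m ∧ σ = τ ∧ k = l ∧ InI τ l then 1 else 0 := by
  classical
  rw [ptVec, ptVec, inner_basisVec, pt_mem_Iq h0 h1]
  refine if_congr ?_ rfl rfl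
  constructor
  · rintro ⟨h2, h3, h4⟩
    exact ⟨h2, (pt_injective h0 h1 h3).1, (pt_injective h0 h1 h3).2, h4⟩
  · rintro ⟨rfl, rfl, rfl, h4⟩
    exact ⟨rfl, rfl, h4⟩

theorem ptVec_of_not_mem (n : ℤ) {σ : ℤˣ} {k : ℤ} (h : ¬InI σ k) : ptVec q n σ k = 0 :=
  basisVec_of_not_mem n (mt (pt_mem_Iq h0 h1).1 h)

theorem pt_eq_mul_iff {ε σ τ : ℤˣ} {m ξ η : ℤ} :
    sg τ * q ^ η = sg ε * q ^ m * (sg σ * q ^ ξ) ↔ τ = ε * σ ∧ η = ξ + m := by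
  rw [pt_mul h0 h1, add_comm m]
  exact ⟨pt_injective h0 h1, fun h => by rw [h.1, h.2]⟩

open Classical in
/-- A sum over the pairs `(x, y)` in `I_q` with `y = ε q^m x` is a sum over `x`. -/
theorem hasSum_pairs {ε : ℤˣ} {m : ℤ} {h : ℤˣ × ℤ → ℂ}
    (hh : ∀ x, ¬(InI x.1 x.2 ∧ InI (ε * x.1) (x.2 + m)) → h x = 0) {a : ℂ} :
    HasSum (fun z : Iq q × Iq q => if (z.2 : ℝ) = sg ε * q ^ m * z.1 then h (coord q z.1) else 0) a ↔
      HasSum h a := by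
  have hm : ∀ x : Function.support h, InI x.1.1 x.1.2 ∧ InI (ε * x.1.1) (x.1.2 + m) := fun x => by
    by_contra h2
    exact x.2 (hh _ h2)
  refine hasSum_iff_hasSum_of_ne_zero_bij (fun x : Function.support h =>
    (⟨_, (pt_mem_Iq h0 h1).2 (hm x).1⟩, ⟨_, (pt_mem_Iq h0 h1).2 (hm x).2⟩)) ?_ ?_ ?_
  · intro x y hxy
    have := pt_injective h0 h1 (congrArg (fun z : Iq q × Iq q => (z.1 : ℝ)) hxy)
    exact Subtype.ext (Prod.ext this.1 this.2)
  · rintro ⟨⟨x, hx⟩, ⟨y, hy⟩⟩ hz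
    obtain ⟨⟨σ, ξ⟩, -, rfl⟩ := exists_pt h0 h1 hx
    obtain ⟨⟨τ, η⟩, -, rfl⟩ := exists_pt h0 h1 hy
    simp only [Function.mem_support, ne_eq, ite_eq_right_iff, Classical.not_imp, coord_pt h0 h1,
      pt_eq_mul_iff h0 h1] at hz
    obtain ⟨⟨rfl, rfl⟩, hz⟩ := hz
    exact ⟨⟨(σ, ξ), hz⟩, rfl⟩
  · rintro ⟨⟨σ, ξ⟩, hx⟩
    simp only [coord_pt h0 h1]
    rw [if_pos ((pt_eq_mul_iff h0 h1).2 ⟨rfl, rfl⟩)]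

theorem fcoef_pt (ε σ τ : ℤˣ) (m π ξ η : ℤ) (hx : sg σ * q ^ ξ ∈ Iq q) (hy : sg τ * q ^ η ∈ Iq q)
    [Decidable (τ = ε * σ ∧ η = ξ + m)] :
    fcoef q ε m π (⟨sg σ * q ^ ξ, hx⟩, ⟨sg τ * q ^ η, hy⟩) =
      if τ = ε * σ ∧ η = ξ + m then ((amp q σ τ π ξ η : ℝ) : ℂ) else 0 := by
  rw [fcoef]
  by_cases h : τ = ε * σ ∧ η = ξ + m
  · rw [if_pos h, if_pos ((pt_eq_mul_iff h0 h1).2 h)]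
    simp only [coord_pt h0 h1, h.1, h.2]
    rfl
  · rw [if_neg h, if_neg (mt (pt_eq_mul_iff h0 h1).1 h)]

theorem fvec_pt (r s π : ℤ) (σ τ : ℤˣ) (ξ η : ℤ) (hx : sg σ * q ^ ξ ∈ Iq q)
    (hy : sg τ * q ^ η ∈ Iq q) : fvec q r s π (⟨sg σ * q ^ ξ, hx⟩, ⟨sg τ * q ^ η, hy⟩) =
      HTensor.tmul (ptVec q (r + η - π) σ ξ) (ptVec q (s - ξ + π) τ η) := by
  simp only [fvec, chi_pt h0 h1]
  rfl

theorem exists_pt_pair (z : Iq q × Iq q) : ∃ (σ τ : ℤˣ) (ξ η : ℤ) (hx : sg σ * q ^ ξ ∈ Iq q)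
    (hy : sg τ * q ^ η ∈ Iq q), z = (⟨sg σ * q ^ ξ, hx⟩, ⟨sg τ * q ^ η, hy⟩) := by
  obtain ⟨⟨x, hx⟩, ⟨y, hy⟩⟩ := z
  obtain ⟨⟨σ, ξ⟩, -, rfl⟩ := exists_pt h0 h1 hx
  obtain ⟨⟨τ, η⟩, -, rfl⟩ := exists_pt h0 h1 hy
  exact ⟨σ, τ, ξ, η, hx, hy, rfl⟩

theorem summable_FVec (r s m : ℤ) {ε : ℤˣ} {π : ℤ} :
    Summable fun z : Iq q × Iq q => fcoef q ε m π z • fvec q r s π z := by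
  classical
  refine (((orthonormal_fvec r s π).orthogonalFamily.summable_iff_norm_sq_summable _).2 ?_)
  have h2 := (summable_fam_prod h0 h1 ε m π π)
  have h3 : Summable fun x : ℤˣ × ℤ => ((fam q ε m π x.1 x.2 * fam q ε m π x.1 x.2 : ℝ) : ℂ) :=
    Complex.summable_ofReal.2 h2
  obtain ⟨a, ha⟩ := h3
  have h4 := ((hasSum_pairs h0 h1 (ε := ε) (m := m) (fun x hx => by
    rw [fam_eq_zero h0 h1 (by tauto)]; simp)).2 ha).summable.norm
  refine h4.congr fun z => ?_
  change _ = ‖fcoef q ε m π z‖ ^ 2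
  unfold fcoef
  by_cases h : (z.2 : ℝ) = sg ε * q ^ m * z.1
  · rw [if_pos h, if_pos h, Complex.norm_real, Complex.norm_real, norm_mul, pow_two]
  · rw [if_neg h, if_neg h, norm_zero, zero_pow two_ne_zero]

theorem hasSum_FVec (r s m : ℤ) (ε : ℤˣ) (π : ℤ) :
    HasSum (fun z : Iq q × Iq q => fcoef q ε m π z • fvec q r s π z)
      (FVec q r s m (sg ε * q ^ π)) := by
  classical
  have := (summable_FVec h0 h1 r s m (ε := ε) (π := π)).hasSum
  convert this using 1
  rw [FVec]
  refine tsum_congr fun z => ?_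
  obtain ⟨σ, τ, ξ, η, hx, hy, rfl⟩ := exists_pt_pair h0 h1 z
  rw [fcoef_pt h0 h1, fvec_pt h0 h1]
  simp only [sign_pt h0, pt_eq_mul_iff h0 h1, pt_div h0 h1, chi_pt h0 h1]
  split_ifs with h
  · obtain ⟨rfl, rfl⟩ := h
    have := aFun_eq_amp h0 h1 σ (ε * σ) π ξ (ξ + m)
    rw [mul_mul_self_unit] at this
    rw [this, ptVec, ptVec, ← add_sub_assoc, ← sub_add]
  · rw [zero_smul]

/-- The coordinates of `F_{r,s,m,p}`. -/
theorem inner_tmul_FVec (r s m n₁ n₂ : ℤ) (ε σ τ : ℤˣ) (π ξ η : ℤ)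
    [Decidable (ε = σ * τ ∧ m = η - ξ ∧ n₁ = r + η - π ∧ n₂ = s - ξ + π)] :
    ⟪HTensor.tmul (ptVec q n₁ σ ξ) (ptVec q n₂ τ η), FVec q r s m (sg ε * q ^ π)⟫_ℂ =
      if ε = σ * τ ∧ m = η - ξ ∧ n₁ = r + η - π ∧ n₂ = s - ξ + π then
        ((amp q σ τ π ξ η : ℝ) : ℂ) else 0 := by
  classical
  by_cases hx : InI σ ξ
  swap
  · rw [ptVec_of_not_mem h0 h1 _ hx, HTensor.zero_tmul, inner_zero_left,
      amp_eq_zero h0 h1 (by tauto), Complex.ofReal_zero, ite_self]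
  by_cases hy : InI τ η
  swap
  · rw [ptVec_of_not_mem h0 h1 _ hy, HTensor.tmul_zero, inner_zero_left,
      amp_eq_zero h0 h1 (by tauto), Complex.ofReal_zero, ite_self]
  have hs := (hasSum_FVec h0 h1 r s m ε π).mapL
    (innerSL ℂ (HTensor.tmul (ptVec q n₁ σ ξ) (ptVec q n₂ τ η)))
  refine hs.unique ?_
  have hsingle := hasSum_single (f := fun z : Iq q × Iq q =>
    innerSL ℂ (HTensor.tmul (ptVec q n₁ σ ξ) (ptVec q n₂ τ η))
    (fcoef q ε m π z • fvec q r s π z))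
    ((⟨_, (pt_mem_Iq h0 h1).2 hx⟩, ⟨_, (pt_mem_Iq h0 h1).2 hy⟩) : Iq q × Iq q) ?_
  · refine Eq.subst (motive := HasSum _) (Eq.symm ?_) hsingle
    rw [fcoef_pt h0 h1, fvec_pt h0 h1, innerSL_apply_apply, inner_smul_right, HTensor.inner_tmul,
      inner_ptVec h0 h1, inner_ptVec h0 h1]
    by_cases h2 : ε = σ * τ ∧ m = η - ξ ∧ n₁ = r + η - π ∧ n₂ = s - ξ + π
    · rw [if_pos h2, if_pos ⟨by rw [h2.1, mul_comm, ← mul_assoc, Int.units_mul_self, one_mul],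
        by omega⟩, if_pos ⟨h2.2.2.1, rfl, rfl, hx⟩, if_pos ⟨h2.2.2.2, rfl, rfl, hy⟩, mul_one, mul_one]
    · rw [if_neg h2]
      by_cases hc : τ = ε * σ ∧ η = ξ + m
      · by_cases h3 : n₁ = r + η - π
        · have h4 : n₂ ≠ s - ξ + π := fun h4 => h2
            ⟨by rw [hc.1, mul_mul_self_unit], by omega, h3, h4⟩
          simp [h4]
        · simp [h3]
      · rw [if_neg hc, zero_mul]
  · intro z hz
    obtain ⟨σ', τ', ξ', η', hx', hy', rfl⟩ := exists_pt_pair h0 h1 z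
    rw [fvec_pt h0 h1, innerSL_apply_apply, inner_smul_right, HTensor.inner_tmul,
      inner_ptVec h0 h1, inner_ptVec h0 h1]
    by_cases h2 : σ = σ' ∧ ξ = ξ'
    · have h3 : ¬(n₂ = s - ξ' + π ∧ τ = τ' ∧ η = η' ∧ InI τ' η') := fun h3 => hz (by
        obtain ⟨rfl, rfl⟩ := h2
        obtain ⟨-, rfl, rfl, -⟩ := h3
        rfl)
      rw [if_neg h3, mul_zero, mul_zero]
    · have h3 : ¬(n₁ = r + η' - π ∧ σ = σ' ∧ ξ = ξ' ∧ InI σ' ξ') := fun h3 =>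
        h2 ⟨h3.2.1, h3.2.2.1⟩
      rw [if_neg h3, zero_mul, mul_zero]

theorem orthonormal_FVec : Orthonormal ℂ fun i : (ℤ × ℤ) × (ℤ × Iq q) =>
    FVec q i.1.1 i.1.2 i.2.1 i.2.2 := by
  classical
  rw [orthonormal_iff_ite]
  rintro ⟨⟨r, s⟩, ⟨m, ⟨p, hp⟩⟩⟩ ⟨⟨r', s'⟩, ⟨m', ⟨p', hp'⟩⟩⟩
  obtain ⟨⟨ε, π⟩, hI, rfl⟩ := exists_pt h0 h1 hp
  obtain ⟨⟨ε', π'⟩, hI', rfl⟩ := exists_pt h0 h1 hp'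
  simp only
  have hs := (hasSum_FVec h0 h1 r' s' m' ε' π').mapL (innerSL ℂ (FVec q r s m (sg ε * q ^ π)))
  refine hs.unique ?_
  have hterm : ∀ z : Iq q × Iq q, innerSL ℂ (FVec q r s m (sg ε * q ^ π))
      (fcoef q ε' m' π' z • fvec q r' s' π' z) =
      if (z.2 : ℝ) = sg ε' * q ^ m' * z.1 then (fun x : ℤˣ × ℤ =>
        if ε = ε' ∧ m = m' ∧ r' - π' = r - π ∧ s' + π' = s + π then
        ((fam q ε m π x.1 x.2 * fam q ε m π' x.1 x.2 : ℝ) : ℂ) else 0) (coord q z.1) else 0 := by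
    intro z
    obtain ⟨σ, τ, ξ, η, hx, hy, rfl⟩ := exists_pt_pair h0 h1 z
    rw [fcoef_pt h0 h1, fvec_pt h0 h1, innerSL_apply_apply, inner_smul_right, ← inner_conj_symm,
      inner_tmul_FVec h0 h1]
    simp only [coord_pt h0 h1, pt_eq_mul_iff h0 h1]
    by_cases hc : τ = ε' * σ ∧ η = ξ + m'
    · simp only [hc, and_self, if_true]
      by_cases hd : ε = ε' ∧ m = m' ∧ r' - π' = r - π ∧ s' + π' = s + π
      · rw [if_pos hd, if_pos ⟨by rw [mul_mul_self_unit, hd.1], by omega, by omega, by omega⟩]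
        obtain ⟨rfl, rfl, -⟩ := hd
        rw [Complex.conj_ofReal, ← Complex.ofReal_mul, mul_comm]
        rfl
      · rw [if_neg hd, if_neg, map_zero, mul_zero]
        rintro ⟨h2, h3, h4, h5⟩
        rw [mul_mul_self_unit] at h2
        exact hd ⟨h2, by omega, by omega, by omega⟩
    · rw [if_neg hc, if_neg hc, zero_mul]
  have hval : HasSum (fun x : ℤˣ × ℤ =>
        if ε = ε' ∧ m = m' ∧ r' - π' = r - π ∧ s' + π' = s + π then
        ((fam q ε m π x.1 x.2 * fam q ε m π' x.1 x.2 : ℝ) : ℂ) else 0)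
      (if ((r, s), (m, (⟨_, hp⟩ : Iq q))) = ((r', s'), (m', (⟨_, hp'⟩ : Iq q))) then 1 else 0) := by
    by_cases hd : ε = ε' ∧ m = m' ∧ r' - π' = r - π ∧ s' + π' = s + π
    · simp only [if_pos hd]
      obtain ⟨rfl, rfl, h3, h4⟩ := hd
      have h5 := (summable_fam_prod h0 h1 ε m π π').hasSum
      rw [tsum_fam_prod h0 h1, gram_eq h0 h1 ε m π π' hI] at h5
      have h6 := h5.mapL Complex.ofRealCLM
      by_cases h7 : π = π'
      · subst h7
        rw [if_pos rfl] at h6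
        rw [if_pos (by simp; omega)]
        simpa using h6
      · rw [if_neg h7] at h6
        rw [if_neg]
        · simpa using h6
        · intro h8
          simp only [Prod.mk.injEq, Subtype.mk.injEq] at h8
          exact h7 (pt_injective h0 h1 h8.2.2).2
    · simp only [if_neg hd]
      rw [if_neg]
      · exact hasSum_zero
      · intro h8
        simp only [Prod.mk.injEq, Subtype.mk.injEq] at h8
        obtain ⟨⟨rfl, rfl⟩, rfl, h9⟩ := h8
        obtain ⟨rfl, rfl⟩ := pt_injective h0 h1 h9
        exact hd ⟨rfl, rfl, rfl, rfl⟩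
  have := (hasSum_pairs h0 h1 (ε := ε') (m := m') (fun x hx => ?_)).2 hval
  · simpa only [hterm] using this
  · split_ifs with hd
    · obtain ⟨rfl, rfl, -⟩ := hd
      rw [fam_eq_zero h0 h1 (π := π) (by tauto), zero_mul, Complex.ofReal_zero]
    · rfl

/-- Parseval's equality holds for each elementary tensor, because the columns of the matrix of
amplitudes have length one. -/
theorem tmul_mem_span_FVec (n₁ n₂ : ℤ) (x y : Iq q) :
    HTensor.tmul (basisVec q n₁ x) (basisVec q n₂ y) ∈ (Submodule.span ℂ (Set.range
      fun i : (ℤ × ℤ) × (ℤ × Iq q) => FVec q i.1.1 i.1.2 i.2.1 i.2.2)).topologicalClosure := by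
  classical
  refine (orthonormal_FVec h0 h1).mem_closure_span ?_
  obtain ⟨x, hx⟩ := x
  obtain ⟨y, hy⟩ := y
  obtain ⟨⟨σ, ξ⟩, hI, rfl⟩ := exists_pt h0 h1 hx
  obtain ⟨⟨τ, η⟩, hI', rfl⟩ := exists_pt h0 h1 hy
  have hn : ‖HTensor.tmul (basisVec q n₁ (sg σ * q ^ ξ)) (basisVec q n₂ (sg τ * q ^ η))‖ = 1 := by
    rw [HTensor.norm_tmul, (orthonormal_basisVec q).1 (n₁, ⟨_, hx⟩),
      (orthonormal_basisVec q).1 (n₂, ⟨_, hy⟩), one_mul]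
  simp only
  rw [hn, one_pow]
  change HasSum (fun j : (ℤ × ℤ) × (ℤ × Iq q) => ‖⟪FVec q j.1.1 j.1.2 j.2.1 j.2.2,
    HTensor.tmul (ptVec q n₁ σ ξ) (ptVec q n₂ τ η)⟫_ℂ‖ ^ 2) 1
  have hsum : HasSum (fun π => amp q σ τ π ξ η ^ 2) 1 := by
    have e : ∀ π, amp q σ τ π ξ η = fam q (σ * τ) (η - ξ) π σ ξ := fun π => by
      unfold fam
      rw [mul_comm σ τ, mul_assoc, Int.units_mul_self, mul_one, add_sub_cancel]
    have hy : InI (σ * τ * σ) (ξ + (η - ξ)) := by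
      rw [mul_comm σ τ, mul_assoc, Int.units_mul_self, mul_one, add_sub_cancel]
      exact hI'
    simp only [e]
    have h2 := (summable_fam_sq h0 h1 (σ * τ) (η - ξ) (σ, ξ)).hasSum
    rwa [tsum_fam_sq h0 h1 _ _ hI hy] at h2
  have hm : ∀ π : Function.support fun π => amp q σ τ π ξ η ^ 2, InI (σ * τ) π := fun π => by
    by_contra h2
    refine π.2 ?_
    simp only
    rw [amp_eq_zero h0 h1 (by tauto), pow_two, zero_mul]
  refine (hasSum_iff_hasSum_of_ne_zero_bij (fun π : Function.support fun π => amp q σ τ π ξ η ^ 2 =>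
    ((n₁ - η + π, n₂ + ξ - π), (η - ξ, (⟨_, (pt_mem_Iq h0 h1).2 (hm π)⟩ : Iq q)))) ?_ ?_ ?_).2 hsum
  · intro π π' h
    simp only [Prod.mk.injEq] at h
    exact Subtype.ext (by omega)
  · rintro ⟨⟨r, s⟩, ⟨m, ⟨p, hp⟩⟩⟩ hne
    obtain ⟨⟨ε, π⟩, -, rfl⟩ := exists_pt h0 h1 hp
    rw [Function.mem_support] at hne
    simp only at hne
    rw [← inner_conj_symm, inner_tmul_FVec h0 h1] at hne
    split_ifs at hne with h2
    · obtain ⟨rfl, rfl, rfl, rfl⟩ := h2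
      refine ⟨⟨π, fun h3 => hne ?_⟩, ?_⟩
      · simpa using h3
      · simp only [Prod.mk.injEq, and_true]
        constructor <;> ring
    · simp at hne
  · intro π
    simp only
    rw [← inner_conj_symm, inner_tmul_FVec h0 h1, if_pos ⟨rfl, rfl, by ring, by ring⟩]
    simp

theorem span_FVec_dense : ⊤ ≤ (Submodule.span ℂ (Set.range
    fun i : (ℤ × ℤ) × (ℤ × Iq q) => FVec q i.1.1 i.1.2 i.2.1 i.2.2)).topologicalClosure := by
  intro v _
  refine ((hBasis q).tensor (hBasis q)).map_mem_of_isClosed (.id ℂ _)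
    (Submodule.isClosed_topologicalClosure _) (fun i => ?_) v
  rw [HilbertBasis.tensor_apply]
  obtain ⟨⟨n₁, x⟩, ⟨n₂, y⟩⟩ := i
  rw [hBasis_apply, hBasis_apply]
  exact tmul_mem_span_FVec h0 h1 n₁ n₂ x y

/-- The Hilbert basis of `H ⊗ H` that consists of the vectors `F_{r,s,m,p}`. -/
def fBasis : HilbertBasis ((ℤ × ℤ) × (ℤ × Iq q)) ℂ (HTensor (HSp q) (HSp q)) :=
  HilbertBasis.mk (orthonormal_FVec h0 h1) (span_FVec_dense h0 h1)

@[simp] theorem fBasis_apply (r s m : ℤ) (p : Iq q) :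
    fBasis h0 h1 ((r, s), (m, p)) = FVec q r s m p := by
  rw [fBasis, HilbertBasis.coe_mk]

/-- The adjoint of the isometry `ζ^m ⊗ δ_p ↦ F_{r,s,m,p}`. -/
theorem adjoint_slice_tmul (r s n₁ n₂ : ℤ) (σ τ : ℤˣ) (ξ η : ℤ) :
    ((fBasis h0 h1).slice (hBasis q) (r, s)).adjoint
      (HTensor.tmul (ptVec q n₁ σ ξ) (ptVec q n₂ τ η)) =
    ((if n₁ + n₂ = r + s + η - ξ then amp q σ τ (r + η - n₁) ξ η else 0 : ℝ) : ℂ) •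
      ptVec q (η - ξ) (σ * τ) (r + η - n₁) := by
  classical
  refine (hBasis q).ext_inner ?_
  rintro ⟨m, ⟨p, hp⟩⟩
  obtain ⟨⟨ε, π⟩, hI, rfl⟩ := exists_pt h0 h1 hp
  rw [ContinuousLinearMap.adjoint_inner_right, HilbertBasis.slice_apply, fBasis_apply, hBasis_apply,
    ← ptVec, inner_smul_right, inner_ptVec h0 h1, ← inner_conj_symm, inner_tmul_FVec h0 h1]
  by_cases h2 : ε = σ * τ ∧ m = η - ξ ∧ n₁ = r + η - π ∧ n₂ = s - ξ + π
  · have e : r + η - n₁ = π := by omega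
    rw [if_pos h2, if_pos (by omega), e, if_pos ⟨h2.2.1, h2.1, rfl, h2.1 ▸ hI⟩, mul_one,
      Complex.conj_ofReal]
  · rw [if_neg h2, map_zero]
    by_cases h3 : n₁ + n₂ = r + s + η - ξ
    · have h4 : ¬(m = η - ξ ∧ ε = σ * τ ∧ π = r + η - n₁ ∧ InI (σ * τ) (r + η - n₁)) := by
        rintro ⟨h4, h5, h6, -⟩
        exact h2 ⟨h5, h4, by omega, by omega⟩
      rw [if_neg h4, mul_zero]
    · rw [if_neg h3, Complex.ofReal_zero, zero_mul]

end

end QSU11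

/-! ### Injectivity of a convolution operator -/

namespace QSU11

section

set_option linter.unusedSectionVars false

variable {q : ℝ} (h0 : 0 < q) (h1 : q < 1)
include h0 h1

theorem al_nonneg (n i : ℤ) : 0 ≤ al q n i := by unfold al; positivity

/-- The coefficient form of `(-vS; Q)_∞ = (1 + vS) (-QvS; Q)_∞`. -/
theorem al_split (n i : ℤ) : al q n i = al q (n + 2) i + q ^ n * al q (n + 2) (i - 1) := by
  have hw : wt q (-1) i ^ 2 = (1 - (q ^ 2) ^ i) * wt q (-1) (i + 1) ^ 2 := by
    rw [wt_sq h0 h1, wt_sq h0 h1, eulerSeries_eq (norm_sq_lt_one h0 h1), mul_neg, ← kp_succ h0]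
    have e : (q ^ i) ^ 2 = (q ^ 2) ^ i := by
      rw [← zpow_natCast, ← zpow_natCast, zpow_comm]
    simp [kp, e]
  have hq := h0.ne'
  rw [al, al, al, sub_add_cancel, hw]
  have e1 : q ^ ((n + 2) * i + i * (i - 1)) = q ^ (n * i + i * (i - 1)) * (q ^ 2) ^ i := by
    rw [← zpow_natCast q 2, ← zpow_mul, ← zpow_add₀ hq]
    congr 1
    push_cast
    ring
  have e2 : q ^ (n * i + i * (i - 1)) = q ^ n * q ^ ((n + 2) * (i - 1) + (i - 1) * (i - 1 - 1)) := by
    rw [← zpow_add₀ hq]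
    congr 1
    ring
  rw [e1, ← mul_assoc (q ^ n), ← e2]
  ring

theorem summable_al_smul {E : Type*} [NormedAddCommGroup E] [NormedSpace ℝ E] [CompleteSpace E]
    (n : ℤ) {c : ℤ → E} {C : ℝ} (hC : ∀ l, ‖c l‖ ≤ C) : Summable fun i => al q n i • c i := by
  refine Summable.of_norm_bounded ((summable_al h0 h1 n).mul_right C) fun i => ?_
  rw [norm_smul, Real.norm_of_nonneg (al_nonneg h0 h1 n i)]
  exact mul_le_mul_of_nonneg_left (hC i) (al_nonneg h0 h1 n i)

theorem eq_zero_of_add_smul_succ {d : ℤ → ℂ} (hd : Tendsto d cofinite (𝓝 0)) (n : ℤ)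
    (h : ∀ l, d l + q ^ n • d (l + 1) = 0) (l : ℤ) : d l = 0 := by
  have hv : 0 < q ^ n := by positivity
  have hn : ∀ l, ‖d l‖ = q ^ n * ‖d (l + 1)‖ := fun l => by
    rw [eq_neg_of_add_eq_zero_left (h l), norm_neg, norm_smul, Real.norm_of_nonneg hv.le]
  have ht := hd.norm
  rw [norm_zero, Int.cofinite_eq, tendsto_sup] at ht
  refine norm_le_zero_iff.1 ?_
  rcases le_total (q ^ n) 1 with h2 | h2
  · exact (monotone_int_of_le_succ fun l => by
      rw [hn l]; exact mul_le_of_le_one_left (norm_nonneg _) h2).ge_of_tendsto ht.2 l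
  · exact (antitone_int_of_succ_le (f := fun l => ‖d l‖) fun l => by
      simp only [hn l]; exact le_mul_of_one_le_left (norm_nonneg _) h2).ge_of_tendsto ht.1 l

theorem sum_al_add_two {c : ℤ → ℂ} {C : ℝ} (hC : ∀ l, ‖c l‖ ≤ C) (hc : Tendsto c cofinite (𝓝 0))
    (n : ℤ) (h : ∀ l, ∑' i, al q n i • c (l + i) = 0) (l : ℤ) :
    ∑' i, al q (n + 2) i • c (l + i) = 0 := by
  have hs : ∀ n l, Summable fun i => al q n i • c (l + i) := fun n l =>
    summable_al_smul h0 h1 n fun i => hC (l + i)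
  refine eq_zero_of_add_smul_succ h0 h1 (d := fun l => ∑' i, al q (n + 2) i • c (l + i)) ?_ n
    (fun l => ?_) l
  · have := tendsto_tsum_of_dominated_convergence (𝓕 := cofinite) (g := fun _ : ℤ => (0 : ℂ))
      (f := fun l i => al q (n + 2) i • c (l + i)) ((summable_al h0 h1 (n + 2)).mul_right C)
      (fun i => ?_) (Eventually.of_forall fun l i => ?_)
    · simpa using this
    · have h2 : Tendsto (fun l : ℤ => c (l + i)) cofinite (𝓝 0) :=
        hc.comp (add_left_injective i).tendsto_cofinite
      simpa using h2.const_smul (al q (n + 2) i)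
    · rw [norm_smul, Real.norm_of_nonneg (al_nonneg h0 h1 _ i)]
      exact mul_le_mul_of_nonneg_left (hC _) (al_nonneg h0 h1 _ i)
  · have e : ∑' i, q ^ n • al q (n + 2) (i - 1) • c (l + i) =
        q ^ n • ∑' i, al q (n + 2) i • c (l + 1 + i) := by
      rw [← tsum_const_smul'']
      rw [← (Equiv.addRight (1 : ℤ)).tsum_eq]
      refine tsum_congr fun i => ?_
      simp only [Equiv.coe_addRight, add_sub_cancel_right]
      rw [add_assoc, add_comm 1 i]
    have hs2 : Summable fun i => q ^ n • al q (n + 2) (i - 1) • c (l + i) := by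
      have := ((hs (n + 2) (l + 1)).const_smul (q ^ n))
      rw [← (Equiv.addRight (1 : ℤ)).summable_iff]
      refine this.congr fun i => ?_
      simp only [Function.comp, Equiv.coe_addRight, add_sub_cancel_right]
      rw [add_assoc, add_comm 1 i]
    rw [← h l, ← e, ← (hs (n + 2) l).tsum_add hs2]
    refine tsum_congr fun i => ?_
    rw [al_split h0 h1 n i, add_smul, mul_smul]

/-- The convolution operator with symbol `(-vS; Q)_∞` is injective on the sequences that tend to
zero. -/
theorem eq_zero_of_sum_al {c : ℤ → ℂ} {C : ℝ} (hC : ∀ l, ‖c l‖ ≤ C) (hc : Tendsto c cofinite (𝓝 0))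
    (n : ℤ) (h : ∀ l, ∑' i, al q n i • c (l + i) = 0) (l : ℤ) : c l = 0 := by
  have h2 : ∀ k : ℕ, ∀ l, ∑' i, al q (n + 2 * k) i • c (l + i) = 0 := by
    intro k
    induction k with
    | zero => simpa using h
    | succ k ih =>
      have := sum_al_add_two h0 h1 hC hc _ ih
      simpa only [Nat.cast_succ, mul_add, mul_one, add_assoc] using this
  have e : ∀ (k : ℕ) i, al q (n + 2 * k) i = ((q ^ 2) ^ i) ^ k * al q n i := fun k i => by
    rw [al, al, ← mul_assoc]
    congr 1
    rw [← zpow_natCast q 2, ← zpow_natCast, ← zpow_mul, ← zpow_mul, ← zpow_add₀ h0.ne']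
    congr 1
    push_cast
    ring
  have hlim := tendsto_tsum_of_dominated_convergence (𝓕 := atTop)
    (f := fun (k : ℕ) i => al q (n + 2 * k) i • c (l + i))
    (g := fun i : ℤ => if i = 0 then al q n 0 • c l else 0) ((summable_al h0 h1 n).mul_right C)
    (fun i => ?_) (Eventually.of_forall fun k i => ?_)
  · simp only [h2, tsum_ite_eq] at hlim
    have h3 := tendsto_nhds_unique hlim tendsto_const_nhds
    refine (smul_eq_zero.1 h3).resolve_left ?_
    have : 0 < wt q (-1) (0 + 1) := wt_pos h0 h1 (Or.inr (by norm_num))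
    unfold al
    positivity
  · split_ifs with hi
    · subst hi
      simp [e]
    · rcases lt_or_gt_of_ne hi with hi | hi
      · simp [al_eq_zero h0 h1 hi]
      · have h3 : Tendsto (fun k : ℕ => ((q ^ 2) ^ i) ^ k) atTop (𝓝 0) := by
          refine tendsto_pow_atTop_nhds_zero_of_lt_one (by positivity) ?_
          lift i to ℕ using hi.le
          rw [zpow_natCast]
          exact pow_lt_one₀ (by positivity) (by nlinarith) (by omega)
        simp only [e]
        simpa using (h3.mul_const (al q n i)).smul_const (c (l + i))
  · rw [norm_smul, Real.norm_of_nonneg (al_nonneg h0 h1 _ i)]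
    refine mul_le_mul ?_ (hC _) (norm_nonneg _) (al_nonneg h0 h1 n i)
    rcases lt_or_ge i 0 with hi | hi
    · rw [al_eq_zero h0 h1 hi, al_eq_zero h0 h1 hi]
    · rw [e]
      refine mul_le_of_le_one_left (al_nonneg h0 h1 n i) (pow_le_one₀ (by positivity) ?_)
      lift i to ℕ using hi
      rw [zpow_natCast]
      exact pow_le_one₀ (by positivity) (by nlinarith)

end

end QSU11

/-! ### Slices of a tensor product of Hilbert spaces -/

section TensorSlices

set_option linter.unusedSectionVars false

variable {I Λ κ : Type*} {K L E : Type*}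
  [NormedAddCommGroup K] [InnerProductSpace ℂ K] [CompleteSpace K]
  [NormedAddCommGroup L] [InnerProductSpace ℂ L] [CompleteSpace L]
  [NormedAddCommGroup E] [InnerProductSpace ℂ E] [CompleteSpace E]

namespace HilbertBasis

variable (c : HilbertBasis (I × Λ) ℂ K) (b : HilbertBasis Λ ℂ L) (d : HilbertBasis κ ℂ E)

/-- The basis of `K ⊗ E` whose slices are those of the basis `c` of `K`, tensored with `E`. -/
def tensorRight : HilbertBasis (I × (Λ × κ)) ℂ (HTensor K E) :=
  (c.tensor d).reindex (Equiv.prodAssoc I Λ κ).symm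

/-- The basis of `E ⊗ K` whose slices are those of the basis `c` of `K`, tensored with `E`. -/
def tensorLeft : HilbertBasis (I × (κ × Λ)) ℂ (HTensor E K) :=
  (d.tensor c).reindex ((Equiv.prodAssoc I κ Λ).symm.trans
    (((Equiv.prodComm I κ).prodCongr (Equiv.refl Λ)).trans (Equiv.prodAssoc κ I Λ)))

@[simp] theorem tensorRight_apply (i : I) (l : Λ) (k : κ) :
    c.tensorRight d (i, (l, k)) = HTensor.tmul (c (i, l)) (d k) := by
  simp [tensorRight]

@[simp] theorem tensorLeft_apply (i : I) (l : Λ) (k : κ) :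
    c.tensorLeft d (i, (k, l)) = HTensor.tmul (d k) (c (i, l)) := by
  simp [tensorLeft]

theorem slice_tensorRight (i : I) (v : L) (w : E) :
    (c.tensorRight d).slice (b.tensor d) i (HTensor.tmul v w) = HTensor.tmul (c.slice b i v) w := by
  have h : ∀ k, (c.tensorRight d).slice (b.tensor d) i ∘L HTensor.tmulR (d k) =
      HTensor.tmulR (d k) ∘L c.slice b i := fun k => b.clm_ext fun l => by
    have := (c.tensorRight d).slice_apply (b.tensor d) i (l, k)
    rw [tensor_apply] at this
    simp [this]
  have h2 : (c.tensorRight d).slice (b.tensor d) i ∘L HTensor.tmulL v =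
      HTensor.tmulL (c.slice b i v) := d.clm_ext fun k =>
    congrArg (fun f : L →L[ℂ] HTensor K E => f v) (h k)
  exact congrArg (fun f : E →L[ℂ] HTensor K E => f w) h2

theorem slice_tensorLeft (i : I) (v : L) (w : E) :
    (c.tensorLeft d).slice (d.tensor b) i (HTensor.tmul w v) = HTensor.tmul w (c.slice b i v) := by
  have h : ∀ k, (c.tensorLeft d).slice (d.tensor b) i ∘L HTensor.tmulL (d k) =
      HTensor.tmulL (d k) ∘L c.slice b i := fun k => b.clm_ext fun l => by
    have := (c.tensorLeft d).slice_apply (d.tensor b) i (k, l)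
    rw [tensor_apply] at this
    simp [this]
  have h2 : (c.tensorLeft d).slice (d.tensor b) i ∘L HTensor.tmulR v =
      HTensor.tmulR (c.slice b i v) := d.clm_ext fun k =>
    congrArg (fun f : L →L[ℂ] HTensor E K => f v) (h k)
  exact congrArg (fun f : E →L[ℂ] HTensor E K => f w) h2

theorem adjoint_slice_tensorRight (i : I) (u : K) (w : E) :
    ((c.tensorRight d).slice (b.tensor d) i).adjoint (HTensor.tmul u w) =
      HTensor.tmul ((c.slice b i).adjoint u) w :=
  HTensor.ext_inner fun v w' => by
    rw [ContinuousLinearMap.adjoint_inner_right, slice_tensorRight, HTensor.inner_tmul,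
      HTensor.inner_tmul, ContinuousLinearMap.adjoint_inner_right]

theorem adjoint_slice_tensorLeft (i : I) (u : K) (w : E) :
    ((c.tensorLeft d).slice (d.tensor b) i).adjoint (HTensor.tmul w u) =
      HTensor.tmul w ((c.slice b i).adjoint u) :=
  HTensor.ext_inner fun w' v => by
    rw [ContinuousLinearMap.adjoint_inner_right, slice_tensorLeft, HTensor.inner_tmul,
      HTensor.inner_tmul, ContinuousLinearMap.adjoint_inner_right]

theorem ext_slice_tensorRight {f g : HTensor K E →L[ℂ] HTensor K E}
    (h : ∀ i v w, f (HTensor.tmul (c.slice b i v) w) = g (HTensor.tmul (c.slice b i v) w)) :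
    f = g :=
  HTensor.clm_ext fun u w => congrArg (fun F : K →L[ℂ] HTensor K E => F u)
    (c.ext_slice b (f := f ∘L HTensor.tmulR w) (g := g ∘L HTensor.tmulR w) fun i v => h i v w)

theorem ext_slice_tensorLeft {f g : HTensor E K →L[ℂ] HTensor E K}
    (h : ∀ i v w, f (HTensor.tmul w (c.slice b i v)) = g (HTensor.tmul w (c.slice b i v))) :
    f = g :=
  HTensor.clm_ext fun w u => congrArg (fun F : K →L[ℂ] HTensor E K => F u)
    (c.ext_slice b (f := f ∘L HTensor.tmulL w) (g := g ∘L HTensor.tmulL w) fun i v => h i v w)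

theorem ampl_tensorRight_map (x : L →L[ℂ] L) (y : E →L[ℂ] E) :
    (c.tensorRight d).ampl (b.tensor d) (HTensor.map x y) = HTensor.map (c.ampl b x) y :=
  c.ext_slice_tensorRight b fun i v w => by
    rw [← slice_tensorRight, ampl_slice, slice_tensorRight, HTensor.map_tmul, HTensor.map_tmul,
      slice_tensorRight, ampl_slice]

theorem ampl_tensorLeft_map (x : L →L[ℂ] L) (y : E →L[ℂ] E) :
    (c.tensorLeft d).ampl (d.tensor b) (HTensor.map y x) = HTensor.map y (c.ampl b x) :=
  c.ext_slice_tensorLeft b fun i v w => by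
    rw [← slice_tensorLeft, ampl_slice, slice_tensorLeft, HTensor.map_tmul, HTensor.map_tmul,
      slice_tensorLeft, ampl_slice]

end HilbertBasis

end TensorSlices

/-- The restriction of a `*`-homomorphism to von Neumann algebras. -/
def VonNeumannAlgebra.restrictHom {L K : Type*}
    [NormedAddCommGroup K] [InnerProductSpace ℂ K] [CompleteSpace K]
    [NormedAddCommGroup L] [InnerProductSpace ℂ L] [CompleteSpace L]
    {M : VonNeumannAlgebra L} {N : VonNeumannAlgebra K} (φ : (L →L[ℂ] L) →⋆ₐ[ℂ] (K →L[ℂ] K))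
    (h : ∀ x ∈ M, φ x ∈ N) : M.toStarSubalgebra →⋆ₐ[ℂ] N.toStarSubalgebra :=
  StarAlgHom.codRestrict (φ.comp M.toStarSubalgebra.subtype) N.toStarSubalgebra fun x => h x x.2

/-! ### The comultiplication -/

namespace QSU11

open VonNeumannAlgebra HilbertBasis

section

set_option linter.unusedSectionVars false

variable {q : ℝ} (h0 : 0 < q) (h1 : q < 1)
include h0 h1

/-- The isometry `H → H ⊗ H` that maps `ζ^m ⊗ δ_p` to `F_{r,s,m,p}`. -/
def fIso (i : ℤ × ℤ) : HSp q →L[ℂ] HTensor (HSp q) (HSp q) :=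
  (fBasis h0 h1).slice (hBasis q) i

theorem map_shift_FVec (g g' r s m : ℤ) (p : Iq q) :
    HTensor.map ((hBasis q).shift g) ((hBasis q).shift g') (FVec q r s m p) =
      FVec q (g + r) (g' + s) m p := by
  obtain ⟨p, hp⟩ := p
  obtain ⟨⟨ε, π⟩, -, rfl⟩ := exists_pt h0 h1 hp
  have h := (hasSum_FVec h0 h1 r s m ε π).mapL
    (HTensor.map ((hBasis q).shift g) ((hBasis q).shift g'))
  refine h.unique ?_
  convert hasSum_FVec h0 h1 (g + r) (g' + s) m ε π using 2 with z
  rw [map_smul, fvec, fvec, HTensor.map_tmul, shift_basisVec, shift_basisVec]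
  simp only [add_assoc, add_sub_assoc]

theorem map_shift_fIso (g g' r s : ℤ) (v : HSp q) :
    HTensor.map ((hBasis q).shift g) ((hBasis q).shift g') (fIso h0 h1 (r, s) v) =
      fIso h0 h1 (g + r, g' + s) v := by
  have h : HTensor.map ((hBasis q).shift g) ((hBasis q).shift g') ∘L fIso h0 h1 (r, s) =
      fIso h0 h1 (g + r, g' + s) := (hBasis q).clm_ext fun ⟨m, p⟩ => by
    rw [ContinuousLinearMap.comp_apply, fIso, fIso, slice_apply, slice_apply, fBasis_apply,
      fBasis_apply, map_shift_FVec h0 h1]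
  exact congrArg (fun f : HSp q →L[ℂ] HTensor (HSp q) (HSp q) => f v) h

theorem isInvariantAlgebra_tensor_Mq : ((hBasis q).prodTensor (hBasis q)).IsInvariantAlgebra
    (tensor (Mq q) (Mq q)) :=
  (isInvariantAlgebra_Mq h0 h1).tensor (isInvariantAlgebra_Mq h0 h1)

/-- Multiplication by `ζ^g ⊗ ζ^g'` maps the slices of the basis `F` to each other, so that every
amplification commutes with it. -/
theorem ampl_mem_tensor (x : HSp q →L[ℂ] HSp q) :
    (fBasis h0 h1).ampl (hBasis q) x ∈ tensor (Mq q) (Mq q) := by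
  rw [isInvariantAlgebra_tensor_Mq h0 h1]
  rintro ⟨g, g'⟩
  rw [shift_prodTensor]
  refine (fBasis h0 h1).ext_slice (hBasis q) fun ⟨r, s⟩ v => ?_
  simp only [mul_apply_eq_comp]
  have := map_shift_fIso h0 h1 g g' r s
  simp only [fIso] at this
  rw [this, ampl_slice, ampl_slice, this]

theorem ampl_tensorRight_mem {x : HTensor (HSp q) (HSp q) →L[ℂ] HTensor (HSp q) (HSp q)}
    (hx : x ∈ tensor (Mq q) (Mq q)) :
    ((fBasis h0 h1).tensorRight (hBasis q)).ampl ((hBasis q).tensor (hBasis q)) x ∈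
      tensor (tensor (Mq q) (Mq q)) (Mq q) := by
  rw [(isInvariantAlgebra_tensor_Mq h0 h1).tensor (isInvariantAlgebra_Mq h0 h1)]
  rintro ⟨⟨g, g'⟩, k⟩
  have hc := (isInvariantAlgebra_tensor_Mq h0 h1 x).1 hx (0, k)
  rw [shift_prodTensor, shift_zero] at hc
  have hs : ∀ (r s : ℤ) (z : HTensor (HSp q) (HSp q)),
      HTensor.map (HTensor.map ((hBasis q).shift g) ((hBasis q).shift g')) ((hBasis q).shift k)
        (((fBasis h0 h1).tensorRight (hBasis q)).slice ((hBasis q).tensor (hBasis q)) (r, s) z) =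
      ((fBasis h0 h1).tensorRight (hBasis q)).slice ((hBasis q).tensor (hBasis q)) (g + r, g' + s)
        (HTensor.map 1 ((hBasis q).shift k) z) := fun r s z => by
    have e : HTensor.map (HTensor.map ((hBasis q).shift g) ((hBasis q).shift g'))
        ((hBasis q).shift k) ∘L
        ((fBasis h0 h1).tensorRight (hBasis q)).slice ((hBasis q).tensor (hBasis q)) (r, s) =
      ((fBasis h0 h1).tensorRight (hBasis q)).slice ((hBasis q).tensor (hBasis q)) (g + r, g' + s)
        ∘L HTensor.map 1 ((hBasis q).shift k) := HTensor.clm_ext fun v w => by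
      rw [ContinuousLinearMap.comp_apply, ContinuousLinearMap.comp_apply, slice_tensorRight,
        HTensor.map_tmul, HTensor.map_tmul, slice_tensorRight, one_apply_eq_self]
      exact congrArg (HTensor.tmul · _) (map_shift_fIso h0 h1 g g' r s v)
    exact congrArg (fun f : HTensor (HSp q) (HSp q) →L[ℂ] _ => f z) e
  rw [shift_prodTensor, shift_prodTensor]
  refine ((fBasis h0 h1).tensorRight (hBasis q)).ext_slice ((hBasis q).tensor (hBasis q))
    fun ⟨r, s⟩ v => ?_
  simp only [mul_apply_eq_comp]
  rw [hs, ampl_slice, ampl_slice, hs]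
  exact congrArg _ (congrArg (fun f : HTensor (HSp q) (HSp q) →L[ℂ] _ => f v) hc)

theorem ampl_tensorLeft_mem {x : HTensor (HSp q) (HSp q) →L[ℂ] HTensor (HSp q) (HSp q)}
    (hx : x ∈ tensor (Mq q) (Mq q)) :
    ((fBasis h0 h1).tensorLeft (hBasis q)).ampl ((hBasis q).tensor (hBasis q)) x ∈
      tensor (Mq q) (tensor (Mq q) (Mq q)) := by
  rw [(isInvariantAlgebra_Mq h0 h1).tensor (isInvariantAlgebra_tensor_Mq h0 h1)]
  rintro ⟨k, ⟨g, g'⟩⟩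
  have hc := (isInvariantAlgebra_tensor_Mq h0 h1 x).1 hx (k, 0)
  rw [shift_prodTensor, shift_zero] at hc
  have hs : ∀ (r s : ℤ) (z : HTensor (HSp q) (HSp q)),
      HTensor.map ((hBasis q).shift k) (HTensor.map ((hBasis q).shift g) ((hBasis q).shift g'))
        (((fBasis h0 h1).tensorLeft (hBasis q)).slice ((hBasis q).tensor (hBasis q)) (r, s) z) =
      ((fBasis h0 h1).tensorLeft (hBasis q)).slice ((hBasis q).tensor (hBasis q)) (g + r, g' + s)
        (HTensor.map ((hBasis q).shift k) 1 z) := fun r s z => by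
    have e : HTensor.map ((hBasis q).shift k)
        (HTensor.map ((hBasis q).shift g) ((hBasis q).shift g')) ∘L
        ((fBasis h0 h1).tensorLeft (hBasis q)).slice ((hBasis q).tensor (hBasis q)) (r, s) =
      ((fBasis h0 h1).tensorLeft (hBasis q)).slice ((hBasis q).tensor (hBasis q)) (g + r, g' + s)
        ∘L HTensor.map ((hBasis q).shift k) 1 := HTensor.clm_ext fun v w => by
      rw [ContinuousLinearMap.comp_apply, ContinuousLinearMap.comp_apply, slice_tensorLeft,
        HTensor.map_tmul, HTensor.map_tmul, slice_tensorLeft, one_apply_eq_self]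
      exact congrArg (HTensor.tmul _) (map_shift_fIso h0 h1 g g' r s w)
    exact congrArg (fun f : HTensor (HSp q) (HSp q) →L[ℂ] _ => f z) e
  rw [shift_prodTensor, shift_prodTensor]
  refine ((fBasis h0 h1).tensorLeft (hBasis q)).ext_slice ((hBasis q).tensor (hBasis q))
    fun ⟨r, s⟩ v => ?_
  simp only [mul_apply_eq_comp]
  rw [hs, ampl_slice, ampl_slice, hs]
  exact congrArg _ (congrArg (fun f : HTensor (HSp q) (HSp q) →L[ℂ] _ => f v) hc)

/-- The comultiplication `Δ`. -/
def comul : (Mq q).toStarSubalgebra →⋆ₐ[ℂ] (tensor (Mq q) (Mq q)).toStarSubalgebra :=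
  restrictHom ((fBasis h0 h1).ampl (hBasis q)) fun x _ => ampl_mem_tensor h0 h1 x

/-- The homomorphism `Δ ⊗ ι`. -/
def comulLeft : (tensor (Mq q) (Mq q)).toStarSubalgebra →⋆ₐ[ℂ]
    (tensor (tensor (Mq q) (Mq q)) (Mq q)).toStarSubalgebra :=
  restrictHom (((fBasis h0 h1).tensorRight (hBasis q)).ampl ((hBasis q).tensor (hBasis q)))
    fun _ hx => ampl_tensorRight_mem h0 h1 hx

/-- The homomorphism `ι ⊗ Δ`. -/
def comulRight : (tensor (Mq q) (Mq q)).toStarSubalgebra →⋆ₐ[ℂ]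
    (tensor (Mq q) (tensor (Mq q) (Mq q))).toStarSubalgebra :=
  restrictHom (((fBasis h0 h1).tensorLeft (hBasis q)).ampl ((hBasis q).tensor (hBasis q)))
    fun _ hx => ampl_tensorLeft_mem h0 h1 hx

theorem isNormalHom_comul : IsNormalHom (comul h0 h1) :=
  isNormalHom_of_ampl _ _ _ fun _ => rfl

theorem comul_injective : Function.Injective (comul h0 h1) := fun _ _ h =>
  Subtype.ext ((fBasis h0 h1).ampl_injective (hBasis q) (congrArg Subtype.val h))

theorem isTensorHom_comulLeft :
    IsTensorHom (comul h0 h1) (StarAlgHom.id ℂ (Mq q).toStarSubalgebra) (comulLeft h0 h1) :=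
  ⟨isNormalHom_of_ampl _ _ _ fun _ => rfl, fun _ _ =>
    Subtype.ext ((fBasis h0 h1).ampl_tensorRight_map (hBasis q) (hBasis q) _ _)⟩

theorem isTensorHom_comulRight :
    IsTensorHom (StarAlgHom.id ℂ (Mq q).toStarSubalgebra) (comul h0 h1) (comulRight h0 h1) :=
  ⟨isNormalHom_of_ampl _ _ _ fun _ => rfl, fun _ _ =>
    Subtype.ext ((fBasis h0 h1).ampl_tensorLeft_map (hBasis q) (hBasis q) _ _)⟩

/-- The unitary `V` that maps `F_{r,s,m,p}` to `ζ^r ⊗ ζ^s ⊗ ζ^m ⊗ δ_p`. -/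
def unitaryV : HTensor (HSp q) (HSp q) ≃ₗᵢ[ℂ] HTensor L2T (HTensor L2T (HSp q)) :=
  (fBasis h0 h1).equiv ((fourierBasis.tensor (fourierBasis.tensor (hBasis q))).reindex
    (Equiv.prodAssoc ℤ ℤ (ℤ × Iq q)))

theorem unitaryV_FVec (r s m : ℤ) (p : Iq q) : unitaryV h0 h1 (FVec q r s m p) =
    HTensor.tmul (zeta r) (HTensor.tmul (zeta s) (basisVec q m p)) := by
  rw [← fBasis_apply h0 h1, unitaryV, equiv_apply]
  simp [zeta, coe_fourierBasis]

theorem unitaryV_fIso (r s : ℤ) (v : HSp q) : unitaryV h0 h1 (fIso h0 h1 (r, s) v) =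
    HTensor.tmul (zeta r) (HTensor.tmul (zeta s) v) := by
  have h : (unitaryV h0 h1).toContinuousLinearEquiv.toContinuousLinearMap ∘L fIso h0 h1 (r, s) =
      HTensor.tmulL (zeta r) ∘L HTensor.tmulL (zeta s) := (hBasis q).clm_ext fun ⟨m, p⟩ => by
    rw [ContinuousLinearMap.comp_apply, fIso, slice_apply, fBasis_apply, hBasis_apply]
    exact unitaryV_FVec h0 h1 r s m p
  exact congrArg (fun f : HSp q →L[ℂ] _ => f v) h

theorem comul_apply (a : (Mq q).toStarSubalgebra) (v : HTensor (HSp q) (HSp q)) :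
    (comul h0 h1 a : HTensor (HSp q) (HSp q) →L[ℂ] HTensor (HSp q) (HSp q)) v =
      (unitaryV h0 h1).symm (HTensor.map 1 (HTensor.map 1 (a : HSp q →L[ℂ] HSp q))
        (unitaryV h0 h1 v)) := by
  have h : (fBasis h0 h1).ampl (hBasis q) a =
      (unitaryV h0 h1).symm.toContinuousLinearEquiv.toContinuousLinearMap ∘L
        HTensor.map 1 (HTensor.map 1 (a : HSp q →L[ℂ] HSp q)) ∘L
        (unitaryV h0 h1).toContinuousLinearEquiv.toContinuousLinearMap := by
    refine (fBasis h0 h1).ext_slice (hBasis q) fun ⟨r, s⟩ w => ?_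
    rw [ampl_slice]
    change _ = (unitaryV h0 h1).symm (HTensor.map 1 (HTensor.map 1 (a : HSp q →L[ℂ] HSp q))
      (unitaryV h0 h1 (fIso h0 h1 (r, s) w)))
    rw [LinearIsometryEquiv.eq_symm_apply, unitaryV_fIso, HTensor.map_tmul, HTensor.map_tmul,
      one_apply_eq_self, one_apply_eq_self]
    exact unitaryV_fIso h0 h1 r s _
  exact congrArg (fun f : HTensor (HSp q) (HSp q) →L[ℂ] _ => f v) h

end

end QSU11

/-! ### Coassociativity -/

namespace QSU11

open VonNeumannAlgebra HilbertBasis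

section

set_option linter.unusedSectionVars false

variable {q : ℝ} (h0 : 0 < q) (h1 : q < 1)
include h0 h1

/-- The isometry `F_{r,s} ⊗ 1 : H ⊗ H → (H ⊗ H) ⊗ H`, where `F_{r,s}` stands for `fIso`. -/
def fIsoLeft (i : ℤ × ℤ) : HTensor (HSp q) (HSp q) →L[ℂ] HTensor (HTensor (HSp q) (HSp q)) (HSp q) :=
  ((fBasis h0 h1).tensorRight (hBasis q)).slice ((hBasis q).tensor (hBasis q)) i

/-- The isometry `1 ⊗ F_{r,s} : H ⊗ H → H ⊗ (H ⊗ H)`, where `F_{r,s}` stands for `fIso`. -/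
def fIsoRight (i : ℤ × ℤ) :
    HTensor (HSp q) (HSp q) →L[ℂ] HTensor (HSp q) (HTensor (HSp q) (HSp q)) :=
  ((fBasis h0 h1).tensorLeft (hBasis q)).slice ((hBasis q).tensor (hBasis q)) i

/-- The `i`-th term of the vector `intertwiner`, written with the isometries `F ⊗ 1`. -/
def leftTerm (r s r' s' : ℤ) (w : HSp q) (i : ℤ) : HTensor (HTensor (HSp q) (HSp q)) (HSp q) :=
  ((al q (r' + 1) i : ℝ) : ℂ) • fIsoLeft h0 h1 (r + i, s - i)
    (fIso h0 h1 (r', s' + i) ((hBasis q).shift (-i) w))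

/-- The `i`-th term of the image of `intertwiner` in `H ⊗ (H ⊗ H)`, written with the isometries
`1 ⊗ F`. -/
def rightTerm (r s r' s' : ℤ) (w : HSp q) (i : ℤ) : HTensor (HSp q) (HTensor (HSp q) (HSp q)) :=
  ((al q (r' + 1) i : ℝ) : ℂ) • fIsoRight h0 h1 (s + r' + i, s' - i)
    (fIso h0 h1 (r - i, -r') ((hBasis q).shift (r' + i) w))

theorem summable_leftTerm (r s r' s' : ℤ) (w : HSp q) :
    Summable (leftTerm h0 h1 r s r' s' w) := by
  refine Summable.of_norm_bounded ((summable_al h0 h1 (r' + 1)).mul_right ‖w‖) fun i => ?_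
  rw [leftTerm, fIsoLeft, fIso, norm_smul, norm_slice_apply, norm_slice_apply, norm_shift_apply,
    Complex.norm_real, Real.norm_of_nonneg (al_nonneg h0 h1 _ i)]

theorem summable_rightTerm (r s r' s' : ℤ) (w : HSp q) :
    Summable (rightTerm h0 h1 r s r' s' w) := by
  refine Summable.of_norm_bounded ((summable_al h0 h1 (r' + 1)).mul_right ‖w‖) fun i => ?_
  rw [rightTerm, fIsoRight, fIso, norm_smul, norm_slice_apply, norm_slice_apply, norm_shift_apply,
    Complex.norm_real, Real.norm_of_nonneg (al_nonneg h0 h1 _ i)]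

/-- For fixed `r, s, r', s'`, an operator from `H` to `(H ⊗ H) ⊗ H` that intertwines every
`x ∈ M_q` with `(Δ ⊗ ι) Δ x`. -/
def intertwiner (r s r' s' : ℤ) (w : HSp q) : HTensor (HTensor (HSp q) (HSp q)) (HSp q) :=
  ∑' i, leftTerm h0 h1 r s r' s' w i

theorem shift_ptVec (k n : ℤ) (σ : ℤˣ) (ξ : ℤ) :
    (hBasis q).shift k (ptVec q n σ ξ) = ptVec q (k + n) σ ξ := shift_basisVec q k n _

/-- The pairing with an elementary tensor of basis vectors is a term of the left hand side of the
bilinear identity. -/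
theorem inner_leftTerm (r s r' s' : ℤ) (w : HSp q) (i n₁ n₂ n₃ : ℤ) (s₁ s₂ s₃ : ℤˣ)
    (ζ₁ ζ₂ ζ₃ : ℤ) : ⟪HTensor.tmul (HTensor.tmul (ptVec q n₁ s₁ ζ₁) (ptVec q n₂ s₂ ζ₂))
      (ptVec q n₃ s₃ ζ₃), leftTerm h0 h1 r s r' s' w i⟫_ℂ =
    ((if n₁ + n₂ = r + s + ζ₂ - ζ₁ ∧ n₂ + n₃ = s + r' + s' + ζ₃ - ζ₂ then
      al q (r' + 1) i * (amp q (s₁ * s₂) s₃ (r' + ζ₁ + ζ₃ - ζ₂) (r + ζ₂ - n₁ + i) ζ₃ *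
        amp q s₁ s₂ (r + ζ₂ - n₁ + i) ζ₁ ζ₂) else 0 : ℝ) : ℂ) *
      ⟪ptVec q (ζ₃ - (r + ζ₂ - n₁)) (s₁ * s₂ * s₃) (r' + ζ₁ + ζ₃ - ζ₂), w⟫_ℂ := by
  rw [leftTerm, fIsoLeft, fIso, inner_smul_right, ← ContinuousLinearMap.adjoint_inner_left,
    adjoint_slice_tensorRight, adjoint_slice_tmul, HTensor.smul_tmul, inner_smul_left,
    ← ContinuousLinearMap.adjoint_inner_left, adjoint_slice_tmul, inner_smul_left, Complex.conj_ofReal, Complex.conj_ofReal, ← inner_shift _ i,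
    ← mul_apply_eq_comp, ← shift_add, add_neg_cancel, shift_zero, one_apply_eq_self, shift_ptVec h0 h1,
    show i + (ζ₃ - (r + i + ζ₂ - n₁)) = ζ₃ - (r + ζ₂ - n₁) by ring,
    show r' + ζ₃ - (ζ₂ - ζ₁) = r' + ζ₁ + ζ₃ - ζ₂ by ring,
    show r + i + ζ₂ - n₁ = r + ζ₂ - n₁ + i by ring]
  by_cases h : n₁ + n₂ = r + s + ζ₂ - ζ₁ ∧ n₂ + n₃ = s + r' + s' + ζ₃ - ζ₂
  · rw [if_pos h, if_pos (by omega), if_pos (by omega)]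
    push_cast
    ring
  · rw [if_neg h]
    by_cases h2 : n₁ + n₂ = r + i + (s - i) + ζ₂ - ζ₁
    · rw [if_neg (c := ζ₂ - ζ₁ + n₃ = _) (by omega)]
      simp
    · rw [if_neg h2]
      simp

/-- The pairing with an elementary tensor of basis vectors is a term of the right hand side of the
bilinear identity. -/
theorem inner_rightTerm (r s r' s' : ℤ) (w : HSp q) (i n₁ n₂ n₃ : ℤ) (s₁ s₂ s₃ : ℤˣ)
    (ζ₁ ζ₂ ζ₃ : ℤ) : ⟪HTensor.tmul (ptVec q n₁ s₁ ζ₁) (HTensor.tmul (ptVec q n₂ s₂ ζ₂)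
      (ptVec q n₃ s₃ ζ₃)), rightTerm h0 h1 r s r' s' w i⟫_ℂ =
    ((if n₁ + n₂ = r + s + ζ₂ - ζ₁ ∧ n₂ + n₃ = s + r' + s' + ζ₃ - ζ₂ then
      al q (r' + 1) i * (amp q s₁ (s₂ * s₃) (r' + ζ₁ + ζ₃ - ζ₂) ζ₁ (s + r' + ζ₃ - n₂ + i) *
        amp q s₂ s₃ (s + r' + ζ₃ - n₂ + i) ζ₂ ζ₃) else 0 : ℝ) : ℂ) *
      ⟪ptVec q (ζ₃ - (r + ζ₂ - n₁)) (s₁ * s₂ * s₃) (r' + ζ₁ + ζ₃ - ζ₂), w⟫_ℂ := by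
  rw [rightTerm, fIsoRight, fIso, inner_smul_right, ← ContinuousLinearMap.adjoint_inner_left,
    adjoint_slice_tensorLeft, adjoint_slice_tmul, HTensor.tmul_smul, inner_smul_left,
    ← ContinuousLinearMap.adjoint_inner_left, adjoint_slice_tmul, inner_smul_left, Complex.conj_ofReal, Complex.conj_ofReal, ← inner_shift _ (-(r' + i)),
    ← mul_apply_eq_comp, ← shift_add, neg_add_cancel, shift_zero, one_apply_eq_self, shift_ptVec h0 h1,
    show s + r' + i + ζ₃ - n₂ = s + r' + ζ₃ - n₂ + i by ring]
  by_cases h : n₁ + n₂ = r + s + ζ₂ - ζ₁ ∧ n₂ + n₃ = s + r' + s' + ζ₃ - ζ₂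
  · rw [if_pos h, if_pos (by omega), if_pos (by omega),
      show r - i + (s + r' + ζ₃ - n₂ + i) - n₁ = r' + ζ₁ + ζ₃ - ζ₂ by omega,
      show -(r' + i) + (s + r' + ζ₃ - n₂ + i - ζ₁) = ζ₃ - (r + ζ₂ - n₁) by omega, ← mul_assoc s₁]
    push_cast
    ring
  · rw [if_neg h]
    by_cases h2 : n₂ + n₃ = s + r' + i + (s' - i) + ζ₃ - ζ₂
    · rw [if_neg (c := n₁ + (ζ₃ - ζ₂) = _) (by omega)]
      simp
    · rw [if_neg h2]
      simp

/-- The bilinear identity, expressed by the intertwiners. -/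
theorem assoc_intertwiner (r s r' s' : ℤ) (w : HSp q) :
    HTensor.assoc (intertwiner h0 h1 r s r' s' w) = ∑' i, rightTerm h0 h1 r s r' s' w i := by
  refine ((hBasis q).tensor ((hBasis q).tensor (hBasis q))).ext_inner ?_
  rintro ⟨⟨n₁, x₁, hx₁⟩, ⟨n₂, x₂, hx₂⟩, ⟨n₃, x₃, hx₃⟩⟩
  obtain ⟨⟨s₁, ζ₁⟩, -, rfl⟩ := exists_pt h0 h1 hx₁
  obtain ⟨⟨s₂, ζ₂⟩, -, rfl⟩ := exists_pt h0 h1 hx₂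
  obtain ⟨⟨s₃, ζ₃⟩, -, rfl⟩ := exists_pt h0 h1 hx₃
  rw [tensor_apply, tensor_apply, hBasis_apply, hBasis_apply, hBasis_apply]
  change ⟪HTensor.tmul (ptVec q n₁ s₁ ζ₁) (HTensor.tmul (ptVec q n₂ s₂ ζ₂) (ptVec q n₃ s₃ ζ₃)),
    _⟫_ℂ = ⟪HTensor.tmul (ptVec q n₁ s₁ ζ₁) (HTensor.tmul (ptVec q n₂ s₂ ζ₂) (ptVec q n₃ s₃ ζ₃)),
    _⟫_ℂ
  have hL := (summable_leftTerm h0 h1 r s r' s' w).hasSum.mapL (innerSL ℂ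
    (HTensor.tmul (HTensor.tmul (ptVec q n₁ s₁ ζ₁) (ptVec q n₂ s₂ ζ₂)) (ptVec q n₃ s₃ ζ₃)))
  have hR := (summable_rightTerm h0 h1 r s r' s' w).hasSum.mapL (innerSL ℂ
    (HTensor.tmul (ptVec q n₁ s₁ ζ₁) (HTensor.tmul (ptVec q n₂ s₂ ζ₂) (ptVec q n₃ s₃ ζ₃))))
  simp only [innerSL_apply_apply, inner_leftTerm h0 h1, inner_rightTerm h0 h1] at hL hR
  rw [← hR.tsum_eq, ← HTensor.assoc_tmul, LinearIsometryEquiv.inner_map_map, intertwiner,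
    ← hL.tsum_eq, tsum_mul_right, tsum_mul_right, ← Complex.ofReal_tsum, ← Complex.ofReal_tsum]
  congr 2
  by_cases h : n₁ + n₂ = r + s + ζ₂ - ζ₁ ∧ n₂ + n₃ = s + r' + s' + ζ₃ - ζ₂
  · simp only [if_pos h]
    have hb := bilinAt h0 h1 s₁ s₂ s₃ (r' + ζ₁ + ζ₃ - ζ₂) (r + ζ₂ - n₁) ζ₁ ζ₂ ζ₃
    unfold BilinAt sumL sumR at hb
    rwa [show 1 + (r' + ζ₁ + ζ₃ - ζ₂) + ζ₂ - ζ₁ - ζ₃ = r' + 1 by ring,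
      show r' + ζ₁ + ζ₃ - ζ₂ + ζ₂ - (r + ζ₂ - n₁) = s + r' + ζ₃ - n₂ by omega] at hb
  · simp only [if_neg h]

theorem ampl_intertwiner (r s r' s' : ℤ) {x : HSp q →L[ℂ] HSp q} (hx : x ∈ Mq q) (w : HSp q) :
    ((fBasis h0 h1).tensorRight (hBasis q)).ampl ((hBasis q).tensor (hBasis q))
        ((fBasis h0 h1).ampl (hBasis q) x) (intertwiner h0 h1 r s r' s' w) =
      intertwiner h0 h1 r s r' s' (x w) := by
  have h := (summable_leftTerm h0 h1 r s r' s' w).hasSum.mapL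
    (((fBasis h0 h1).tensorRight (hBasis q)).ampl ((hBasis q).tensor (hBasis q))
        ((fBasis h0 h1).ampl (hBasis q) x))
  refine h.tsum_eq.symm.trans (tsum_congr fun i => ?_)
  have hx := congrArg (fun f : HSp q →L[ℂ] HSp q => f w)
    ((isInvariantAlgebra_Mq h0 h1 x).1 hx (-i))
  simp only [mul_apply_eq_comp] at hx
  rw [leftTerm, leftTerm, map_smul, ← hx, fIsoLeft, ampl_slice, fIso, ampl_slice]

theorem ampl_assoc_intertwiner (r s r' s' : ℤ) {x : HSp q →L[ℂ] HSp q} (hx : x ∈ Mq q)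
    (w : HSp q) :
    ((fBasis h0 h1).tensorLeft (hBasis q)).ampl ((hBasis q).tensor (hBasis q))
        ((fBasis h0 h1).ampl (hBasis q) x) (HTensor.assoc (intertwiner h0 h1 r s r' s' w)) =
      HTensor.assoc (intertwiner h0 h1 r s r' s' (x w)) := by
  rw [assoc_intertwiner, assoc_intertwiner]
  have h := (summable_rightTerm h0 h1 r s r' s' w).hasSum.mapL
    (((fBasis h0 h1).tensorLeft (hBasis q)).ampl ((hBasis q).tensor (hBasis q))
        ((fBasis h0 h1).ampl (hBasis q) x))
  refine h.tsum_eq.symm.trans (tsum_congr fun i => ?_)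
  have hx := congrArg (fun f : HSp q →L[ℂ] HSp q => f w)
    ((isInvariantAlgebra_Mq h0 h1 x).1 hx (r' + i))
  simp only [mul_apply_eq_comp] at hx
  rw [rightTerm, rightTerm, map_smul, ← hx, fIsoRight, ampl_slice, fIso, ampl_slice]

/-- The ranges of the intertwiners span a dense subspace. -/
theorem eq_zero_of_inner_intertwiner {g : HTensor (HTensor (HSp q) (HSp q)) (HSp q)}
    (hg : ∀ r s r' s' w, ⟪g, intertwiner h0 h1 r s r' s' w⟫_ℂ = 0) : g = 0 := by
  have key : ∀ (r s r' s' m : ℤ) (p : Iq q),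
      ⟪g, fIsoLeft h0 h1 (r, s) (fIso h0 h1 (r', s') (basisVec q m p))⟫_ℂ = 0 := by
    intro r s r' s' m p
    have hbound : ∀ l : ℤ, ‖⟪g, fIsoLeft h0 h1 (r + l, s - l)
        (fIso h0 h1 (r', s' + l) (basisVec q (m - l) p))⟫_ℂ‖ ≤
        ‖(fIsoLeft h0 h1 (r + l, s - l)).adjoint g‖ := fun l => by
      rw [← ContinuousLinearMap.adjoint_inner_left]
      refine (norm_inner_le_norm _ _).trans ?_
      rw [fIso, norm_slice_apply, (orthonormal_basisVec q).1 (m - l, p), mul_one]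
    have hsum := (((fBasis h0 h1).tensorRight (hBasis q)).hasSum_norm_sq_slice
      ((hBasis q).tensor (hBasis q)) g).summable.comp_injective
      (i := fun l : ℤ => (r + l, s - l)) fun l l' h => by simpa using congrArg Prod.fst h
    have htend : Tendsto (fun l : ℤ => ‖(fIsoLeft h0 h1 (r + l, s - l)).adjoint g‖) cofinite
        (𝓝 0) := by
      have h2 := hsum.tendsto_cofinite_zero.sqrt
      simp only [Function.comp_def, Real.sqrt_sq (norm_nonneg _), Real.sqrt_zero] at h2
      exact h2
    have h2 := eq_zero_of_sum_al h0 h1 (C := ‖g‖) (c := fun l => ⟪g, fIsoLeft h0 h1 (r + l, s - l)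
        (fIso h0 h1 (r', s' + l) (basisVec q (m - l) p))⟫_ℂ) (fun l => ?_)
        (squeeze_zero_norm hbound htend) (r' + 1) (fun l => ?_) 0
    · simpa using h2
    · refine (norm_inner_le_norm _ _).trans ?_
      rw [fIsoLeft, fIso, norm_slice_apply, norm_slice_apply,
        (orthonormal_basisVec q).1 (m - l, p), mul_one]
    · have h3 := hg (r + l) (s - l) r' (s' + l) (basisVec q (m - l) p)
      have h4 := (summable_leftTerm h0 h1 (r + l) (s - l) r' (s' + l)
        (basisVec q (m - l) p)).hasSum.mapL (innerSL ℂ g)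
      rw [← h3]
      refine Eq.trans ?_ h4.tsum_eq
      refine tsum_congr fun i => ?_
      rw [innerSL_apply_apply, leftTerm, inner_smul_right, shift_basisVec, Complex.real_smul,
        add_assoc r, ← sub_sub s, add_assoc s', show m - (l + i) = -i + (m - l) by ring]
  have h2 : ∀ r s, (fIsoLeft h0 h1 (r, s)).adjoint g = 0 := fun r s =>
    (fBasis h0 h1).ext_inner fun ⟨⟨r', s'⟩, m, p⟩ => by
      have h3 := key r s r' s' m p
      rw [← ContinuousLinearMap.adjoint_inner_left, fIso, ← hBasis_apply, slice_apply] at h3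
      rw [inner_zero_right, ← inner_conj_symm, h3, map_zero]
  refine ((fBasis h0 h1).tensorRight (hBasis q)).ext_inner fun ⟨⟨r, s⟩, j⟩ => ?_
  rw [inner_zero_right, ← slice_apply _ ((hBasis q).tensor (hBasis q)),
    ← ContinuousLinearMap.adjoint_inner_right]
  exact (congrArg _ (h2 r s)).trans (inner_zero_right _)

/-- Let `D` be the difference of the two sides. It vanishes on the ranges of the intertwiners, so that
`D* D v` is orthogonal to them. Since they span a dense subspace, `D* D v = 0`, whence `D v = 0`. -/
theorem assoc_ampl_apply {x : HSp q →L[ℂ] HSp q} (hx : x ∈ Mq q)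
    (v : HTensor (HTensor (HSp q) (HSp q)) (HSp q)) :
    HTensor.assoc (((fBasis h0 h1).tensorRight (hBasis q)).ampl ((hBasis q).tensor (hBasis q))
        ((fBasis h0 h1).ampl (hBasis q) x) v) =
      ((fBasis h0 h1).tensorLeft (hBasis q)).ampl ((hBasis q).tensor (hBasis q))
        ((fBasis h0 h1).ampl (hBasis q) x) (HTensor.assoc v) := by
  let e := HTensor.assoc (H := HSp q) (K := HSp q) (L := HSp q)
  let D : HTensor (HTensor (HSp q) (HSp q)) (HSp q) →L[ℂ] HTensor (HSp q) (HTensor (HSp q) (HSp q)) :=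
    e.toContinuousLinearEquiv.toContinuousLinearMap ∘L
        ((fBasis h0 h1).tensorRight (hBasis q)).ampl ((hBasis q).tensor (hBasis q))
        ((fBasis h0 h1).ampl (hBasis q) x) -
      ((fBasis h0 h1).tensorLeft (hBasis q)).ampl ((hBasis q).tensor (hBasis q))
        ((fBasis h0 h1).ampl (hBasis q) x) ∘L e.toContinuousLinearEquiv.toContinuousLinearMap
  have hD : ∀ v, D v = HTensor.assoc (((fBasis h0 h1).tensorRight (hBasis q)).ampl
      ((hBasis q).tensor (hBasis q)) ((fBasis h0 h1).ampl (hBasis q) x) v) -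
      ((fBasis h0 h1).tensorLeft (hBasis q)).ampl ((hBasis q).tensor (hBasis q))
        ((fBasis h0 h1).ampl (hBasis q) x) (HTensor.assoc v) := fun v => rfl
  have hz : D.adjoint (D v) = 0 := eq_zero_of_inner_intertwiner h0 h1 fun r s r' s' w => by
    rw [ContinuousLinearMap.adjoint_inner_left, hD (intertwiner h0 h1 r s r' s' w),
      ampl_intertwiner h0 h1 r s r' s' hx, ampl_assoc_intertwiner h0 h1 r s r' s' hx, sub_self,
      inner_zero_right]
  have hv : D v = 0 := by
    rw [← inner_self_eq_zero (𝕜 := ℂ), ← ContinuousLinearMap.adjoint_inner_left, hz,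
      inner_zero_left]
  rwa [hD, sub_eq_zero] at hv

theorem isCoassociative_comul : IsCoassociative (comul h0 h1) :=
  ⟨comulLeft h0 h1, comulRight h0 h1, isTensorHom_comulLeft h0 h1,
    isTensorHom_comulRight h0 h1, fun x v => assoc_ampl_apply h0 h1 x.2 v⟩

end

end QSU11

end


theorem mainTheorem2 (q : ℝ) (hq0 : 0 < q) (hq1 : q < 1) :
    ∃ V : HTensor (QSU11.HSp q) (QSU11.HSp q) ≃ₗᵢ[ℂ]
        HTensor QSU11.L2T (HTensor QSU11.L2T (QSU11.HSp q)),
      (∀ (r s m : ℤ) (p : QSU11.Iq q),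
        V (QSU11.FVec q r s m p) =
          HTensor.tmul (QSU11.zeta r) (HTensor.tmul (QSU11.zeta s) (QSU11.basisVec q m p))) ∧
      ∃ Δ : (QSU11.Mq q).toStarSubalgebra →⋆ₐ[ℂ]
          (VonNeumannAlgebra.tensor (QSU11.Mq q) (QSU11.Mq q)).toStarSubalgebra,
        VonNeumannAlgebra.IsNormalHom Δ ∧
        Function.Injective Δ ∧
        (∀ (a : (QSU11.Mq q).toStarSubalgebra) (v : HTensor (QSU11.HSp q) (QSU11.HSp q)),
          (Δ a : HTensor (QSU11.HSp q) (QSU11.HSp q) →L[ℂ] HTensor (QSU11.HSp q) (QSU11.HSp q)) v =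
            V.symm (HTensor.map 1 (HTensor.map 1 (a : QSU11.HSp q →L[ℂ] QSU11.HSp q)) (V v))) ∧
        VonNeumannAlgebra.IsCoassociative Δ :=
  ⟨QSU11.unitaryV hq0 hq1, QSU11.unitaryV_FVec hq0 hq1, QSU11.comul hq0 hq1,
    QSU11.isNormalHom_comul hq0 hq1, QSU11.comul_injective hq0 hq1, QSU11.comul_apply hq0 hq1,
    QSU11.isCoassociative_comul hq0 hq1⟩
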